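/- **Setting.** Let $d\in\mathbb N$, $1<p<\infty$, let $\gamma_1,\gamma_2:[0,1]\to\mathbb R^d$ be continuous curves consisting of finitely many pieces, each of class $C^2$ on its closed parameter interval, let $\delta>0$, and put $f(x,y)=\|\gamma_1(x)-\gamma_2(y)\|_p$. The free space is $\mathcal D_\delta=\{f\le\delta\}\subset[0,1]^2$, the forbidden region is its complement in $[0,1]^2$, and $B_\delta=\{f=\delta\}\subset[0,1]^2$. The products of the parameter intervals of the pieces are the (closed) cells. Partial derivatives of $f$ at a point of a cell are taken inside the cell (one-sided on its edges). * $I_{\mathrm{sing}}$ is the set of points of $B_\delta$ at which, in some cell containing the point, both partial derivatives of $f$ vanish. * For a cell $C$, $E_h(C)$ is the set of $z=(x_0,y_0)\in B_\delta\cap C$ with $\partial_xf(z)=0$ (horizontal tangent) at which $x\mapsto f(x,y_0)$, on the $x$-interval of $C$, has a local extremum (for nonsingular $z$ in the interior of $C$: $z$ is a local extremum of $B_\delta$ in the $y$ direction). $E_v(C)$ is defined in the same way with $x$ and $y$ exchanged. $E_h=\bigcup_CE_h(C)$ and $E_v=\bigcup_CE_v(C)$. A point $z\in E_h(C)$ belongs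 to $E_h^-$ (to $E_h^+$) if, inside $C$, the points of the vertical line through $z$ close to $z$ are forbidden above and free below $z$ (forbidden below and free above $z$); $z\in E_v(C)$ belongs to $E_v^-$ (to $E_v^+$) if the forbidden region lies in the same sense locally to the right (to the left) of $z$. * Each cell $C$ is cut into subcells by the vertical lines through the points of $E_h(C)$ and the horizontal lines through the points of $E_v(C)$. For a subcell $S$, $\mathcal I_S$ is the set of points of $B_\delta$ on the four edges of $S$, and $\mathcal I=\bigcup_S\mathcal I_S$. * $G_\delta$ has vertex set $\mathcal I$; in a subcell $S$, two points of $\mathcal I_S$ are joined if they are the endpoints of an arc, monotone in both coordinates, which apart from its endpoints is contained in $B_\delta$ and the interior of $S$. The combinatorial structure of $G_\delta$ is the list of all triples ($S$, $z$, $w$) with $z,w\in\mathcal I_S$ joined in $S$. * The slope information at $z\in\mathcal I_S$ tells whether $B_\delta$ enters the interior of $S$ at $z$, and if so, whether it is increasing or decreasing there as a function of $x$. **Input.** The points of $\mathcal I$ are numbered arbitrarily. The input gives for each point its membership in $E_h^+,E_h^-,E_v^+,E_v^-$. It lists the subcells with $\mathcal I_S\ne\emptyset$ in lexicographic order (cells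 row by row, and in each cell the subcells row by row, rows from bottom to top and each from left to right). For each of these subcells it gives the points of $\mathcal I_S$ on each of the four edges, in their order along the edge. It says whether the bottom (left) edge of $S$ lies on the bottom (left) edge of its cell and, only for edges that do, gives the slope information at the points of $\mathcal I_S$ on that edge. No coordinates are given. **Lemma.** There are a program for a unit-cost random access machine (natural number registers, memory and read-only input, indirect addressing, addition, truncated subtraction, zero test; no multiplication) and a constant $K$ such that the following holds for all $d,p,\gamma_1,\gamma_2,\delta$ as above. If $I_{\mathrm{sing}}=\emptyset$ and $E_h,E_v$ are finite, then on every input describing the diagram as above the program halts after at most $K(|\mathcal I|+1)$ steps, and its output is the combinatorial structure of $G_\delta$, each edge listed exactly once. -/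

import Mathlib

open Set Filter Topology
open scoped ENNReal

/-! ### The machine model: structured programs for a unit-cost random access machine -/

namespace RAM

/-- Expressions: constants, registers, memory and input cells under a computed address, sum and
truncated difference. There is no multiplication. -/
inductive Expr where
  | const (n : ℕ)
  | reg (r : ℕ)
  | mem (e : Expr)
  | inp (e : Expr)
  | plus (e₁ e₂ : Expr)
  | minus (e₁ e₂ : Expr)

/-- Programs. A test `e` succeeds when the value of `e` is nonzero. -/
inductive Cmd where
  | skip
  | assign (r : ℕ) (e : Expr)
  | store (addr e : Expr)
  | emit (e : Expr)
  | seq (c₁ c₂ : Cmd)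
  | ite (e : Expr) (c₁ c₂ : Cmd)
  | loop (e : Expr) (c : Cmd)

/-- A configuration: registers, memory and the list of words written to the output so far. -/
structure State where
  reg : ℕ → ℕ
  mem : ℕ → ℕ
  out : List ℕ

/-- All registers and memory cells are zero and the output is empty. -/
def State.init : State := ⟨fun _ => 0, fun _ => 0, []⟩

/-- The value of an expression; reading beyond the end of the input gives `0`. -/
def Expr.eval (input : List ℕ) (s : State) : Expr → ℕ
  | .const n => n
  | .reg r => s.reg r
  | .mem e => s.mem (e.eval input s)
  | .inp e => input.getD (e.eval input s) 0
  | .plus e₁ e₂ => e₁.eval input s + e₂.eval input s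
  | .minus e₁ e₂ => e₁.eval input s - e₂.eval input s

/-- The cost of an evaluation: one step for every node of the expression. -/
def Expr.cost : Expr → ℕ
  | .const _ => 1
  | .reg _ => 1
  | .mem e => e.cost + 1
  | .inp e => e.cost + 1
  | .plus e₁ e₂ => e₁.cost + e₂.cost + 1
  | .minus e₁ e₂ => e₁.cost + e₂.cost + 1

/-- `Exec input c s t s'`: on the given input, the program `c` started in the configuration `s`
halts after exactly `t` steps in the configuration `s'`. -/
inductive Exec (input : List ℕ) : Cmd → State → ℕ → State → Prop where
  | skip (s : State) : Exec input .skip s 1 s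
  | assign (s : State) (r : ℕ) (e : Expr) :
      Exec input (.assign r e) s (e.cost + 1)
        { s with reg := Function.update s.reg r (e.eval input s) }
  | store (s : State) (addr e : Expr) :
      Exec input (.store addr e) s (addr.cost + e.cost + 1)
        { s with mem := Function.update s.mem (addr.eval input s) (e.eval input s) }
  | emit (s : State) (e : Expr) :
      Exec input (.emit e) s (e.cost + 1) { s with out := s.out ++ [e.eval input s] }
  | seq {s s' s'' : State} {t t' : ℕ} {c₁ c₂ : Cmd} :
      Exec input c₁ s t s' → Exec input c₂ s' t' s'' → Exec input (.seq c₁ c₂) s (t + t') s''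
  | ite_true {s s' : State} {t : ℕ} {e : Expr} {c₁ c₂ : Cmd} :
      e.eval input s ≠ 0 → Exec input c₁ s t s' → Exec input (.ite e c₁ c₂) s (e.cost + 1 + t) s'
  | ite_false {s s' : State} {t : ℕ} {e : Expr} {c₁ c₂ : Cmd} :
      e.eval input s = 0 → Exec input c₂ s t s' → Exec input (.ite e c₁ c₂) s (e.cost + 1 + t) s'
  | loop_done {s : State} {e : Expr} {c : Cmd} :
      e.eval input s = 0 → Exec input (.loop e c) s (e.cost + 1) s
  | loop_step {s s' s'' : State} {t t' : ℕ} {e : Expr} {c : Cmd} :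
      e.eval input s ≠ 0 → Exec input c s t s' → Exec input (.loop e c) s' t' s'' →
        Exec input (.loop e c) s (e.cost + 1 + t + t') s''

end RAM

/-! ### Piecewise smooth curves and the free space diagram -/

/-- A continuous curve on `[0,1]` consisting of `pieces` many pieces of class `C²`; the pieces
are the restrictions to the closed intervals between consecutive breakpoints. -/
structure PiecewiseC2 (E : Type*) [NormedAddCommGroup E] [NormedSpace ℝ E] where
  toFun : ℝ → E
  pieces : ℕ
  brk : Fin (pieces + 1) → ℝ
  brk_strictMono : StrictMono brk
  brk_zero : brk 0 = 0
  brk_last : brk (Fin.last pieces) = 1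
  continuousOn : ContinuousOn toFun (Icc 0 1)
  contDiffOn : ∀ i : Fin pieces, ContDiffOn ℝ 2 toFun (Icc (brk i.castSucc) (brk i.succ))

namespace FreeSpace

variable {E : Type*} [NormedAddCommGroup E] [NormedSpace ℝ E]

/-- The parameter interval of the `i`-th smooth piece. -/
def piece (γ : PiecewiseC2 E) (i : Fin γ.pieces) : Set ℝ :=
  Icc (γ.brk i.castSucc) (γ.brk i.succ)

/-- The distance of the curve points with parameters `x` and `y`. -/
def gap (γ₁ γ₂ : PiecewiseC2 E) (x y : ℝ) : ℝ := ‖γ₁.toFun x - γ₂.toFun y‖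

/-- The free space; its complement in the unit square is the forbidden region. -/
def freeSpace (γ₁ γ₂ : PiecewiseC2 E) (δ : ℝ) : Set (ℝ × ℝ) :=
  {z | z ∈ Icc (0 : ℝ) 1 ×ˢ Icc (0 : ℝ) 1 ∧ gap γ₁ γ₂ z.1 z.2 ≤ δ}

/-- The boundary curves `B_δ` of the free space: the level set of the distance at `δ`. -/
def bdry (γ₁ γ₂ : PiecewiseC2 E) (δ : ℝ) : Set (ℝ × ℝ) :=
  {z | z ∈ Icc (0 : ℝ) 1 ×ˢ Icc (0 : ℝ) 1 ∧ gap γ₁ γ₂ z.1 z.2 = δ}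

/-- The closed cell belonging to the `i`-th piece of `γ₁` and the `j`-th piece of `γ₂`. -/
def cell (γ₁ γ₂ : PiecewiseC2 E) (i : Fin γ₁.pieces) (j : Fin γ₂.pieces) : Set (ℝ × ℝ) :=
  piece γ₁ i ×ˢ piece γ₂ j

/-- The partial derivative of the distance in `x`, taken inside the cell (one-sided on its vertical
edges). -/
noncomputable def dx (γ₁ γ₂ : PiecewiseC2 E) (i : Fin γ₁.pieces) (z : ℝ × ℝ) : ℝ :=
  derivWithin (fun x => gap γ₁ γ₂ x z.2) (piece γ₁ i) z.1

/-- The partial derivative of the distance in `y`, taken inside the cell (one-sided on its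
horizontal edges). -/
noncomputable def dy (γ₁ γ₂ : PiecewiseC2 E) (j : Fin γ₂.pieces) (z : ℝ × ℝ) : ℝ :=
  derivWithin (fun y => gap γ₁ γ₂ z.1 y) (piece γ₂ j) z.2

/-- The singular points of `B_δ`: the points of `B_δ` at which both partial derivatives of the
distance vanish, in a cell that contains the point. -/
def singularSet (γ₁ γ₂ : PiecewiseC2 E) (δ : ℝ) : Set (ℝ × ℝ) :=
  {z ∈ bdry γ₁ γ₂ δ | ∃ i j, z ∈ cell γ₁ γ₂ i j ∧ dx γ₁ γ₂ i z = 0 ∧ dy γ₁ γ₂ j z = 0}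

/-- The extrema of `B_δ` in the `y` direction in a cell: the tangent at `z` is horizontal, and the
horizontal line through `z` does not change between free space and forbidden region at `z`.
At a nonsingular point `z` inside the cell this says that `B_δ` is near `z` the graph of a function
of `x` with a local extremum at `z`. -/
def cellEh (γ₁ γ₂ : PiecewiseC2 E) (δ : ℝ) (i : Fin γ₁.pieces) (j : Fin γ₂.pieces) :
    Set (ℝ × ℝ) :=
  {z ∈ bdry γ₁ γ₂ δ ∩ cell γ₁ γ₂ i j | dx γ₁ γ₂ i z = 0 ∧
    IsLocalExtrOn (fun x => gap γ₁ γ₂ x z.2) (piece γ₁ i) z.1}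

/-- The extrema of `B_δ` in the `x` direction in a cell (with vertical tangent). -/
def cellEv (γ₁ γ₂ : PiecewiseC2 E) (δ : ℝ) (i : Fin γ₁.pieces) (j : Fin γ₂.pieces) :
    Set (ℝ × ℝ) :=
  {z ∈ bdry γ₁ γ₂ δ ∩ cell γ₁ γ₂ i j | dy γ₁ γ₂ j z = 0 ∧
    IsLocalExtrOn (fun y => gap γ₁ γ₂ z.1 y) (piece γ₂ j) z.2}

/-- `E_h`, the union over all cells. -/
def Eh (γ₁ γ₂ : PiecewiseC2 E) (δ : ℝ) : Set (ℝ × ℝ) := ⋃ i, ⋃ j, cellEh γ₁ γ₂ δ i j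

/-- `E_v`, the union over all cells. -/
def Ev (γ₁ γ₂ : PiecewiseC2 E) (δ : ℝ) : Set (ℝ × ℝ) := ⋃ i, ⋃ j, cellEv γ₁ γ₂ δ i j

/-- `E_h⁻`: inside the cell, the forbidden region lies locally above the point. -/
def EhMinus (γ₁ γ₂ : PiecewiseC2 E) (δ : ℝ) : Set (ℝ × ℝ) :=
  {z | ∃ i j, z ∈ cellEh γ₁ γ₂ δ i j ∧ ∀ᶠ y in 𝓝[piece γ₂ j] z.2,
    (z.2 < y → (z.1, y) ∉ freeSpace γ₁ γ₂ δ) ∧ (y < z.2 → (z.1, y) ∈ freeSpace γ₁ γ₂ δ)}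

/-- `E_h⁺`: inside the cell, the forbidden region lies locally below the point. -/
def EhPlus (γ₁ γ₂ : PiecewiseC2 E) (δ : ℝ) : Set (ℝ × ℝ) :=
  {z | ∃ i j, z ∈ cellEh γ₁ γ₂ δ i j ∧ ∀ᶠ y in 𝓝[piece γ₂ j] z.2,
    (y < z.2 → (z.1, y) ∉ freeSpace γ₁ γ₂ δ) ∧ (z.2 < y → (z.1, y) ∈ freeSpace γ₁ γ₂ δ)}

/-- `E_v⁻`: inside the cell, the forbidden region lies locally to the right of the point. -/
def EvMinus (γ₁ γ₂ : PiecewiseC2 E) (δ : ℝ) : Set (ℝ × ℝ) :=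
  {z | ∃ i j, z ∈ cellEv γ₁ γ₂ δ i j ∧ ∀ᶠ x in 𝓝[piece γ₁ i] z.1,
    (z.1 < x → (x, z.2) ∉ freeSpace γ₁ γ₂ δ) ∧ (x < z.1 → (x, z.2) ∈ freeSpace γ₁ γ₂ δ)}

/-- `E_v⁺`: inside the cell, the forbidden region lies locally to the left of the point. -/
def EvPlus (γ₁ γ₂ : PiecewiseC2 E) (δ : ℝ) : Set (ℝ × ℝ) :=
  {z | ∃ i j, z ∈ cellEv γ₁ γ₂ δ i j ∧ ∀ᶠ x in 𝓝[piece γ₁ i] z.1,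
    (x < z.1 → (x, z.2) ∉ freeSpace γ₁ γ₂ δ) ∧ (z.1 < x → (x, z.2) ∈ freeSpace γ₁ γ₂ δ)}

/-! ### Subcells and marked points -/

/-- The abscissae of the vertical lines in a cell: its vertical edges and the vertical cuts through
the points of `E_h` of the cell. -/
def xCuts (γ₁ γ₂ : PiecewiseC2 E) (δ : ℝ) (i : Fin γ₁.pieces) (j : Fin γ₂.pieces) : Set ℝ :=
  {γ₁.brk i.castSucc, γ₁.brk i.succ} ∪ Prod.fst '' cellEh γ₁ γ₂ δ i j

/-- The ordinates of the horizontal lines in a cell: its horizontal edges and the horizontal cuts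
through the points of `E_v` of the cell. -/
def yCuts (γ₁ γ₂ : PiecewiseC2 E) (δ : ℝ) (i : Fin γ₁.pieces) (j : Fin γ₂.pieces) : Set ℝ :=
  {γ₂.brk j.castSucc, γ₂.brk j.succ} ∪ Prod.snd '' cellEv γ₁ γ₂ δ i j

/-- `a < b` are consecutive elements of `T`. -/
def Consecutive (T : Set ℝ) (a b : ℝ) : Prop :=
  a ∈ T ∧ b ∈ T ∧ a < b ∧ ∀ t ∈ T, ¬ (a < t ∧ t < b)

/-- A rectangle `[a,b] × [c,d]` together with the cell that contains it. -/
@[ext]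
structure Subcell (γ₁ γ₂ : PiecewiseC2 E) where
  i : Fin γ₁.pieces
  j : Fin γ₂.pieces
  a : ℝ
  b : ℝ
  c : ℝ
  d : ℝ

namespace Subcell

variable {γ₁ γ₂ : PiecewiseC2 E}

/-- The rectangle is one of the subcells into which its cell is cut. -/
def IsSubcell (S : Subcell γ₁ γ₂) (δ : ℝ) : Prop :=
  Consecutive (xCuts γ₁ γ₂ δ S.i S.j) S.a S.b ∧ Consecutive (yCuts γ₁ γ₂ δ S.i S.j) S.c S.d

def bottom (S : Subcell γ₁ γ₂) : Set (ℝ × ℝ) := {z | z.1 ∈ Icc S.a S.b ∧ z.2 = S.c}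
def top (S : Subcell γ₁ γ₂) : Set (ℝ × ℝ) := {z | z.1 ∈ Icc S.a S.b ∧ z.2 = S.d}
def left (S : Subcell γ₁ γ₂) : Set (ℝ × ℝ) := {z | z.1 = S.a ∧ z.2 ∈ Icc S.c S.d}
def right (S : Subcell γ₁ γ₂) : Set (ℝ × ℝ) := {z | z.1 = S.b ∧ z.2 ∈ Icc S.c S.d}

/-- The open rectangle. -/
def inner (S : Subcell γ₁ γ₂) : Set (ℝ × ℝ) := Ioo S.a S.b ×ˢ Ioo S.c S.d

/-- `I_S`: the intersection of `B_δ` with the four edges of the subcell. -/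
def marked (S : Subcell γ₁ γ₂) (δ : ℝ) : Set (ℝ × ℝ) :=
  bdry γ₁ γ₂ δ ∩ (S.bottom ∪ S.top ∪ S.left ∪ S.right)

/-- The lexicographic order: first the cells row by row, then the subcells of a cell row by row,
rows from bottom to top and each row from left to right. -/
def Before (S S' : Subcell γ₁ γ₂) : Prop :=
  S.j < S'.j ∨ S.j = S'.j ∧ (S.i < S'.i ∨ S.i = S'.i ∧
    (S.c < S'.c ∨ S.c = S'.c ∧ S.a < S'.a))

end Subcell

/-- `I`: all intersections of `B_δ` with the edges of the subcells. -/
def marked (γ₁ γ₂ : PiecewiseC2 E) (δ : ℝ) : Set (ℝ × ℝ) :=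
  {z | ∃ S : Subcell γ₁ γ₂, S.IsSubcell δ ∧ z ∈ S.marked δ}

/-! ### Monotone arcs, the graph, and slope information -/

/-- `β` parametrizes an arc from `z` to `w` that runs, apart from its endpoints, in `A`. -/
def IsArc (A : Set (ℝ × ℝ)) (z w : ℝ × ℝ) (β : ℝ → ℝ × ℝ) : Prop :=
  ContinuousOn β (Icc 0 1) ∧ InjOn β (Icc 0 1) ∧ β 0 = z ∧ β 1 = w ∧ ∀ t ∈ Ioo (0 : ℝ) 1, β t ∈ A

/-- An arc from `z` to `w` through `A` on which `y` increases with `x`. -/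
def IncreasingArc (A : Set (ℝ × ℝ)) (z w : ℝ × ℝ) : Prop :=
  ∃ β, IsArc A z w β ∧
    (MonotoneOn (fun t => (β t).1) (Icc 0 1) ∧ MonotoneOn (fun t => (β t).2) (Icc 0 1) ∨
      AntitoneOn (fun t => (β t).1) (Icc 0 1) ∧ AntitoneOn (fun t => (β t).2) (Icc 0 1))

/-- An arc from `z` to `w` through `A` on which `y` decreases as `x` increases. -/
def DecreasingArc (A : Set (ℝ × ℝ)) (z w : ℝ × ℝ) : Prop :=
  ∃ β, IsArc A z w β ∧
    (MonotoneOn (fun t => (β t).1) (Icc 0 1) ∧ AntitoneOn (fun t => (β t).2) (Icc 0 1) ∨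
      AntitoneOn (fun t => (β t).1) (Icc 0 1) ∧ MonotoneOn (fun t => (β t).2) (Icc 0 1))

variable {γ₁ γ₂ : PiecewiseC2 E}

/-- The edges of `G_δ` in the subcell `S`: two marked points of `S` are joined if a monotone arc of
`B_δ` connects them through the interior of `S`. -/
def Joined (δ : ℝ) (S : Subcell γ₁ γ₂) (z w : ℝ × ℝ) : Prop :=
  z ∈ S.marked δ ∧ w ∈ S.marked δ ∧
    (IncreasingArc (bdry γ₁ γ₂ δ ∩ S.inner) z w ∨ DecreasingArc (bdry γ₁ γ₂ δ ∩ S.inner) z w)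

/-- The slope information at a point `z` of an edge of `S`: the value `1` if `B_δ` enters the
interior of `S` at `z` and is increasing there, `2` if it enters and is decreasing, and `0` if
`B_δ` does not enter the interior of `S` at `z`. -/
def SlopeCode (δ : ℝ) (S : Subcell γ₁ γ₂) (z : ℝ × ℝ) (v : ℕ) : Prop :=
  (v = 1 ∧ ∃ w, IncreasingArc (bdry γ₁ γ₂ δ ∩ S.inner) z w) ∨
  (v = 2 ∧ ∃ w, DecreasingArc (bdry γ₁ γ₂ δ ∩ S.inner) z w) ∨
  (v = 0 ∧ ¬ (∃ w, IncreasingArc (bdry γ₁ γ₂ δ ∩ S.inner) z w) ∧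
    ¬ ∃ w, DecreasingArc (bdry γ₁ γ₂ δ ∩ S.inner) z w)

/-! ### Input and output of the algorithm -/

/-- The input record of one subcell. Marked points are referred to by their numbers. The slope
lists accompany the lists `bottom` and `left`; they are empty unless the subcell lies on the bottom
(on the left) edge of its cell. -/
structure SubcellRecord where
  onBottom : Bool
  onLeft : Bool
  bottom : List ℕ
  left : List ℕ
  top : List ℕ
  right : List ℕ
  bottomSlope : List ℕ
  leftSlope : List ℕ

/-- The whole input: the number of marked points, their membership in the four sets of extrema, and
the records of the subcells. -/
structure InputData where
  size : ℕ
  ehPlus : ℕ → Bool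
  ehMinus : ℕ → Bool
  evPlus : ℕ → Bool
  evMinus : ℕ → Bool
  subcells : List SubcellRecord

def SubcellRecord.words (R : SubcellRecord) : List ℕ :=
  [R.onBottom.toNat, R.onLeft.toNat, R.bottom.length, R.left.length, R.top.length, R.right.length]
    ++ R.bottom ++ R.left ++ R.top ++ R.right ++ R.bottomSlope ++ R.leftSlope

/-- The sequence of words that the machine finds on its input. -/
def InputData.words (D : InputData) : List ℕ :=
  [D.size, D.subcells.length]
    ++ (List.range D.size).flatMap (fun k =>
        [(D.ehPlus k).toNat, (D.ehMinus k).toNat, (D.evPlus k).toNat, (D.evMinus k).toNat])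
    ++ D.subcells.flatMap SubcellRecord.words

/-- The list `l` consists of the numbers of the points of `A`, in increasing order of the
coordinate `coord`. -/
def Lists (pts : ℕ → ℝ × ℝ) (size : ℕ) (A : Set (ℝ × ℝ)) (coord : ℝ × ℝ → ℝ) (l : List ℕ) : Prop :=
  l.Pairwise (fun k k' => coord (pts k) < coord (pts k')) ∧ ∀ k, k ∈ l ↔ k < size ∧ pts k ∈ A

/-- The record `R` describes the subcell `S`: its marked points on each edge, ordered along the
edge, and the slope information on the edges that lie on the bottom or left edge of the cell. -/
def RecordOf (δ : ℝ) (pts : ℕ → ℝ × ℝ) (size : ℕ) (R : SubcellRecord) (S : Subcell γ₁ γ₂) : Prop :=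
  Lists pts size (bdry γ₁ γ₂ δ ∩ S.bottom) Prod.fst R.bottom ∧
  Lists pts size (bdry γ₁ γ₂ δ ∩ S.left) Prod.snd R.left ∧
  Lists pts size (bdry γ₁ γ₂ δ ∩ S.top) Prod.fst R.top ∧
  Lists pts size (bdry γ₁ γ₂ δ ∩ S.right) Prod.snd R.right ∧
  (R.onBottom = true ↔ S.c = γ₂.brk S.j.castSucc) ∧
  (R.onLeft = true ↔ S.a = γ₁.brk S.i.castSucc) ∧
  (if R.onBottom = true then
    List.Forall₂ (fun k v => SlopeCode δ S (pts k) v) R.bottom R.bottomSlope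
    else R.bottomSlope = []) ∧
  (if R.onLeft = true then
    List.Forall₂ (fun k v => SlopeCode δ S (pts k) v) R.left R.leftSlope
    else R.leftSlope = [])

/-- `D` is the input belonging to the free space diagram, for the numbering `pts` of the marked
points and the list `subs` of all subcells with a marked point, in lexicographic order. -/
def IsInput (δ : ℝ) (pts : ℕ → ℝ × ℝ) (subs : List (Subcell γ₁ γ₂)) (D : InputData) : Prop :=
  BijOn pts (Iio D.size) (marked γ₁ γ₂ δ) ∧
  (∀ k < D.size,
    (D.ehPlus k = true ↔ pts k ∈ EhPlus γ₁ γ₂ δ) ∧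
    (D.ehMinus k = true ↔ pts k ∈ EhMinus γ₁ γ₂ δ) ∧
    (D.evPlus k = true ↔ pts k ∈ EvPlus γ₁ γ₂ δ) ∧
    (D.evMinus k = true ↔ pts k ∈ EvMinus γ₁ γ₂ δ)) ∧
  (∀ S, S ∈ subs ↔ S.IsSubcell δ ∧ (S.marked δ).Nonempty) ∧
  subs.Pairwise Subcell.Before ∧
  List.Forall₂ (RecordOf δ pts D.size) D.subcells subs

/-- The output lists every edge of `G_δ` exactly once, as a triple `k, i, j`: in the `k`-th subcell
of the list, the marked points number `i` and `j` are joined. -/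
def IsOutput (δ : ℝ) (pts : ℕ → ℝ × ℝ) (size : ℕ) (subs : List (Subcell γ₁ γ₂)) (out : List ℕ) :
    Prop :=
  ∃ edges : List (ℕ × ℕ × ℕ),
    out = edges.flatMap (fun e => [e.1, e.2.1, e.2.2]) ∧
    edges.Nodup ∧
    (∀ k i j, (k, i, j) ∈ edges → (k, j, i) ∉ edges) ∧
    ∀ k i j, ((k, i, j) ∈ edges ∨ (k, j, i) ∈ edges) ↔
      ∃ S, subs[k]? = some S ∧ i < size ∧ j < size ∧ Joined δ S (pts i) (pts j)

end FreeSpace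

/-! ### Smoothness of the `p`-norm -/

/-! Local picture. For `1 < p < ∞` the norm is `C¹` off the origin, and `δ > 0` keeps the difference
of the curve points off the origin along `B_δ`. As there are no singular points, near each point of
`B_δ` the distance is, inside a cell, strictly monotone in `x` or in `y`, with one sense on a whole
neighbourhood. As `E_h` and `E_v` are finite, a small quadrant at the point has no extrema along
lines other than its own two sides. A level set which is a graph over one side and has no extrema in
the interior is either absent near the corner or a strictly monotone arc leaving it
(`LevelQuadrant.branch_or_empty`). Of the two quadrants on one side of a vertical line, `B_δ` enters
exactly one, unless the point belongs to `E_v`; then it enters both or none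
(`LevelQuadrant.half_plane`). The same holds for horizontal lines and `E_h`.

Inside a subcell. The cuts remove all extrema from the open strips, so the exclusive alternative
holds throughout the interior: a branch entering an interior point from the lower left leaves it to
the upper right, and similarly for decreasing branches. A maximal monotone branch therefore ends on
the boundary (`TameBox.exists_incArc`), two arcs with a common interior point coincide, and every
marked point that is no corner is the end of exactly one arc. An arc separates the rectangle, so the
pairs of ends form a noncrossing matching of the points on the boundary (`TameBox.noncrossing`).

The algorithm. Each subcell is traversed counterclockwise from its upper left corner. A stack holds
the points whose partner is still to come; since the matching is noncrossing, a partner that has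
been passed is on top of the stack (`pending_pop`). It remains to decide between push and pop.
Points of the left edge are pushed, points inside the upper edge are popped. On the lower edge the
slope is known: increasing arcs are pushed, and a decreasing arc is popped exactly if the top of the
stack is a point of the left edge with a decreasing arc. On the right edge the slope is unknown, and
counting decides: as soon as one arc goes up to the upper edge, all stored and all remaining points
must be matched with the upper edge, so the comparison of their number with that of the points of
the upper edge tells whether to pop (`BoxPattern.right_pop_lt`, `BoxPattern.right_not_pop_le`).

The two ends of an arc have the same slope, so the traversal also finds the slopes on the upper and
right edges. By the alternative above, these slopes and the membership in `E_v` and `E_h` determine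
the slopes on the lower and left edges of the neighbouring subcells, which come later in the
lexicographic order. Slopes on edges of the cell are part of the input.

Time. Each marked point lies in at most four subcells and each listed subcell has a marked point, so
the records have linear total length (`IsInput.sum_length_le`), and every listed point costs a
bounded number of steps. -/

theorem PiLp.contDiffAt_norm {d : ℕ} {p : ℝ≥0∞} [Fact (1 ≤ p)] (hp : 1 < p) (hp' : p ≠ ∞)
    {v : PiLp p (fun _ : Fin d => ℝ)} (hv : v ≠ 0) :
    ContDiffAt ℝ 1 (fun w : PiLp p (fun _ : Fin d => ℝ) => ‖w‖) v := by
  have h1 : 1 < p.toReal := by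
    have := (ENNReal.toReal_lt_toReal ENNReal.one_ne_top hp').2 hp
    simpa using this
  have h0 : 0 < p.toReal := by linarith
  have hn : ∀ w : PiLp p (fun _ : Fin d => ℝ), ‖w‖ = (∑ i, ‖w i‖ ^ p.toReal) ^ (1 / p.toReal) :=
    fun w => PiLp.norm_eq_sum h0 w
  -- Here `1 < p` is essential: it makes `|t| ^ p` continuously differentiable also at `0`. The
  -- outer power `1 / p` is smooth because the sum is nonzero off the origin.
  have hs : ContDiff ℝ 1 (fun w : PiLp p (fun _ : Fin d => ℝ) => ∑ i, ‖w i‖ ^ p.toReal) := by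
    refine ContDiff.sum fun i _ => (contDiff_norm_rpow h1).comp ?_
    exact (PiLp.proj (𝕜 := ℝ) p (fun _ : Fin d => ℝ) i).contDiff
  have hne : (∑ i, ‖v i‖ ^ p.toReal) ≠ 0 := by
    intro h
    apply hv
    have := hn v
    rw [h, Real.zero_rpow (by positivity)] at this
    exact norm_eq_zero.1 this
  have := hs.contDiffAt.rpow_const_of_ne (x := v) (p := 1 / p.toReal) hne
  refine this.congr_of_eventuallyEq (Eventually.of_forall fun w => hn w)

/-! ### Continuity and local strict monotonicity of the distance -/

namespace FreeSpace

variable {E : Type*} [NormedAddCommGroup E] [NormedSpace ℝ E]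

/-- The norm is continuously differentiable away from the origin. -/
def SmoothNorm (E : Type*) [NormedAddCommGroup E] [NormedSpace ℝ E] : Prop :=
  ∀ v : E, v ≠ 0 → ContDiffAt ℝ 1 (fun w : E => ‖w‖) v

theorem brk_lt (γ : PiecewiseC2 E) (i : Fin γ.pieces) : γ.brk i.castSucc < γ.brk i.succ :=
  γ.brk_strictMono Fin.castSucc_lt_succ

theorem piece_subset (γ : PiecewiseC2 E) (i : Fin γ.pieces) : piece γ i ⊆ Icc 0 1 := by
  refine Icc_subset_Icc ?_ ?_
  · rw [← γ.brk_zero]; exact γ.brk_strictMono.monotone (Fin.zero_le _)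
  · rw [← γ.brk_last]; exact γ.brk_strictMono.monotone (Fin.le_last _)

theorem gap_comm (γ₁ γ₂ : PiecewiseC2 E) (x y : ℝ) : gap γ₁ γ₂ x y = gap γ₂ γ₁ y x :=
  norm_sub_rev _ _

theorem continuousOn_gap (γ₁ γ₂ : PiecewiseC2 E) :
    ContinuousOn (fun z : ℝ × ℝ => gap γ₁ γ₂ z.1 z.2) (Icc 0 1 ×ˢ Icc 0 1) := by
  refine (ContinuousOn.sub ?_ ?_).norm
  · exact γ₁.continuousOn.comp continuousOn_fst fun z hz => hz.1
  · exact γ₂.continuousOn.comp continuousOn_snd fun z hz => hz.2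

theorem isClosed_bdry (γ₁ γ₂ : PiecewiseC2 E) (δ : ℝ) : IsClosed (bdry γ₁ γ₂ δ) := by
  have := (continuousOn_gap γ₁ γ₂).preimage_isClosed_of_isClosed
    (isClosed_Icc.prod isClosed_Icc) (isClosed_singleton (x := δ))
  exact this

/-- Near a point of the level set at which the partial derivative in `x` does not vanish, the
distance is strictly monotone in `x`, with the same sense for all `y`. -/
theorem exists_strictMonoOn_fst (hN : SmoothNorm E) {γ₁ γ₂ : PiecewiseC2 E} {δ : ℝ} (hδ : 0 < δ)
    {i : Fin γ₁.pieces} {j : Fin γ₂.pieces} {z : ℝ × ℝ} (hz : z ∈ bdry γ₁ γ₂ δ)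
    (hc : z ∈ cell γ₁ γ₂ i j) (hd : dx γ₁ γ₂ i z ≠ 0) :
    ∃ ρ : ℝ, (ρ = 1 ∨ ρ = -1) ∧ ∃ ε > 0, ∀ y ∈ piece γ₂ j, |y - z.2| < ε →
      StrictMonoOn (fun x => ρ * gap γ₁ γ₂ x y) (piece γ₁ i ∩ Ioo (z.1 - ε) (z.1 + ε)) := by
  obtain ⟨x0, y0⟩ := z
  have hgap : gap γ₁ γ₂ x0 y0 = δ := hz.2
  have hud : UniqueDiffOn ℝ (piece γ₁ i) := uniqueDiffOn_Icc (brk_lt γ₁ i)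
  have hγ₁ : ContDiffOn ℝ 1 γ₁.toFun (piece γ₁ i) := (γ₁.contDiffOn i).of_le (by norm_num)
  have hder : ∀ x ∈ piece γ₁ i, HasDerivWithinAt γ₁.toFun
      (derivWithin γ₁.toFun (piece γ₁ i) x) (piece γ₁ i) x := fun x hx =>
    ((hγ₁.differentiableOn (by norm_num)) x hx).hasDerivWithinAt
  have hcd : ContinuousOn (derivWithin γ₁.toFun (piece γ₁ i)) (piece γ₁ i) :=
    hγ₁.continuousOn_derivWithin hud le_rfl
  set u : ℝ × ℝ → E := fun w => γ₁.toFun w.1 - γ₂.toFun w.2 with hu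
  set nf : E → E →L[ℝ] ℝ := fderiv ℝ (fun w : E => ‖w‖) with hnf
  -- By the chain rule `g` is the partial derivative in `x` wherever the two curve points differ. It
  -- is continuous in both variables at the given point within the cell; for `γ₂` continuity alone
  -- is enough here.
  set g : ℝ × ℝ → ℝ := fun w => nf (u w) (derivWithin γ₁.toFun (piece γ₁ i) w.1) with hg
  have hu0 : u (x0, y0) ≠ 0 := by
    intro h
    have : gap γ₁ γ₂ x0 y0 = 0 := by
      show ‖u (x0, y0)‖ = 0
      rw [h, norm_zero]
    linarith
  have hsub : cell γ₁ γ₂ i j ⊆ Icc 0 1 ×ˢ Icc 0 1 :=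
    prod_mono (piece_subset γ₁ i) (piece_subset γ₂ j)
  have huc : ContinuousOn u (cell γ₁ γ₂ i j) := by
    refine ContinuousOn.sub ?_ ?_
    · exact γ₁.continuousOn.comp continuousOn_fst fun w hw => (hsub hw).1
    · exact γ₂.continuousOn.comp continuousOn_snd fun w hw => (hsub hw).2
  have hasd : ∀ w ∈ cell γ₁ γ₂ i j, u w ≠ 0 →
      HasDerivWithinAt (fun x => gap γ₁ γ₂ x w.2) (g w) (piece γ₁ i) w.1 := by
    intro w hw hne
    have h1 : HasFDerivAt (fun v : E => ‖v‖) (nf (u w)) (u w) :=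
      ((hN _ hne).differentiableAt (by norm_num)).hasFDerivAt
    have h2 := (hder w.1 hw.1).sub_const (γ₂.toFun w.2)
    exact h1.comp_hasDerivWithinAt w.1 h2
  have hgc : ContinuousWithinAt g (cell γ₁ γ₂ i j) (x0, y0) := by
    have h1 : ContinuousAt nf (u (x0, y0)) :=
      (hN _ hu0).continuousAt_fderiv (by norm_num)
    have h2 : ContinuousWithinAt (fun w => nf (u w)) (cell γ₁ γ₂ i j) (x0, y0) :=
      ContinuousAt.comp_continuousWithinAt h1 (huc _ hc)
    have h3 : ContinuousOn (fun w : ℝ × ℝ => derivWithin γ₁.toFun (piece γ₁ i) w.1)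
        (cell γ₁ γ₂ i j) := hcd.comp continuousOn_fst fun w hw => hw.1
    exact h2.clm_apply (h3 _ hc)
  have hg0 : g (x0, y0) = dx γ₁ γ₂ i (x0, y0) :=
    ((hasd _ hc hu0).derivWithin (hud _ hc.1)).symm
  have hev1 : ∀ᶠ w in 𝓝[cell γ₁ γ₂ i j] (x0, y0), u w ≠ 0 :=
    (huc _ hc).eventually_ne hu0
  -- With `ρ` the sign of the derivative at the point, `ρ * g` stays positive on a neighbourhood in
  -- the cell, so one sense of monotonicity serves all nearby horizontal lines.
  have key : ∀ ρ : ℝ, 0 < ρ * g (x0, y0) → ∃ ε > 0, ∀ y ∈ piece γ₂ j, |y - y0| < ε →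
      StrictMonoOn (fun x => ρ * gap γ₁ γ₂ x y) (piece γ₁ i ∩ Ioo (x0 - ε) (x0 + ε)) := by
    intro ρ hρ
    have hev2 : ∀ᶠ w in 𝓝[cell γ₁ γ₂ i j] (x0, y0), 0 < ρ * g w :=
      (continuousWithinAt_const.mul hgc).eventually_const_lt hρ
    obtain ⟨ε, hε, h⟩ := Metric.mem_nhdsWithin_iff.1 (hev1.and hev2)
    refine ⟨ε, hε, fun y hy hyε => ?_⟩
    have hmem : ∀ x ∈ piece γ₁ i ∩ Ioo (x0 - ε) (x0 + ε), u (x, y) ≠ 0 ∧ 0 < ρ * g (x, y) := by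
      intro x hx
      refine h ⟨?_, hx.1, hy⟩
      rw [Metric.mem_ball, Prod.dist_eq]
      refine max_lt ?_ ?_
      · rw [Real.dist_eq, abs_lt]; constructor <;> linarith [hx.2.1, hx.2.2]
      · exact hyε
    refine strictMonoOn_of_deriv_pos ((convex_Icc _ _).inter (convex_Ioo _ _)) ?_ ?_
    · intro x hx
      exact (((hasd (x, y) ⟨hx.1, hy⟩ (hmem x hx).1).const_mul ρ).continuousWithinAt).mono
        inter_subset_left
    · intro x hx
      have hx' := interior_subset hx
      have hn : piece γ₁ i ∈ 𝓝 x := mem_of_superset (mem_interior_iff_mem_nhds.1 hx)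
        inter_subset_left
      have := ((hasd (x, y) ⟨hx'.1, hy⟩ (hmem x hx').1).const_mul ρ).hasDerivAt hn
      rw [this.deriv]
      exact (hmem x hx').2
  rcases lt_or_gt_of_ne (hg0 ▸ hd : g (x0, y0) ≠ 0) with h | h
  · exact ⟨-1, Or.inr rfl, key (-1) (by linarith)⟩
  · exact ⟨1, Or.inl rfl, key 1 (by linarith)⟩

theorem bdry_swap {γ₁ γ₂ : PiecewiseC2 E} {δ : ℝ} {z : ℝ × ℝ} :
    z.swap ∈ bdry γ₂ γ₁ δ ↔ z ∈ bdry γ₁ γ₂ δ := by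
  simp only [bdry, mem_ofPred_eq, mem_prod, Prod.fst_swap, Prod.snd_swap, gap_comm γ₂ γ₁]
  tauto

/-- Exchanging the curves transposes the square and does not change the distance. -/
theorem exists_strictMonoOn_snd (hN : SmoothNorm E) {γ₁ γ₂ : PiecewiseC2 E} {δ : ℝ} (hδ : 0 < δ)
    {i : Fin γ₁.pieces} {j : Fin γ₂.pieces} {z : ℝ × ℝ} (hz : z ∈ bdry γ₁ γ₂ δ)
    (hc : z ∈ cell γ₁ γ₂ i j) (hd : dy γ₁ γ₂ j z ≠ 0) :
    ∃ ρ : ℝ, (ρ = 1 ∨ ρ = -1) ∧ ∃ ε > 0, ∀ x ∈ piece γ₁ i, |x - z.1| < ε →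
      StrictMonoOn (fun y => ρ * gap γ₁ γ₂ x y) (piece γ₂ j ∩ Ioo (z.2 - ε) (z.2 + ε)) := by
  have := exists_strictMonoOn_fst hN hδ (z := z.swap) (bdry_swap.2 hz)
    (show z.swap ∈ cell γ₂ γ₁ j i from ⟨hc.2, hc.1⟩)
    (by simpa only [dx, dy, gap_comm γ₂ γ₁, Prod.fst_swap, Prod.snd_swap] using hd)
  simpa only [gap_comm γ₂ γ₁, Prod.fst_swap, Prod.snd_swap] using this

end FreeSpace

/-! ### Level sets near a corner of a rectangle -/

/-- Any two points of the set are comparable, strictly in both coordinates. -/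
def StrictChain (N : Set (ℝ × ℝ)) : Prop :=
  ∀ u ∈ N, ∀ v ∈ N, u = v ∨ (u.1 < v.1 ∧ u.2 < v.2) ∨ (v.1 < u.1 ∧ v.2 < u.2)

/-- A function on `[0,S] × [0,T]` that vanishes at the origin and has, along horizontal and vertical
lines, no local extrema on its zero set. -/
structure LevelQuadrant (H : ℝ → ℝ → ℝ) (S T : ℝ) : Prop where
  S_pos : 0 < S
  T_pos : 0 < T
  cont : ContinuousOn (fun w : ℝ × ℝ => H w.1 w.2) (Icc 0 S ×ˢ Icc 0 T)
  zero : H 0 0 = 0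
  noX : ∀ s ∈ Ioo 0 S, ∀ t ∈ Icc 0 T, H s t = 0 → ¬ IsLocalExtr (fun s => H s t) s
  noY : ∀ s ∈ Icc 0 S, ∀ t ∈ Ioo 0 T, H s t = 0 → ¬ IsLocalExtr (fun t => H s t) t

/-- Zeros in the open quadrant accumulate at the origin. -/
def ZerosAccumulate (H : ℝ → ℝ → ℝ) : Prop :=
  ∀ ε > 0, ∃ s t, 0 < s ∧ s < ε ∧ 0 < t ∧ t < ε ∧ H s t = 0

/-- In arbitrarily small rectangles the zero set is an increasing arc between opposite corners. -/
def ZerosBranch (H : ℝ → ℝ → ℝ) : Prop :=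
  ∀ ε > 0, ∃ s t, 0 < s ∧ s < ε ∧ 0 < t ∧ t < ε ∧ H s t = 0 ∧
    IsPreconnected {w : ℝ × ℝ | w.1 ∈ Icc 0 s ∧ w.2 ∈ Icc 0 t ∧ H w.1 w.2 = 0} ∧
    StrictChain {w : ℝ × ℝ | w.1 ∈ Icc 0 s ∧ w.2 ∈ Icc 0 t ∧ H w.1 w.2 = 0}

theorem ZerosBranch.zerosAccumulate {H : ℝ → ℝ → ℝ} (h : ZerosBranch H) : ZerosAccumulate H := by
  intro ε hε
  obtain ⟨s, t, h1, h2, h3, h4, h5, -⟩ := h ε hε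
  exact ⟨s, t, h1, h2, h3, h4, h5⟩

theorem ZerosAccumulate.swap {H : ℝ → ℝ → ℝ} (h : ZerosAccumulate H) :
    ZerosAccumulate (fun s t => H t s) := by
  intro ε hε
  obtain ⟨s, t, h1, h2, h3, h4, h5⟩ := h ε hε
  exact ⟨t, s, h3, h4, h1, h2, h5⟩

theorem ZerosBranch.swap {H : ℝ → ℝ → ℝ} (h : ZerosBranch H) :
    ZerosBranch (fun s t => H t s) := by
  intro ε hε
  obtain ⟨s, t, h1, h2, h3, h4, h5, h6, h7⟩ := h ε hε
  refine ⟨t, s, h3, h4, h1, h2, h5, ?_, ?_⟩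
  · have : {w : ℝ × ℝ | w.1 ∈ Icc 0 t ∧ w.2 ∈ Icc 0 s ∧ H w.2 w.1 = 0} =
        Prod.swap '' {w : ℝ × ℝ | w.1 ∈ Icc 0 s ∧ w.2 ∈ Icc 0 t ∧ H w.1 w.2 = 0} := by
      ext ⟨a, b⟩
      simp only [mem_ofPred_eq, mem_image, Prod.exists, Prod.swap_prod_mk, Prod.mk.injEq]
      constructor
      · rintro ⟨h1, h2, h3⟩; exact ⟨b, a, ⟨h2, h1, h3⟩, rfl, rfl⟩
      · rintro ⟨x, y, ⟨h1, h2, h3⟩, rfl, rfl⟩; exact ⟨h2, h1, h3⟩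
    rw [this]
    exact h6.image _ continuous_swap.continuousOn
  · rintro ⟨a, b⟩ hu ⟨a', b'⟩ hv
    have := h7 (b, a) ⟨hu.2.1, hu.1, hu.2.2⟩ (b', a') ⟨hv.2.1, hv.1, hv.2.2⟩
    simp only [Prod.mk.injEq] at this ⊢
    tauto

theorem ZerosAccumulate.neg {H : ℝ → ℝ → ℝ} (h : ZerosAccumulate H) :
    ZerosAccumulate (fun s t => - H s t) := by
  simpa [ZerosAccumulate] using h

theorem ZerosBranch.neg {H : ℝ → ℝ → ℝ} (h : ZerosBranch H) :
    ZerosBranch (fun s t => - H s t) := by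
  simpa [ZerosBranch] using h

namespace LevelQuadrant

variable {H : ℝ → ℝ → ℝ} {S T : ℝ}

theorem swap (h : LevelQuadrant H S T) : LevelQuadrant (fun s t => H t s) T S where
  S_pos := h.T_pos
  T_pos := h.S_pos
  cont := h.cont.comp (f := Prod.swap) continuous_swap.continuousOn fun _ hw => ⟨hw.2, hw.1⟩
  zero := h.zero
  noX := fun s hs t ht => h.noY t ht s hs
  noY := fun s hs t ht => h.noX t ht s hs

theorem neg (h : LevelQuadrant H S T) : LevelQuadrant (fun s t => - H s t) S T where
  S_pos := h.S_pos
  T_pos := h.T_pos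
  cont := h.cont.neg
  zero := by simp [h.zero]
  noX := fun s hs t ht h0 he => h.noX s hs t ht (by simpa using h0) (by simpa using he.neg)
  noY := fun s hs t ht h0 he => h.noY s hs t ht (by simpa using h0) (by simpa using he.neg)

theorem contOn_left (h : LevelQuadrant H S T) {s : ℝ} (hs : s ∈ Icc 0 S) :
    ContinuousOn (fun t => H s t) (Icc 0 T) :=
  h.cont.comp (f := fun t => (s, t)) (by fun_prop) fun t ht => ⟨hs, ht⟩

theorem contOn_right (h : LevelQuadrant H S T) {t : ℝ} (ht : t ∈ Icc 0 T) :
    ContinuousOn (fun s => H s t) (Icc 0 S) :=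
  h.cont.comp (f := fun s => (s, t)) (by fun_prop) fun s hs => ⟨hs, ht⟩

/-- If the function is strictly increasing in `s`, the zero set is near the origin either empty
or an arc. -/
theorem branch_or_empty (hq : LevelQuadrant H S T)
    (hm : ∀ t ∈ Icc 0 T, StrictMonoOn (fun s => H s t) (Icc 0 S)) :
    ∃ e > 0, e ≤ T ∧ ((∀ t ∈ Ioc 0 e, H 0 t < 0) ∧ ZerosBranch H ∨
      (∀ t ∈ Ioc 0 e, 0 < H 0 t) ∧ ¬ ZerosAccumulate H) := by
  have S0 := hq.S_pos
  have T0 := hq.T_pos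
  have m0 : (0 : ℝ) ∈ Icc 0 S := ⟨le_rfl, S0.le⟩
  have mS : S ∈ Icc 0 S := ⟨S0.le, le_rfl⟩
  have t0 : (0 : ℝ) ∈ Icc 0 T := ⟨le_rfl, T0.le⟩
  have hS0 : 0 < H S 0 := by
    have := hm 0 t0 m0 mS S0
    simpa [hq.zero] using this
  -- The function is positive on the far side `s = S` for small `t`, so every zero on these lines
  -- stays away from that side.
  obtain ⟨T1, hT1, hT1T, hST⟩ : ∃ T1 > 0, T1 ≤ T ∧ ∀ t ∈ Icc 0 T1, 0 < H S t := by
    have h1 := (hq.contOn_left mS 0 t0).eventually_const_lt hS0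
    obtain ⟨ε, hε, h⟩ := Metric.mem_nhdsWithin_iff.1 h1
    refine ⟨min (ε / 2) T, by positivity, min_le_right _ _, fun t ht => ?_⟩
    refine h ⟨?_, ht.1, ht.2.trans (min_le_right _ _)⟩
    rw [Metric.mem_ball, Real.dist_eq, sub_zero, abs_of_nonneg ht.1]
    linarith [ht.2.trans (min_le_left _ _)]
  have sub1 : Icc 0 T1 ⊆ Icc 0 T := Icc_subset_Icc_right hT1T
  -- The zero on the line at height `t` is unique if it exists. The function `h` takes this zero
  -- where `H 0 t ≤ 0`, and is cut off at `0` where `H 0 t > 0` and the line has no zero. This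
  -- truncated function is continuous on the whole interval.
  have hex : ∀ t, ∃ s, t ∈ Icc 0 T1 → 0 ≤ s ∧ s < S ∧ (H 0 t ≤ 0 → H s t = 0) ∧
      (0 < H 0 t → s = 0) := by
    intro t
    by_cases ht : t ∈ Icc 0 T1
    · rcases le_or_gt (H 0 t) 0 with h | h
      · obtain ⟨s, hs, hs'⟩ := intermediate_value_Icc S0.le (hq.contOn_right (sub1 ht))
          ⟨h, (hST t ht).le⟩
        refine ⟨s, fun _ => ⟨hs.1, lt_of_le_of_ne hs.2 ?_, fun _ => hs', fun h' => ?_⟩⟩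
        · rintro rfl
          have := hST t ht
          beta_reduce at hs'
          linarith
        · linarith
      · exact ⟨0, fun _ => ⟨le_rfl, S0, fun h' => by linarith, fun _ => rfl⟩⟩
    · exact ⟨0, fun h => absurd h ht⟩
  choose h hh using hex
  have hI : ∀ t ∈ Icc 0 T1, h t ∈ Icc 0 S := fun t ht => ⟨(hh t ht).1, (hh t ht).2.1.le⟩
  have hroot : ∀ t ∈ Icc 0 T1, 0 < h t → H (h t) t = 0 := by
    intro t ht hp
    refine (hh t ht).2.2.1 ?_
    by_contra hc
    have := (hh t ht).2.2.2 (not_le.1 hc)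
    linarith
  have hnn : ∀ t ∈ Icc 0 T1, 0 ≤ H (h t) t := by
    intro t ht
    rcases le_or_gt (H 0 t) 0 with h' | h'
    · exact ((hh t ht).2.2.1 h').ge
    · rw [(hh t ht).2.2.2 h']; exact h'.le
  have hlt : ∀ t ∈ Icc 0 T1, ∀ s ∈ Icc 0 S, H s t < 0 → s < h t := by
    intro t ht s hs hn
    by_contra hc
    have := (hm t (sub1 ht)).monotoneOn (hI t ht) hs (not_lt.1 hc)
    have := hnn t ht
    beta_reduce at *
    linarith
  have hgt : ∀ t ∈ Icc 0 T1, ∀ s ∈ Icc 0 S, 0 < s → 0 < H s t → h t < s := by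
    intro t ht s hs hs0 hn
    by_contra hc
    have h1 := (hm t (sub1 ht)).monotoneOn hs (hI t ht) (not_lt.1 hc)
    have h2 := hroot t ht (by linarith)
    beta_reduce at h1
    linarith
  -- Since `H` increases in `s`, the sign of `H a t` tells on which side of `a` the value `h t`
  -- lies, and this sign persists for nearby `t`.
  have hcont : ContinuousOn h (Icc 0 T1) := by
    intro t1 ht1
    refine tendsto_order.2 ⟨fun a ha => ?_, fun a ha => ?_⟩
    · rcases lt_or_ge a 0 with h0 | h0
      · filter_upwards [self_mem_nhdsWithin] with t ht
        exact h0.trans_le (hI t ht).1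
      · have ha' : a ∈ Icc 0 S := ⟨h0, ha.le.trans (hI t1 ht1).2⟩
        have h1 : H a t1 < 0 := by
          have := hm t1 (sub1 ht1) ha' (hI t1 ht1) ha
          beta_reduce at this
          rwa [hroot t1 ht1 (h0.trans_lt ha)] at this
        have h2 := (((hq.contOn_left ha').mono sub1) t1 ht1).eventually_lt_const h1
        filter_upwards [self_mem_nhdsWithin, h2] with t ht h2
        exact hlt t ht a ha' h2
    · rcases lt_or_ge a S with h0 | h0
      · have ha0 : 0 < a := (hI t1 ht1).1.trans_lt ha
        have ha' : a ∈ Icc 0 S := ⟨ha0.le, h0.le⟩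
        have h1 : 0 < H a t1 := (hnn t1 ht1).trans_lt (hm t1 (sub1 ht1) (hI t1 ht1) ha' ha)
        have h2 := (((hq.contOn_left ha').mono sub1) t1 ht1).eventually_const_lt h1
        filter_upwards [self_mem_nhdsWithin, h2] with t ht h2
        exact hgt t ht a ha' ha0 h2
      · filter_upwards [self_mem_nhdsWithin] with t ht
        exact (hh t ht).2.1.trans_le h0
  -- Either `h` vanishes near `0`, which leads to the empty quadrant, or it has positive values
  -- arbitrarily close to `0`, which leads to an arc.
  by_cases hcase : ∃ e > 0, e ≤ T1 ∧ ∀ t ∈ Ioc 0 e, h t = 0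
  · obtain ⟨e, he, heT, hz⟩ := hcase
    have hge : ∀ t ∈ Ioc 0 e, 0 ≤ H 0 t := by
      intro t ht
      have := hnn t ⟨ht.1.le, ht.2.trans heT⟩
      rwa [hz t ht] at this
    have hpos : ∀ t ∈ Ioc 0 (e / 2), 0 < H 0 t := by
      intro t ht
      have hte : t ∈ Ioc 0 e := ⟨ht.1, by linarith [ht.2]⟩
      refine lt_of_le_of_ne (hge t hte) fun h0 => ?_
      -- As `H 0` is nonnegative on this side, a further zero would be a local minimum along the
      -- side.
      refine hq.noY 0 m0 t ⟨ht.1, by linarith [ht.2]⟩ h0.symm (Or.inl ?_)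
      filter_upwards [Ioo_mem_nhds ht.1 (show t < e by linarith [ht.2])] with t' ht'
      simp only [← h0]
      exact hge t' ⟨ht'.1, ht'.2.le⟩
    refine ⟨e / 2, by positivity, by linarith, Or.inr ⟨hpos, fun hacc => ?_⟩⟩
    obtain ⟨s, t, hs, hs', ht, ht', h0⟩ := hacc (min S (e / 2)) (by positivity)
    have h1 := hpos t ⟨ht, ht'.le.trans (min_le_right _ _)⟩
    have h2 := hm t ⟨ht.le, by linarith [ht'.le.trans (min_le_right _ _)]⟩ m0
      ⟨hs.le, hs'.le.trans (min_le_left _ _)⟩ hs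
    beta_reduce at h2
    linarith
  · push Not at hcase
    have hacc : ∀ e > 0, e ≤ T1 → ∃ t ∈ Ioc 0 e, 0 < h t := by
      intro e he heT
      obtain ⟨t, ht, hne⟩ := hcase e he heT
      exact ⟨t, ht, lt_of_le_of_ne (hh t ⟨ht.1.le, ht.2.trans heT⟩).1 hne.symm⟩
    -- Monotonicity in `s` turns a local minimum of `h` with positive value into a local maximum of
    -- `H (h t)` along the vertical line, and a local maximum into a local minimum; both are
    -- excluded on the zero set.
    have noext : ∀ t ∈ Ioo 0 T1, 0 < h t → ¬ IsLocalExtr h t := by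
      intro t ht hp he
      have ht' : t ∈ Icc 0 T1 := ⟨ht.1.le, ht.2.le⟩
      refine hq.noY (h t) (hI t ht') t ⟨ht.1, ht.2.trans_le hT1T⟩ (hroot t ht' hp) ?_
      rcases he with he | he
      · refine Or.inr ?_
        filter_upwards [he, Icc_mem_nhds ht.1 ht.2] with t' h1 h2
        simp only [hroot t ht' hp]
        have h3 := (hm t' (sub1 h2)).monotoneOn (hI t ht') (hI t' h2) h1
        have h4 := hroot t' h2 (hp.trans_le h1)
        beta_reduce at h3
        linarith
      · refine Or.inl ?_
        filter_upwards [he, Icc_mem_nhds ht.1 ht.2] with t' h1 h2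
        simp only [hroot t ht' hp]
        have h3 := (hm t' (sub1 h2)).monotoneOn (hI t' h2) (hI t ht') h1
        have h4 := hnn t' h2
        beta_reduce at h3
        linarith
    obtain ⟨t1, ht1, hp1⟩ := hacc (T1 / 2) (by positivity) (by linarith)
    have ht1T : t1 < T1 := by linarith [ht1.2]
    -- If `h` returned to `0` at `t2`, its maximum on `[0, t2]` would be positive and attained
    -- inside, since `H 0 0 = 0` prevents `h 0` from being positive.
    have hpos : ∀ t ∈ Ioc 0 t1, 0 < h t := by
      intro t2 ht2
      by_contra hc
      have h0 : h t2 = 0 := le_antisymm (not_lt.1 hc) (hh t2 ⟨ht2.1.le, ht2.2.trans ht1T.le⟩).1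
      obtain ⟨t3, ht3, hp3⟩ := hacc t2 ht2.1 (ht2.2.trans ht1T.le)
      have sub2 : Icc 0 t2 ⊆ Icc 0 T1 := Icc_subset_Icc_right (ht2.2.trans ht1T.le)
      obtain ⟨tm, htm, hmax⟩ := isCompact_Icc.exists_isMaxOn ⟨t3, ⟨ht3.1.le, ht3.2⟩⟩
        (hcont.mono sub2)
      have hpm : 0 < h tm := hp3.trans_le (hmax ⟨ht3.1.le, ht3.2⟩)
      have hne0 : tm ≠ 0 := by
        rintro rfl
        have := hroot 0 ⟨le_rfl, hT1.le⟩ hpm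
        have h2 := hm 0 t0 m0 (hI 0 ⟨le_rfl, hT1.le⟩) hpm
        simp only [hq.zero] at h2
        linarith
      have hne2 : tm ≠ t2 := by
        rintro rfl; linarith
      have hmem : tm ∈ Ioo 0 t2 := ⟨lt_of_le_of_ne htm.1 hne0.symm, lt_of_le_of_ne htm.2 hne2⟩
      exact noext tm ⟨hmem.1, by linarith [hmem.2, ht2.2]⟩ hpm
        (Or.inr (hmax.isLocalMax (Icc_mem_nhds hmem.1 hmem.2)))
    have h00 : h 0 = 0 := by
      by_contra hc
      have hp : 0 < h 0 := lt_of_le_of_ne (hh 0 ⟨le_rfl, hT1.le⟩).1 (Ne.symm hc)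
      have := hroot 0 ⟨le_rfl, hT1.le⟩ hp
      have h2 := hm 0 t0 m0 (hI 0 ⟨le_rfl, hT1.le⟩) hp
      simp only [hq.zero] at h2
      linarith
    have sub3 : Icc 0 t1 ⊆ Icc 0 T1 := Icc_subset_Icc_right ht1T.le
    -- Rolle's argument: equal values would produce a local extremum in between. Hence `h` is
    -- injective, so strictly monotone, and increasing since it starts at `0` and is positive later.
    have hne : ∀ u ∈ Icc 0 t1, ∀ v ∈ Icc 0 t1, u < v → h u ≠ h v := by
      intro u hu v hv huv he
      obtain ⟨c, hc, hce⟩ := exists_isLocalExtr_Ioo huv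
        (hcont.mono ((Icc_subset_Icc hu.1 hv.2).trans sub3)) he
      refine noext c ⟨hu.1.trans_lt hc.1, (hc.2.trans_le hv.2).trans ht1T⟩ (hpos c ?_) hce
      exact ⟨hu.1.trans_lt hc.1, (hc.2.trans_le hv.2).le⟩
    have hinj : InjOn h (Icc 0 t1) := by
      intro u hu v hv he
      rcases lt_trichotomy u v with h1 | h1 | h1
      · exact absurd he (hne u hu v hv h1)
      · exact h1
      · exact absurd he.symm (hne v hv u hu h1)
    have hmono : StrictMonoOn h (Icc 0 t1) := by
      rcases (hcont.mono sub3).strictMonoOn_of_injOn_Icc' ht1.1.le hinj with h1 | h1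
      · exact h1
      · have := h1 ⟨le_rfl, ht1.1.le⟩ ⟨ht1.1.le, le_rfl⟩ ht1.1
        linarith
    refine ⟨t1, ht1.1, ht1T.le.trans hT1T, Or.inl ⟨fun t ht => ?_, fun ε hε => ?_⟩⟩
    · have htI : t ∈ Icc 0 T1 := sub3 ⟨ht.1.le, ht.2⟩
      have h1 := hm t (sub1 htI) m0 (hI t htI) (hpos t ht)
      beta_reduce at h1
      linarith [hroot t htI (hpos t ht)]
    · have h1 : ∀ᶠ t in 𝓝[Icc 0 T1] 0, h t < ε :=
        (hcont 0 ⟨le_rfl, hT1.le⟩).eventually_lt_const (by rw [h00]; exact hε)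
      obtain ⟨η, hη, hh1⟩ := Metric.mem_nhdsWithin_iff.1 h1
      set t := min (min (η / 2) (ε / 2)) t1 with ht
      have htp : 0 < t := by have := ht1.1; positivity
      have htt1 : t ≤ t1 := min_le_right _ _
      have htη : t ≤ η / 2 := (min_le_left _ _).trans (min_le_left _ _)
      have htε : t ≤ ε / 2 := (min_le_left _ _).trans (min_le_right _ _)
      have htI : t ∈ Icc 0 T1 := sub3 ⟨htp.le, htt1⟩
      -- In the rectangle with upper right corner `(h t, t)` the zero set is the graph of `h` over
      -- `[0, t]`; hence it is connected, a strict chain, and runs from corner to corner.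
      have hset : {w : ℝ × ℝ | w.1 ∈ Icc 0 (h t) ∧ w.2 ∈ Icc 0 t ∧ H w.1 w.2 = 0} =
          (fun t' => (h t', t')) '' Icc 0 t := by
        ext ⟨a, b⟩
        simp only [mem_ofPred_eq, mem_image, Prod.mk.injEq]
        constructor
        · rintro ⟨ha, hb, h0⟩
          refine ⟨b, hb, ?_, rfl⟩
          have hb1 : b ∈ Icc 0 T1 := ⟨hb.1, hb.2.trans htI.2⟩
          have haS : a ∈ Icc 0 S := ⟨ha.1, ha.2.trans (hI t htI).2⟩
          have hb0 : H (h b) b = 0 := by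
            refine (hh b hb1).2.2.1 ?_
            have h2 := (hm b (sub1 hb1)).monotoneOn m0 haS ha.1
            beta_reduce at h2
            linarith
          exact (hm b (sub1 hb1)).injOn (hI b hb1) haS (by simp only [hb0, h0])
        · rintro ⟨t', ht', rfl, rfl⟩
          have ht1' : t' ∈ Icc 0 t1 := ⟨ht'.1, ht'.2.trans htt1⟩
          refine ⟨⟨(hI t' (sub3 ht1')).1, hmono.monotoneOn ht1' ⟨htp.le, htt1⟩ ht'.2⟩, ht', ?_⟩
          rcases eq_or_lt_of_le ht'.1 with h2 | h2
          · rw [← h2, h00]; exact hq.zero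
          · exact hroot t' (sub3 ht1') (hpos t' ⟨h2, ht1'.2⟩)
      refine ⟨h t, t, hpos t ⟨htp, htt1⟩, hh1 ⟨?_, htI⟩, htp, by linarith,
        hroot t htI (hpos t ⟨htp, htt1⟩), ?_, ?_⟩
      · rw [Metric.mem_ball, Real.dist_eq, sub_zero, abs_of_pos htp]; linarith
      · rw [hset]
        refine isPreconnected_Icc.image _ (ContinuousOn.prodMk ?_ continuousOn_id)
        exact hcont.mono fun t' ht' => ⟨ht'.1, ht'.2.trans htI.2⟩
      · rw [hset]
        rintro _ ⟨a, ha, rfl⟩ _ ⟨b, hb, rfl⟩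
        have ha' : a ∈ Icc 0 t1 := ⟨ha.1, ha.2.trans htt1⟩
        have hb' : b ∈ Icc 0 t1 := ⟨hb.1, hb.2.trans htt1⟩
        rcases lt_trichotomy a b with h1 | h1 | h1
        · exact Or.inr (Or.inl ⟨hmono ha' hb' h1, h1⟩)
        · exact Or.inl (by simp [h1])
        · exact Or.inr (Or.inr ⟨hmono hb' ha' h1, h1⟩)

/-- The decreasing case follows by passing to `-H`, which has the same zeros and the same places of
local extrema. -/
theorem branch_or_empty' (hq : LevelQuadrant H S T) {ρ : ℝ} (hρ : ρ = 1 ∨ ρ = -1)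
    (hm : ∀ t ∈ Icc 0 T, StrictMonoOn (fun s => ρ * H s t) (Icc 0 S)) :
    ∃ e > 0, e ≤ T ∧ ((∀ t ∈ Ioc 0 e, ρ * H 0 t < 0) ∧ ZerosBranch H ∨
      (∀ t ∈ Ioc 0 e, 0 < ρ * H 0 t) ∧ ¬ ZerosAccumulate H) := by
  rcases hρ with rfl | rfl
  · simp only [one_mul] at *
    exact hq.branch_or_empty hm
  · simp only [neg_mul, one_mul] at *
    obtain ⟨e, he, heT, h⟩ := hq.neg.branch_or_empty hm
    refine ⟨e, he, heT, h.imp (And.imp_right fun h => ?_) (And.imp_right fun h h' => h h'.neg)⟩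
    simpa using h.neg

/-- At a corner of a rectangle at which the function is strictly monotone in one of the two
directions, accumulating zeros form an arc, and there are no zeros on the edges. -/
theorem branch_of_accumulate (hq : LevelQuadrant H S T) {ρ : ℝ} (hρ : ρ = 1 ∨ ρ = -1)
    (hm : (∀ t ∈ Icc 0 T, StrictMonoOn (fun s => ρ * H s t) (Icc 0 S)) ∨
      ∀ s ∈ Icc 0 S, StrictMonoOn (fun t => ρ * H s t) (Icc 0 T)) :
    (ZerosAccumulate H → ZerosBranch H) ∧ ∃ e > 0, ∀ t ∈ Ioc 0 e, H 0 t ≠ 0 ∧ H t 0 ≠ 0 := by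
  have aux : ∀ {H : ℝ → ℝ → ℝ} {S T : ℝ} (hq : LevelQuadrant H S T)
      (hm : ∀ t ∈ Icc 0 T, StrictMonoOn (fun s => ρ * H s t) (Icc 0 S)),
      (ZerosAccumulate H → ZerosBranch H) ∧ ∃ e > 0, ∀ t ∈ Ioc 0 e, H 0 t ≠ 0 ∧ H t 0 ≠ 0 := by
    intro H S T hq hm
    obtain ⟨e, he, heT, h⟩ := hq.branch_or_empty' hρ hm
    -- The side `s = 0` has no zeros by the strict signs in the alternative; the side `t = 0` has
    -- none because `H` is strictly monotone there and vanishes at the corner.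
    refine ⟨fun ha => ?_, min e S, lt_min he hq.S_pos, fun t ht => ⟨fun h0 => ?_, fun h0 => ?_⟩⟩
    · rcases h with h | h
      · exact h.2
      · exact absurd ha h.2
    · have hte : t ∈ Ioc 0 e := ⟨ht.1, ht.2.trans (min_le_left _ _)⟩
      rcases h with h | h
      · have := h.1 t hte
        simp [h0] at this
      · have := h.1 t hte
        simp [h0] at this
    · have := hm 0 ⟨le_rfl, hq.T_pos.le⟩ ⟨le_rfl, hq.S_pos.le⟩
        ⟨ht.1.le, ht.2.trans (min_le_right _ _)⟩ ht.1
      simp [h0, hq.zero] at this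
  rcases hm with hm | hm
  · exact aux hq hm
  · obtain ⟨h1, e, he, h2⟩ := aux hq.swap hm
    exact ⟨fun h => (h1 h.swap).swap, e, he, fun t ht => (h2 t ht).symm⟩

/-- At a point of an edge, the zero set enters exactly one of the two quadrants, unless the function
has a local extremum along the edge; in this case it enters both quadrants or none. -/
theorem half_plane {H' : ℝ → ℝ → ℝ} (hH' : H' = fun s t => H s (-t)) (hq : LevelQuadrant H S T)
    (hq' : LevelQuadrant H' S T) {ρ : ℝ} (hρ : ρ = 1 ∨ ρ = -1)
    (hm : (∀ t ∈ Icc (-T) T, StrictMonoOn (fun s => ρ * H s t) (Icc 0 S)) ∨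
      ∀ s ∈ Icc 0 S, StrictMonoOn (fun t => ρ * H s t) (Icc (-T) T)) :
    (IsLocalExtr (fun t => H 0 t) 0 → (ZerosAccumulate H ↔ ZerosAccumulate H')) ∧
    (¬ IsLocalExtr (fun t => H 0 t) 0 → (ZerosAccumulate H ↔ ¬ ZerosAccumulate H')) := by
  subst hH'
  have T0 := hq.T_pos
  have S0 := hq.S_pos
  have extr_iff : IsLocalExtr (fun t => ρ * H 0 t) 0 ↔ IsLocalExtr (fun t => H 0 t) 0 := by
    rcases hρ with rfl | rfl
    · simp
    · constructor
      · intro h; simpa using h.neg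
      · intro h; simpa using h.neg
  rcases hm with hm | hm
  -- Monotone transversally to the edge: in each quadrant the sign of `ρ * H 0` on its part of the
  -- edge decides whether there is a branch. Equal signs on the two parts mean a local extremum
  -- along the edge, and opposite signs mean none.
  · obtain ⟨e, he, heT, h⟩ := hq.branch_or_empty' hρ fun t ht =>
      hm t ⟨by linarith [ht.1], ht.2⟩
    obtain ⟨e', he', heT', h'⟩ := hq'.branch_or_empty' hρ fun t ht =>
      hm (-t) ⟨by linarith [ht.2], by linarith [ht.1]⟩
    have nb : Ioo (-e') e ∈ 𝓝 (0 : ℝ) := Ioo_mem_nhds (by linarith) he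
    have hz : ρ * H 0 0 = 0 := by simp [hq.zero]
    have hout : ∀ P : ℝ → Prop, (∀ t ∈ Ioc 0 e, P (ρ * H 0 t)) →
        (∀ t ∈ Ioc 0 e', P (ρ * H 0 (-t))) → P 0 → ∀ᶠ t in 𝓝 (0 : ℝ), P (ρ * H 0 t) := by
      intro P h1 h2 h0
      filter_upwards [nb] with t ht
      rcases lt_trichotomy t 0 with h | h | h
      · simpa using h2 (-t) ⟨by linarith, by linarith [ht.1]⟩
      · rw [h, hz]; exact h0
      · exact h1 t ⟨h, ht.2.le⟩
    have mixed : ∀ {f : ℝ → ℝ} {a b : ℝ}, 0 < a → 0 < b → (∀ t ∈ Ioc 0 a, 0 < f t) →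
        (∀ t ∈ Ioc 0 b, f (-t) < 0) → f 0 = 0 → ¬ IsLocalExtr f 0 := by
      intro f a b ha hb h1 h2 h0 h3
      rcases h3 with h3 | h3
      · obtain ⟨η, hη, h4⟩ := Metric.eventually_nhds_iff.1 h3
        have h5 := h4 (y := -min (η / 2) b) (by
          rw [Real.dist_eq, sub_zero, abs_neg, abs_of_pos (by positivity)]
          linarith [min_le_left (η / 2) b])
        have h6 := h2 (min (η / 2) b) ⟨by positivity, min_le_right _ _⟩
        linarith
      · obtain ⟨η, hη, h4⟩ := Metric.eventually_nhds_iff.1 h3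
        have h5 := h4 (y := min (η / 2) a) (by
          rw [Real.dist_eq, sub_zero, abs_of_pos (by positivity)]
          linarith [min_le_left (η / 2) a])
        have h6 := h1 (min (η / 2) a) ⟨by positivity, min_le_right _ _⟩
        linarith
    rcases h with ⟨h1, h2⟩ | ⟨h1, h2⟩ <;> rcases h' with ⟨h1', h2'⟩ | ⟨h1', h2'⟩
    · have : IsLocalExtr (fun t => H 0 t) 0 := extr_iff.1 (Or.inr (by
        have := hout (· ≤ 0) (fun t ht => (h1 t ht).le) (fun t ht => (h1' t ht).le) le_rfl
        simpa [IsLocalMax, IsMaxFilter, hz] using this))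
      have := h2.zerosAccumulate
      have := h2'.zerosAccumulate
      tauto
    · have : ¬ IsLocalExtr (fun t => H 0 t) 0 := fun hx => by
        have hx' : IsLocalExtr (fun t => - (ρ * H 0 t)) 0 := (extr_iff.2 hx).neg
        exact mixed he he' (fun t ht => by have := h1 t ht; linarith)
          (fun t ht => by have := h1' t ht; beta_reduce at *; linarith) (by simp [hq.zero]) hx'
      have := h2.zerosAccumulate
      tauto
    · have : ¬ IsLocalExtr (fun t => H 0 t) 0 := fun hx => by
        exact mixed he he' (fun t ht => h1 t ht)
          (fun t ht => by have := h1' t ht; beta_reduce at *; linarith) (by simp [hq.zero])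
          (extr_iff.2 hx)
      have := h2'.zerosAccumulate
      tauto
    · have : IsLocalExtr (fun t => H 0 t) 0 := extr_iff.1 (Or.inl (by
        have := hout (0 ≤ ·) (fun t ht => (h1 t ht).le) (fun t ht => (h1' t ht).le) le_rfl
        simpa [IsLocalMin, IsMinFilter, hz] using this))
      tauto
  -- Monotone along the edge: there is no extremum, and exactly one of the quadrants has to be
  -- entered.
  · have hnot : ¬ IsLocalExtr (fun t => H 0 t) 0 := by
      rw [← extr_iff]
      have hmono := hm 0 ⟨le_rfl, S0.le⟩
      have h0 : (0 : ℝ) ∈ Icc (-T) T := ⟨by linarith, T0.le⟩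
      intro hx
      rcases hx with hx | hx
      · obtain ⟨η, hη, h4⟩ := Metric.eventually_nhds_iff.1 hx
        have hpos : 0 < min (η / 2) T := by positivity
        have h5 := h4 (y := -min (η / 2) T) (by
          rw [Real.dist_eq, sub_zero, abs_neg, abs_of_pos hpos]
          linarith [min_le_left (η / 2) T])
        have h6 := hmono ⟨by linarith [min_le_right (η / 2) T], by linarith⟩ h0
          (show -min (η / 2) T < 0 by linarith)
        beta_reduce at h5 h6
        linarith
      · obtain ⟨η, hη, h4⟩ := Metric.eventually_nhds_iff.1 hx
        have hpos : 0 < min (η / 2) T := by positivity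
        have h5 := h4 (y := min (η / 2) T) (by
          rw [Real.dist_eq, sub_zero, abs_of_pos hpos]
          linarith [min_le_left (η / 2) T])
        have h6 := hmono h0 ⟨by linarith, min_le_right (η / 2) T⟩ hpos
        beta_reduce at h5 h6
        linarith
    have hρ' : -ρ = 1 ∨ -ρ = -1 := by rcases hρ with rfl | rfl <;> simp
    -- Both alternatives are governed by the sign of `H` on the common side `t = 0` of the two
    -- quadrants. The reflection reverses the sense of monotonicity, so this sign is tested once
    -- with `ρ` and once with `-ρ`, and exactly one test gives a branch.
    obtain ⟨e, he, heT, h⟩ := hq.swap.branch_or_empty' hρ fun s hs =>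
      (hm s hs).mono (Icc_subset_Icc_left (by linarith))
    obtain ⟨e', he', heT', h'⟩ := hq'.swap.branch_or_empty' hρ' fun s hs => by
      intro a ha b hb hab
      have := hm s hs (show -b ∈ Icc (-T) T from ⟨by linarith [hb.2], by linarith [hb.1]⟩)
        (show -a ∈ Icc (-T) T from ⟨by linarith [ha.2], by linarith [ha.1]⟩) (by linarith)
      beta_reduce at this ⊢
      linarith
    have hmin : min e e' ∈ Ioc 0 e := ⟨lt_min he he', min_le_left _ _⟩
    have hmin' : min e e' ∈ Ioc 0 e' := ⟨lt_min he he', min_le_right _ _⟩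
    rcases h with ⟨h1, h2⟩ | ⟨h1, h2⟩ <;> rcases h' with ⟨h1', h2'⟩ | ⟨h1', h2'⟩
    · have h3 := h1 _ hmin
      have h4 := h1' _ hmin'
      simp only [neg_zero] at h3 h4
      linarith
    · have := h2.swap.zerosAccumulate
      have := fun h : ZerosAccumulate (fun s t => H s (-t)) => h2' h.swap
      tauto
    · have := h2'.swap.zerosAccumulate
      have := fun h : ZerosAccumulate H => h2 h.swap
      tauto
    · have h3 := h1 _ hmin
      have h4 := h1' _ hmin'
      simp only [neg_zero] at h3 h4
      linarith

end LevelQuadrant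

/-! ### Branches of a planar set in the four quadrants of a point -/

/-- Points of `L` in the open quadrant of `z` with signs `σ`, `τ` accumulate at `z`. -/
def Enters (L : Set (ℝ × ℝ)) (z : ℝ × ℝ) (σ τ : ℝ) : Prop :=
  ∀ ε > 0, ∃ w ∈ L, 0 < σ * (w.1 - z.1) ∧ σ * (w.1 - z.1) < ε ∧
    0 < τ * (w.2 - z.2) ∧ τ * (w.2 - z.2) < ε

/-- The rectangle with side lengths `s` and `t` at the corner `z` in the quadrant `σ`, `τ`. -/
def quadBox (z : ℝ × ℝ) (σ τ s t : ℝ) : Set (ℝ × ℝ) :=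
  {w | σ * (w.1 - z.1) ∈ Icc 0 s ∧ τ * (w.2 - z.2) ∈ Icc 0 t}

/-- In arbitrarily small rectangles at `z` in the quadrant, `L` is a connected strict chain between
opposite corners. -/
def Branch (L : Set (ℝ × ℝ)) (z : ℝ × ℝ) (σ τ : ℝ) : Prop :=
  ∀ ε > 0, ∃ s t, 0 < s ∧ s < ε ∧ 0 < t ∧ t < ε ∧ (z.1 + σ * s, z.2 + τ * t) ∈ L ∧
    IsPreconnected (L ∩ quadBox z σ τ s t) ∧
    ∀ u ∈ L ∩ quadBox z σ τ s t, ∀ v ∈ L ∩ quadBox z σ τ s t,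
      u = v ∨ (0 < σ * (v.1 - u.1) ∧ 0 < τ * (v.2 - u.2)) ∨
        (0 < σ * (u.1 - v.1) ∧ 0 < τ * (u.2 - v.2))

def IsSign (σ : ℝ) : Prop := σ = 1 ∨ σ = -1

theorem IsSign.mul_self {σ : ℝ} (h : IsSign σ) : σ * σ = 1 := by
  rcases h with rfl | rfl <;> norm_num

theorem IsSign.mul {σ τ : ℝ} (h : IsSign σ) (h' : IsSign τ) : IsSign (σ * τ) := by
  rcases h with rfl | rfl <;> rcases h' with rfl | rfl <;> norm_num [IsSign]

theorem isSign_one : IsSign 1 := Or.inl rfl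
theorem isSign_neg_one : IsSign (-1) := Or.inr rfl

theorem Enters.swap {L : Set (ℝ × ℝ)} {z : ℝ × ℝ} {σ τ : ℝ} :
    Enters (Prod.swap ⁻¹' L) z.swap τ σ ↔ Enters L z σ τ := by
  constructor
  · intro h ε hε
    obtain ⟨w, hw, h1, h2, h3, h4⟩ := h ε hε
    exact ⟨w.swap, hw, h3, h4, h1, h2⟩
  · intro h ε hε
    obtain ⟨w, hw, h1, h2, h3, h4⟩ := h ε hε
    exact ⟨w.swap, by simpa using hw, h3, h4, h1, h2⟩

/-! ### Exchange of the curves, and the branches of `B_δ` at a point of a cell -/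

namespace FreeSpace

variable {E : Type*} [NormedAddCommGroup E] [NormedSpace ℝ E] {γ₁ γ₂ : PiecewiseC2 E} {δ : ℝ}

theorem swap_preimage_bdry : Prod.swap ⁻¹' bdry γ₁ γ₂ δ = bdry γ₂ γ₁ δ := by
  ext z
  exact bdry_swap (γ₁ := γ₂) (γ₂ := γ₁)

theorem cellEv_swap {i : Fin γ₁.pieces} {j : Fin γ₂.pieces} {z : ℝ × ℝ} :
    z.swap ∈ cellEv γ₂ γ₁ δ j i ↔ z ∈ cellEh γ₁ γ₂ δ i j := by
  simp only [cellEv, cellEh, mem_ofPred_eq, mem_inter_iff, bdry_swap, cell, mem_prod, dx, dy,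
    Prod.fst_swap, Prod.snd_swap, gap_comm γ₂ γ₁]
  tauto

theorem cellEh_swap {i : Fin γ₁.pieces} {j : Fin γ₂.pieces} {z : ℝ × ℝ} :
    z.swap ∈ cellEh γ₂ γ₁ δ j i ↔ z ∈ cellEv γ₁ γ₂ δ i j := by
  have := cellEv_swap (γ₁ := γ₂) (γ₂ := γ₁) (δ := δ) (i := j) (j := i) (z := z.swap)
  rw [Prod.swap_swap] at this
  exact this.symm

theorem Ev_swap {z : ℝ × ℝ} : z.swap ∈ Ev γ₂ γ₁ δ ↔ z ∈ Eh γ₁ γ₂ δ := by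
  simp only [Ev, Eh, mem_iUnion, cellEv_swap]
  exact exists_comm

theorem Eh_swap {z : ℝ × ℝ} : z.swap ∈ Eh γ₂ γ₁ δ ↔ z ∈ Ev γ₁ γ₂ δ := by
  simp only [Ev, Eh, mem_iUnion, cellEh_swap]
  exact exists_comm

/-- The assumptions of the free space diagram. -/
structure Generic (γ₁ γ₂ : PiecewiseC2 E) (δ : ℝ) : Prop where
  smooth : SmoothNorm E
  pos : 0 < δ
  nonsing : singularSet γ₁ γ₂ δ = ∅
  finEh : (Eh γ₁ γ₂ δ).Finite
  finEv : (Ev γ₁ γ₂ δ).Finite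

/-- The assumptions are symmetric in the curves, so that everything proved for vertical lines holds
for horizontal lines by transposition. -/
theorem Generic.symm (hG : Generic γ₁ γ₂ δ) : Generic γ₂ γ₁ δ where
  smooth := hG.smooth
  pos := hG.pos
  nonsing := by
    rw [eq_empty_iff_forall_notMem]
    rintro z ⟨hz, j, i, hc, h1, h2⟩
    have : z.swap ∈ singularSet γ₁ γ₂ δ := by
      refine ⟨bdry_swap.2 hz, i, j, ⟨hc.2, hc.1⟩, ?_, ?_⟩
      · simpa only [dx, dy, gap_comm γ₂ γ₁, Prod.fst_swap, Prod.snd_swap] using h2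
      · simpa only [dx, dy, gap_comm γ₂ γ₁, Prod.fst_swap, Prod.snd_swap] using h1
    rw [hG.nonsing] at this
    exact this
  finEh := by
    refine (hG.finEv.image Prod.swap).subset fun z hz => ⟨z.swap, ?_, Prod.swap_swap z⟩
    exact Eh_swap.1 (by simpa using hz)
  finEv := by
    refine (hG.finEh.image Prod.swap).subset fun z hz => ⟨z.swap, ?_, Prod.swap_swap z⟩
    exact Ev_swap.1 (by simpa using hz)

/-- In the interior of the `x`-interval the derivative vanishes at a two-sided local extremum by
Fermat's theorem, so the tangent condition in the definition comes for free. -/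
theorem mem_cellEh_of_isLocalExtr {i : Fin γ₁.pieces} {j : Fin γ₂.pieces} {w : ℝ × ℝ}
    (hw : w ∈ bdry γ₁ γ₂ δ) (h1 : w.1 ∈ Ioo (γ₁.brk i.castSucc) (γ₁.brk i.succ))
    (h2 : w.2 ∈ piece γ₂ j) (he : IsLocalExtr (fun x => gap γ₁ γ₂ x w.2) w.1) :
    w ∈ cellEh γ₁ γ₂ δ i j := by
  refine ⟨⟨hw, Ioo_subset_Icc_self h1, h2⟩, ?_, he.on _⟩
  rw [dx, piece, derivWithin_of_mem_nhds (Icc_mem_nhds h1.1 h1.2)]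
  exact he.deriv_eq_zero

theorem mem_cellEv_of_isLocalExtr {i : Fin γ₁.pieces} {j : Fin γ₂.pieces} {w : ℝ × ℝ}
    (hw : w ∈ bdry γ₁ γ₂ δ) (h1 : w.1 ∈ piece γ₁ i)
    (h2 : w.2 ∈ Ioo (γ₂.brk j.castSucc) (γ₂.brk j.succ))
    (he : IsLocalExtr (fun y => gap γ₁ γ₂ w.1 y) w.2) :
    w ∈ cellEv γ₁ γ₂ δ i j := by
  refine ⟨⟨hw, h1, Ioo_subset_Icc_self h2⟩, ?_, he.on _⟩
  rw [dy, piece, derivWithin_of_mem_nhds (Icc_mem_nhds h2.1 h2.2)]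
  exact he.deriv_eq_zero

theorem exists_isolating {A : Set ℝ} (hA : A.Finite) (x : ℝ) :
    ∃ ε > 0, ∀ a ∈ A, |a - x| < ε → a = x := by
  have h : (A \ {x})ᶜ ∈ 𝓝 x := (hA.subset sdiff_subset).isClosed.isOpen_compl.mem_nhds (by simp)
  obtain ⟨ε, hε, h⟩ := Metric.mem_nhds_iff.1 h
  refine ⟨ε, hε, fun a ha hd => ?_⟩
  by_contra hne
  exact h (Metric.mem_ball.2 hd) ⟨ha, hne⟩

/-- Near `z`, on the scale `ε`, there are no extrema on other horizontal and vertical lines, and the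
distance is strictly monotone in one direction, with sense `ρ`. -/
structure NiceScale (γ₁ γ₂ : PiecewiseC2 E) (δ : ℝ) (i : Fin γ₁.pieces) (j : Fin γ₂.pieces)
    (z : ℝ × ℝ) (ρ ε : ℝ) : Prop where
  sign : IsSign ρ
  pos : 0 < ε
  noEh : ∀ w ∈ Eh γ₁ γ₂ δ, |w.1 - z.1| < ε → w.1 = z.1
  noEv : ∀ w ∈ Ev γ₁ γ₂ δ, |w.2 - z.2| < ε → w.2 = z.2
  mono : (∀ y ∈ piece γ₂ j, |y - z.2| < ε →
      StrictMonoOn (fun x => ρ * gap γ₁ γ₂ x y) (piece γ₁ i ∩ Ioo (z.1 - ε) (z.1 + ε))) ∨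
    (∀ x ∈ piece γ₁ i, |x - z.1| < ε →
      StrictMonoOn (fun y => ρ * gap γ₁ γ₂ x y) (piece γ₂ j ∩ Ioo (z.2 - ε) (z.2 + ε)))

/-- Nonsingularity makes one partial derivative nonzero, which gives the monotonicity; the
finiteness of `E_h` and `E_v` isolates the abscissa and the ordinate of the point from those of the
other extrema. -/
theorem Generic.exists_niceScale (hG : Generic γ₁ γ₂ δ) {i : Fin γ₁.pieces} {j : Fin γ₂.pieces}
    {z : ℝ × ℝ} (hz : z ∈ bdry γ₁ γ₂ δ) (hc : z ∈ cell γ₁ γ₂ i j) :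
    ∃ ρ ε, NiceScale γ₁ γ₂ δ i j z ρ ε := by
  obtain ⟨ε1, h1, h1'⟩ := exists_isolating (hG.finEh.image Prod.fst) z.1
  obtain ⟨ε2, h2, h2'⟩ := exists_isolating (hG.finEv.image Prod.snd) z.2
  have hh : ∃ ρ : ℝ, IsSign ρ ∧ ∃ ε > 0, ((∀ y ∈ piece γ₂ j, |y - z.2| < ε →
      StrictMonoOn (fun x => ρ * gap γ₁ γ₂ x y) (piece γ₁ i ∩ Ioo (z.1 - ε) (z.1 + ε))) ∨
    (∀ x ∈ piece γ₁ i, |x - z.1| < ε →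
      StrictMonoOn (fun y => ρ * gap γ₁ γ₂ x y) (piece γ₂ j ∩ Ioo (z.2 - ε) (z.2 + ε)))) := by
    by_cases hd : dx γ₁ γ₂ i z = 0
    · have hd' : dy γ₁ γ₂ j z ≠ 0 := by
        intro h0
        have : z ∈ singularSet γ₁ γ₂ δ := ⟨hz, i, j, hc, hd, h0⟩
        rw [hG.nonsing] at this
        exact this
      obtain ⟨ρ, hρ, ε, hε, h⟩ := exists_strictMonoOn_snd hG.smooth hG.pos hz hc hd'
      exact ⟨ρ, hρ, ε, hε, Or.inr h⟩
    · obtain ⟨ρ, hρ, ε, hε, h⟩ := exists_strictMonoOn_fst hG.smooth hG.pos hz hc hd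
      exact ⟨ρ, hρ, ε, hε, Or.inl h⟩
  obtain ⟨ρ, hρ, ε3, h3, hm⟩ := hh
  set ε := min ε1 (min ε2 ε3) with hε
  have e1 : ε ≤ ε1 := min_le_left _ _
  have e2 : ε ≤ ε2 := (min_le_right _ _).trans (min_le_left _ _)
  have e3 : ε ≤ ε3 := (min_le_right _ _).trans (min_le_right _ _)
  refine ⟨ρ, ε, hρ, by positivity, fun w hw hd => h1' _ ⟨w, hw, rfl⟩ (hd.trans_le e1),
    fun w hw hd => h2' _ ⟨w, hw, rfl⟩ (hd.trans_le e2), hm.imp ?_ ?_⟩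
  · exact fun h y hy hd => (h y hy (hd.trans_le e3)).mono
      (inter_subset_inter_right _ (Ioo_subset_Ioo (by linarith) (by linarith)))
  · exact fun h y hy hd => (h y hy (hd.trans_le e3)).mono
      (inter_subset_inter_right _ (Ioo_subset_Ioo (by linarith) (by linarith)))

theorem exists_side {A B x σ ε : ℝ} (hx : x ∈ Icc A B) (hσ : IsSign σ) (hr : σ = 1 → x < B)
    (hl : σ = -1 → A < x) (hε : 0 < ε) : ∃ S > 0, S < ε ∧ x + σ * S ∈ Icc A B := by
  rcases hσ with rfl | rfl
  · have := hr rfl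
    refine ⟨min (ε / 2) (B - x), lt_min (by positivity) (by linarith), ?_, ?_⟩
    · linarith [min_le_left (ε / 2) (B - x)]
    · have h1 := min_le_right (ε / 2) (B - x)
      have h2 : 0 < min (ε / 2) (B - x) := lt_min (by positivity) (by linarith)
      constructor <;> linarith [hx.1]
  · have := hl rfl
    refine ⟨min (ε / 2) (x - A), lt_min (by positivity) (by linarith), ?_, ?_⟩
    · linarith [min_le_left (ε / 2) (x - A)]
    · have h1 := min_le_right (ε / 2) (x - A)
      have h2 : 0 < min (ε / 2) (x - A) := lt_min (by positivity) (by linarith)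
      constructor <;> linarith [hx.2]

theorem side_mem {A B x σ S s : ℝ} (hx : x ∈ Icc A B) (hσ : IsSign σ) (hS : x + σ * S ∈ Icc A B)
    (hs : s ∈ Icc 0 S) : x + σ * s ∈ Icc A B := by
  rcases hσ with rfl | rfl <;> constructor <;> linarith [hx.1, hx.2, hS.1, hS.2, hs.1, hs.2]

theorem side_mem_Ioo {A B x σ S s : ℝ} (hx : x ∈ Icc A B) (hσ : IsSign σ)
    (hS : x + σ * S ∈ Icc A B) (hs : s ∈ Ioo 0 S) : x + σ * s ∈ Ioo A B := by
  rcases hσ with rfl | rfl <;> constructor <;> linarith [hx.1, hx.2, hS.1, hS.2, hs.1, hs.2]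

theorem abs_side {x σ s ε : ℝ} (hσ : IsSign σ) (hs : |s| < ε) : |x + σ * s - x| < ε := by
  rcases hσ with rfl | rfl <;> simpa using hs

/-- The distance in coordinates along the sides of the quadrant `σ`, `τ` of `z`. -/
def localGap (γ₁ γ₂ : PiecewiseC2 E) (δ : ℝ) (z : ℝ × ℝ) (σ τ s t : ℝ) : ℝ :=
  gap γ₁ γ₂ (z.1 + σ * s) (z.2 + τ * t) - δ

section local_coordinates

variable {i : Fin γ₁.pieces} {j : Fin γ₂.pieces} {z : ℝ × ℝ} {ρ ε σ τ S T : ℝ}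

/-- A zero off the side `s = 0` with a local extremum in `s` would be a point of `E_h` with abscissa
different from that of `z` but within the isolating distance. The same argument with `E_v` excludes
extrema in `t`. -/
theorem NiceScale.levelQuadrant (hn : NiceScale γ₁ γ₂ δ i j z ρ ε) (hz : z ∈ bdry γ₁ γ₂ δ)
    (hc : z ∈ cell γ₁ γ₂ i j) (hσ : IsSign σ) (hτ : IsSign τ)
    (S0 : 0 < S) (T0 : 0 < T) (hSε : S < ε) (hTε : T < ε)
    (hS : z.1 + σ * S ∈ piece γ₁ i) (hT : z.2 + τ * T ∈ piece γ₂ j) :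
    LevelQuadrant (localGap γ₁ γ₂ δ z σ τ) S T where
  S_pos := S0
  T_pos := T0
  cont := by
    refine ContinuousOn.sub ?_ continuousOn_const
    refine (continuousOn_gap γ₁ γ₂).comp
      (f := fun w : ℝ × ℝ => (z.1 + σ * w.1, z.2 + τ * w.2)) (by fun_prop) ?_
    intro w hw
    exact ⟨piece_subset _ _ (side_mem hc.1 hσ hS hw.1),
      piece_subset _ _ (side_mem hc.2 hτ hT hw.2)⟩
  zero := by
    have : gap γ₁ γ₂ z.1 z.2 = δ := hz.2
    simp [localGap, this]
  noX := by
    intro s hs t ht h0 he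
    have h1 := side_mem_Ioo hc.1 hσ hS hs
    have h2 := side_mem hc.2 hτ hT ht
    have hg : gap γ₁ γ₂ (z.1 + σ * s) (z.2 + τ * t) = δ := by
      simp only [localGap] at h0; linarith
    have hw : (z.1 + σ * s, z.2 + τ * t) ∈ Eh γ₁ γ₂ δ := by
      refine mem_iUnion₂.2 ⟨i, j, mem_cellEh_of_isLocalExtr ⟨⟨piece_subset _ i
        (Ioo_subset_Icc_self h1), piece_subset _ _ h2⟩, hg⟩ h1 h2 ?_⟩
      have hcomp : IsLocalExtr ((fun s => localGap γ₁ γ₂ δ z σ τ s t) ∘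
          fun x => σ * (x - z.1)) (z.1 + σ * s) := by
        refine IsExtrFilter.comp_tendsto (l := 𝓝 s) ?_ ?_
        · have : σ * (z.1 + σ * s - z.1) = s := by linear_combination s * hσ.mul_self
          rw [this]; exact he
        · have : Tendsto (fun x => σ * (x - z.1)) (𝓝 (z.1 + σ * s))
              (𝓝 (σ * (z.1 + σ * s - z.1))) := by
            apply Continuous.tendsto; fun_prop
          have h3 : σ * (z.1 + σ * s - z.1) = s := by linear_combination s * hσ.mul_self
          rwa [h3] at this
      have heq : ((fun s => localGap γ₁ γ₂ δ z σ τ s t) ∘ fun x => σ * (x - z.1)) =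
          fun x => gap γ₁ γ₂ x (z.2 + τ * t) - δ := by
        funext x
        simp only [Function.comp, localGap]
        congr 2
        linear_combination (x - z.1) * hσ.mul_self
      rw [heq] at hcomp
      exact hcomp.imp (fun h => by simpa [IsMinFilter] using h)
        (fun h => by simpa [IsMaxFilter] using h)
    have h4 := hn.noEh _ hw (abs_side hσ (by rw [abs_of_pos hs.1]; exact hs.2.trans hSε))
    have h5 : σ * (σ * s) = 0 := by
      simp only at h4
      have : σ * s = 0 := by linarith
      rw [this, mul_zero]
    rw [← mul_assoc, hσ.mul_self, one_mul] at h5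
    exact hs.1.ne' h5
  noY := by
    intro s hs t ht h0 he
    have h1 := side_mem hc.1 hσ hS hs
    have h2 := side_mem_Ioo hc.2 hτ hT ht
    have hg : gap γ₁ γ₂ (z.1 + σ * s) (z.2 + τ * t) = δ := by
      simp only [localGap] at h0; linarith
    have hw : (z.1 + σ * s, z.2 + τ * t) ∈ Ev γ₁ γ₂ δ := by
      refine mem_iUnion₂.2 ⟨i, j, mem_cellEv_of_isLocalExtr ⟨⟨piece_subset _ i h1,
        piece_subset _ j (Ioo_subset_Icc_self h2)⟩, hg⟩ h1 h2 ?_⟩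
      have h3 : τ * (z.2 + τ * t - z.2) = t := by linear_combination t * hτ.mul_self
      have hcomp : IsLocalExtr ((fun t => localGap γ₁ γ₂ δ z σ τ s t) ∘
          fun x => τ * (x - z.2)) (z.2 + τ * t) := by
        refine IsExtrFilter.comp_tendsto (l := 𝓝 t) ?_ ?_
        · rw [h3]; exact he
        · have : Tendsto (fun x => τ * (x - z.2)) (𝓝 (z.2 + τ * t))
              (𝓝 (τ * (z.2 + τ * t - z.2))) := by
            apply Continuous.tendsto; fun_prop
          rwa [h3] at this
      have heq : ((fun t => localGap γ₁ γ₂ δ z σ τ s t) ∘ fun x => τ * (x - z.2)) =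
          fun x => gap γ₁ γ₂ (z.1 + σ * s) x - δ := by
        funext x
        simp only [Function.comp, localGap]
        congr 2
        linear_combination (x - z.2) * hτ.mul_self
      rw [heq] at hcomp
      exact hcomp.imp (fun h => by simpa [IsMinFilter] using h)
        (fun h => by simpa [IsMaxFilter] using h)
    have h4 := hn.noEv _ hw (abs_side hτ (by rw [abs_of_pos ht.1]; exact ht.2.trans hTε))
    have h5 : τ * (τ * t) = 0 := by
      simp only at h4
      have : τ * t = 0 := by linarith
      rw [this, mul_zero]
    rw [← mul_assoc, hτ.mul_self, one_mul] at h5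
    exact ht.1.ne' h5

/-- Reversing the direction of a coordinate reverses the sense of monotonicity; the factor `σ`
records this. -/
theorem strictMonoOn_side {f : ℝ → ℝ} {A : Set ℝ} {B : Set ℝ} {x : ℝ} (hσ : IsSign σ) (c : ℝ)
    (hf : StrictMonoOn (fun x => ρ * f x) A) (hB : ∀ s ∈ B, x + σ * s ∈ A) :
    StrictMonoOn (fun s => (ρ * σ) * (f (x + σ * s) - c)) B := by
  intro a ha b hb hab
  rcases hσ with rfl | rfl
  · have := hf (hB a ha) (hB b hb) (by linarith)
    simp only at this ⊢
    linarith
  · have := hf (hB b hb) (hB a ha) (by linarith)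
    simp only at this ⊢
    linarith

theorem side_mem_ball {x s ε : ℝ} (hσ : IsSign σ) (hs : |s| < ε) :
    x + σ * s ∈ Ioo (x - ε) (x + ε) := by
  rw [abs_lt] at hs
  rcases hσ with rfl | rfl <;> constructor <;> linarith

theorem zerosAccumulate_localGap (hc : z ∈ cell γ₁ γ₂ i j)
    (hσ : IsSign σ) (hτ : IsSign τ) (S0 : 0 < S) (T0 : 0 < T)
    (hS : z.1 + σ * S ∈ piece γ₁ i) (hT : z.2 + τ * T ∈ piece γ₂ j) :
    ZerosAccumulate (localGap γ₁ γ₂ δ z σ τ) ↔ Enters (bdry γ₁ γ₂ δ) z σ τ := by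
  constructor
  · intro h ε hε
    obtain ⟨s, t, h1, h2, h3, h4, h5⟩ := h (min ε (min S T)) (by positivity)
    have e1 : s < ε := h2.trans_le (min_le_left _ _)
    have e2 : s < S := h2.trans_le ((min_le_right _ _).trans (min_le_left _ _))
    have e3 : t < ε := h4.trans_le (min_le_left _ _)
    have e4 : t < T := h4.trans_le ((min_le_right _ _).trans (min_le_right _ _))
    refine ⟨(z.1 + σ * s, z.2 + τ * t), ⟨⟨piece_subset _ _ (side_mem hc.1 hσ hS ⟨h1.le, e2.le⟩),
      piece_subset _ _ (side_mem hc.2 hτ hT ⟨h3.le, e4.le⟩)⟩, ?_⟩, ?_⟩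
    · simp only [localGap] at h5 ⊢; linarith
    · have a1 : σ * (z.1 + σ * s - z.1) = s := by linear_combination s * hσ.mul_self
      have a2 : τ * (z.2 + τ * t - z.2) = t := by linear_combination t * hτ.mul_self
      simp only [a1, a2]
      exact ⟨h1, e1, h3, e3⟩
  · intro h ε hε
    obtain ⟨w, hw, h1, h2, h3, h4⟩ := h ε hε
    refine ⟨_, _, h1, h2, h3, h4, ?_⟩
    have a1 : z.1 + σ * (σ * (w.1 - z.1)) = w.1 := by
      linear_combination (w.1 - z.1) * hσ.mul_self
    have a2 : z.2 + τ * (τ * (w.2 - z.2)) = w.2 := by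
      linear_combination (w.2 - z.2) * hτ.mul_self
    have := hw.2
    simp only [localGap, a1, a2]
    linarith

theorem branch_of_zerosBranch (hc : z ∈ cell γ₁ γ₂ i j)
    (hσ : IsSign σ) (hτ : IsSign τ) (S0 : 0 < S) (T0 : 0 < T)
    (hS : z.1 + σ * S ∈ piece γ₁ i) (hT : z.2 + τ * T ∈ piece γ₂ j)
    (h : ZerosBranch (localGap γ₁ γ₂ δ z σ τ)) : Branch (bdry γ₁ γ₂ δ) z σ τ := by
  intro ε hε
  obtain ⟨s, t, h1, h2, h3, h4, h5, h6, h7⟩ := h (min ε (min S T)) (by positivity)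
  have e1 : s < ε := h2.trans_le (min_le_left _ _)
  have e2 : s < S := h2.trans_le ((min_le_right _ _).trans (min_le_left _ _))
  have e3 : t < ε := h4.trans_le (min_le_left _ _)
  have e4 : t < T := h4.trans_le ((min_le_right _ _).trans (min_le_right _ _))
  have hmem : ∀ a ∈ Icc 0 s, ∀ b ∈ Icc 0 t, localGap γ₁ γ₂ δ z σ τ a b = 0 →
      (z.1 + σ * a, z.2 + τ * b) ∈ bdry γ₁ γ₂ δ := by
    intro a ha b hb h0
    refine ⟨⟨piece_subset _ _ (side_mem hc.1 hσ hS ⟨ha.1, ha.2.trans e2.le⟩),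
      piece_subset _ _ (side_mem hc.2 hτ hT ⟨hb.1, hb.2.trans e4.le⟩)⟩, ?_⟩
    simp only [localGap] at h0 ⊢; linarith
  have a1 : ∀ a, σ * (z.1 + σ * a - z.1) = a := fun a => by linear_combination a * hσ.mul_self
  have a2 : ∀ a, τ * (z.2 + τ * a - z.2) = a := fun a => by linear_combination a * hτ.mul_self
  have b1 : ∀ x, z.1 + σ * (σ * (x - z.1)) = x := fun x => by
    linear_combination (x - z.1) * hσ.mul_self
  have b2 : ∀ x, z.2 + τ * (τ * (x - z.2)) = x := fun x => by
    linear_combination (x - z.2) * hτ.mul_self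
  have hset : bdry γ₁ γ₂ δ ∩ quadBox z σ τ s t =
      (fun w : ℝ × ℝ => (z.1 + σ * w.1, z.2 + τ * w.2)) ''
        {w : ℝ × ℝ | w.1 ∈ Icc 0 s ∧ w.2 ∈ Icc 0 t ∧ localGap γ₁ γ₂ δ z σ τ w.1 w.2 = 0} := by
    ext w
    constructor
    · rintro ⟨hw, hw1, hw2⟩
      refine ⟨(σ * (w.1 - z.1), τ * (w.2 - z.2)), ⟨hw1, hw2, ?_⟩, ?_⟩
      · have := hw.2
        simp only [localGap, b1, b2]
        linarith
      · simp only [b1, b2]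
    · rintro ⟨w, ⟨hw1, hw2, h0⟩, rfl⟩
      refine ⟨hmem _ hw1 _ hw2 h0, ?_, ?_⟩
      · simp only [a1]; exact hw1
      · simp only [a2]; exact hw2
  refine ⟨s, t, h1, e1, h3, e3, hmem s ⟨h1.le, le_rfl⟩ t ⟨h3.le, le_rfl⟩ h5, ?_, ?_⟩
  · rw [hset]
    exact h6.image _ (by fun_prop)
  · rw [hset]
    rintro _ ⟨u, hu, rfl⟩ _ ⟨v, hv, rfl⟩
    have c1 : ∀ a b, σ * (z.1 + σ * a - (z.1 + σ * b)) = a - b := fun a b => by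
      linear_combination (a - b) * hσ.mul_self
    have c2 : ∀ a b, τ * (z.2 + τ * a - (z.2 + τ * b)) = a - b := fun a b => by
      linear_combination (a - b) * hτ.mul_self
    simp only [c1, c2, sub_pos]
    rcases h7 u hu v hv with h | h | h
    · exact Or.inl (by rw [h])
    · exact Or.inr (Or.inl h)
    · exact Or.inr (Or.inr h)

end local_coordinates

/-- Inside a cell, points of `B_δ` accumulating in a quadrant of a point `z` of `B_δ` form an arc,
and there are no points of `B_δ` on the sides of the quadrant close to `z`. -/
theorem Generic.branch_of_acc (hG : Generic γ₁ γ₂ δ) {i : Fin γ₁.pieces} {j : Fin γ₂.pieces}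
    {z : ℝ × ℝ} (hz : z ∈ bdry γ₁ γ₂ δ) (hc : z ∈ cell γ₁ γ₂ i j) {σ τ : ℝ} (hσ : IsSign σ)
    (hτ : IsSign τ) (hr : σ = 1 → z.1 < γ₁.brk i.succ) (hl : σ = -1 → γ₁.brk i.castSucc < z.1)
    (ht : τ = 1 → z.2 < γ₂.brk j.succ) (hb : τ = -1 → γ₂.brk j.castSucc < z.2) :
    (Enters (bdry γ₁ γ₂ δ) z σ τ → Branch (bdry γ₁ γ₂ δ) z σ τ) ∧
    ∃ e > 0, ∀ t ∈ Ioc 0 e,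
      (z.1, z.2 + τ * t) ∉ bdry γ₁ γ₂ δ ∧ (z.1 + σ * t, z.2) ∉ bdry γ₁ γ₂ δ := by
  obtain ⟨ρ, ε, hn⟩ := hG.exists_niceScale hz hc
  obtain ⟨S, S0, hSε, hS⟩ := exists_side hc.1 hσ hr hl hn.pos
  obtain ⟨T, T0, hTε, hT⟩ := exists_side hc.2 hτ ht hb hn.pos
  have hq := hn.levelQuadrant hz hc hσ hτ S0 T0 hSε hTε hS hT
  have hacc := zerosAccumulate_localGap (δ := δ) hc hσ hτ S0 T0 hS hT
  have main : ∃ ρ', IsSign ρ' ∧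
      ((∀ t ∈ Icc 0 T, StrictMonoOn (fun s => ρ' * localGap γ₁ γ₂ δ z σ τ s t) (Icc 0 S)) ∨
      ∀ s ∈ Icc 0 S, StrictMonoOn (fun t => ρ' * localGap γ₁ γ₂ δ z σ τ s t) (Icc 0 T)) := by
    have absS : ∀ s ∈ Icc 0 S, |s| < ε := fun s hs => by
      rw [abs_of_nonneg hs.1]; exact hs.2.trans_lt hSε
    have absT : ∀ t ∈ Icc 0 T, |t| < ε := fun t ht => by
      rw [abs_of_nonneg ht.1]; exact ht.2.trans_lt hTε
    rcases hn.mono with hm | hm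
    · refine ⟨ρ * σ, hn.sign.mul hσ, Or.inl fun t ht => ?_⟩
      refine strictMonoOn_side (f := fun x => gap γ₁ γ₂ x (z.2 + τ * t)) hσ δ
        (hm _ (side_mem hc.2 hτ hT ht) (abs_side hτ (absT t ht))) ?_
      exact fun s hs => ⟨side_mem hc.1 hσ hS hs, side_mem_ball hσ (absS s hs)⟩
    · refine ⟨ρ * τ, hn.sign.mul hτ, Or.inr fun s hs => ?_⟩
      refine strictMonoOn_side (f := fun y => gap γ₁ γ₂ (z.1 + σ * s) y) hτ δ
        (hm _ (side_mem hc.1 hσ hS hs) (abs_side hσ (absS s hs))) ?_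
      exact fun t ht => ⟨side_mem hc.2 hτ hT ht, side_mem_ball hτ (absT t ht)⟩
  obtain ⟨ρ', hρ', hm⟩ := main
  obtain ⟨h1, e, he, h2⟩ := hq.branch_of_accumulate hρ' hm
  refine ⟨fun h => branch_of_zerosBranch hc hσ hτ S0 T0 hS hT (h1 (hacc.2 h)), e, he, fun t ht => ?_⟩
  have h3 := h2 t ht
  constructor
  · intro hw
    have := hw.2
    apply h3.1
    simp only [localGap, mul_zero, add_zero]
    linarith
  · intro hw
    have := hw.2
    apply h3.2
    simp only [localGap, mul_zero, add_zero]
    linarith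

/-- On each side of a vertical line, `B_δ` enters exactly one of the two quadrants at a point that
is no extremum in the `x` direction, and both or none at an extremum. -/
theorem Generic.acc_vertical (hG : Generic γ₁ γ₂ δ) {i : Fin γ₁.pieces} {j : Fin γ₂.pieces}
    {z : ℝ × ℝ} (hz : z ∈ bdry γ₁ γ₂ δ) (hx : z.1 ∈ piece γ₁ i)
    (hy : z.2 ∈ Ioo (γ₂.brk j.castSucc) (γ₂.brk j.succ)) {σ : ℝ} (hσ : IsSign σ)
    (hr : σ = 1 → z.1 < γ₁.brk i.succ) (hl : σ = -1 → γ₁.brk i.castSucc < z.1) :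
    (z ∈ Ev γ₁ γ₂ δ → (Enters (bdry γ₁ γ₂ δ) z σ 1 ↔ Enters (bdry γ₁ γ₂ δ) z σ (-1))) ∧
    (z ∉ Ev γ₁ γ₂ δ → (Enters (bdry γ₁ γ₂ δ) z σ 1 ↔ ¬ Enters (bdry γ₁ γ₂ δ) z σ (-1))) := by
  have hc : z ∈ cell γ₁ γ₂ i j := ⟨hx, Ioo_subset_Icc_self hy⟩
  -- The ordinate lies inside one piece of `γ₂`, which fixes the index `j`, and the extremum
  -- condition on the vertical line does not involve the piece of `γ₁`. So membership in the union
  -- over all cells is a two-sided extremum on this line.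
  have hev : z ∈ Ev γ₁ γ₂ δ ↔ IsLocalExtr (fun y => gap γ₁ γ₂ z.1 y) z.2 := by
    constructor
    · intro h
      obtain ⟨i', j', h⟩ := mem_iUnion₂.1 h
      have hj : j' = j := by
        have h1 := h.1.2.2
        have a1 : γ₂.brk j'.castSucc < γ₂.brk j.succ := h1.1.trans_lt hy.2
        have a2 : γ₂.brk j.castSucc < γ₂.brk j'.succ := hy.1.trans_le h1.2
        rw [γ₂.brk_strictMono.lt_iff_lt] at a1 a2
        rw [Fin.castSucc_lt_succ_iff] at a1 a2
        exact le_antisymm a1 a2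
      subst hj
      exact h.2.2.isLocalExtr (Icc_mem_nhds hy.1 hy.2)
    · intro h
      exact mem_iUnion₂.2 ⟨i, j, mem_cellEv_of_isLocalExtr hz hx hy h⟩
  obtain ⟨ρ, ε, hn⟩ := hG.exists_niceScale hz hc
  obtain ⟨S, S0, hSε, hS⟩ := exists_side hc.1 hσ hr hl hn.pos
  obtain ⟨T₁, T₁0, hT₁ε, hT₁⟩ := exists_side hc.2 isSign_one (fun _ => hy.2)
    (fun h => by norm_num at h) hn.pos
  obtain ⟨T₂, T₂0, hT₂ε, hT₂⟩ := exists_side hc.2 isSign_neg_one (fun h => by norm_num at h)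
    (fun _ => hy.1) hn.pos
  set T := min T₁ T₂ with hT
  have T0 : 0 < T := by positivity
  have hTε : T < ε := (min_le_left _ _).trans_lt hT₁ε
  have hTp : z.2 + 1 * T ∈ piece γ₂ j :=
    side_mem hc.2 isSign_one hT₁ ⟨T0.le, min_le_left _ _⟩
  have hTm : z.2 + (-1) * T ∈ piece γ₂ j :=
    side_mem hc.2 isSign_neg_one hT₂ ⟨T0.le, min_le_right _ _⟩
  have hq := hn.levelQuadrant hz hc hσ isSign_one S0 T0 hSε hTε hS hTp
  have hq' := hn.levelQuadrant hz hc hσ isSign_neg_one S0 T0 hSε hTε hS hTm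
  have hacc := zerosAccumulate_localGap (δ := δ) hc hσ isSign_one S0 T0 hS hTp
  have hacc' := zerosAccumulate_localGap (δ := δ) hc hσ isSign_neg_one S0 T0 hS hTm
  have hyT : ∀ t ∈ Icc (-T) T, z.2 + 1 * t ∈ piece γ₂ j := fun t ht =>
    ⟨by linarith [hTm.1, ht.1], by linarith [hTp.2, ht.2]⟩
  have main : ∃ ρ', IsSign ρ' ∧
      ((∀ t ∈ Icc (-T) T, StrictMonoOn (fun s => ρ' * localGap γ₁ γ₂ δ z σ 1 s t) (Icc 0 S)) ∨
      ∀ s ∈ Icc 0 S, StrictMonoOn (fun t => ρ' * localGap γ₁ γ₂ δ z σ 1 s t) (Icc (-T) T)) := by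
    have absS : ∀ s ∈ Icc 0 S, |s| < ε := fun s hs => by
      rw [abs_of_nonneg hs.1]; exact hs.2.trans_lt hSε
    have absT : ∀ t ∈ Icc (-T) T, |t| < ε := fun t ht => by
      rw [abs_lt]; constructor <;> linarith [ht.1, ht.2]
    rcases hn.mono with hm | hm
    · refine ⟨ρ * σ, hn.sign.mul hσ, Or.inl fun t ht => ?_⟩
      refine strictMonoOn_side (f := fun x => gap γ₁ γ₂ x (z.2 + 1 * t)) hσ δ
        (hm _ (hyT t ht) (abs_side isSign_one (absT t ht))) ?_
      exact fun s hs => ⟨side_mem hc.1 hσ hS hs, side_mem_ball hσ (absS s hs)⟩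
    · refine ⟨ρ * 1, hn.sign.mul isSign_one, Or.inr fun s hs => ?_⟩
      refine strictMonoOn_side (f := fun y => gap γ₁ γ₂ (z.1 + σ * s) y) isSign_one δ
        (hm _ (side_mem hc.1 hσ hS hs) (abs_side hσ (absS s hs))) ?_
      exact fun t ht => ⟨hyT t ht, side_mem_ball isSign_one (absT t ht)⟩
  obtain ⟨ρ', hρ', hm⟩ := main
  have hH' : localGap γ₁ γ₂ δ z σ (-1) = fun s t => localGap γ₁ γ₂ δ z σ 1 s (-t) := by
    funext s t
    simp only [localGap]
    congr 2
    ring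
  have hfin := hq.half_plane hH' hq' hρ' hm
  have hext : IsLocalExtr (fun t => localGap γ₁ γ₂ δ z σ 1 0 t) 0 ↔ z ∈ Ev γ₁ γ₂ δ := by
    rw [hev]
    constructor
    · intro h
      have h1 : IsLocalExtr ((fun t => localGap γ₁ γ₂ δ z σ 1 0 t) ∘ fun y => y - z.2) z.2 := by
        refine IsExtrFilter.comp_tendsto (l := 𝓝 0) ?_ ?_
        · rw [sub_self]; exact h
        · have : Tendsto (fun y => y - z.2) (𝓝 z.2) (𝓝 (z.2 - z.2)) := by
            apply Continuous.tendsto; fun_prop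
          rwa [sub_self] at this
      have heq : ((fun t => localGap γ₁ γ₂ δ z σ 1 0 t) ∘ fun y => y - z.2) =
          fun y => gap γ₁ γ₂ z.1 y - δ := by
        funext y; simp [localGap]
      rw [heq] at h1
      exact h1.imp (fun h => by simpa [IsMinFilter] using h)
        (fun h => by simpa [IsMaxFilter] using h)
    · intro h
      have h1 : IsLocalExtr ((fun y => gap γ₁ γ₂ z.1 y) ∘ fun t => z.2 + t) 0 := by
        refine IsExtrFilter.comp_tendsto (l := 𝓝 z.2) ?_ ?_
        · rw [add_zero]; exact h
        · have : Tendsto (fun t => z.2 + t) (𝓝 0) (𝓝 (z.2 + 0)) := by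
            apply Continuous.tendsto; fun_prop
          rwa [add_zero] at this
      exact h1.imp (fun h => by simpa [IsMinFilter, localGap] using h)
        (fun h => by simpa [IsMaxFilter, localGap] using h)
  rw [hext, hacc, hacc'] at hfin
  exact hfin

/-- The transposed form of `Generic.acc_vertical`. -/
theorem Generic.acc_horizontal (hG : Generic γ₁ γ₂ δ) {i : Fin γ₁.pieces} {j : Fin γ₂.pieces}
    {z : ℝ × ℝ} (hz : z ∈ bdry γ₁ γ₂ δ) (hy : z.2 ∈ piece γ₂ j)
    (hx : z.1 ∈ Ioo (γ₁.brk i.castSucc) (γ₁.brk i.succ)) {τ : ℝ} (hτ : IsSign τ)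
    (ht : τ = 1 → z.2 < γ₂.brk j.succ) (hb : τ = -1 → γ₂.brk j.castSucc < z.2) :
    (z ∈ Eh γ₁ γ₂ δ → (Enters (bdry γ₁ γ₂ δ) z 1 τ ↔ Enters (bdry γ₁ γ₂ δ) z (-1) τ)) ∧
    (z ∉ Eh γ₁ γ₂ δ → (Enters (bdry γ₁ γ₂ δ) z 1 τ ↔ ¬ Enters (bdry γ₁ γ₂ δ) z (-1) τ)) := by
  have := hG.symm.acc_vertical (z := z.swap) (bdry_swap.2 hz) hy hx hτ ht hb
  rwa [← swap_preimage_bdry, Enters.swap, Enters.swap, Ev_swap] at this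

/-- Every point of `E_h` has the forbidden region above or below. -/
theorem Generic.mem_Eh_iff (hG : Generic γ₁ γ₂ δ) {z : ℝ × ℝ} :
    z ∈ Eh γ₁ γ₂ δ ↔ z ∈ EhPlus γ₁ γ₂ δ ∨ z ∈ EhMinus γ₁ γ₂ δ := by
  constructor
  · intro h
    obtain ⟨i, j, h⟩ := mem_iUnion₂.1 h
    have hz := h.1.1
    have hd' : dy γ₁ γ₂ j z ≠ 0 := by
      intro h0
      have : z ∈ singularSet γ₁ γ₂ δ := ⟨hz, i, j, h.1.2, h.2.1, h0⟩
      rw [hG.nonsing] at this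
      exact this
    -- The horizontal partial derivative vanishes at a point of `E_h`, hence the vertical one does
    -- not. The sense `ρ` of monotonicity in `y` decides: the forbidden region is above if the
    -- distance increases, and below if it decreases.
    obtain ⟨ρ, hρ, ε, hε, hm⟩ := exists_strictMonoOn_snd hG.smooth hG.pos hz h.1.2 hd'
    have hm' := hm z.1 h.1.2.1 (by simpa using hε)
    have hzm : z.2 ∈ piece γ₂ j ∩ Ioo (z.2 - ε) (z.2 + ε) :=
      ⟨h.1.2.2, by linarith, by linarith⟩
    have hδ : gap γ₁ γ₂ z.1 z.2 = δ := hz.2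
    have hev : ∀ᶠ y in 𝓝[piece γ₂ j] z.2, y ∈ piece γ₂ j ∩ Ioo (z.2 - ε) (z.2 + ε) :=
      inter_mem self_mem_nhdsWithin
        (mem_nhdsWithin_of_mem_nhds (Ioo_mem_nhds (by linarith) (by linarith)))
    have hfree : ∀ y ∈ piece γ₂ j, (z.1, y) ∈ freeSpace γ₁ γ₂ δ ↔ gap γ₁ γ₂ z.1 y ≤ δ :=
      fun y hy => ⟨fun h' => h'.2, fun h' => ⟨⟨hz.1.1, piece_subset _ _ hy⟩, h'⟩⟩
    rcases hρ with rfl | rfl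
    · refine Or.inr ⟨i, j, h, ?_⟩
      filter_upwards [hev] with y hy
      rw [hfree y hy.1]
      constructor
      · intro hlt
        have := hm' hzm hy hlt
        simp only [one_mul] at this
        linarith
      · intro hlt
        have := hm' hy hzm hlt
        simp only [one_mul] at this
        linarith
    · refine Or.inl ⟨i, j, h, ?_⟩
      filter_upwards [hev] with y hy
      rw [hfree y hy.1]
      constructor
      · intro hlt
        have := hm' hy hzm hlt
        simp only [neg_mul, one_mul] at this
        linarith
      · intro hlt
        have := hm' hzm hy hlt
        simp only [neg_mul, one_mul] at this
        linarith
  · rintro (⟨i, j, h, -⟩ | ⟨i, j, h, -⟩) <;> exact mem_iUnion₂.2 ⟨i, j, h⟩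

theorem EvMinus_swap {z : ℝ × ℝ} : z.swap ∈ EvMinus γ₂ γ₁ δ ↔ z ∈ EhMinus γ₁ γ₂ δ := by
  have hf : ∀ x y, (y, x) ∈ freeSpace γ₂ γ₁ δ ↔ (x, y) ∈ freeSpace γ₁ γ₂ δ := by
    intro x y
    simp only [freeSpace, mem_ofPred_eq, mem_prod, gap_comm γ₂ γ₁]
    tauto
  simp only [EvMinus, EhMinus, mem_ofPred_eq, cellEv_swap, Prod.fst_swap, Prod.snd_swap, hf]
  exact exists_comm

theorem EvPlus_swap {z : ℝ × ℝ} : z.swap ∈ EvPlus γ₂ γ₁ δ ↔ z ∈ EhPlus γ₁ γ₂ δ := by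
  have hf : ∀ x y, (y, x) ∈ freeSpace γ₂ γ₁ δ ↔ (x, y) ∈ freeSpace γ₁ γ₂ δ := by
    intro x y
    simp only [freeSpace, mem_ofPred_eq, mem_prod, gap_comm γ₂ γ₁]
    tauto
  simp only [EvPlus, EhPlus, mem_ofPred_eq, cellEv_swap, Prod.fst_swap, Prod.snd_swap, hf]
  exact exists_comm

theorem Generic.mem_Ev_iff (hG : Generic γ₁ γ₂ δ) {z : ℝ × ℝ} :
    z ∈ Ev γ₁ γ₂ δ ↔ z ∈ EvPlus γ₁ γ₂ δ ∨ z ∈ EvMinus γ₁ γ₂ δ := by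
  have := hG.symm.mem_Eh_iff (z := z.swap)
  rw [Eh_swap, ← EvPlus_swap, ← EvMinus_swap, Prod.swap_swap] at this
  exact this

end FreeSpace

/-! ### Strict chains and increasing arcs -/

namespace StrictChain

variable {N : Set (ℝ × ℝ)}

theorem mono {M : Set (ℝ × ℝ)} (h : StrictChain N) (hM : M ⊆ N) : StrictChain M :=
  fun u hu v hv => h u (hM hu) v (hM hv)

/-- On a strict chain both coordinates are increasing functions of their sum, and each changes by at
most as much as the sum. The sum therefore serves as a Lipschitz parameter. -/
theorem abs_fst_le (h : StrictChain N) {u v : ℝ × ℝ} (hu : u ∈ N) (hv : v ∈ N) :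
    |u.1 - v.1| ≤ |(u.1 + u.2) - (v.1 + v.2)| := by
  rcases h u hu v hv with rfl | h | h
  · simp
  · rw [abs_of_neg (by linarith), abs_of_neg (by linarith)]; linarith
  · rw [abs_of_pos (by linarith), abs_of_pos (by linarith)]; linarith

theorem abs_snd_le (h : StrictChain N) {u v : ℝ × ℝ} (hu : u ∈ N) (hv : v ∈ N) :
    |u.2 - v.2| ≤ |(u.1 + u.2) - (v.1 + v.2)| := by
  rcases h u hu v hv with rfl | h | h
  · simp
  · rw [abs_of_neg (by linarith), abs_of_neg (by linarith)]; linarith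
  · rw [abs_of_pos (by linarith), abs_of_pos (by linarith)]; linarith

theorem eq_of_sum_eq (h : StrictChain N) {u v : ℝ × ℝ} (hu : u ∈ N) (hv : v ∈ N)
    (he : u.1 + u.2 = v.1 + v.2) : u = v := by
  rcases h u hu v hv with h | h | h
  · exact h
  · linarith
  · linarith

theorem lt_of_sum_lt (h : StrictChain N) {u v : ℝ × ℝ} (hu : u ∈ N) (hv : v ∈ N)
    (he : u.1 + u.2 < v.1 + v.2) : u.1 < v.1 ∧ u.2 < v.2 := by
  rcases h u hu v hv with h | h | h
  · rw [h] at he; linarith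
  · exact h
  · linarith

theorem exists_sum_eq (hc : IsPreconnected N) {u v : ℝ × ℝ} (hu : u ∈ N) (hv : v ∈ N) {t : ℝ}
    (h1 : u.1 + u.2 ≤ t) (h2 : t ≤ v.1 + v.2) : ∃ k ∈ N, k.1 + k.2 = t := by
  have := hc.intermediate_value hu hv (f := fun w : ℝ × ℝ => w.1 + w.2) (by fun_prop)
  obtain ⟨k, hk, hk'⟩ := this ⟨h1, h2⟩
  exact ⟨k, hk, hk'⟩

/-- For a limit point `u` connectedness provides a point `k` of the chain with the same coordinate
sum. The Lipschitz estimates against `k` pass to the closure and give `u = k`. -/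
theorem isClosed (h : StrictChain N) (hc : IsPreconnected N) {z w : ℝ × ℝ} (hz : z ∈ N)
    (hw : w ∈ N) (hb : ∀ u ∈ N, z.1 + z.2 ≤ u.1 + u.2 ∧ u.1 + u.2 ≤ w.1 + w.2) :
    IsClosed N := by
  refine isClosed_of_closure_subset fun u hu => ?_
  have hle : ∀ f g : ℝ × ℝ → ℝ, Continuous f → Continuous g → (∀ v ∈ N, f v ≤ g v) → f u ≤ g u :=
    fun f g hf hg h => closure_minimal (s := N) (t := {v | f v ≤ g v}) h (isClosed_le hf hg) hu
  have hcl1 := hle (fun _ => z.1 + z.2) (fun u => u.1 + u.2) (by fun_prop) (by fun_prop)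
    fun v hv => (hb v hv).1
  have hcl2 := hle (fun u => u.1 + u.2) (fun _ => w.1 + w.2) (by fun_prop) (by fun_prop)
    fun v hv => (hb v hv).2
  obtain ⟨k, hk, hks⟩ := exists_sum_eq hc hz hw hcl1 hcl2
  have h1 := hle (fun u => |u.1 - k.1|) (fun u => |(u.1 + u.2) - (k.1 + k.2)|) (by fun_prop)
    (by fun_prop) fun v hv => h.abs_fst_le hv hk
  have h2 := hle (fun u => |u.2 - k.2|) (fun u => |(u.1 + u.2) - (k.1 + k.2)|) (by fun_prop)
    (by fun_prop) fun v hv => h.abs_snd_le hv hk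
  rw [hks, sub_self, abs_zero] at h1 h2
  have e1 := abs_nonpos_iff.1 h1
  have e2 := abs_nonpos_iff.1 h2
  have : u = k := Prod.ext (by linarith) (by linarith)
  rwa [this]

end StrictChain

/-- `K` is an increasing arc of `L` from `z` to `w` that runs through the interior of the rectangle
`[a,b] × [c,d]` and connects points of its boundary. -/
structure IncArc (L : Set (ℝ × ℝ)) (a b c d : ℝ) (z w : ℝ × ℝ) (K : Set (ℝ × ℝ)) : Prop where
  conn : IsPreconnected K
  chain : StrictChain K
  left_mem : z ∈ K
  right_mem : w ∈ K
  subL : K ⊆ L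
  box : K ⊆ Icc a b ×ˢ Icc c d
  low : z.1 = a ∨ z.2 = c
  high : w.1 = b ∨ w.2 = d
  lt : z.1 < w.1 ∧ z.2 < w.2
  inner : ∀ u ∈ K, u = z ∨ u = w ∨ u ∈ Ioo a b ×ˢ Ioo c d

namespace IncArc

variable {L : Set (ℝ × ℝ)} {a b c d : ℝ} {z w : ℝ × ℝ} {K : Set (ℝ × ℝ)}

theorem low_notMem (h : IncArc L a b c d z w K) : z ∉ Ioo a b ×ˢ Ioo c d := by
  rintro ⟨h1, h2⟩
  rcases h.low with h3 | h3
  · exact h1.1.ne' h3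
  · exact h2.1.ne' h3

theorem high_notMem (h : IncArc L a b c d z w K) : w ∉ Ioo a b ×ˢ Ioo c d := by
  rintro ⟨h1, h2⟩
  rcases h.high with h3 | h3
  · exact h1.2.ne h3
  · exact h2.2.ne h3

theorem low_lt (h : IncArc L a b c d z w K) {u : ℝ × ℝ} (hu : u ∈ K) :
    u = z ∨ (z.1 < u.1 ∧ z.2 < u.2) := by
  rcases h.chain u hu z h.left_mem with h1 | h1 | h1
  · exact Or.inl h1
  · have := h.box hu
    rcases h.low with h2 | h2
    · linarith [this.1.1]
    · linarith [this.2.1]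
  · exact Or.inr h1

theorem lt_high (h : IncArc L a b c d z w K) {u : ℝ × ℝ} (hu : u ∈ K) :
    u = w ∨ (u.1 < w.1 ∧ u.2 < w.2) := by
  rcases h.chain u hu w h.right_mem with h1 | h1 | h1
  · exact Or.inl h1
  · exact Or.inr h1
  · have := h.box hu
    rcases h.high with h2 | h2
    · linarith [this.1.2]
    · linarith [this.2.2]

theorem sum_bounds (h : IncArc L a b c d z w K) {u : ℝ × ℝ} (hu : u ∈ K) :
    z.1 + z.2 ≤ u.1 + u.2 ∧ u.1 + u.2 ≤ w.1 + w.2 := by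
  constructor
  · rcases h.low_lt hu with rfl | h1
    · exact le_rfl
    · linarith
  · rcases h.lt_high hu with rfl | h1
    · exact le_rfl
    · linarith

theorem isClosed (h : IncArc L a b c d z w K) : IsClosed K :=
  h.chain.isClosed h.conn h.left_mem h.right_mem fun _ hu => h.sum_bounds hu

theorem isCompact (h : IncArc L a b c d z w K) : IsCompact K :=
  (isCompact_Icc.prod isCompact_Icc).of_isClosed_subset h.isClosed h.box

/-- An increasing arc has a parametrization that is strictly increasing in both coordinates. -/
theorem exists_param (h : IncArc L a b c d z w K) : ∃ β : ℝ → ℝ × ℝ,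
    ContinuousOn β (Icc 0 1) ∧ β 0 = z ∧ β 1 = w ∧ β '' Icc 0 1 = K ∧
    ∀ s ∈ Icc (0 : ℝ) 1, ∀ t ∈ Icc (0 : ℝ) 1, s < t → (β s).1 < (β t).1 ∧ (β s).2 < (β t).2 := by
  set A := z.1 + z.2 with hA
  set B := w.1 + w.2 with hB
  have hAB : A < B := by linarith [h.lt.1, h.lt.2]
  -- The parameter is the coordinate sum, scaled affinely so that it runs from `0` to `1`.
  have hex : ∀ t, ∃ k, t ∈ Icc (0 : ℝ) 1 → k ∈ K ∧ k.1 + k.2 = A + t * (B - A) := by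
    intro t
    by_cases ht : t ∈ Icc (0 : ℝ) 1
    · obtain ⟨k, hk, hks⟩ := StrictChain.exists_sum_eq h.conn h.left_mem h.right_mem
        (t := A + t * (B - A)) (by nlinarith [ht.1]) (by nlinarith [ht.2])
      exact ⟨k, fun _ => ⟨hk, hks⟩⟩
    · exact ⟨z, fun h => absurd h ht⟩
  choose β hβ using hex
  have m0 : (0 : ℝ) ∈ Icc (0 : ℝ) 1 := ⟨le_rfl, zero_le_one⟩
  have m1 : (1 : ℝ) ∈ Icc (0 : ℝ) 1 := ⟨zero_le_one, le_rfl⟩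
  refine ⟨β, ?_, ?_, ?_, ?_, ?_⟩
  · intro t ht
    rw [Metric.continuousWithinAt_iff]
    intro ε hε
    refine ⟨ε / (B - A), by apply div_pos hε; linarith, fun {s} hs hst => ?_⟩
    have hd : |((β s).1 + (β s).2) - ((β t).1 + (β t).2)| < ε := by
      rw [(hβ s hs).2, (hβ t ht).2]
      have : A + s * (B - A) - (A + t * (B - A)) = (s - t) * (B - A) := by ring
      rw [this, abs_mul, abs_of_pos (show 0 < B - A by linarith)]
      rw [Real.dist_eq, lt_div_iff₀ (by linarith)] at hst
      exact hst
    rw [Prod.dist_eq]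
    exact max_lt ((h.chain.abs_fst_le (hβ s hs).1 (hβ t ht).1).trans_lt hd)
      ((h.chain.abs_snd_le (hβ s hs).1 (hβ t ht).1).trans_lt hd)
  · exact h.chain.eq_of_sum_eq (hβ 0 m0).1 h.left_mem (by rw [(hβ 0 m0).2]; ring)
  · exact h.chain.eq_of_sum_eq (hβ 1 m1).1 h.right_mem (by rw [(hβ 1 m1).2]; ring)
  · ext u
    constructor
    · rintro ⟨t, ht, rfl⟩
      exact (hβ t ht).1
    · intro hu
      have hb := h.sum_bounds hu
      have ht : (u.1 + u.2 - A) / (B - A) ∈ Icc (0 : ℝ) 1 := by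
        constructor
        · apply div_nonneg <;> linarith
        · rw [div_le_one (by linarith)]; linarith
      refine ⟨_, ht, h.chain.eq_of_sum_eq (hβ _ ht).1 hu ?_⟩
      rw [(hβ _ ht).2, div_mul_cancel₀ _ (by linarith)]
      ring
  · intro s hs t ht hst
    refine h.chain.lt_of_sum_lt (hβ s hs).1 (hβ t ht).1 ?_
    rw [(hβ s hs).2, (hβ t ht).2]
    nlinarith

end IncArc

/-- A connected chain has points of every coordinate sum between those of `v` and `u`; those with
sum slightly larger than at `v` lie in the open upper right quadrant, close to `v`. -/
theorem StrictChain.enters_pos {K L : Set (ℝ × ℝ)} (hch : StrictChain K) (hc : IsPreconnected K)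
    (hL : K ⊆ L) {v u : ℝ × ℝ} (hv : v ∈ K) (hu : u ∈ K) (h : v.1 < u.1 ∧ v.2 < u.2) :
    Enters L v 1 1 := by
  intro ε hε
  have hm : 0 < min ε (u.1 + u.2 - (v.1 + v.2)) := lt_min hε (by linarith)
  set η := min ε (u.1 + u.2 - (v.1 + v.2)) / 2 with hη
  have e1 : η < ε := by linarith [min_le_left ε (u.1 + u.2 - (v.1 + v.2))]
  have e2 : η ≤ u.1 + u.2 - (v.1 + v.2) := by
    linarith [min_le_right ε (u.1 + u.2 - (v.1 + v.2))]
  obtain ⟨k, hk, hks⟩ := StrictChain.exists_sum_eq hc hv hu (t := v.1 + v.2 + η)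
    (by linarith) (by linarith)
  have := hch.lt_of_sum_lt hv hk (by linarith)
  exact ⟨k, hL hk, by linarith, by linarith, by linarith, by linarith⟩

theorem StrictChain.enters_neg {K L : Set (ℝ × ℝ)} (hch : StrictChain K) (hc : IsPreconnected K)
    (hL : K ⊆ L) {v u : ℝ × ℝ} (hv : v ∈ K) (hu : u ∈ K) (h : u.1 < v.1 ∧ u.2 < v.2) :
    Enters L v (-1) (-1) := by
  intro ε hε
  have hm : 0 < min ε (v.1 + v.2 - (u.1 + u.2)) := lt_min hε (by linarith)
  set η := min ε (v.1 + v.2 - (u.1 + u.2)) / 2 with hη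
  have e1 : η < ε := by linarith [min_le_left ε (v.1 + v.2 - (u.1 + u.2))]
  have e2 : η ≤ v.1 + v.2 - (u.1 + u.2) := by
    linarith [min_le_right ε (v.1 + v.2 - (u.1 + u.2))]
  obtain ⟨k, hk, hks⟩ := StrictChain.exists_sum_eq hc hu hv (t := v.1 + v.2 - η)
    (by linarith) (by linarith)
  have := hch.lt_of_sum_lt hk hv (by linarith)
  exact ⟨k, hL hk, by linarith, by linarith, by linarith, by linarith⟩

/-- A connected chain through `v` contains all points of `L` that are close to `v` in the quadrant
in which it leaves `v`. -/
theorem StrictChain.germ_subset {K L : Set (ℝ × ℝ)} (hch : StrictChain K) (hc : IsPreconnected K)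
    (hL : K ⊆ L) {v u : ℝ × ℝ} (hv : v ∈ K) (hu : u ∈ K) {σ : ℝ} (hσ : IsSign σ)
    (h : 0 < σ * (u.1 - v.1) ∧ 0 < σ * (u.2 - v.2)) (hb : Branch L v σ σ) :
    ∃ η > 0, ∀ w ∈ L, 0 ≤ σ * (w.1 - v.1) → σ * (w.1 - v.1) < η → 0 ≤ σ * (w.2 - v.2) →
      σ * (w.2 - v.2) < η → w ∈ K := by
  obtain ⟨s, t, s0, -, t0, -, -, -, hN⟩ := hb 1 one_pos
  have hD : 0 < σ * (u.1 - v.1) + σ * (u.2 - v.2) := by linarith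
  set D := σ * (u.1 - v.1) + σ * (u.2 - v.2) with hDdef
  refine ⟨min (min s t) D / 2, by positivity, fun w hw h1 h2 h3 h4 => ?_⟩
  have m1 : min (min s t) D ≤ s := (min_le_left _ _).trans (min_le_left _ _)
  have m2 : min (min s t) D ≤ t := (min_le_left _ _).trans (min_le_right _ _)
  have m3 : min (min s t) D ≤ D := min_le_right _ _
  -- The bound on the coordinates of `w` makes its coordinate sum so close to that of `v` that `K`
  -- contains a point `k` with this sum, and `k` lies in the rectangle of the branch. There all
  -- points of `L` are strictly comparable, so equal sums force `k = w`.
  have hkex : ∃ k ∈ K, k.1 + k.2 = w.1 + w.2 := by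
    rcases hσ with rfl | rfl
    · exact StrictChain.exists_sum_eq hc hv hu (by linarith) (by linarith)
    · exact StrictChain.exists_sum_eq hc hu hv (by linarith) (by linarith)
  obtain ⟨k, hk, hks⟩ := hkex
  have hkbox : k ∈ quadBox v σ σ s t := by
    rcases hch v hv k hk with h5 | h5 | h5
    · rw [← h5]; simp [quadBox, s0.le, t0.le]
    · rcases hσ with rfl | rfl
      · exact ⟨⟨by linarith, by linarith⟩, ⟨by linarith, by linarith⟩⟩
      · linarith
    · rcases hσ with rfl | rfl
      · linarith
      · exact ⟨⟨by linarith, by linarith⟩, ⟨by linarith, by linarith⟩⟩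
  have hwbox : w ∈ quadBox v σ σ s t := ⟨⟨h1, by linarith⟩, ⟨h3, by linarith⟩⟩
  rcases hN k ⟨hL hk, hkbox⟩ w ⟨hw, hwbox⟩ with h5 | h5 | h5
  · exact h5 ▸ hk
  · rcases hσ with rfl | rfl <;> linarith
  · rcases hσ with rfl | rfl <;> linarith

/-- A closed set in a rectangle that is locally, in the interior, a strictly monotone curve, and
near the points of the boundary consists of at most one arc in each quadrant. -/
structure TameBox (L : Set (ℝ × ℝ)) (a b c d : ℝ) : Prop where
  hab : a < b
  hcd : c < d
  closed : IsClosed L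
  vertical : ∀ z ∈ L, z.1 ∈ Icc a b → z.2 ∈ Ioo c d → ∀ σ, IsSign σ → (σ = 1 → z.1 < b) →
    (σ = -1 → a < z.1) → (Enters L z σ 1 ↔ ¬ Enters L z σ (-1))
  horizontal : ∀ z ∈ L, z.1 ∈ Ioo a b → z.2 ∈ Icc c d → ∀ τ, IsSign τ → (τ = 1 → z.2 < d) →
    (τ = -1 → c < z.2) → (Enters L z 1 τ ↔ ¬ Enters L z (-1) τ)
  axis : ∀ z ∈ L ∩ Ioo a b ×ˢ Ioo c d, ∀ σ, IsSign σ →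
    ∃ e > 0, ∀ t ∈ Ioc 0 e, (z.1, z.2 + σ * t) ∉ L ∧ (z.1 + σ * t, z.2) ∉ L
  branch : ∀ z ∈ L ∩ Icc a b ×ˢ Icc c d, ∀ σ τ, IsSign σ → IsSign τ → (σ = 1 → z.1 < b) →
    (σ = -1 → a < z.1) → (τ = 1 → z.2 < d) → (τ = -1 → c < z.2) → Enters L z σ τ → Branch L z σ τ

/-! ### Existence and uniqueness of increasing arcs in a rectangle -/

namespace TameBox

variable {L : Set (ℝ × ℝ)} {a b c d : ℝ}

theorem vert (hT : TameBox L a b c d) : ∀ z ∈ L ∩ Ioo a b ×ˢ Ioo c d, ∀ σ, IsSign σ →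
    (Enters L z σ 1 ↔ ¬ Enters L z σ (-1)) := fun z hz σ hσ =>
  hT.vertical z hz.1 (Ioo_subset_Icc_self hz.2.1) hz.2.2 σ hσ (fun _ => hz.2.1.2)
    fun _ => hz.2.1.1

theorem horiz (hT : TameBox L a b c d) : ∀ z ∈ L ∩ Ioo a b ×ˢ Ioo c d, ∀ τ, IsSign τ →
    (Enters L z 1 τ ↔ ¬ Enters L z (-1) τ) := fun z hz τ hτ =>
  hT.horizontal z hz.1 hz.2.1 (Ioo_subset_Icc_self hz.2.2) τ hτ (fun _ => hz.2.2.2)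
    fun _ => hz.2.2.1

/-- Passing first to the adjacent quadrant below and from there to the one on its left negates
twice. This is what makes an increasing branch continue through an interior point. -/
theorem enters_opposite (hT : TameBox L a b c d) {z : ℝ × ℝ} (hz : z ∈ L ∩ Ioo a b ×ˢ Ioo c d) :
    Enters L z 1 1 ↔ Enters L z (-1) (-1) := by
  rw [hT.vert z hz 1 isSign_one, hT.horiz z hz (-1) isSign_neg_one, not_not]

/-- The increasing arc that starts at a point of the boundary can be continued to another point of
the boundary. -/
theorem exists_incArc (hT : TameBox L a b c d) {z : ℝ × ℝ} (hzL : z ∈ L)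
    (hzB : z ∈ Icc a b ×ˢ Icc c d) (hzl : z.1 = a ∨ z.2 = c) (hzb : z.1 < b) (hzd : z.2 < d)
    (hE : Enters L z 1 1) : ∃ w K, IncArc L a b c d z w K := by
  -- The arc is obtained from a maximal connected strict chain of `L` that starts at `z` and
  -- otherwise stays in the open rectangle.
  set 𝒦 : Set (Set (ℝ × ℝ)) := {K | IsPreconnected K ∧ StrictChain K ∧ z ∈ K ∧
    ∀ u ∈ K, u = z ∨ (u ∈ L ∩ Ioo a b ×ˢ Ioo c d ∧ z.1 < u.1 ∧ z.2 < u.2)} with h𝒦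
  have small : ∀ v ∈ L, v ∈ Icc a b ×ˢ Icc c d → v.1 < b → v.2 < d → Branch L v 1 1 →
      ∃ N, IsPreconnected N ∧ StrictChain N ∧ v ∈ N ∧
        (∀ u ∈ N, u = v ∨ (u ∈ L ∩ Ioo a b ×ˢ Ioo c d ∧ v.1 < u.1 ∧ v.2 < u.2)) ∧
        ∃ u ∈ N, v.1 < u.1 ∧ v.2 < u.2 := by
    intro v hvL hvB hvb hvd hbr
    obtain ⟨s, t, s0, hs, t0, ht, hcor, hpc, hch⟩ := hbr (min (b - v.1) (d - v.2))
      (lt_min (by linarith) (by linarith))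
    have hs' : s < b - v.1 := hs.trans_le (min_le_left _ _)
    have ht' : t < d - v.2 := ht.trans_le (min_le_right _ _)
    have hvN : v ∈ L ∩ quadBox v 1 1 s t := ⟨hvL, by simp [quadBox, s0.le, t0.le]⟩
    have hchain : StrictChain (L ∩ quadBox v 1 1 s t) := by
      intro x hx y hy
      have := hch x hx y hy
      simpa only [one_mul, sub_pos] using this
    refine ⟨_, hpc, hchain, hvN, fun u hu => ?_,
      (v.1 + 1 * s, v.2 + 1 * t), ⟨hcor, ?_⟩, ?_⟩
    · rcases hchain v hvN u hu with h | h | h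
      · exact Or.inl h.symm
      · refine Or.inr ⟨⟨hu.1, ⟨?_, ?_⟩, ?_, ?_⟩, h⟩
        · linarith [hvB.1.1]
        · linarith [hu.2.1.2]
        · linarith [hvB.2.1]
        · linarith [hu.2.2.2]
      · linarith [hu.2.1.1]
    · simp [quadBox, s0.le, t0.le, add_comm]
    · simp [s0, t0]
  have hbr := hT.branch z ⟨hzL, hzB⟩ 1 1 isSign_one isSign_one (fun _ => hzb)
    (fun h => by norm_num at h) (fun _ => hzd) (fun h => by norm_num at h) hE
  obtain ⟨N₀, hN1, hN2, hN3, hN4, u₀, hu₀, hu₀z⟩ := small z hzL hzB hzb hzd hbr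
  obtain ⟨M, hNM, hMax⟩ := zorn_subset_nonempty 𝒦 (fun C hC hchain hne => by
    refine ⟨⋃₀ C, ⟨?_, ?_, ?_, ?_⟩, fun s hs => subset_sUnion_of_mem hs⟩
    · exact isPreconnected_sUnion z C (fun s hs => (hC hs).2.2.1) fun s hs => (hC hs).1
    · rintro u ⟨s, hs, hu⟩ v ⟨t, ht, hv⟩
      rcases hchain.total hs ht with h | h
      · exact (hC ht).2.1 u (h hu) v hv
      · exact (hC hs).2.1 u hu v (h hv)
    · obtain ⟨s, hs⟩ := hne
      exact ⟨s, hs, (hC hs).2.2.1⟩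
    · rintro u ⟨s, hs, hu⟩
      exact (hC hs).2.2.2 u hu) N₀ ⟨hN1, hN2, hN3, hN4⟩
  obtain ⟨⟨hM1, hM2, hM3, hM4⟩, hM5⟩ := hMax
  have hMB : M ⊆ Icc a b ×ˢ Icc c d := by
    intro u hu
    rcases hM4 u hu with rfl | h
    · exact hzB
    · exact ⟨Ioo_subset_Icc_self h.1.2.1, Ioo_subset_Icc_self h.1.2.2⟩
  have hML : M ⊆ L := by
    intro u hu
    rcases hM4 u hu with rfl | h
    · exact hzL
    · exact h.1.1
  have bdd1 : BddAbove (Prod.fst '' M) := ⟨b, by rintro _ ⟨u, hu, rfl⟩; exact (hMB hu).1.2⟩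
  have bdd2 : BddAbove (Prod.snd '' M) := ⟨d, by rintro _ ⟨u, hu, rfl⟩; exact (hMB hu).2.2⟩
  -- The upper end is the point of the suprema of the coordinates. It is a limit of `M` because, by
  -- comparability, one point of the chain comes close to both suprema at once.
  set w : ℝ × ℝ := (sSup (Prod.fst '' M), sSup (Prod.snd '' M)) with hw
  have le1 : ∀ u ∈ M, u.1 ≤ w.1 := fun u hu => le_csSup bdd1 ⟨u, hu, rfl⟩
  have le2 : ∀ u ∈ M, u.2 ≤ w.2 := fun u hu => le_csSup bdd2 ⟨u, hu, rfl⟩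
  have hwcl : w ∈ closure M := by
    rw [Metric.mem_closure_iff]
    intro ε hε
    obtain ⟨_, ⟨u, hu, rfl⟩, hu'⟩ := exists_lt_of_lt_csSup (s := Prod.fst '' M)
      ⟨_, z, hM3, rfl⟩ (show w.1 - ε < sSup (Prod.fst '' M) by simp only [hw]; linarith)
    obtain ⟨_, ⟨v, hv, rfl⟩, hv'⟩ := exists_lt_of_lt_csSup (s := Prod.snd '' M)
      ⟨_, z, hM3, rfl⟩ (show w.2 - ε < sSup (Prod.snd '' M) by simp only [hw]; linarith)
    have : ∃ k ∈ M, w.1 - ε < k.1 ∧ w.2 - ε < k.2 := by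
      rcases hM2 u hu v hv with h | h | h
      · exact ⟨u, hu, hu', h ▸ hv'⟩
      · exact ⟨v, hv, by linarith, hv'⟩
      · exact ⟨u, hu, hu', by linarith⟩
    obtain ⟨k, hk, h1, h2⟩ := this
    refine ⟨k, hk, ?_⟩
    rw [Prod.dist_eq, Real.dist_eq, Real.dist_eq,
      abs_of_nonneg (by linarith [le1 k hk]), abs_of_nonneg (by linarith [le2 k hk])]
    exact max_lt (by linarith) (by linarith)
  have hwL : w ∈ L := closure_minimal hML hT.closed hwcl
  have hwB : w ∈ Icc a b ×ˢ Icc c d :=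
    closure_minimal hMB (isClosed_Icc.prod isClosed_Icc) hwcl
  have hzw : z.1 < w.1 ∧ z.2 < w.2 :=
    ⟨hu₀z.1.trans_le (le1 _ (hNM hu₀)), hu₀z.2.trans_le (le2 _ (hNM hu₀))⟩
  have strict : ∀ u ∈ M, u = w ∨ (u.1 < w.1 ∧ u.2 < w.2) := by
    intro u hu
    by_cases hlt : u.1 < w.1 ∧ u.2 < w.2
    · exact Or.inr hlt
    · left
      have hall : ∀ v ∈ M, v.1 ≤ u.1 ∧ v.2 ≤ u.2 := by
        intro v hv
        rcases hM2 u hu v hv with h | h | h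
        · rw [h]; exact ⟨le_rfl, le_rfl⟩
        · exact absurd ⟨h.1.trans_le (le1 v hv), h.2.trans_le (le2 v hv)⟩ hlt
        · exact ⟨h.1.le, h.2.le⟩
      refine Prod.ext (le_antisymm (le1 u hu) ?_) (le_antisymm (le2 u hu) ?_)
      · exact csSup_le ⟨_, z, hM3, rfl⟩ (by rintro _ ⟨v, hv, rfl⟩; exact (hall v hv).1)
      · exact csSup_le ⟨_, z, hM3, rfl⟩ (by rintro _ ⟨v, hv, rfl⟩; exact (hall v hv).2)
  set K := insert w M with hK
  have hKc : IsPreconnected K := hM1.subset_closure (subset_insert _ _)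
    (insert_subset hwcl subset_closure)
  have hKch : StrictChain K := by
    rintro u (rfl | hu) v (rfl | hv)
    · exact Or.inl rfl
    · rcases strict v hv with h | h
      · exact Or.inl h.symm
      · exact Or.inr (Or.inr h)
    · rcases strict u hu with h | h
      · exact Or.inl h
      · exact Or.inr (Or.inl h)
    · exact hM2 u hu v hv
  have hKL : K ⊆ L := insert_subset hwL hML
  -- An end in the interior would belong to `M` by maximality. The chain enters it from the lower
  -- left, hence `L` leaves it to the upper right, and the branch there would extend `M` beyond the
  -- suprema.
  have hwn : w ∉ Ioo a b ×ˢ Ioo c d := by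
    intro hwi
    have hK𝒦 : K ∈ 𝒦 := by
      refine ⟨hKc, hKch, Or.inr hM3, ?_⟩
      rintro u (rfl | hu)
      · exact Or.inr ⟨⟨hwL, hwi⟩, hzw⟩
      · exact hM4 u hu
    have hwM : w ∈ M := hM5 hK𝒦 (subset_insert _ _) (mem_insert _ _)
    have hE' : Enters L w 1 1 := (hT.enters_opposite ⟨hwL, hwi⟩).2
      (hM2.enters_neg hM1 hML hwM hM3 hzw)
    have hbr' := hT.branch w ⟨hwL, hwB⟩ 1 1 isSign_one isSign_one (fun _ => hwi.1.2)
      (fun h => by norm_num at h) (fun _ => hwi.2.2) (fun h => by norm_num at h) hE'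
    obtain ⟨N, g1, g2, g3, g4, u₁, hu₁, hu₁w⟩ := small w hwL hwB hwi.1.2 hwi.2.2 hbr'
    have hext : M ∪ N ∈ 𝒦 := by
      refine ⟨hM1.union w hwM g3 g1, ?_, Or.inl hM3, ?_⟩
      · have cross : ∀ u ∈ M, ∀ v ∈ N, u = v ∨ (u.1 < v.1 ∧ u.2 < v.2) := by
          intro u hu v hv
          rcases strict u hu with rfl | h <;> rcases g4 v hv with rfl | h'
          · exact Or.inl rfl
          · exact Or.inr h'.2
          · exact Or.inr h
          · exact Or.inr ⟨h.1.trans h'.2.1, h.2.trans h'.2.2⟩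
        rintro u (hu | hu) v (hv | hv)
        · exact hM2 u hu v hv
        · exact (cross u hu v hv).imp_right Or.inl
        · rcases cross v hv u hu with h | h
          · exact Or.inl h.symm
          · exact Or.inr (Or.inr h)
        · exact g2 u hu v hv
      · rintro u (hu | hu)
        · exact hM4 u hu
        · rcases g4 u hu with rfl | h
          · exact Or.inr ⟨⟨hwL, hwi⟩, hzw⟩
          · exact Or.inr ⟨h.1, hzw.1.trans h.2.1, hzw.2.trans h.2.2⟩
    have := le1 u₁ (hM5 hext subset_union_left (Or.inr hu₁))
    linarith
  refine ⟨w, K, hKc, hKch, Or.inr hM3, mem_insert _ _, hKL, insert_subset hwB hMB, hzl, ?_, hzw, ?_⟩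
  · by_contra hcon
    push Not at hcon
    refine hwn ⟨⟨?_, lt_of_le_of_ne hwB.1.2 hcon.1⟩, ?_, lt_of_le_of_ne hwB.2.2 hcon.2⟩
    · exact hzB.1.1.trans_lt hzw.1
    · exact hzB.2.1.trans_lt hzw.2
  · rintro u (rfl | hu)
    · exact Or.inr (Or.inl rfl)
    · rcases hM4 u hu with h | h
      · exact Or.inl h
      · exact Or.inr (Or.inr h.1.2)

/-- An arc is open in `L` at its interior points. -/
theorem incArc_nhds (hT : TameBox L a b c d) {z w : ℝ × ℝ} {K : Set (ℝ × ℝ)}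
    (hK : IncArc L a b c d z w K) {v : ℝ × ℝ} (hv : v ∈ K) (hvi : v ∈ Ioo a b ×ˢ Ioo c d) :
    ∃ U, IsOpen U ∧ v ∈ U ∧ L ∩ U ⊆ K := by
  have hvL := hK.subL hv
  have hlow : z.1 < v.1 ∧ z.2 < v.2 := (hK.low_lt hv).resolve_left
    fun h => hK.low_notMem (h ▸ hvi)
  have hhigh : v.1 < w.1 ∧ v.2 < w.2 := (hK.lt_high hv).resolve_left
    fun h => hK.high_notMem (h ▸ hvi)
  -- At an interior point the arc leaves in the upper right and the lower left quadrant, and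
  -- contains all nearby points of `L` there. The other two quadrants are not entered, and the four
  -- half-axes are free of `L` close to the point. The smallest of the six radii works.
  have E1 := hK.chain.enters_pos hK.conn hK.subL hv hK.right_mem hhigh
  have E2 := hK.chain.enters_neg hK.conn hK.subL hv hK.left_mem hlow
  have hvm : v ∈ L ∩ Ioo a b ×ˢ Ioo c d := ⟨hvL, hvi⟩
  have hvB : v ∈ L ∩ Icc a b ×ˢ Icc c d :=
    ⟨hvL, Ioo_subset_Icc_self hvi.1, Ioo_subset_Icc_self hvi.2⟩
  have B1 := hT.branch v hvB 1 1 isSign_one isSign_one (fun _ => hvi.1.2)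
      (fun h => by norm_num at h) (fun _ => hvi.2.2) (fun h => by norm_num at h) E1
  have B2 := hT.branch v hvB (-1) (-1) isSign_neg_one isSign_neg_one (fun h => by norm_num at h)
      (fun _ => hvi.1.1) (fun h => by norm_num at h) (fun _ => hvi.2.1) E2
  have E3 : ¬ Enters L v 1 (-1) := (hT.vert v hvm 1 isSign_one).1 E1
  have E4 : ¬ Enters L v (-1) 1 := (hT.horiz v hvm 1 isSign_one).1 E1
  obtain ⟨η₁, p1, g1⟩ := hK.chain.germ_subset hK.conn hK.subL hv hK.right_mem isSign_one
    (by constructor <;> linarith) B1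
  obtain ⟨η₂, p2, g2⟩ := hK.chain.germ_subset hK.conn hK.subL hv hK.left_mem isSign_neg_one
    (by constructor <;> linarith) B2
  obtain ⟨η₃, p3, g3⟩ := hT.axis v hvm 1 isSign_one
  obtain ⟨η₄, p4, g4⟩ := hT.axis v hvm (-1) isSign_neg_one
  unfold Enters at E3 E4
  push Not at E3 E4
  obtain ⟨η₅, p5, g5⟩ := E3
  obtain ⟨η₆, p6, g6⟩ := E4
  obtain ⟨η, p, q1, q2, q3, q4, q5, q6⟩ : ∃ η > 0, η ≤ η₁ ∧ η ≤ η₂ ∧ η ≤ η₃ ∧ η ≤ η₄ ∧ η ≤ η₅ ∧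
      η ≤ η₆ := ⟨min η₁ (min η₂ (min η₃ (min η₄ (min η₅ η₆)))), by positivity, by simp, by simp,
        by simp, by simp, by simp, by simp⟩
  refine ⟨Ioo (v.1 - η) (v.1 + η) ×ˢ Ioo (v.2 - η) (v.2 + η), isOpen_Ioo.prod isOpen_Ioo,
    ⟨⟨by linarith, by linarith⟩, by linarith, by linarith⟩, ?_⟩
  rintro u ⟨huL, ⟨h1, h2⟩, h3, h4⟩
  rcases lt_trichotomy u.1 v.1 with h5 | h5 | h5 <;> rcases lt_trichotomy u.2 v.2 with h6 | h6 | h6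
  · exact g2 u huL (by linarith) (by linarith) (by linarith) (by linarith)
  · exfalso
    refine (g4 (v.1 - u.1) ⟨by linarith, by linarith⟩).2 ?_
    have : (v.1 + -1 * (v.1 - u.1), v.2) = u := Prod.ext (by simp) h6.symm
    rwa [this]
  · exact absurd (g6 u huL (by linarith) (by linarith) (by linarith)) (by linarith)
  · exfalso
    refine (g4 (v.2 - u.2) ⟨by linarith, by linarith⟩).1 ?_
    have : (v.1, v.2 + -1 * (v.2 - u.2)) = u := Prod.ext h5.symm (by simp)
    rwa [this]
  · have : u = v := Prod.ext h5 h6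
    exact this ▸ hv
  · exfalso
    refine (g3 (u.2 - v.2) ⟨by linarith, by linarith⟩).1 ?_
    have : (v.1, v.2 + 1 * (u.2 - v.2)) = u := Prod.ext h5.symm (by simp)
    rwa [this]
  · exact absurd (g5 u huL (by linarith) (by linarith) (by linarith)) (by linarith)
  · exfalso
    refine (g3 (u.1 - v.1) ⟨by linarith, by linarith⟩).2 ?_
    have : (v.1 + 1 * (u.1 - v.1), v.2) = u := Prod.ext (by simp) h6.symm
    rwa [this]
  · exact g1 u huL (by linarith) (by linarith) (by linarith) (by linarith)

/-- The interior of `K'` is connected, and its part in `K` is both closed and relatively open,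
because `L` coincides with `K` near interior points of `K`. Being nonempty, this part is everything;
the ends follow by taking the closure. -/
theorem incArc_subset (hT : TameBox L a b c d) {z w z' w' : ℝ × ℝ} {K K' : Set (ℝ × ℝ)}
    (hK : IncArc L a b c d z w K) (hK' : IncArc L a b c d z' w' K')
    (hne : (K ∩ K' ∩ Ioo a b ×ˢ Ioo c d).Nonempty) : K' ⊆ K := by
  obtain ⟨β, hβc, hβ0, hβ1, hβK, hβm⟩ := hK'.exists_param
  have hsub : Ioo (0 : ℝ) 1 ⊆ Icc 0 1 := Ioo_subset_Icc_self
  have m0 : (0 : ℝ) ∈ Icc (0 : ℝ) 1 := ⟨le_rfl, zero_le_one⟩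
  have m1 : (1 : ℝ) ∈ Icc (0 : ℝ) 1 := ⟨zero_le_one, le_rfl⟩
  have hin : ∀ t ∈ Ioo (0 : ℝ) 1, β t ∈ Ioo a b ×ˢ Ioo c d := by
    intro t ht
    have hmem : β t ∈ K' := hβK ▸ mem_image_of_mem β (hsub ht)
    rcases hK'.inner _ hmem with h | h | h
    · have := hβm 0 m0 t (hsub ht) ht.1
      rw [h, hβ0] at this
      exact absurd this.1 (lt_irrefl _)
    · have := hβm t (hsub ht) 1 m1 ht.2
      rw [h, hβ1] at this
      exact absurd this.1 (lt_irrefl _)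
    · exact h
  have hpc : IsPreconnected (β '' Ioo 0 1) := isPreconnected_Ioo.image _ (hβc.mono hsub)
  have key : β '' Ioo 0 1 ⊆ K := by
    -- On the interior of `K'`, lying in the open set `U` is the same as lying in `K`, so `U` and
    -- the complement of `K` separate it.
    set U := ⋃₀ {U | IsOpen U ∧ L ∩ U ⊆ K} with hU
    have hUo : IsOpen U := isOpen_sUnion fun s hs => hs.1
    have hLU : L ∩ U ⊆ K := by
      rintro u ⟨hu, s, hs, hus⟩
      exact hs.2 ⟨hu, hus⟩
    have hsubL : β '' Ioo 0 1 ⊆ L := by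
      rintro _ ⟨t, ht, rfl⟩
      exact hK'.subL (hβK ▸ mem_image_of_mem β (hsub ht))
    have := isPreconnected_iff_subset_of_disjoint.1 hpc U Kᶜ hUo hK.isClosed.isOpen_compl ?_ ?_
    · rcases this with h | h
      · exact fun u hu => hLU ⟨hsubL hu, h hu⟩
      · obtain ⟨v, ⟨hv, hv'⟩, hvi⟩ := hne
        rw [← hβK] at hv'
        obtain ⟨t, ht, rfl⟩ := hv'
        have ht' : t ∈ Ioo (0 : ℝ) 1 := by
          refine ⟨lt_of_le_of_ne ht.1 ?_, lt_of_le_of_ne ht.2 ?_⟩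
          · rintro rfl
            rw [hβ0] at hvi
            exact hK'.low_notMem hvi
          · rintro rfl
            rw [hβ1] at hvi
            exact hK'.high_notMem hvi
        exact absurd hv (h (mem_image_of_mem β ht'))
    · rintro _ ⟨t, ht, rfl⟩
      by_cases hmem : β t ∈ K
      · obtain ⟨V, hV, hvV, hVK⟩ := hT.incArc_nhds hK hmem (hin t ht)
        exact Or.inl ⟨V, ⟨hV, hVK⟩, hvV⟩
      · exact Or.inr hmem
    · rw [eq_empty_iff_forall_notMem]
      rintro u ⟨hu, hu1, hu2⟩
      exact hu2 (hLU ⟨hsubL hu, hu1⟩)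
  rw [← hβK]
  calc β '' Icc 0 1 = β '' closure (Ioo 0 1) := by rw [closure_Ioo zero_ne_one]
    _ ⊆ closure (β '' Ioo 0 1) := by
        apply ContinuousOn.image_closure
        rwa [closure_Ioo zero_ne_one]
    _ ⊆ K := closure_minimal key hK.isClosed

/-- Arcs with a common interior point contain each other, and the ends are the least and the
greatest element of the chain. -/
theorem incArc_unique (hT : TameBox L a b c d) {z w z' w' : ℝ × ℝ} {K K' : Set (ℝ × ℝ)}
    (hK : IncArc L a b c d z w K) (hK' : IncArc L a b c d z' w' K')
    (hne : (K ∩ K' ∩ Ioo a b ×ˢ Ioo c d).Nonempty) : z = z' ∧ w = w' := by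
  have h1 := hT.incArc_subset hK hK' hne
  have h2 := hT.incArc_subset hK' hK (by rwa [inter_comm K' K])
  constructor
  · rcases hK.low_lt (h1 hK'.left_mem) with h | h
    · exact h.symm
    · rcases hK'.low_lt (h2 hK.left_mem) with h' | h'
      · exact h'
      · linarith [h.1, h'.1]
  · rcases hK.lt_high (h1 hK'.right_mem) with h | h
    · exact h.symm
    · rcases hK'.lt_high (h2 hK.right_mem) with h' | h'
      · exact h'
      · linarith [h.1, h'.1]

/-- Near its lower end the first arc contains all points of `L` in the upper right quadrant, in
particular points of the second arc inside the rectangle. So the arcs share an interior point. -/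
theorem incArc_unique_of_low (hT : TameBox L a b c d) {z w w' : ℝ × ℝ} {K K' : Set (ℝ × ℝ)}
    (hK : IncArc L a b c d z w K) (hK' : IncArc L a b c d z w' K') : w = w' := by
  have hzB := hK.box hK.left_mem
  have hwB := hK.box hK.right_mem
  have E1 := hK.chain.enters_pos hK.conn hK.subL hK.left_mem hK.right_mem hK.lt
  have B1 := hT.branch z ⟨hK.subL hK.left_mem, hzB⟩ 1 1 isSign_one isSign_one
      (fun _ => hK.lt.1.trans_le hwB.1.2)
      (fun h => by norm_num at h) (fun _ => hK.lt.2.trans_le hwB.2.2)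
      (fun h => by norm_num at h) E1
  obtain ⟨η, p, g⟩ := hK.chain.germ_subset hK.conn hK.subL hK.left_mem hK.right_mem isSign_one
    (by constructor <;> linarith [hK.lt.1, hK.lt.2]) B1
  have E2 := hK'.chain.enters_pos hK'.conn subset_rfl hK'.left_mem hK'.right_mem hK'.lt
  obtain ⟨v, hv, h1, h2, h3, h4⟩ := E2 (min η (min (w'.1 - z.1) (w'.2 - z.2)))
    (lt_min p (lt_min (by linarith [hK'.lt.1]) (by linarith [hK'.lt.2])))
  have hvK : v ∈ K := g v (hK'.subL hv) h1.le (h2.trans_le (min_le_left _ _)) h3.le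
    (h4.trans_le (min_le_left _ _))
  have hlt : v.1 < w'.1 := by
    have := h2.trans_le ((min_le_right _ _).trans (min_le_left _ _))
    linarith
  have hvi : v ∈ Ioo a b ×ˢ Ioo c d := by
    rcases hK'.inner v hv with h | h | h
    · rw [h] at h1; simp at h1
    · rw [h] at hlt; simp at hlt
    · exact h
  exact (hT.incArc_unique hK hK' ⟨v, ⟨hvK, hv⟩, hvi⟩).2

theorem incArc_unique_of_high (hT : TameBox L a b c d) {z z' w : ℝ × ℝ} {K K' : Set (ℝ × ℝ)}
    (hK : IncArc L a b c d z w K) (hK' : IncArc L a b c d z' w K') : z = z' := by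
  have hzB := hK.box hK.left_mem
  have hwB := hK.box hK.right_mem
  have E1 := hK.chain.enters_neg hK.conn hK.subL hK.right_mem hK.left_mem hK.lt
  have B1 := hT.branch w ⟨hK.subL hK.right_mem, hwB⟩ (-1) (-1) isSign_neg_one isSign_neg_one
      (fun h => by norm_num at h) (fun _ => hzB.1.1.trans_lt hK.lt.1)
      (fun h => by norm_num at h) (fun _ => hzB.2.1.trans_lt hK.lt.2) E1
  obtain ⟨η, p, g⟩ := hK.chain.germ_subset hK.conn hK.subL hK.right_mem hK.left_mem isSign_neg_one
    (by constructor <;> linarith [hK.lt.1, hK.lt.2]) B1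
  have E2 := hK'.chain.enters_neg hK'.conn subset_rfl hK'.right_mem hK'.left_mem hK'.lt
  obtain ⟨v, hv, h1, h2, h3, h4⟩ := E2 (min η (min (w.1 - z'.1) (w.2 - z'.2)))
    (lt_min p (lt_min (by linarith [hK'.lt.1]) (by linarith [hK'.lt.2])))
  have hvK : v ∈ K := g v (hK'.subL hv) h1.le (h2.trans_le (min_le_left _ _)) h3.le
    (h4.trans_le (min_le_left _ _))
  have hlt : z'.1 < v.1 := by
    have := h2.trans_le ((min_le_right _ _).trans (min_le_left _ _))
    linarith
  have hvi : v ∈ Ioo a b ×ˢ Ioo c d := by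
    rcases hK'.inner v hv with h | h | h
    · rw [h] at hlt; simp at hlt
    · rw [h] at h1; simp at h1
    · exact h
  exact (hT.incArc_unique hK hK' ⟨v, ⟨hvK, hv⟩, hvi⟩).1

end TameBox

/-! ### Reflections -/

/-- Reflection in the horizontal axis. -/
def vflip (z : ℝ × ℝ) : ℝ × ℝ := (z.1, -z.2)

theorem vflip_vflip (z : ℝ × ℝ) : vflip (vflip z) = z := by simp [vflip]

theorem continuous_vflip : Continuous vflip := by unfold vflip; fun_prop

theorem vflip_preimage_vflip_preimage (A : Set (ℝ × ℝ)) : vflip ⁻¹' (vflip ⁻¹' A) = A := by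
  ext z; simp [vflip_vflip]

theorem vflip_preimage_eq_image (A : Set (ℝ × ℝ)) : vflip ⁻¹' A = vflip '' A := by
  ext z
  constructor
  · intro h; exact ⟨vflip z, h, vflip_vflip z⟩
  · rintro ⟨w, hw, rfl⟩; simpa [vflip_vflip] using hw

theorem neg_preimage_eq_image (A : Set (ℝ × ℝ)) :
    (fun z : ℝ × ℝ => -z) ⁻¹' A = (fun z : ℝ × ℝ => -z) '' A := by
  ext z
  constructor
  · intro h; exact ⟨-z, h, neg_neg z⟩
  · rintro ⟨w, hw, rfl⟩; simpa using hw

theorem IsSign.neg {σ : ℝ} (h : IsSign σ) : IsSign (-σ) := by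
  rcases h with rfl | rfl <;> norm_num [IsSign]

theorem enters_vflip {L : Set (ℝ × ℝ)} {z : ℝ × ℝ} {σ τ : ℝ} :
    Enters (vflip ⁻¹' L) z σ τ ↔ Enters L (vflip z) σ (-τ) := by
  constructor
  · intro h ε hε
    obtain ⟨w, hw, h1, h2, h3, h4⟩ := h ε hε
    refine ⟨vflip w, hw, h1, h2, ?_, ?_⟩ <;> simp only [vflip] <;> linarith
  · intro h ε hε
    obtain ⟨w, hw, h1, h2, h3, h4⟩ := h ε hε
    refine ⟨vflip w, by simpa [vflip_vflip] using hw, h1, h2, ?_, ?_⟩ <;>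
      simp only [vflip] at * <;> linarith

theorem enters_neg {L : Set (ℝ × ℝ)} {z : ℝ × ℝ} {σ τ : ℝ} :
    Enters ((fun z : ℝ × ℝ => -z) ⁻¹' L) z σ τ ↔ Enters L (-z) (-σ) (-τ) := by
  constructor
  · intro h ε hε
    obtain ⟨w, hw, h1, h2, h3, h4⟩ := h ε hε
    refine ⟨-w, hw, ?_, ?_, ?_, ?_⟩ <;> simp only [Prod.fst_neg, Prod.snd_neg] <;> linarith
  · intro h ε hε
    obtain ⟨w, hw, h1, h2, h3, h4⟩ := h ε hε
    refine ⟨-w, by simpa using hw, ?_, ?_, ?_, ?_⟩ <;>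
      simp only [Prod.fst_neg, Prod.snd_neg] at * <;> linarith

theorem Branch.vflip_preimage {L : Set (ℝ × ℝ)} {z : ℝ × ℝ} {σ τ : ℝ}
    (h : Branch L (vflip z) σ (-τ)) : Branch (vflip ⁻¹' L) z σ τ := by
  intro ε hε
  obtain ⟨s, t, h1, h2, h3, h4, h5, h6, h7⟩ := h ε hε
  have hset : vflip ⁻¹' L ∩ quadBox z σ τ s t =
      vflip '' (L ∩ quadBox (vflip z) σ (-τ) s t) := by
    rw [← vflip_preimage_eq_image]
    ext w
    have e : -τ * (-w.2 - -z.2) = τ * (w.2 - z.2) := by ring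
    simp only [mem_inter_iff, mem_preimage, quadBox, mem_ofPred_eq, vflip, e]
  refine ⟨s, t, h1, h2, h3, h4, ?_, ?_, ?_⟩
  · have : vflip (z.1 + σ * s, z.2 + τ * t) = ((vflip z).1 + σ * s, (vflip z).2 + -τ * t) := by
      simp only [vflip, Prod.mk.injEq, true_and]; ring
    rwa [mem_preimage, this]
  · rw [hset]; exact h6.image _ continuous_vflip.continuousOn
  · rw [hset]
    rintro _ ⟨u, hu, rfl⟩ _ ⟨v, hv, rfl⟩
    have e : ∀ x y : ℝ, τ * (-x - -y) = -τ * (x - y) := fun x y => by ring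
    simp only [vflip, e]
    exact (h7 u hu v hv).imp_left fun h => by rw [h]

theorem Branch.neg_preimage {L : Set (ℝ × ℝ)} {z : ℝ × ℝ} {σ τ : ℝ}
    (h : Branch L (-z) (-σ) (-τ)) : Branch ((fun z : ℝ × ℝ => -z) ⁻¹' L) z σ τ := by
  intro ε hε
  obtain ⟨s, t, h1, h2, h3, h4, h5, h6, h7⟩ := h ε hε
  have e : ∀ τ x y : ℝ, τ * (-x - -y) = -τ * (x - y) := fun τ x y => by ring
  have hset : (fun z : ℝ × ℝ => -z) ⁻¹' L ∩ quadBox z σ τ s t =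
      (fun z : ℝ × ℝ => -z) '' (L ∩ quadBox (-z) (-σ) (-τ) s t) := by
    rw [← neg_preimage_eq_image]
    ext w
    simp only [mem_inter_iff, mem_preimage, quadBox, mem_ofPred_eq, Prod.fst_neg, Prod.snd_neg, e,
      neg_neg]
  refine ⟨s, t, h1, h2, h3, h4, ?_, ?_, ?_⟩
  · have : -(z.1 + σ * s, z.2 + τ * t) = ((-z).1 + -σ * s, (-z).2 + -τ * t) := by
      simp only [Prod.neg_mk, Prod.fst_neg, Prod.snd_neg, Prod.mk.injEq]
      constructor <;> ring
    rwa [mem_preimage, this]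
  · rw [hset]; exact h6.image _ continuous_neg.continuousOn
  · rw [hset]
    rintro _ ⟨u, hu, rfl⟩ _ ⟨v, hv, rfl⟩
    simp only [Prod.fst_neg, Prod.snd_neg, e]
    exact (h7 u hu v hv).imp_left fun h => by rw [h]

namespace TameBox

variable {L : Set (ℝ × ℝ)} {a b c d : ℝ}

/-- The conditions are invariant under reflection, so results on increasing arcs carry over to
decreasing ones. -/
theorem flip (hT : TameBox L a b c d) : TameBox (vflip ⁻¹' L) a b (-d) (-c) where
  hab := hT.hab
  hcd := neg_lt_neg hT.hcd
  closed := hT.closed.preimage continuous_vflip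
  vertical := by
    intro z hz h1 h2 σ hσ h3 h4
    rw [enters_vflip, enters_vflip, neg_neg]
    have := hT.vertical (vflip z) hz h1 ⟨by simp only [vflip]; linarith [h2.2],
      by simp only [vflip]; linarith [h2.1]⟩ σ hσ h3 h4
    tauto
  horizontal := by
    intro z hz h1 h2 τ hτ h3 h4
    rw [enters_vflip, enters_vflip]
    refine hT.horizontal (vflip z) hz h1 ⟨by simp only [vflip]; linarith [h2.2],
      by simp only [vflip]; linarith [h2.1]⟩ (-τ) hτ.neg (fun h => ?_) fun h => ?_
    · simp only [vflip]; linarith [h4 (by linarith)]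
    · simp only [vflip]; linarith [h3 (by linarith)]
  axis := by
    intro z hz σ hσ
    have hzi : vflip z ∈ Ioo a b ×ˢ Ioo c d := ⟨hz.2.1, by simp only [vflip]; linarith [hz.2.2.2],
      by simp only [vflip]; linarith [hz.2.2.1]⟩
    obtain ⟨e, he, h⟩ := hT.axis (vflip z) ⟨hz.1, hzi⟩ σ hσ
    -- Only the vertical direction is reversed, so the two half-axes require `axis` with opposite
    -- signs.
    obtain ⟨e', he', h'⟩ := hT.axis (vflip z) ⟨hz.1, hzi⟩ (-σ) hσ.neg
    refine ⟨min e e', by positivity, fun t ht => ⟨fun hm => ?_, fun hm => ?_⟩⟩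
    · refine (h' t ⟨ht.1, ht.2.trans (min_le_right _ _)⟩).1 ?_
      have : ((vflip z).1, (vflip z).2 + -σ * t) = vflip (z.1, z.2 + σ * t) := by
        simp only [vflip, Prod.mk.injEq, true_and]; ring
      rw [this]; exact hm
    · exact (h t ⟨ht.1, ht.2.trans (min_le_left _ _)⟩).2 hm
  branch := by
    intro z hz σ τ hσ hτ h1 h2 h3 h4 hE
    refine Branch.vflip_preimage (hT.branch (vflip z) ⟨hz.1, hz.2.1,
      by simp only [vflip]; linarith [hz.2.2.2], by simp only [vflip]; linarith [hz.2.2.1]⟩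
      σ (-τ) hσ hτ.neg h1 h2 (fun h => ?_) (fun h => ?_) (enters_vflip.1 hE))
    · simp only [vflip]; linarith [h4 (by linarith)]
    · simp only [vflip]; linarith [h3 (by linarith)]

/-- The point reflection exchanges lower and upper ends of increasing arcs; it yields arcs that
start at an upper end. -/
theorem neg (hT : TameBox L a b c d) :
    TameBox ((fun z : ℝ × ℝ => -z) ⁻¹' L) (-b) (-a) (-d) (-c) where
  hab := neg_lt_neg hT.hab
  hcd := neg_lt_neg hT.hcd
  closed := hT.closed.preimage continuous_neg
  vertical := by
    intro z hz h1 h2 σ hσ h3 h4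
    rw [enters_neg, enters_neg, neg_neg]
    have := hT.vertical (-z) hz ⟨by simp; linarith [h1.2], by simp; linarith [h1.1]⟩
      ⟨by simp; linarith [h2.2], by simp; linarith [h2.1]⟩ (-σ) hσ.neg
      (fun h => by simp; linarith [h4 (by linarith)])
      (fun h => by simp; linarith [h3 (by linarith)])
    tauto
  horizontal := by
    intro z hz h1 h2 τ hτ h3 h4
    rw [enters_neg, enters_neg, neg_neg]
    have := hT.horizontal (-z) hz ⟨by simp; linarith [h1.2], by simp; linarith [h1.1]⟩
      ⟨by simp; linarith [h2.2], by simp; linarith [h2.1]⟩ (-τ) hτ.neg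
      (fun h => by simp; linarith [h4 (by linarith)])
      (fun h => by simp; linarith [h3 (by linarith)])
    tauto
  axis := by
    intro z hz σ hσ
    obtain ⟨e, he, h⟩ := hT.axis (-z) ⟨hz.1, ⟨by simp; linarith [hz.2.1.2],
      by simp; linarith [hz.2.1.1]⟩, by simp; linarith [hz.2.2.2], by simp; linarith [hz.2.2.1]⟩
      (-σ) hσ.neg
    refine ⟨e, he, fun t ht => ⟨fun hm => (h t ht).1 ?_, fun hm => (h t ht).2 ?_⟩⟩
    · have : ((-z).1, (-z).2 + -σ * t) = -(z.1, z.2 + σ * t) := by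
        simp only [Prod.fst_neg, Prod.snd_neg, Prod.neg_mk, Prod.mk.injEq, true_and]; ring
      rw [this]; exact hm
    · have : ((-z).1 + -σ * t, (-z).2) = -(z.1 + σ * t, z.2) := by
        simp only [Prod.fst_neg, Prod.snd_neg, Prod.neg_mk, Prod.mk.injEq, and_true]; ring
      rw [this]; exact hm
  branch := by
    intro z hz σ τ hσ hτ h1 h2 h3 h4 hE
    refine Branch.neg_preimage (hT.branch (-z) ⟨hz.1, ⟨by simp; linarith [hz.2.1.2],
      by simp; linarith [hz.2.1.1]⟩, by simp; linarith [hz.2.2.2], by simp; linarith [hz.2.2.1]⟩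
      (-σ) (-τ) hσ.neg hτ.neg (fun h => ?_) (fun h => ?_) (fun h => ?_) (fun h => ?_)
      (enters_neg.1 hE))
    · simp; linarith [h2 (by linarith)]
    · simp; linarith [h1 (by linarith)]
    · simp; linarith [h4 (by linarith)]
    · simp; linarith [h3 (by linarith)]

end TameBox

theorem IncArc.neg {L : Set (ℝ × ℝ)} {a b c d : ℝ} {z w : ℝ × ℝ} {K : Set (ℝ × ℝ)}
    (h : IncArc L a b c d z w K) :
    IncArc ((fun z : ℝ × ℝ => -z) ⁻¹' L) (-b) (-a) (-d) (-c) (-w) (-z)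
      ((fun z : ℝ × ℝ => -z) ⁻¹' K) where
  conn := by
    rw [neg_preimage_eq_image]; exact h.conn.image _ continuous_neg.continuousOn
  chain := by
    intro u hu v hv
    have := h.chain (-u) hu (-v) hv
    simp only [neg_inj, Prod.fst_neg, Prod.snd_neg, neg_lt_neg_iff] at this
    tauto
  left_mem := by simpa using h.right_mem
  right_mem := by simpa using h.left_mem
  subL := preimage_mono h.subL
  box := by
    intro u hu
    have := h.box hu
    simp only [mem_prod, mem_Icc, Prod.fst_neg, Prod.snd_neg] at this ⊢
    refine ⟨⟨?_, ?_⟩, ?_, ?_⟩ <;> linarith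
  low := by
    rcases h.high with h | h
    · left; simp [h]
    · right; simp [h]
  high := by
    rcases h.low with h | h
    · left; simp [h]
    · right; simp [h]
  lt := by simpa using h.lt
  inner := by
    intro u hu
    rcases h.inner _ hu with h | h | h
    · right; left; rw [← h, neg_neg]
    · left; rw [← h, neg_neg]
    · right; right
      simp only [mem_prod, mem_Ioo, Prod.fst_neg, Prod.snd_neg] at h ⊢
      refine ⟨⟨?_, ?_⟩, ?_, ?_⟩ <;> linarith

/-- `K` is a decreasing arc of `L` through the rectangle from the upper left end `z` to the lower
right end `w`. -/
def DecArc (L : Set (ℝ × ℝ)) (a b c d : ℝ) (z w : ℝ × ℝ) (K : Set (ℝ × ℝ)) : Prop :=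
  IncArc (vflip ⁻¹' L) a b (-d) (-c) (vflip z) (vflip w) (vflip ⁻¹' K)

/-- `z` and `w` are the ends of an increasing arc. -/
def IncJoin (L : Set (ℝ × ℝ)) (a b c d : ℝ) (z w : ℝ × ℝ) : Prop :=
  ∃ K, IncArc L a b c d z w K ∨ IncArc L a b c d w z K

/-- `z` and `w` are the ends of a decreasing arc. -/
def DecJoin (L : Set (ℝ × ℝ)) (a b c d : ℝ) (z w : ℝ × ℝ) : Prop :=
  IncJoin (vflip ⁻¹' L) a b (-d) (-c) (vflip z) (vflip w)

/-- The boundary of the rectangle. -/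
def boxEdge (a b c d : ℝ) : Set (ℝ × ℝ) :=
  {z | z ∈ Icc a b ×ˢ Icc c d ∧ (z.1 = a ∨ z.2 = c ∨ z.1 = b ∨ z.2 = d)}

theorem vflip_mem_boxEdge {a b c d : ℝ} {z : ℝ × ℝ} :
    vflip z ∈ boxEdge a b (-d) (-c) ↔ z ∈ boxEdge a b c d := by
  simp only [boxEdge, vflip, mem_ofPred_eq, mem_prod, mem_Icc, neg_le_neg_iff, neg_inj]
  tauto

/-! ### Points of the boundary as ends of arcs -/

namespace IncJoin

variable {L : Set (ℝ × ℝ)} {a b c d : ℝ} {z w w' : ℝ × ℝ}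

theorem symm (h : IncJoin L a b c d z w) : IncJoin L a b c d w z := by
  obtain ⟨K, h⟩ := h
  exact ⟨K, h.symm⟩

theorem mem_left (h : IncJoin L a b c d z w) : z ∈ L ∧ z ∈ boxEdge a b c d := by
  obtain ⟨K, h | h⟩ := h
  · exact ⟨h.subL h.left_mem, h.box h.left_mem, by have := h.low; tauto⟩
  · exact ⟨h.subL h.right_mem, h.box h.right_mem, by have := h.high; tauto⟩

theorem mem_right (h : IncJoin L a b c d z w) : w ∈ L ∧ w ∈ boxEdge a b c d := h.symm.mem_left

/-- The same point cannot be the lower end of one increasing arc and the upper end of another: a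
lower end lies on the left or lower edge, and an upper end has points of the rectangle strictly to
its lower left. -/
theorem eq (hT : TameBox L a b c d) (h : IncJoin L a b c d z w) (h' : IncJoin L a b c d z w') :
    w = w' := by
  have aux : ∀ {z w w' K K'}, IncArc L a b c d z w K → IncArc L a b c d w' z K' → False := by
    intro z w w' K K' h h'
    have h1 := h'.box h'.left_mem
    rcases h.low with h2 | h2
    · linarith [h'.lt.1, h1.1.1]
    · linarith [h'.lt.2, h1.2.1]
  obtain ⟨K, h | h⟩ := h <;> obtain ⟨K', h' | h'⟩ := h'
  · exact hT.incArc_unique_of_low h h'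
  · exact (aux h h').elim
  · exact (aux h' h).elim
  · exact hT.incArc_unique_of_high h h'

/-- Reduces the existence of an arc to the behaviour of `L` in a quadrant at `z`. Only quadrants
that meet the interior of the rectangle count, whence the inequalities. -/
theorem exists_iff (hT : TameBox L a b c d) (hz : z ∈ L) (hzB : z ∈ boxEdge a b c d) :
    (∃ w, IncJoin L a b c d z w) ↔ (z.1 < b ∧ z.2 < d ∧ Enters L z 1 1) ∨
      (a < z.1 ∧ c < z.2 ∧ Enters L z (-1) (-1)) := by
  constructor
  · rintro ⟨w, K, h | h⟩
    · have := h.box h.right_mem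
      exact Or.inl ⟨h.lt.1.trans_le this.1.2, h.lt.2.trans_le this.2.2,
        h.chain.enters_pos h.conn h.subL h.left_mem h.right_mem h.lt⟩
    · have := h.box h.left_mem
      exact Or.inr ⟨this.1.1.trans_lt h.lt.1, this.2.1.trans_lt h.lt.2,
        h.chain.enters_neg h.conn h.subL h.right_mem h.left_mem h.lt⟩
  · rintro (⟨h1, h2, h3⟩ | ⟨h1, h2, h3⟩)
    · have hlow : z.1 = a ∨ z.2 = c := by
        rcases hzB.2 with h | h | h | h
        · exact Or.inl h
        · exact Or.inr h
        · linarith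
        · linarith
      obtain ⟨w, K, h⟩ := hT.exists_incArc hz hzB.1 hlow h1 h2 h3
      exact ⟨w, K, Or.inl h⟩
    · have hlow : (-z).1 = -b ∨ (-z).2 = -d := by
        rcases hzB.2 with h | h | h | h
        · linarith
        · linarith
        · left; simp [h]
        · right; simp [h]
      -- After the point reflection `z` is a lower end.
      obtain ⟨w, K, h⟩ := hT.neg.exists_incArc (z := -z) (by simpa using hz)
        ⟨⟨by simpa using hzB.1.1.2, by simpa using hzB.1.1.1⟩,
          by simpa using hzB.1.2.2, by simpa using hzB.1.2.1⟩ hlow (by simpa using h1)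
          (by simpa using h2) (enters_neg.2 (by simpa using h3))
      have := h.neg
      have h0 : (fun z : ℝ × ℝ => -z) ⁻¹' ((fun z : ℝ × ℝ => -z) ⁻¹' L) = L := by ext; simp
      simp only [neg_neg, h0] at this
      exact ⟨-w, _, Or.inr this⟩

end IncJoin

namespace DecJoin

variable {L : Set (ℝ × ℝ)} {a b c d : ℝ} {z w w' : ℝ × ℝ}

theorem symm (h : DecJoin L a b c d z w) : DecJoin L a b c d w z := IncJoin.symm h

theorem mem_left (h : DecJoin L a b c d z w) : z ∈ L ∧ z ∈ boxEdge a b c d := by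
  have := IncJoin.mem_left h
  rwa [vflip_mem_boxEdge, mem_preimage, vflip_vflip] at this

theorem mem_right (h : DecJoin L a b c d z w) : w ∈ L ∧ w ∈ boxEdge a b c d := h.symm.mem_left

theorem eq (hT : TameBox L a b c d) (h : DecJoin L a b c d z w) (h' : DecJoin L a b c d z w') :
    w = w' := by
  have := IncJoin.eq hT.flip h h'
  rw [← vflip_vflip w, this, vflip_vflip]

theorem exists_iff (hT : TameBox L a b c d) (hz : z ∈ L) (hzB : z ∈ boxEdge a b c d) :
    (∃ w, DecJoin L a b c d z w) ↔ (z.1 < b ∧ c < z.2 ∧ Enters L z 1 (-1)) ∨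
      (a < z.1 ∧ z.2 < d ∧ Enters L z (-1) 1) := by
  have h := IncJoin.exists_iff hT.flip (z := vflip z) (by simpa [vflip_vflip] using hz)
    (vflip_mem_boxEdge.2 hzB)
  rw [enters_vflip, enters_vflip, vflip_vflip, neg_neg] at h
  simp only [vflip, neg_lt_neg_iff] at h
  rw [← h]
  constructor
  · rintro ⟨w, hw⟩; exact ⟨vflip w, hw⟩
  · rintro ⟨w, hw⟩
    refine ⟨vflip w, ?_⟩
    unfold DecJoin
    rw [vflip_vflip]
    exact hw

end DecJoin

namespace TameBox

variable {L : Set (ℝ × ℝ)} {a b c d : ℝ} {z w w' : ℝ × ℝ}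

/-- The end of an increasing arc is not the end of a decreasing arc. -/
theorem not_incJoin_decJoin (hT : TameBox L a b c d) (h : IncJoin L a b c d z w)
    (h' : DecJoin L a b c d z w') : False := by
  obtain ⟨hz, hB⟩ := h.mem_left
  have h1 := (IncJoin.exists_iff hT hz hB).1 ⟨w, h⟩
  have h2 := (DecJoin.exists_iff hT hz hB).1 ⟨w', h'⟩
  have hb := hB.1
  have hab := hT.hab
  have hcd := hT.hcd
  have V := hT.vertical z hz hb.1
  have H := hT.horizontal z hz
  rcases h1 with ⟨a1, a2, a3⟩ | ⟨a1, a2, a3⟩ <;> rcases h2 with ⟨b1, b2, b3⟩ | ⟨b1, b2, b3⟩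
  -- An increasing and a decreasing branch leave through adjacent quadrants. These lie on one side
  -- of a vertical or of a horizontal line, and the inequalities place `z` strictly inside the
  -- corresponding strip, where only one of them may be entered.
  · exact (V ⟨b2, a2⟩ 1 isSign_one (fun _ => a1) (fun h => by norm_num at h)).1 a3 b3
  · exact (H ⟨b1, a1⟩ hb.2 1 isSign_one (fun _ => a2) (fun h => by norm_num at h)).1 a3 b3
  · exact (H ⟨a1, b1⟩ hb.2 (-1) isSign_neg_one (fun h => by norm_num at h) (fun _ => a2)).1 b3 a3
  · exact (V ⟨a2, b2⟩ (-1) isSign_neg_one (fun h => by norm_num at h) (fun _ => b1)).1 b3 a3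

/-- Every point of the boundary that is no corner is the end of an arc. -/
theorem exists_join (hT : TameBox L a b c d) (hz : z ∈ L) (hB : z ∈ boxEdge a b c d)
    (hc : z.1 ∈ Ioo a b ∨ z.2 ∈ Ioo c d) :
    (∃ w, IncJoin L a b c d z w) ∨ ∃ w, DecJoin L a b c d z w := by
  rw [IncJoin.exists_iff hT hz hB, DecJoin.exists_iff hT hz hB]
  have hb := hB.1
  have hab := hT.hab
  have hcd := hT.hcd
  rcases hc with hc | hc
  · have H := hT.horizontal z hz hc hb.2
    -- At least one side of the horizontal line through `z` belongs to the rectangle; of the two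
    -- quadrants on that side exactly one is entered, and either choice starts an arc.
    rcases lt_or_ge z.2 d with h | h
    · have := H 1 isSign_one (fun _ => h) (fun h => by norm_num at h)
      have := hc.1
      have := hc.2
      tauto
    · have hcz : c < z.2 := by linarith
      have := H (-1) isSign_neg_one (fun h => by norm_num at h) (fun _ => hcz)
      have := hc.1
      have := hc.2
      tauto
  · have V := hT.vertical z hz hb.1 hc
    rcases lt_or_ge z.1 b with h | h
    · have := V 1 isSign_one (fun _ => h) (fun h => by norm_num at h)
      have := hc.1
      have := hc.2
      tauto
    · have hcz : a < z.1 := by linarith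
      have := V (-1) isSign_neg_one (fun h => by norm_num at h) (fun _ => hcz)
      have := hc.1
      have := hc.2
      tauto

end TameBox

/-! ### Parametrized monotone arcs -/

namespace TameBox

variable {L : Set (ℝ × ℝ)} {a b c d : ℝ} {z w : ℝ × ℝ}

/-- A monotone arc through the interior is strictly monotone in both coordinates. -/
theorem param_strict (hT : TameBox L a b c d) {β : ℝ → ℝ × ℝ} (hc : ContinuousOn β (Icc 0 1))
    (hi : InjOn β (Icc 0 1)) (hin : ∀ t ∈ Ioo (0 : ℝ) 1, β t ∈ L ∩ Ioo a b ×ˢ Ioo c d)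
    (h1 : MonotoneOn (fun t => (β t).1) (Icc 0 1)) (h2 : MonotoneOn (fun t => (β t).2) (Icc 0 1))
    {s t : ℝ} (hs : s ∈ Icc (0 : ℝ) 1) (ht : t ∈ Icc (0 : ℝ) 1) (hst : s < t) :
    (β s).1 < (β t).1 ∧ (β s).2 < (β t).2 := by
  set m := (s + t) / 2 with hm
  have hsm : s < m := by linarith
  have hmt : m < t := by linarith
  have hmI : m ∈ Ioo (0 : ℝ) 1 := ⟨by linarith [hs.1], by linarith [ht.2]⟩
  have hmI' : m ∈ Icc (0 : ℝ) 1 := Ioo_subset_Icc_self hmI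
  -- If one coordinate were constant between the interior parameter `m` and a nearby later one `r`,
  -- then by injectivity `β r` would be a point of `L` on a half-axis of `β m`, arbitrarily close to
  -- it.
  obtain ⟨e, he, hax⟩ := hT.axis (β m) (hin m hmI) 1 isSign_one
  have hcm := hc m hmI'
  obtain ⟨η, hη, hclose⟩ := Metric.continuousWithinAt_iff.1 hcm e he
  set r := m + min (η / 2) (t - m) / 2 with hr
  have hmin : 0 < min (η / 2) (t - m) := lt_min (by positivity) (by linarith)
  have hmr : m < r := by linarith
  have hrt : r < t := by linarith [min_le_right (η / 2) (t - m)]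
  have hrη : r - m < η := by linarith [min_le_left (η / 2) (t - m)]
  have hrI : r ∈ Icc (0 : ℝ) 1 := ⟨by linarith [hmI.1], by linarith [ht.2]⟩
  have hne : β m ≠ β r := fun h => hmr.ne (hi hmI' hrI h)
  have hd := hclose hrI (by rw [Real.dist_eq, abs_of_pos (by linarith)]; exact hrη)
  rw [Prod.dist_eq] at hd
  have hd1 := (le_max_left _ _).trans_lt hd
  have hd2 := (le_max_right _ _).trans_lt hd
  rw [Real.dist_eq] at hd1 hd2
  have hrL : β r ∈ L := (hin r ⟨by linarith [hmI.1], by linarith [ht.2]⟩).1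
  have m1 := h1 hmI' hrI hmr.le
  have m2 := h2 hmI' hrI hmr.le
  have s1 := h1 hs hmI' hsm.le
  have s2 := h2 hs hmI' hsm.le
  have t1 := h1 hrI ht hrt.le
  have t2 := h2 hrI ht hrt.le
  simp only at m1 m2 s1 s2 t1 t2
  have c1 : (β m).1 ≠ (β r).1 := by
    intro h
    have hlt : (β m).2 < (β r).2 := lt_of_le_of_ne m2 fun h' => hne (Prod.ext h h')
    refine (hax ((β r).2 - (β m).2) ⟨by linarith, by linarith [(abs_lt.1 hd2).2]⟩).1 ?_
    have : ((β m).1, (β m).2 + 1 * ((β r).2 - (β m).2)) = β r := Prod.ext h (by simp)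
    rwa [this]
  have c2 : (β m).2 ≠ (β r).2 := by
    intro h
    have hlt : (β m).1 < (β r).1 := lt_of_le_of_ne m1 fun h' => hne (Prod.ext h' h)
    refine (hax ((β r).1 - (β m).1) ⟨by linarith, by linarith [(abs_lt.1 hd1).2]⟩).2 ?_
    have : ((β m).1 + 1 * ((β r).1 - (β m).1), (β m).2) = β r := Prod.ext (by simp) h
    rwa [this]
  have d1 := lt_of_le_of_ne m1 c1
  have d2 := lt_of_le_of_ne m2 c2
  constructor <;> linarith

theorem param_chain (hT : TameBox L a b c d) {β : ℝ → ℝ × ℝ} (hc : ContinuousOn β (Icc 0 1))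
    (hi : InjOn β (Icc 0 1)) (hin : ∀ t ∈ Ioo (0 : ℝ) 1, β t ∈ L ∩ Ioo a b ×ˢ Ioo c d)
    (h1 : MonotoneOn (fun t => (β t).1) (Icc 0 1)) (h2 : MonotoneOn (fun t => (β t).2) (Icc 0 1)) :
    StrictChain (β '' Icc 0 1) := by
  rintro _ ⟨s, hs, rfl⟩ _ ⟨t, ht, rfl⟩
  rcases lt_trichotomy s t with h | h | h
  · exact Or.inr (Or.inl (hT.param_strict hc hi hin h1 h2 hs ht h))
  · exact Or.inl (by rw [h])
  · exact Or.inr (Or.inr (hT.param_strict hc hi hin h1 h2 ht hs h))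

theorem incArc_of_param (hT : TameBox L a b c d) {β : ℝ → ℝ × ℝ} (hc : ContinuousOn β (Icc 0 1))
    (hi : InjOn β (Icc 0 1)) (hin : ∀ t ∈ Ioo (0 : ℝ) 1, β t ∈ L ∩ Ioo a b ×ˢ Ioo c d)
    (h1 : MonotoneOn (fun t => (β t).1) (Icc 0 1)) (h2 : MonotoneOn (fun t => (β t).2) (Icc 0 1))
    (hz : β 0 ∈ L ∧ β 0 ∈ boxEdge a b c d) (hw : β 1 ∈ L ∧ β 1 ∈ boxEdge a b c d) :
    IncArc L a b c d (β 0) (β 1) (β '' Icc 0 1) := by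
  have m0 : (0 : ℝ) ∈ Icc (0 : ℝ) 1 := ⟨le_rfl, zero_le_one⟩
  have m1 : (1 : ℝ) ∈ Icc (0 : ℝ) 1 := ⟨zero_le_one, le_rfl⟩
  have hlt := hT.param_strict hc hi hin h1 h2 m0 m1 one_pos
  have cases : ∀ t ∈ Icc (0 : ℝ) 1, t = 0 ∨ t = 1 ∨ t ∈ Ioo (0 : ℝ) 1 := by
    intro t ht
    rcases eq_or_lt_of_le ht.1 with h | h
    · exact Or.inl h.symm
    · rcases eq_or_lt_of_le ht.2 with h' | h'
      · exact Or.inr (Or.inl h')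
      · exact Or.inr (Or.inr ⟨h, h'⟩)
  refine ⟨isPreconnected_Icc.image _ hc, hT.param_chain hc hi hin h1 h2, ⟨0, m0, rfl⟩,
    ⟨1, m1, rfl⟩, ?_, ?_, ?_, ?_, hlt, ?_⟩
  · rintro _ ⟨t, ht, rfl⟩
    rcases cases t ht with rfl | rfl | h
    · exact hz.1
    · exact hw.1
    · exact (hin t h).1
  · rintro _ ⟨t, ht, rfl⟩
    rcases cases t ht with rfl | rfl | h
    · exact hz.2.1
    · exact hw.2.1
    · exact ⟨Ioo_subset_Icc_self (hin t h).2.1, Ioo_subset_Icc_self (hin t h).2.2⟩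
  · have hb := hw.2.1
    rcases hz.2.2 with h | h | h | h
    · exact Or.inl h
    · exact Or.inr h
    · linarith [hb.1.2, hlt.1]
    · linarith [hb.2.2, hlt.2]
  · have hb := hz.2.1
    rcases hw.2.2 with h | h | h | h
    · linarith [hb.1.1, hlt.1]
    · linarith [hb.2.1, hlt.2]
    · exact Or.inl h
    · exact Or.inr h
  · rintro _ ⟨t, ht, rfl⟩
    rcases cases t ht with rfl | rfl | h
    · exact Or.inl rfl
    · exact Or.inr (Or.inl rfl)
    · exact Or.inr (Or.inr (hin t h).2)

theorem reverse_param {β : ℝ → ℝ × ℝ} :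
    (ContinuousOn β (Icc 0 1) → ContinuousOn (fun t => β (1 - t)) (Icc 0 1)) ∧
    (InjOn β (Icc 0 1) → InjOn (fun t => β (1 - t)) (Icc 0 1)) ∧
    (AntitoneOn (fun t => (β t).1) (Icc 0 1) →
      MonotoneOn (fun t => (β (1 - t)).1) (Icc 0 1)) ∧
    (AntitoneOn (fun t => (β t).2) (Icc 0 1) →
      MonotoneOn (fun t => (β (1 - t)).2) (Icc 0 1)) := by
  have hI : ∀ t ∈ Icc (0 : ℝ) 1, 1 - t ∈ Icc (0 : ℝ) 1 := fun t ht =>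
    ⟨by linarith [ht.2], by linarith [ht.1]⟩
  refine ⟨fun h => h.comp (f := fun t => 1 - t) (by fun_prop) hI, ?_, ?_, ?_⟩
  · intro h s hs t ht hst
    have := h (hI s hs) (hI t ht) hst
    linarith
  · intro h s hs t ht hst
    exact h (hI t ht) (hI s hs) (by linarith)
  · intro h s hs t ht hst
    exact h (hI t ht) (hI s hs) (by linarith)

open FreeSpace in
-- A parametrized arc may run upwards or downwards, which corresponds to the two orders of the ends
-- in `IncJoin`. Its strict monotonicity is not part of the definition and comes from
-- `param_strict`.
theorem increasingArc_iff (hT : TameBox L a b c d) (hz : z ∈ L ∧ z ∈ boxEdge a b c d)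
    (hw : w ∈ L ∧ w ∈ boxEdge a b c d) :
    IncreasingArc (L ∩ Ioo a b ×ˢ Ioo c d) z w ↔ IncJoin L a b c d z w := by
  constructor
  · rintro ⟨β, ⟨hc, hi, rfl, rfl, hin⟩, ⟨h1, h2⟩ | ⟨h1, h2⟩⟩
    · exact ⟨_, Or.inl (hT.incArc_of_param hc hi hin h1 h2 hz hw)⟩
    · obtain ⟨r1, r2, r3, r4⟩ := reverse_param (β := β)
      have := hT.incArc_of_param (r1 hc) (r2 hi)
        (fun t ht => hin (1 - t) ⟨by linarith [ht.2], by linarith [ht.1]⟩) (r3 h1) (r4 h2)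
        (by simpa using hw) (by simpa using hz)
      simp only [sub_zero, sub_self] at this
      exact ⟨_, Or.inr this⟩
  · have key : ∀ {z w K}, IncArc L a b c d z w K → ∃ β,
        IsArc (L ∩ Ioo a b ×ˢ Ioo c d) z w β ∧ MonotoneOn (fun t => (β t).1) (Icc 0 1) ∧
          MonotoneOn (fun t => (β t).2) (Icc 0 1) := by
      intro z w K h
      obtain ⟨β, hc, h0, h1, hK, hm⟩ := h.exists_param
      have m0 : (0 : ℝ) ∈ Icc (0 : ℝ) 1 := ⟨le_rfl, zero_le_one⟩
      have m1 : (1 : ℝ) ∈ Icc (0 : ℝ) 1 := ⟨zero_le_one, le_rfl⟩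
      refine ⟨β, ⟨hc, ?_, h0, h1, ?_⟩, ?_, ?_⟩
      · intro s hs t ht hst
        rcases lt_trichotomy s t with h2 | h2 | h2
        · have := (hm s hs t ht h2).1; rw [hst] at this; exact absurd this (lt_irrefl _)
        · exact h2
        · have := (hm t ht s hs h2).1; rw [hst] at this; exact absurd this (lt_irrefl _)
      · intro t ht
        have ht' := Ioo_subset_Icc_self ht
        have hmem : β t ∈ K := hK ▸ mem_image_of_mem β ht'
        refine ⟨h.subL hmem, ?_⟩
        rcases h.inner _ hmem with h2 | h2 | h2
        · have := (hm 0 m0 t ht' ht.1).1; rw [h2, h0] at this; exact absurd this (lt_irrefl _)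
        · have := (hm t ht' 1 m1 ht.2).1; rw [h2, h1] at this; exact absurd this (lt_irrefl _)
        · exact h2
      · intro s hs t ht hst
        rcases eq_or_lt_of_le hst with rfl | h2
        · exact le_rfl
        · exact (hm s hs t ht h2).1.le
      · intro s hs t ht hst
        rcases eq_or_lt_of_le hst with rfl | h2
        · exact le_rfl
        · exact (hm s hs t ht h2).2.le
    rintro ⟨K, h | h⟩
    · obtain ⟨β, h1, h2, h3⟩ := key h
      exact ⟨β, h1, Or.inl ⟨h2, h3⟩⟩
    · obtain ⟨β, ⟨h1, h2, h3, h4, h5⟩, h6, h7⟩ := key h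
      have hI : ∀ t ∈ Icc (0 : ℝ) 1, 1 - t ∈ Icc (0 : ℝ) 1 := fun t ht =>
        ⟨by linarith [ht.2], by linarith [ht.1]⟩
      obtain ⟨r1, r2, -, -⟩ := reverse_param (β := β)
      refine ⟨fun t => β (1 - t), ⟨r1 h1, r2 h2, by simpa using h4, by simpa using h3,
        fun t ht => h5 _ ⟨by linarith [ht.2], by linarith [ht.1]⟩⟩, Or.inr ⟨?_, ?_⟩⟩
      · exact fun s hs t ht hst => h6 (hI t ht) (hI s hs) (by linarith)
      · exact fun s hs t ht hst => h7 (hI t ht) (hI s hs) (by linarith)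

open FreeSpace in
/-- `B_δ` is increasing at a point of the boundary at which it enters the rectangle along an
increasing arc. -/
theorem exists_increasingArc_iff (hT : TameBox L a b c d) (hz : z ∈ L ∧ z ∈ boxEdge a b c d) :
    (∃ w, IncreasingArc (L ∩ Ioo a b ×ˢ Ioo c d) z w) ↔ ∃ w, IncJoin L a b c d z w := by
  constructor
  · rintro ⟨w, β, ⟨hc, hi, rfl, rfl, hin⟩, hmon⟩
    rw [IncJoin.exists_iff hT hz.1 hz.2]
    have m0 : (0 : ℝ) ∈ Icc (0 : ℝ) 1 := ⟨le_rfl, zero_le_one⟩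
    have m1 : (1 : ℝ) ∈ Icc (0 : ℝ) 1 := ⟨zero_le_one, le_rfl⟩
    have mh : (1 / 2 : ℝ) ∈ Ioo (0 : ℝ) 1 := by constructor <;> norm_num
    -- The far end of the arc need be neither on the boundary nor in `L`, so only the first half of
    -- the path is used; it shows which quadrant is entered at `z`.
    have hsub : Icc (0 : ℝ) (1 / 2) ⊆ Icc 0 1 := Icc_subset_Icc_right (by norm_num)
    have hin' := (hin _ mh).2
    have hKL : β '' Icc 0 (1 / 2) ⊆ L := by
      rintro _ ⟨t, ht, rfl⟩
      rcases eq_or_lt_of_le ht.1 with h | h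
      · rw [← h]; exact hz.1
      · exact (hin t ⟨h, by linarith [ht.2]⟩).1
    have hKc : IsPreconnected (β '' Icc 0 (1 / 2)) := isPreconnected_Icc.image _ (hc.mono hsub)
    have e0 : β 0 ∈ β '' Icc 0 (1 / 2) := ⟨0, ⟨le_rfl, by norm_num⟩, rfl⟩
    have e1 : β (1 / 2) ∈ β '' Icc 0 (1 / 2) := ⟨1 / 2, ⟨by norm_num, le_rfl⟩, rfl⟩
    rcases hmon with ⟨h1, h2⟩ | ⟨h1, h2⟩
    · have hlt := hT.param_strict hc hi hin h1 h2 m0 (Ioo_subset_Icc_self mh) mh.1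
      have hch := (hT.param_chain hc hi hin h1 h2).mono (image_mono hsub)
      exact Or.inl ⟨hlt.1.trans hin'.1.2, hlt.2.trans hin'.2.2,
        hch.enters_pos hKc hKL e0 e1 hlt⟩
    · obtain ⟨r1, r2, r3, r4⟩ := reverse_param (β := β)
      have hinr : ∀ t ∈ Ioo (0 : ℝ) 1, β (1 - t) ∈ L ∩ Ioo a b ×ˢ Ioo c d := fun t ht =>
        hin (1 - t) ⟨by linarith [ht.2], by linarith [ht.1]⟩
      have hlt := hT.param_strict (r1 hc) (r2 hi) hinr (r3 h1) (r4 h2)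
        (Ioo_subset_Icc_self mh) m1 mh.2
      have hch := (hT.param_chain (r1 hc) (r2 hi) hinr (r3 h1) (r4 h2)).mono
        (M := β '' Icc 0 (1 / 2)) (by
          rintro _ ⟨t, ht, rfl⟩
          exact ⟨1 - t, ⟨by linarith [ht.2], by linarith [ht.1]⟩, by simp⟩)
      have hh : (1 : ℝ) - 1 / 2 = 1 / 2 := by norm_num
      rw [hh, sub_self] at hlt
      exact Or.inr ⟨hin'.1.1.trans hlt.1, hin'.2.1.trans hlt.2,
        hch.enters_neg hKc hKL e0 e1 hlt⟩
  · rintro ⟨w, hw⟩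
    exact ⟨w, (hT.increasingArc_iff hz hw.mem_right).2 hw⟩

open FreeSpace in
-- The reflection leaves the first coordinate alone and reverses the sense of monotonicity of the
-- second.
theorem decreasingArc_iff_vflip {A : Set (ℝ × ℝ)} :
    DecreasingArc A z w ↔ IncreasingArc (vflip ⁻¹' A) (vflip z) (vflip w) := by
  have hinj : Function.Injective vflip := fun u v h => by rw [← vflip_vflip u, h, vflip_vflip]
  have key : ∀ {A : Set (ℝ × ℝ)} {z w β}, IsArc A z w β →
      IsArc (vflip ⁻¹' A) (vflip z) (vflip w) (vflip ∘ β) := by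
    rintro A z w β ⟨h1, h2, h3, h4, h5⟩
    refine ⟨continuous_vflip.comp_continuousOn h1, hinj.comp_injOn h2, by simp [h3], by simp [h4],
      fun t ht => ?_⟩
    simp only [mem_preimage, Function.comp, vflip_vflip]
    exact h5 t ht
  constructor
  · rintro ⟨β, h, hm⟩
    refine ⟨_, key h, hm.imp (And.imp_right fun h => h.neg) (And.imp_right fun h => h.neg)⟩
  · rintro ⟨β, h, hm⟩
    have := key h
    rw [vflip_preimage_vflip_preimage, vflip_vflip, vflip_vflip] at this
    exact ⟨_, this, hm.imp (And.imp_right fun h => h.neg) (And.imp_right fun h => h.neg)⟩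

theorem vflip_preimage_inner {L : Set (ℝ × ℝ)} : vflip ⁻¹' (L ∩ Ioo a b ×ˢ Ioo c d) =
    vflip ⁻¹' L ∩ Ioo a b ×ˢ Ioo (-d) (-c) := by
  ext z
  simp only [mem_preimage, mem_inter_iff, mem_prod, vflip, mem_Ioo]
  constructor
  · rintro ⟨h1, h2, h3, h4⟩; exact ⟨h1, h2, by linarith, by linarith⟩
  · rintro ⟨h1, h2, h3, h4⟩; exact ⟨h1, h2, by linarith, by linarith⟩

theorem vflip_mem_edge (hz : z ∈ L ∧ z ∈ boxEdge a b c d) :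
    vflip z ∈ vflip ⁻¹' L ∧ vflip z ∈ boxEdge a b (-d) (-c) :=
  ⟨by simpa [vflip_vflip] using hz.1, vflip_mem_boxEdge.2 hz.2⟩

open FreeSpace in
theorem decreasingArc_iff (hT : TameBox L a b c d) (hz : z ∈ L ∧ z ∈ boxEdge a b c d)
    (hw : w ∈ L ∧ w ∈ boxEdge a b c d) :
    DecreasingArc (L ∩ Ioo a b ×ˢ Ioo c d) z w ↔ DecJoin L a b c d z w := by
  rw [decreasingArc_iff_vflip, vflip_preimage_inner,
    hT.flip.increasingArc_iff (vflip_mem_edge hz) (vflip_mem_edge hw)]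
  rfl

open FreeSpace in
theorem exists_decreasingArc_iff (hT : TameBox L a b c d) (hz : z ∈ L ∧ z ∈ boxEdge a b c d) :
    (∃ w, DecreasingArc (L ∩ Ioo a b ×ˢ Ioo c d) z w) ↔ ∃ w, DecJoin L a b c d z w := by
  have := hT.flip.exists_increasingArc_iff (vflip_mem_edge hz)
  rw [← vflip_preimage_inner] at this
  constructor
  · rintro ⟨w, hw⟩
    obtain ⟨v, hv⟩ := this.1 ⟨_, decreasingArc_iff_vflip.1 hw⟩
    refine ⟨vflip v, ?_⟩
    unfold DecJoin
    rwa [vflip_vflip]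
  · rintro ⟨w, hw⟩
    exact ⟨w, (hT.decreasingArc_iff hz hw.mem_right).2 hw⟩

end TameBox

/-! ### Arcs do not cross -/

open scoped Pointwise in
/-- An increasing arc separates the rectangle into an upper left and a lower right part. -/
theorem IncArc.separates {L : Set (ℝ × ℝ)} {a b c d : ℝ} {z w : ℝ × ℝ} {K K' : Set (ℝ × ℝ)}
    (h : IncArc L a b c d z w K) (hK' : IsPreconnected K') (hB : K' ⊆ Icc a b ×ˢ Icc c d)
    (hd : Disjoint K K') :
    (∀ u ∈ K', ¬ ∃ v ∈ K, v.1 ≤ u.1 ∧ u.2 ≤ v.2) ∨ (∀ u ∈ K', ¬ ∃ v ∈ K, u.1 ≤ v.1 ∧ v.2 ≤ u.2) := by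
  -- The sets of points to the upper left and to the lower right of some point of the arc are
  -- closed, being sums of a compact set and a closed cone. They cover the rectangle and meet only
  -- in the arc, so a connected set disjoint from the arc lies in one of them.
  set UL : Set (ℝ × ℝ) := {u | ∃ v ∈ K, u.1 ≤ v.1 ∧ v.2 ≤ u.2} with hUL
  set LR : Set (ℝ × ℝ) := {u | ∃ v ∈ K, v.1 ≤ u.1 ∧ u.2 ≤ v.2} with hLR
  have hboth : ∀ u, u ∈ UL → u ∈ LR → u ∈ K := by
    rintro u ⟨v, hv, h1, h2⟩ ⟨v', hv', h3, h4⟩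
    rcases h.chain v hv v' hv' with rfl | h5 | h5
    · have : u = v := Prod.ext (le_antisymm h1 h3) (le_antisymm h4 h2)
      rwa [this]
    · linarith
    · linarith
  have cUL : IsClosed UL := by
    have : UL = K + {p : ℝ × ℝ | p.1 ≤ 0 ∧ 0 ≤ p.2} := by
      ext u
      constructor
      · rintro ⟨v, hv, h1, h2⟩
        exact ⟨v, hv, u - v, ⟨by simpa using h1, by simpa using h2⟩, by simp⟩
      · rintro ⟨v, hv, p, ⟨h1, h2⟩, rfl⟩
        exact ⟨v, hv, by simpa using h1, by simpa using h2⟩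
    rw [this]
    refine IsClosed.add_left_of_isCompact ?_ h.isCompact
    exact (isClosed_le continuous_fst continuous_const).inter
      (isClosed_le continuous_const continuous_snd)
  have cLR : IsClosed LR := by
    have : LR = K + {p : ℝ × ℝ | 0 ≤ p.1 ∧ p.2 ≤ 0} := by
      ext u
      constructor
      · rintro ⟨v, hv, h1, h2⟩
        exact ⟨v, hv, u - v, ⟨by simpa using h1, by simpa using h2⟩, by simp⟩
      · rintro ⟨v, hv, p, ⟨h1, h2⟩, rfl⟩
        exact ⟨v, hv, by simpa using h1, by simpa using h2⟩
    rw [this]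
    refine IsClosed.add_left_of_isCompact ?_ h.isCompact
    exact (isClosed_le continuous_const continuous_fst).inter
      (isClosed_le continuous_snd continuous_const)
  -- A point whose abscissa lies between those of the ends is compared with the point of the arc on
  -- the same vertical line. Outside this range the end on the boundary of the rectangle serves for
  -- comparison.
  have hcov : K' ⊆ UL ∪ LR := by
    intro u hu
    have huB := hB hu
    rcases le_or_gt u.1 z.1 with h1 | h1
    · rcases h.low with h2 | h2
      · rcases le_or_gt z.2 u.2 with h3 | h3
        · exact Or.inl ⟨z, h.left_mem, h1, h3⟩
        · exact Or.inr ⟨z, h.left_mem, by linarith [huB.1.1], h3.le⟩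
      · exact Or.inl ⟨z, h.left_mem, h1, by linarith [huB.2.1]⟩
    · rcases le_or_gt w.1 u.1 with h2 | h2
      · rcases h.high with h3 | h3
        · rcases le_or_gt w.2 u.2 with h4 | h4
          · exact Or.inl ⟨w, h.right_mem, by linarith [huB.1.2], h4⟩
          · exact Or.inr ⟨w, h.right_mem, h2, h4.le⟩
        · exact Or.inr ⟨w, h.right_mem, h2, by linarith [huB.2.2]⟩
      · obtain ⟨k, hk, hk'⟩ := h.conn.intermediate_value h.left_mem h.right_mem
          (f := fun v : ℝ × ℝ => v.1) continuous_fst.continuousOn ⟨h1.le, h2.le⟩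
        simp only at hk'
        rcases le_total k.2 u.2 with h3 | h3
        · exact Or.inl ⟨k, hk, hk'.ge, h3⟩
        · exact Or.inr ⟨k, hk, hk'.le, h3⟩
  by_contra hcon
  push Not at hcon
  obtain ⟨⟨u, hu, hu'⟩, v, hv, hv'⟩ := hcon
  obtain ⟨x, hx, hx1, hx2⟩ := isPreconnected_closed_iff.1 hK' UL LR cUL cLR hcov ⟨v, hv, hv'⟩
    ⟨u, hu, hu'⟩
  exact disjoint_left.1 hd (hboth x hx1 hx2) hx

/-- The position of a point of the boundary of the rectangle, in counterclockwise order beginning at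
the upper left corner. -/
noncomputable def edgePos (a b c d : ℝ) (z : ℝ × ℝ) : ℝ :=
  if z.1 = a then d - z.2 else if z.2 = c then (d - c) + (z.1 - a) else
    if z.1 = b then (d - c) + (b - a) + (z.2 - c) else (d - c) + (b - a) + (d - c) + (b - z.1)

section noncrossing

variable {L : Set (ℝ × ℝ)} {a b c d : ℝ} {z w : ℝ × ℝ} {K K' : Set (ℝ × ℝ)}

theorem IncArc.edgePos_lt (hab : a < b) (hcd : c < d) (h : IncArc L a b c d z w K) :
    edgePos a b c d z < edgePos a b c d w := by
  have hz := h.box h.left_mem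
  have hw := h.box h.right_mem
  have h1 := h.lt.1
  have h2 := h.lt.2
  simp only [mem_prod, mem_Icc] at hz hw
  have e1 : w.1 ≠ a := by linarith
  have e2 : w.2 ≠ c := by linarith
  unfold edgePos
  rw [if_neg e1, if_neg e2]
  rcases h.low with h3 | h3
  · rw [if_pos h3]; split_ifs <;> linarith
  · rw [if_pos h3]; split_ifs <;> linarith

/-- The points between the ends of an increasing arc lie to the lower right of one of the ends. -/
theorem lowerRight_of_between {u : ℝ × ℝ} (hz : z ∈ Icc a b ×ˢ Icc c d)
    (hw : w ∈ Icc a b ×ˢ Icc c d) (hu : u ∈ boxEdge a b c d) (hlt : z.1 < w.1 ∧ z.2 < w.2)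
    (hlow : z.1 = a ∨ z.2 = c) (hhigh : w.1 = b ∨ w.2 = d)
    (h1 : edgePos a b c d z < edgePos a b c d u) (h2 : edgePos a b c d u < edgePos a b c d w) :
    (z.1 ≤ u.1 ∧ u.2 ≤ z.2) ∨ (w.1 ≤ u.1 ∧ u.2 ≤ w.2) := by
  obtain ⟨hb, he⟩ := hu
  obtain ⟨⟨hz1, hz2⟩, hz3, hz4⟩ := hz
  obtain ⟨⟨hw1, hw2⟩, hw3, hw4⟩ := hw
  obtain ⟨⟨hb1, hb2⟩, hb3, hb4⟩ := hb
  obtain ⟨l1, l2⟩ := hlt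
  unfold edgePos at h1 h2
  rw [if_neg (by linarith : w.1 ≠ a), if_neg (by linarith : w.2 ≠ c)] at h2
  split_ifs at h1 h2 <;> grind

/-- Complement of the previous case: the ends of an increasing arc cut the boundary into a part on
its lower right and a part on its upper left. The equality cases are the ends themselves, which
satisfy the conclusion trivially. -/
theorem upperLeft_of_not_between {u : ℝ × ℝ} (hz : z ∈ Icc a b ×ˢ Icc c d)
    (hw : w ∈ Icc a b ×ˢ Icc c d) (hu : u ∈ boxEdge a b c d) (hlt : z.1 < w.1 ∧ z.2 < w.2)
    (hlow : z.1 = a ∨ z.2 = c)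
    (h1 : ¬ (edgePos a b c d z < edgePos a b c d u ∧ edgePos a b c d u < edgePos a b c d w)) :
    (u.1 ≤ z.1 ∧ z.2 ≤ u.2) ∨ (u.1 ≤ w.1 ∧ w.2 ≤ u.2) := by
  obtain ⟨hb, he⟩ := hu
  obtain ⟨⟨hz1, hz2⟩, hz3, hz4⟩ := hz
  obtain ⟨⟨hw1, hw2⟩, hw3, hw4⟩ := hw
  obtain ⟨⟨hb1, hb2⟩, hb3, hb4⟩ := hb
  obtain ⟨l1, l2⟩ := hlt
  unfold edgePos at h1
  rw [if_neg (by linarith : w.1 ≠ a), if_neg (by linarith : w.2 ≠ c)] at h1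
  split_ifs at h1 <;> grind

/-- The upper left end of a decreasing arc comes early in the boundary order if it is on the left
edge, and late if it is inside the upper edge. Either end may therefore come first, and this lemma
and the next three treat both orders. -/
theorem lowerLeft_of_between {u : ℝ × ℝ} (hz : z ∈ Icc a b ×ˢ Icc c d)
    (hw : w ∈ Icc a b ×ˢ Icc c d) (hu : u ∈ boxEdge a b c d) (hlt : z.1 < w.1 ∧ w.2 < z.2)
    (hlow : z.1 = a ∨ z.2 = d) (hhigh : w.1 = b ∨ w.2 = c)
    (h1 : edgePos a b c d z < edgePos a b c d u) (h2 : edgePos a b c d u < edgePos a b c d w) :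
    (u.1 ≤ z.1 ∧ u.2 ≤ z.2) ∨ (u.1 ≤ w.1 ∧ u.2 ≤ w.2) := by
  obtain ⟨hb, he⟩ := hu
  obtain ⟨⟨hz1, hz2⟩, hz3, hz4⟩ := hz
  obtain ⟨⟨hw1, hw2⟩, hw3, hw4⟩ := hw
  obtain ⟨⟨hb1, hb2⟩, hb3, hb4⟩ := hb
  obtain ⟨l1, l2⟩ := hlt
  unfold edgePos at h1 h2
  rw [if_neg (by linarith : w.1 ≠ a)] at h2
  split_ifs at h1 h2 <;> grind

theorem upperRight_of_not_between {u : ℝ × ℝ} (hz : z ∈ Icc a b ×ˢ Icc c d)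
    (hw : w ∈ Icc a b ×ˢ Icc c d) (hu : u ∈ boxEdge a b c d) (hlt : z.1 < w.1 ∧ w.2 < z.2)
    (hhigh : w.1 = b ∨ w.2 = c)
    (h0 : edgePos a b c d z < edgePos a b c d w)
    (h1 : ¬ (edgePos a b c d z < edgePos a b c d u ∧ edgePos a b c d u < edgePos a b c d w)) :
    (z.1 ≤ u.1 ∧ z.2 ≤ u.2) ∨ (w.1 ≤ u.1 ∧ w.2 ≤ u.2) := by
  obtain ⟨hb, he⟩ := hu
  obtain ⟨⟨hz1, hz2⟩, hz3, hz4⟩ := hz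
  obtain ⟨⟨hw1, hw2⟩, hw3, hw4⟩ := hw
  obtain ⟨⟨hb1, hb2⟩, hb3, hb4⟩ := hb
  obtain ⟨l1, l2⟩ := hlt
  unfold edgePos at h0 h1
  rw [if_neg (by linarith : w.1 ≠ a)] at h0 h1
  split_ifs at h0 h1 <;> grind

theorem upperRight_of_between {u : ℝ × ℝ} (hz : z ∈ Icc a b ×ˢ Icc c d)
    (hw : w ∈ Icc a b ×ˢ Icc c d) (hu : u ∈ boxEdge a b c d) (hlt : z.1 < w.1 ∧ w.2 < z.2)
    (hlow : z.1 = a ∨ z.2 = d) (hhigh : w.1 = b ∨ w.2 = c)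
    (h1 : edgePos a b c d w < edgePos a b c d u) (h2 : edgePos a b c d u < edgePos a b c d z) :
    (z.1 ≤ u.1 ∧ z.2 ≤ u.2) ∨ (w.1 ≤ u.1 ∧ w.2 ≤ u.2) := by
  obtain ⟨hb, he⟩ := hu
  obtain ⟨⟨hz1, hz2⟩, hz3, hz4⟩ := hz
  obtain ⟨⟨hw1, hw2⟩, hw3, hw4⟩ := hw
  obtain ⟨⟨hb1, hb2⟩, hb3, hb4⟩ := hb
  obtain ⟨l1, l2⟩ := hlt
  unfold edgePos at h1 h2
  rw [if_neg (by linarith : w.1 ≠ a)] at h1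
  split_ifs at h1 h2 <;> grind

theorem lowerLeft_of_not_between {u : ℝ × ℝ} (hz : z ∈ Icc a b ×ˢ Icc c d)
    (hw : w ∈ Icc a b ×ˢ Icc c d) (hu : u ∈ boxEdge a b c d) (hlt : z.1 < w.1 ∧ w.2 < z.2)
    (hlow : z.1 = a ∨ z.2 = d) (hhigh : w.1 = b ∨ w.2 = c)
    (h0 : edgePos a b c d w < edgePos a b c d z)
    (h1 : ¬ (edgePos a b c d w < edgePos a b c d u ∧ edgePos a b c d u < edgePos a b c d z)) :
    (u.1 ≤ z.1 ∧ u.2 ≤ z.2) ∨ (u.1 ≤ w.1 ∧ u.2 ≤ w.2) := by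
  obtain ⟨hb, he⟩ := hu
  obtain ⟨⟨hz1, hz2⟩, hz3, hz4⟩ := hz
  obtain ⟨⟨hw1, hw2⟩, hw3, hw4⟩ := hw
  obtain ⟨⟨hb1, hb2⟩, hb3, hb4⟩ := hb
  obtain ⟨l1, l2⟩ := hlt
  unfold edgePos at h0 h1
  rw [if_neg (by linarith : w.1 ≠ a)] at h0 h1
  split_ifs at h0 h1 <;> grind

theorem DecArc.isPreconnected (h : DecArc L a b c d z w K) : IsPreconnected K := by
  have := IncArc.conn h
  rw [vflip_preimage_eq_image] at this
  have h2 := this.image _ continuous_vflip.continuousOn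
  rwa [← vflip_preimage_eq_image, ← vflip_preimage_eq_image, vflip_preimage_vflip_preimage] at h2

theorem DecArc.subset_box (h : DecArc L a b c d z w K) : K ⊆ Icc a b ×ˢ Icc c d := by
  intro u hu
  obtain ⟨h1, h2, h3⟩ := IncArc.box h (show vflip u ∈ vflip ⁻¹' K by
    rwa [mem_preimage, vflip_vflip])
  exact ⟨h1, neg_le_neg_iff.1 h3, neg_le_neg_iff.1 h2⟩

theorem DecArc.left_mem (h : DecArc L a b c d z w K) : z ∈ K := by
  simpa [vflip_vflip] using IncArc.left_mem h

theorem DecArc.right_mem (h : DecArc L a b c d z w K) : w ∈ K := by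
  simpa [vflip_vflip] using IncArc.right_mem h

theorem DecArc.lt (h : DecArc L a b c d z w K) : z.1 < w.1 ∧ w.2 < z.2 :=
  ⟨(IncArc.lt h).1, neg_lt_neg_iff.1 (IncArc.lt h).2⟩

theorem DecArc.low (h : DecArc L a b c d z w K) : z.1 = a ∨ z.2 = d :=
  (IncArc.low h).imp_right neg_inj.1

theorem DecArc.high (h : DecArc L a b c d z w K) : w.1 = b ∨ w.2 = c :=
  (IncArc.high h).imp_right neg_inj.1

theorem DecArc.inner (h : DecArc L a b c d z w K) {u : ℝ × ℝ} (hu : u ∈ K) :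
    u = z ∨ u = w ∨ u ∈ Ioo a b ×ˢ Ioo c d := by
  have hinj : Function.Injective vflip := fun u v h => by rw [← vflip_vflip u, h, vflip_vflip]
  rcases IncArc.inner h (vflip u) (by rwa [mem_preimage, vflip_vflip]) with h1 | h1 | h1
  · exact Or.inl (hinj h1)
  · exact Or.inr (Or.inl (hinj h1))
  · exact Or.inr (Or.inr ⟨h1.1, neg_lt_neg_iff.1 h1.2.2, neg_lt_neg_iff.1 h1.2.1⟩)

theorem DecArc.separates (h : DecArc L a b c d z w K) (hK' : IsPreconnected K')
    (hB : K' ⊆ Icc a b ×ˢ Icc c d) (hd : Disjoint K K') :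
    (∀ u ∈ K', ¬ ∃ v ∈ K, v.1 ≤ u.1 ∧ v.2 ≤ u.2) ∨ (∀ u ∈ K', ¬ ∃ v ∈ K, u.1 ≤ v.1 ∧ u.2 ≤ v.2) := by
  have h1 : IsPreconnected (vflip ⁻¹' K') := by
    rw [vflip_preimage_eq_image]; exact hK'.image _ continuous_vflip.continuousOn
  have h2 : vflip ⁻¹' K' ⊆ Icc a b ×ˢ Icc (-d) (-c) := by
    intro u hu
    obtain ⟨h1, h2, h3⟩ := hB hu
    exact ⟨h1, by simp only [vflip] at h3; linarith, by simp only [vflip] at h2; linarith⟩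
  have conv : ∀ u ∈ K', vflip u ∈ vflip ⁻¹' K' := fun u hu => by rwa [mem_preimage, vflip_vflip]
  have conv' : ∀ u ∈ K, vflip u ∈ vflip ⁻¹' K := fun u hu => by rwa [mem_preimage, vflip_vflip]
  refine (IncArc.separates h h1 h2 (hd.preimage _)).imp ?_ ?_
  · rintro h u hu ⟨v, hv, h3, h4⟩
    exact h _ (conv u hu) ⟨vflip v, conv' v hv, h3, neg_le_neg h4⟩
  · rintro h u hu ⟨v, hv, h3, h4⟩
    exact h _ (conv u hu) ⟨vflip v, conv' v hv, h3, neg_le_neg h4⟩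

/-- Some arc joins `z` and `w`. -/
def ArcJoin (L : Set (ℝ × ℝ)) (a b c d : ℝ) (z w : ℝ × ℝ) : Prop :=
  IncJoin L a b c d z w ∨ DecJoin L a b c d z w

theorem ArcJoin.symm (h : ArcJoin L a b c d z w) : ArcJoin L a b c d w z :=
  h.imp IncJoin.symm DecJoin.symm

theorem ArcJoin.mem_left (h : ArcJoin L a b c d z w) : z ∈ L ∧ z ∈ boxEdge a b c d :=
  h.elim IncJoin.mem_left DecJoin.mem_left

/-- Arcs of one kind are determined by an end, and no point is an end of arcs of both kinds. -/
theorem ArcJoin.eq (hT : TameBox L a b c d) {w' : ℝ × ℝ} (h : ArcJoin L a b c d z w)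
    (h' : ArcJoin L a b c d z w') : w = w' := by
  rcases h with h | h <;> rcases h' with h' | h'
  · exact h.eq hT h'
  · exact (hT.not_incJoin_decJoin h h').elim
  · exact (hT.not_incJoin_decJoin h' h).elim
  · exact h.eq hT h'

theorem DecJoin.exists_decArc (h : DecJoin L a b c d z w) :
    ∃ K, DecArc L a b c d z w K ∨ DecArc L a b c d w z K := by
  obtain ⟨K, h⟩ := h
  refine ⟨vflip ⁻¹' K, ?_⟩
  unfold DecArc
  rwa [vflip_preimage_vflip_preimage]

/-- The set `K` runs from `z` to `w` through the interior of the rectangle. -/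
structure CrossPath (L : Set (ℝ × ℝ)) (a b c d : ℝ) (z w : ℝ × ℝ) (K : Set (ℝ × ℝ)) : Prop where
  conn : IsPreconnected K
  box : K ⊆ Icc a b ×ˢ Icc c d
  left_mem : z ∈ K
  right_mem : w ∈ K
  inner : ∀ u ∈ K, u = z ∨ u = w ∨ u ∈ Ioo a b ×ˢ Ioo c d
  join : ArcJoin L a b c d z w

theorem IncArc.crossPath (h : IncArc L a b c d z w K) : CrossPath L a b c d z w K :=
  ⟨h.conn, h.box, h.left_mem, h.right_mem, h.inner, Or.inl ⟨K, Or.inl h⟩⟩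

theorem DecArc.crossPath (h : DecArc L a b c d z w K) : CrossPath L a b c d z w K :=
  ⟨h.isPreconnected, h.subset_box, h.left_mem, h.right_mem, fun _ => h.inner,
    Or.inr ⟨_, Or.inl h⟩⟩

/-- A common point would be an interior point. Two arcs of the same kind would then coincide, and
arcs of different kinds would enter both quadrants below this point, which is impossible off the
cuts. -/
theorem TameBox.disjoint_of_ends_ne (hT : TameBox L a b c d)
    {z w z' w' : ℝ × ℝ} (hK : IncArc L a b c d z w K ∨ DecArc L a b c d z w K)
    (hK' : IncArc L a b c d z' w' K' ∨ DecArc L a b c d z' w' K')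
    (h1 : z ≠ z') (h2 : z ≠ w') (h3 : w ≠ z') (h4 : w ≠ w') : Disjoint K K' := by
  have C := hK.elim IncArc.crossPath DecArc.crossPath
  have C' := hK'.elim IncArc.crossPath DecArc.crossPath
  have edge : ∀ {u}, u ∈ boxEdge a b c d → u ∉ Ioo a b ×ˢ Ioo c d := by
    rintro u ⟨-, hu⟩ ⟨⟨g1, g2⟩, g3, g4⟩
    rcases hu with h | h | h | h <;> linarith
  rw [disjoint_left]
  intro u hu hu'
  have hui : u ∈ Ioo a b ×ˢ Ioo c d := by
    have n1 := edge C.join.mem_left.2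
    have n2 := edge C.join.symm.mem_left.2
    rcases C.inner u hu with h | h | h
    · rcases C'.inner u hu' with h' | h' | h'
      · exact absurd (h.symm.trans h') h1
      · exact absurd (h.symm.trans h') h2
      · exact h'
    · rcases C'.inner u hu' with h' | h' | h'
      · exact absurd (h.symm.trans h') h3
      · exact absurd (h.symm.trans h') h4
      · exact h'
    · exact h
  have hinj : Function.Injective vflip := fun u v h => by rw [← vflip_vflip u, h, vflip_vflip]
  have flipi : ∀ u, u ∈ Ioo a b ×ˢ Ioo c d → vflip u ∈ Ioo a b ×ˢ Ioo (-d) (-c) := fun u h =>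
    ⟨h.1, neg_lt_neg h.2.2, neg_lt_neg h.2.1⟩
  have excl : ∀ {z w z' w' K K'}, IncArc L a b c d z w K → DecArc L a b c d z' w' K' → u ∈ K →
      u ∈ K' → False := by
    intro z w z' w' K K' h h' hu hu'
    have l1 := (h.low_lt hu).resolve_left fun e => h.low_notMem (e ▸ hui)
    have hvu : vflip u ∈ vflip ⁻¹' K' := by rwa [mem_preimage, vflip_vflip]
    have l2 := (IncArc.lt_high h' hvu).resolve_left fun e =>
      IncArc.high_notMem h' (e ▸ flipi u hui)
    have E1 := h.chain.enters_neg h.conn h.subL hu h.left_mem l1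
    have E2 := (IncArc.chain h').enters_pos (IncArc.conn h') (IncArc.subL h') hvu
      (IncArc.right_mem h') l2
    rw [enters_vflip, vflip_vflip] at E2
    exact (hT.horiz u ⟨h.subL hu, hui⟩ (-1) isSign_neg_one).1 E2 E1
  rcases hK with h | h <;> rcases hK' with h' | h'
  · exact h1 (hT.incArc_unique h h' ⟨u, ⟨hu, hu'⟩, hui⟩).1
  · exact excl h h' hu hu'
  · exact excl h' h hu' hu
  · exact h1 (hinj (hT.flip.incArc_unique h h' ⟨vflip u, ⟨by rwa [mem_preimage, vflip_vflip],
      by rwa [mem_preimage, vflip_vflip]⟩, flipi u hui⟩).1)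

/-- The pairs of ends of two different arcs do not separate each other on the boundary. -/
theorem TameBox.noncrossing (hT : TameBox L a b c d) {z' w' : ℝ × ℝ}
    (h : ArcJoin L a b c d z w) (h' : ArcJoin L a b c d z' w')
    (hlt : edgePos a b c d z < edgePos a b c d z')
    (hlt' : edgePos a b c d z' < edgePos a b c d w) :
    edgePos a b c d z < edgePos a b c d w' ∧ edgePos a b c d w' < edgePos a b c d w := by
  have n1 : z ≠ z' := by rintro rfl; exact lt_irrefl _ hlt
  have n2 : w ≠ z' := by rintro rfl; exact lt_irrefl _ hlt'
  have n3 : z ≠ w' := by rintro rfl; exact n2 (ArcJoin.eq hT h h'.symm)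
  have n4 : w ≠ w' := by rintro rfl; exact n1 (ArcJoin.eq hT h.symm h'.symm)
  obtain ⟨K', z₁, w₁, hK', hends⟩ : ∃ K' z₁ w₁, (IncArc L a b c d z₁ w₁ K' ∨
      DecArc L a b c d z₁ w₁ K') ∧ (z₁ = z' ∧ w₁ = w' ∨ z₁ = w' ∧ w₁ = z') := by
    rcases h' with ⟨K, h | h⟩ | h
    · exact ⟨K, z', w', Or.inl h, Or.inl ⟨rfl, rfl⟩⟩
    · exact ⟨K, w', z', Or.inl h, Or.inr ⟨rfl, rfl⟩⟩
    · obtain ⟨K, h | h⟩ := h.exists_decArc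
      · exact ⟨K, z', w', Or.inr h, Or.inl ⟨rfl, rfl⟩⟩
      · exact ⟨K, w', z', Or.inr h, Or.inr ⟨rfl, rfl⟩⟩
  have C' := hK'.elim IncArc.crossPath DecArc.crossPath
  have mz : z' ∈ K' := by
    rcases hends with ⟨rfl, rfl⟩ | ⟨rfl, rfl⟩
    · exact C'.left_mem
    · exact C'.right_mem
  have mw : w' ∈ K' := by
    rcases hends with ⟨rfl, rfl⟩ | ⟨rfl, rfl⟩
    · exact C'.right_mem
    · exact C'.left_mem
  have disj : ∀ {K z₀ w₀}, (IncArc L a b c d z₀ w₀ K ∨ DecArc L a b c d z₀ w₀ K) →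
      (z₀ = z ∧ w₀ = w ∨ z₀ = w ∧ w₀ = z) → Disjoint K K' := by
    rintro K z₀ w₀ hK (⟨rfl, rfl⟩ | ⟨rfl, rfl⟩) <;> rcases hends with ⟨rfl, rfl⟩ | ⟨rfl, rfl⟩
    · exact hT.disjoint_of_ends_ne hK hK' n1 n3 n2 n4
    · exact hT.disjoint_of_ends_ne hK hK' n3 n1 n4 n2
    · exact hT.disjoint_of_ends_ne hK hK' n2 n4 n1 n3
    · exact hT.disjoint_of_ends_ne hK hK' n4 n2 n3 n1
  have ez := h'.mem_left.2
  have ew := h'.symm.mem_left.2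
  -- If `w'` were outside the interval of positions, the second arc would have its ends on different
  -- sides of the first one, although it is connected and disjoint from it.
  by_contra hcon
  rcases h with ⟨K, h | h⟩ | h
  · have hzB := h.box h.left_mem
    have hwB := h.box h.right_mem
    have s1 := lowerRight_of_between hzB hwB ez h.lt h.low h.high hlt hlt'
    have s2 := upperLeft_of_not_between hzB hwB ew h.lt h.low hcon
    rcases h.separates C'.conn C'.box (disj (Or.inl h) (Or.inl ⟨rfl, rfl⟩)) with s | s
    · exact s _ mz (s1.elim (fun s => ⟨z, h.left_mem, s⟩) fun s => ⟨w, h.right_mem, s⟩)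
    · exact s _ mw (s2.elim (fun s => ⟨z, h.left_mem, s⟩) fun s => ⟨w, h.right_mem, s⟩)
  · have := h.edgePos_lt hT.hab hT.hcd
    linarith
  · obtain ⟨K, h | h⟩ := h.exists_decArc
    · have hzB := h.subset_box h.left_mem
      have hwB := h.subset_box h.right_mem
      have s1 := lowerLeft_of_between hzB hwB ez h.lt h.low h.high hlt hlt'
      have s2 := upperRight_of_not_between hzB hwB ew h.lt h.high (hlt.trans hlt') hcon
      rcases h.separates C'.conn C'.box (disj (Or.inr h) (Or.inl ⟨rfl, rfl⟩)) with s | s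
      · exact s _ mw (s2.elim (fun s => ⟨z, h.left_mem, s⟩) fun s => ⟨w, h.right_mem, s⟩)
      · exact s _ mz (s1.elim (fun s => ⟨z, h.left_mem, s⟩) fun s => ⟨w, h.right_mem, s⟩)
    · have hzB := h.subset_box h.left_mem
      have hwB := h.subset_box h.right_mem
      have s1 := upperRight_of_between hzB hwB ez h.lt h.low h.high hlt hlt'
      have s2 := lowerLeft_of_not_between hzB hwB ew h.lt h.low h.high (hlt.trans hlt') hcon
      rcases h.separates C'.conn C'.box (disj (Or.inr h) (Or.inr ⟨rfl, rfl⟩)) with s | s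
      · exact s _ mz (s1.elim (fun s => ⟨w, h.left_mem, s⟩) fun s => ⟨z, h.right_mem, s⟩)
      · exact s _ mw (s2.elim (fun s => ⟨w, h.left_mem, s⟩) fun s => ⟨z, h.right_mem, s⟩)

end noncrossing

/-! ### Subcells as tame rectangles, neighbours, and the number of incidences -/

namespace FreeSpace

variable {E : Type*} [NormedAddCommGroup E] [NormedSpace ℝ E] {γ₁ γ₂ : PiecewiseC2 E} {δ : ℝ}

theorem piece_index_unique {γ : PiecewiseC2 E} {i i' : Fin γ.pieces} {x : ℝ}
    (h : x ∈ Ioo (γ.brk i.castSucc) (γ.brk i.succ)) (h' : x ∈ piece γ i') : i' = i := by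
  have a1 : γ.brk i'.castSucc < γ.brk i.succ := h'.1.trans_lt h.2
  have a2 : γ.brk i.castSucc < γ.brk i'.succ := h.1.trans_le h'.2
  rw [γ.brk_strictMono.lt_iff_lt] at a1 a2
  rw [Fin.castSucc_lt_succ_iff] at a1 a2
  exact le_antisymm a1 a2

/-- `E_v` is a union over all cells, while the cuts of a cell use its own extrema only. With the
ordinate inside a piece of `γ₂` there is no difference: the condition along the vertical line is the
same for all cells containing the point. -/
theorem mem_cellEv_of_mem_Ev {i : Fin γ₁.pieces} {j : Fin γ₂.pieces} {z : ℝ × ℝ}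
    (h : z ∈ Ev γ₁ γ₂ δ) (hx : z.1 ∈ piece γ₁ i)
    (hy : z.2 ∈ Ioo (γ₂.brk j.castSucc) (γ₂.brk j.succ)) : z ∈ cellEv γ₁ γ₂ δ i j := by
  obtain ⟨i', j', h⟩ := mem_iUnion₂.1 h
  obtain rfl := piece_index_unique hy h.1.2.2
  exact ⟨⟨h.1.1, hx, Ioo_subset_Icc_self hy⟩, h.2⟩

theorem mem_cellEh_of_mem_Eh {i : Fin γ₁.pieces} {j : Fin γ₂.pieces} {z : ℝ × ℝ}
    (h : z ∈ Eh γ₁ γ₂ δ) (hy : z.2 ∈ piece γ₂ j)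
    (hx : z.1 ∈ Ioo (γ₁.brk i.castSucc) (γ₁.brk i.succ)) : z ∈ cellEh γ₁ γ₂ δ i j := by
  obtain ⟨i', j', h⟩ := mem_iUnion₂.1 h
  obtain rfl := piece_index_unique hx h.1.2.1
  exact ⟨⟨h.1.1, Ioo_subset_Icc_self hx, hy⟩, h.2⟩

theorem xCuts_subset {i : Fin γ₁.pieces} {j : Fin γ₂.pieces} :
    xCuts γ₁ γ₂ δ i j ⊆ piece γ₁ i := by
  have := (brk_lt γ₁ i).le
  rintro x ((rfl | rfl) | ⟨z, hz, rfl⟩)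
  · exact left_mem_Icc.2 this
  · exact right_mem_Icc.2 this
  · exact hz.1.2.1

theorem yCuts_subset {i : Fin γ₁.pieces} {j : Fin γ₂.pieces} :
    yCuts γ₁ γ₂ δ i j ⊆ piece γ₂ j := by
  have := (brk_lt γ₂ j).le
  rintro x ((rfl | rfl) | ⟨z, hz, rfl⟩)
  · exact left_mem_Icc.2 this
  · exact right_mem_Icc.2 this
  · exact hz.1.2.2

theorem Generic.finite_xCuts (hG : Generic γ₁ γ₂ δ) (i : Fin γ₁.pieces) (j : Fin γ₂.pieces) :
    (xCuts γ₁ γ₂ δ i j).Finite :=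
  (toFinite _).union ((hG.finEh.subset fun _ h => mem_iUnion₂.2 ⟨i, j, h⟩).image _)

theorem Generic.finite_yCuts (hG : Generic γ₁ γ₂ δ) (i : Fin γ₁.pieces) (j : Fin γ₂.pieces) :
    (yCuts γ₁ γ₂ δ i j).Finite :=
  (toFinite _).union ((hG.finEv.subset fun _ h => mem_iUnion₂.2 ⟨i, j, h⟩).image _)

/-- An element of a finite set that is not its least element has a predecessor. -/
theorem exists_consecutive_left {T : Set ℝ} (hT : T.Finite) {t c : ℝ} (ht : t ∈ T) (hc : c ∈ T)
    (h : t < c) : ∃ c', Consecutive T c' c := by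
  obtain ⟨m, hm, hmax⟩ := exists_max_image (T ∩ Iio c) id (hT.subset inter_subset_left) ⟨t, ht, h⟩
  exact ⟨m, hm.1, hc, hm.2, fun s hs hs' => (hmax s ⟨hs, hs'.2⟩).not_gt hs'.1⟩

theorem Consecutive.right_unique {T : Set ℝ} {a b b' : ℝ} (h : Consecutive T a b)
    (h' : Consecutive T a b') : b = b' := by
  by_contra hne
  rcases lt_or_gt_of_ne hne with hl | hl
  · exact h'.2.2.2 b h.2.1 ⟨h.2.2.1, hl⟩
  · exact h.2.2.2 b' h'.2.1 ⟨h'.2.2.1, hl⟩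

theorem Consecutive.left_unique {T : Set ℝ} {a a' b : ℝ} (h : Consecutive T a b)
    (h' : Consecutive T a' b) : a = a' := by
  by_contra hne
  rcases lt_or_gt_of_ne hne with hl | hl
  · exact h.2.2.2 a' h'.1 ⟨hl, h'.2.2.1⟩
  · exact h'.2.2.2 a h.1 ⟨hl, h.2.2.1⟩

namespace Subcell

variable {S : Subcell γ₁ γ₂}

/-- The set `B_δ` and a subcell satisfy the assumptions for the existence of arcs. -/
theorem IsSubcell.tameBox (hG : Generic γ₁ γ₂ δ) (hS : S.IsSubcell δ) :
    TameBox (bdry γ₁ γ₂ δ) S.a S.b S.c S.d := by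
  obtain ⟨⟨ha, hb, hab, hx⟩, hc, hd, hcd, hy⟩ := hS
  have pa := xCuts_subset ha
  have pb := xCuts_subset hb
  have pc := yCuts_subset hc
  have pd := yCuts_subset hd
  have box : ∀ z : ℝ × ℝ, z.1 ∈ Icc S.a S.b → z.2 ∈ Icc S.c S.d → z ∈ cell γ₁ γ₂ S.i S.j :=
    fun z h1 h2 => ⟨⟨pa.1.trans h1.1, h1.2.trans pb.2⟩, ⟨pc.1.trans h2.1, h2.2.trans pd.2⟩⟩
  refine ⟨hab, hcd, isClosed_bdry _ _ _, ?_, ?_, ?_, ?_⟩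
  · intro z hz h1 h2 σ hσ hr hl
    have hc := box z h1 (Ioo_subset_Icc_self h2)
    have h2' : z.2 ∈ Ioo (γ₂.brk S.j.castSucc) (γ₂.brk S.j.succ) :=
      ⟨pc.1.trans_lt h2.1, h2.2.trans_le pd.2⟩
    refine (hG.acc_vertical hz hc.1 h2' hσ (fun h => (hr h).trans_le pb.2)
      fun h => pa.1.trans_lt (hl h)).2 fun hev => ?_
    -- An extremum here would put its ordinate among the cuts, strictly between two consecutive
    -- ones.
    exact hy z.2 (Or.inr ⟨z, mem_cellEv_of_mem_Ev hev hc.1 h2', rfl⟩) h2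
  · intro z hz h1 h2 τ hτ ht hb'
    have hc := box z (Ioo_subset_Icc_self h1) h2
    have h1' : z.1 ∈ Ioo (γ₁.brk S.i.castSucc) (γ₁.brk S.i.succ) :=
      ⟨pa.1.trans_lt h1.1, h1.2.trans_le pb.2⟩
    refine (hG.acc_horizontal hz hc.2 h1' hτ (fun h => (ht h).trans_le pd.2)
      fun h => pc.1.trans_lt (hb' h)).2 fun heh => ?_
    exact hx z.1 (Or.inr ⟨z, mem_cellEh_of_mem_Eh heh hc.2 h1', rfl⟩) h1
  · rintro z ⟨hz, h1, h2⟩ σ hσ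
    have hc := box z (Ioo_subset_Icc_self h1) (Ioo_subset_Icc_self h2)
    exact (hG.branch_of_acc hz hc hσ hσ (fun _ => h1.2.trans_le pb.2) (fun _ => pa.1.trans_lt h1.1)
      (fun _ => h2.2.trans_le pd.2) fun _ => pc.1.trans_lt h2.1).2
  · rintro z ⟨hz, h1, h2⟩ σ τ hσ hτ hr hl ht hb'
    exact (hG.branch_of_acc hz (box z h1 h2) hσ hτ (fun h => (hr h).trans_le pb.2)
      (fun h => pa.1.trans_lt (hl h)) (fun h => (ht h).trans_le pd.2)
      fun h => pc.1.trans_lt (hb' h)).1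

theorem marked_eq (hab : S.a ≤ S.b) (hcd : S.c ≤ S.d) :
    S.marked δ = bdry γ₁ γ₂ δ ∩ boxEdge S.a S.b S.c S.d := by
  ext z
  simp only [marked, bottom, top, left, right, boxEdge, mem_inter_iff, mem_union, mem_ofPred_eq,
    mem_prod, mem_Icc]
  grind

theorem IsSubcell.joined_iff (hG : Generic γ₁ γ₂ δ) (hS : S.IsSubcell δ) {z w : ℝ × ℝ} :
    Joined δ S z w ↔ ArcJoin (bdry γ₁ γ₂ δ) S.a S.b S.c S.d z w := by
  have hT := hS.tameBox hG
  unfold Joined ArcJoin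
  rw [marked_eq hT.hab.le hT.hcd.le]
  constructor
  · rintro ⟨hz, hw, h⟩
    exact h.imp (hT.increasingArc_iff hz hw).1 (hT.decreasingArc_iff hz hw).1
  · intro h
    have hz := ArcJoin.mem_left h
    have hw := (ArcJoin.symm h).mem_left
    exact ⟨hz, hw, h.imp (hT.increasingArc_iff hz hw).2 (hT.decreasingArc_iff hz hw).2⟩

theorem IsSubcell.slopeCode_iff (hG : Generic γ₁ γ₂ δ) (hS : S.IsSubcell δ) {z : ℝ × ℝ}
    (hz : z ∈ S.marked δ) {v : ℕ} :
    SlopeCode δ S z v ↔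
      (v = 1 ∧ ∃ w, IncJoin (bdry γ₁ γ₂ δ) S.a S.b S.c S.d z w) ∨
      (v = 2 ∧ ∃ w, DecJoin (bdry γ₁ γ₂ δ) S.a S.b S.c S.d z w) ∨
      (v = 0 ∧ ¬ (∃ w, IncJoin (bdry γ₁ γ₂ δ) S.a S.b S.c S.d z w) ∧
        ¬ ∃ w, DecJoin (bdry γ₁ γ₂ δ) S.a S.b S.c S.d z w) := by
  have hT := hS.tameBox hG
  rw [marked_eq hT.hab.le hT.hcd.le] at hz
  unfold SlopeCode
  simp only [inner]
  rw [hT.exists_increasingArc_iff hz, hT.exists_decreasingArc_iff hz]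

/-- A subcell not on the lower edge of its cell has a neighbour below. -/
theorem IsSubcell.exists_below (hG : Generic γ₁ γ₂ δ) (hS : S.IsSubcell δ)
    (h : S.c ≠ γ₂.brk S.j.castSucc) :
    ∃ c', IsSubcell (δ := δ) (⟨S.i, S.j, S.a, S.b, c', S.c⟩ : Subcell γ₁ γ₂) := by
  obtain ⟨c', hc'⟩ := exists_consecutive_left (hG.finite_yCuts S.i S.j)
    (t := γ₂.brk S.j.castSucc) (Or.inl (Or.inl rfl)) hS.2.1
    (lt_of_le_of_ne (yCuts_subset hS.2.1).1 h.symm)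
  exact ⟨c', hS.1, hc'⟩

/-- A subcell not on the left edge of its cell has a left neighbour. -/
theorem IsSubcell.exists_leftOf (hG : Generic γ₁ γ₂ δ) (hS : S.IsSubcell δ)
    (h : S.a ≠ γ₁.brk S.i.castSucc) :
    ∃ a', IsSubcell (δ := δ) (⟨S.i, S.j, a', S.a, S.c, S.d⟩ : Subcell γ₁ γ₂) := by
  obtain ⟨a', ha'⟩ := exists_consecutive_left (hG.finite_xCuts S.i S.j)
    (t := γ₁.brk S.i.castSucc) (Or.inl (Or.inl rfl)) hS.1.1
    (lt_of_le_of_ne (xCuts_subset hS.1.1).1 h.symm)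
  exact ⟨a', ha', hS.2⟩

theorem Before.asymm {S' : Subcell γ₁ γ₂} (h : Before S S') : ¬ Before S' S := by
  unfold Before at *
  intro h'
  rcases h with h | ⟨h, h1⟩ <;> rcases h' with h' | ⟨h', h1'⟩
  · exact lt_asymm h h'
  · exact h.ne' h'
  · exact h'.ne' h
  · rcases h1 with h1 | ⟨h1, h2⟩ <;> rcases h1' with h1' | ⟨h1', h2'⟩
    · exact lt_asymm h1 h1'
    · exact h1.ne' h1'
    · exact h1'.ne' h1
    · rcases h2 with h2 | ⟨h2, h3⟩ <;> rcases h2' with h2' | ⟨h2', h3'⟩ <;> linarith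

/-- On the lower edge of a subcell, the branches into the subcell are determined by the branches
below and the membership in `E_v`. -/
theorem IsSubcell.enters_up_iff (hG : Generic γ₁ γ₂ δ) (hS : S.IsSubcell δ)
    (h : S.c ≠ γ₂.brk S.j.castSucc) {z : ℝ × ℝ} (hz : z ∈ bdry γ₁ γ₂ δ) (hx : z.1 ∈ Icc S.a S.b)
    (hy : z.2 = S.c) {σ : ℝ} (hσ : IsSign σ) (hr : σ = 1 → z.1 < S.b) (hl : σ = -1 → S.a < z.1) :
    Enters (bdry γ₁ γ₂ δ) z σ 1 ↔ (Enters (bdry γ₁ γ₂ δ) z σ (-1) ↔ z ∈ Ev γ₁ γ₂ δ) := by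
  have pa := xCuts_subset hS.1.1
  have pb := xCuts_subset hS.1.2.1
  have pc := yCuts_subset hS.2.1
  have pd := yCuts_subset hS.2.2.1
  have := hG.acc_vertical (i := S.i) (j := S.j) hz ⟨pa.1.trans hx.1, hx.2.trans pb.2⟩
    ⟨hy ▸ lt_of_le_of_ne pc.1 h.symm, hy ▸ hS.2.2.2.1.trans_le pd.2⟩ hσ
    (fun h => (hr h).trans_le pb.2) fun h => pa.1.trans_lt (hl h)
  tauto

theorem IsSubcell.enters_right_iff (hG : Generic γ₁ γ₂ δ) (hS : S.IsSubcell δ)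
    (h : S.a ≠ γ₁.brk S.i.castSucc) {z : ℝ × ℝ} (hz : z ∈ bdry γ₁ γ₂ δ) (hy : z.2 ∈ Icc S.c S.d)
    (hx : z.1 = S.a) {τ : ℝ} (hτ : IsSign τ) (ht : τ = 1 → z.2 < S.d) (hb : τ = -1 → S.c < z.2) :
    Enters (bdry γ₁ γ₂ δ) z 1 τ ↔ (Enters (bdry γ₁ γ₂ δ) z (-1) τ ↔ z ∈ Eh γ₁ γ₂ δ) := by
  have pa := xCuts_subset hS.1.1
  have pb := xCuts_subset hS.1.2.1
  have pc := yCuts_subset hS.2.1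
  have pd := yCuts_subset hS.2.2.1
  have := hG.acc_horizontal (i := S.i) (j := S.j) hz ⟨pc.1.trans hy.1, hy.2.trans pd.2⟩
    ⟨hx ▸ lt_of_le_of_ne pa.1 h.symm, hx ▸ hS.1.2.2.1.trans_le pb.2⟩ hτ
    (fun h => (ht h).trans_le pd.2) fun h => pc.1.trans_lt (hb h)
  tauto

end Subcell

theorem Consecutive.lt_or_le {T : Set ℝ} {a b t : ℝ} (h : Consecutive T a b) (ht : t ∈ T) :
    t ≤ a ∨ b ≤ t := by
  by_contra hc
  push Not at hc
  exact h.2.2.2 t ht hc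

/-- At most one piece contains a given point in an interval that extends to the right of it, and at
most one contains it as the right end of an interval. -/
theorem index_le_of_mem {γ : PiecewiseC2 E} {i i' : Fin γ.pieces} {a b a' b' x : ℝ}
    (ha : a ∈ piece γ i) (hab : a < b) (hb' : b' ∈ piece γ i') (hx : x ∈ Icc a b)
    (hx' : x ∈ Icc a' b') (h : x < b ↔ x < b') : i ≤ i' := by
  have : γ.brk i.castSucc < γ.brk i'.succ := by
    rcases lt_or_ge x b with h1 | h1
    · exact (ha.1.trans hx.1).trans_lt ((h.1 h1).trans_le hb'.2)
    · exact (ha.1.trans_lt (hab.trans_le h1)).trans_le (hx'.2.trans hb'.2)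
  rwa [γ.brk_strictMono.lt_iff_lt, Fin.castSucc_lt_succ_iff] at this

theorem index_eq_of_mem {γ : PiecewiseC2 E} {i i' : Fin γ.pieces} {a b a' b' x : ℝ}
    (ha : a ∈ piece γ i) (hb : b ∈ piece γ i) (hab : a < b) (ha' : a' ∈ piece γ i')
    (hb' : b' ∈ piece γ i') (hab' : a' < b') (hx : x ∈ Icc a b) (hx' : x ∈ Icc a' b')
    (h : x < b ↔ x < b') : i = i' :=
  le_antisymm (index_le_of_mem ha hab hb' hx hx' h) (index_le_of_mem ha' hab' hb hx' hx h.symm)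

theorem Consecutive.eq_of_mem {T : Set ℝ} {a b a' b' x : ℝ} (h : Consecutive T a b)
    (h' : Consecutive T a' b') (hx : x ∈ Icc a b) (hx' : x ∈ Icc a' b') (hb : x < b ↔ x < b') :
    a = a' ∧ b = b' := by
  rcases lt_or_ge x b with h1 | h1
  · have h2 := hb.1 h1
    have e1 : a ≤ a' := (h'.lt_or_le h.1).resolve_right fun h3 => by linarith [hx.1]
    have e2 : a' ≤ a := (h.lt_or_le h'.1).resolve_right fun h3 => by linarith [hx'.1]
    obtain rfl := le_antisymm e1 e2
    exact ⟨rfl, h.right_unique h'⟩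
  · have h2 : b' ≤ x := not_lt.1 fun h3 => (hb.2 h3).not_ge h1
    obtain rfl : b = b' := by linarith [hx.2, hx'.2]
    exact ⟨h.left_unique h', rfl⟩

namespace Subcell

variable {S S' : Subcell γ₁ γ₂}

/-- A point of a closed subcell and the two answers whether it lies on the right and on the upper
edge determine the subcell: they tell on which side of the point the intervals extend. This is the
source of the bound four. -/
theorem IsSubcell.eq_of_mem (hS : S.IsSubcell δ) (hS' : S'.IsSubcell δ) {z : ℝ × ℝ}
    (h1 : z.1 ∈ Icc S.a S.b) (h2 : z.2 ∈ Icc S.c S.d) (h1' : z.1 ∈ Icc S'.a S'.b)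
    (h2' : z.2 ∈ Icc S'.c S'.d) (hb : z.1 < S.b ↔ z.1 < S'.b) (hd : z.2 < S.d ↔ z.2 < S'.d) :
    S = S' := by
  have ei := index_eq_of_mem (xCuts_subset hS.1.1) (xCuts_subset hS.1.2.1) hS.1.2.2.1
    (xCuts_subset hS'.1.1) (xCuts_subset hS'.1.2.1) hS'.1.2.2.1 h1 h1' hb
  have ej := index_eq_of_mem (yCuts_subset hS.2.1) (yCuts_subset hS.2.2.1) hS.2.2.2.1
    (yCuts_subset hS'.2.1) (yCuts_subset hS'.2.2.1) hS'.2.2.2.1 h2 h2' hd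
  have hx := hS'.1
  have hy := hS'.2
  rw [← ei, ← ej] at hx hy
  obtain ⟨ea, eb⟩ := hS.1.eq_of_mem hx h1 h1' hb
  obtain ⟨ec, ed⟩ := hS.2.eq_of_mem hy h2 h2' hd
  exact Subcell.ext ei ej ea eb ec ed

/-- A point lies in at most four subcells. -/
theorem card_filter_mem_le (F : Finset (Subcell γ₁ γ₂)) (hF : ∀ S ∈ F, S.IsSubcell δ)
    (z : ℝ × ℝ) (P : Subcell γ₁ γ₂ → Prop) [DecidablePred P]
    (hP : ∀ S ∈ F, P S → z.1 ∈ Icc S.a S.b ∧ z.2 ∈ Icc S.c S.d) : (F.filter P).card ≤ 4 := by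
  classical
  have : (F.filter P).card ≤ (Finset.univ : Finset (Bool × Bool)).card := by
    refine Finset.card_le_card_of_injOn (fun S => (decide (z.1 < S.b), decide (z.2 < S.d)))
      (fun _ _ => Finset.mem_coe.2 (Finset.mem_univ _)) ?_
    intro S hS S' hS' h
    rw [Finset.mem_coe, Finset.mem_filter] at hS hS'
    simp only [Prod.mk.injEq, decide_eq_decide] at h
    obtain ⟨a1, a2⟩ := hP S hS.1 hS.2
    obtain ⟨b1, b2⟩ := hP S' hS'.1 hS'.2
    exact (hF S hS.1).eq_of_mem (hF S' hS'.1) a1 a2 b1 b2 h.1 h.2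
  simpa using this

end Subcell

theorem Lists.nodup {pts : ℕ → ℝ × ℝ} {size : ℕ} {A : Set (ℝ × ℝ)} {coord : ℝ × ℝ → ℝ} {l : List ℕ}
    (h : Lists pts size A coord l) : l.Nodup :=
  h.1.imp fun h => by rintro rfl; exact lt_irrefl _ h

theorem marked_bounds {S : Subcell γ₁ γ₂} (hab : S.a ≤ S.b) (hcd : S.c ≤ S.d) {z : ℝ × ℝ}
    (hz : z ∈ S.marked δ) : z.1 ∈ Icc S.a S.b ∧ z.2 ∈ Icc S.c S.d := by
  rw [Subcell.marked_eq hab hcd] at hz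
  exact hz.2.1

/-- The total length of the input records is linear in the number of marked points. -/
theorem IsInput.sum_length_le {pts : ℕ → ℝ × ℝ} {subs : List (Subcell γ₁ γ₂)} {D : InputData}
    (h : IsInput δ pts subs D) :
    (D.subcells.map fun R =>
      1 + R.bottom.length + R.left.length + R.top.length + R.right.length).sum ≤ 20 * D.size := by
  classical
  obtain ⟨hbij, -, hsubs, hord, hrec⟩ := h
  have hnodup : subs.Nodup := hord.imp fun h => by rintro rfl; exact h.asymm h
  set c : Subcell γ₁ γ₂ → ℕ := fun S =>
    ((Finset.range D.size).filter fun k => pts k ∈ S.marked δ).card with hc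
  -- Each of the four lists has at most `c S` entries, and the extra `1` is paid for by the
  -- nonemptiness of the set of marked points; hence the factor five.
  have hle : ∀ {R S}, RecordOf δ pts D.size R S → S.IsSubcell δ ∧ (S.marked δ).Nonempty →
      1 + R.bottom.length + R.left.length + R.top.length + R.right.length ≤ 5 * c S := by
    intro R S hR hS
    have aux : ∀ {l : List ℕ} {A coord}, Lists pts D.size (bdry γ₁ γ₂ δ ∩ A) coord l →
        A ⊆ S.bottom ∪ S.top ∪ S.left ∪ S.right → l.length ≤ c S := by
      intro l A coord hl hA
      rw [hc, ← List.toFinset_card_of_nodup hl.nodup]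
      refine Finset.card_le_card fun k hk => ?_
      rw [List.mem_toFinset, hl.2] at hk
      exact Finset.mem_filter.2 ⟨Finset.mem_range.2 hk.1, hk.2.1, hA hk.2.2⟩
    have h1 := aux hR.1 fun z hz => Or.inl (Or.inl (Or.inl hz))
    have h2 := aux hR.2.1 fun z hz => Or.inl (Or.inr hz)
    have h3 := aux hR.2.2.1 fun z hz => Or.inl (Or.inl (Or.inr hz))
    have h4 := aux hR.2.2.2.1 fun z hz => Or.inr hz
    have h5 : 0 < c S := by
      obtain ⟨z, hz⟩ := hS.2
      obtain ⟨k, hk, rfl⟩ := hbij.surjOn ⟨S, hS.1, hz⟩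
      exact Finset.card_pos.2 ⟨k, Finset.mem_filter.2 ⟨Finset.mem_range.2 hk, hz⟩⟩
    omega
  have hsum : ∀ {Rs : List SubcellRecord} {Ss : List (Subcell γ₁ γ₂)},
      List.Forall₂ (RecordOf δ pts D.size) Rs Ss →
      (∀ S ∈ Ss, S.IsSubcell δ ∧ (S.marked δ).Nonempty) →
      (Rs.map fun R => 1 + R.bottom.length + R.left.length + R.top.length + R.right.length).sum ≤
        (Ss.map fun S => 5 * c S).sum := by
    intro Rs Ss hf hS
    induction hf with
    | nil => simp
    | cons h _ ih =>
      rw [List.map_cons, List.sum_cons, List.map_cons, List.sum_cons]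
      exact add_le_add (hle h (hS _ List.mem_cons_self))
        (ih fun S h => hS S (List.mem_cons_of_mem _ h))
  refine (hsum hrec fun S h => (hsubs S).1 h).trans ?_
  rw [← List.sum_toFinset _ hnodup, ← Finset.mul_sum]
  -- Double counting of incidences: every point lies in at most four subcells. Together with the
  -- factor five this gives `20`.
  have hcount : ∑ S ∈ subs.toFinset, c S ≤ 4 * D.size := by
    rw [hc]
    have := Finset.sum_card_bipartiteAbove_eq_sum_card_bipartiteBelow
      (s := subs.toFinset) (t := Finset.range D.size) fun S k => pts k ∈ S.marked δ
    simp only [Finset.bipartiteAbove, Finset.bipartiteBelow] at this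
    rw [this]
    refine (Finset.sum_le_card_nsmul _ _ 4 fun k _ => ?_).trans (by simp [mul_comm])
    refine Subcell.card_filter_mem_le (δ := δ) _
      (fun S hS => ((hsubs S).1 (List.mem_toFinset.1 hS)).1) (pts k) _ fun S hS hk => ?_
    have hS' := ((hsubs S).1 (List.mem_toFinset.1 hS)).1
    exact marked_bounds hS'.1.2.2.1.le hS'.2.2.2.1.le hk
  omega

end FreeSpace

/-! ### The combinatorial pattern of a record and the information passed between subcells -/

namespace FreeSpace

/-- The numbers of the points on the four edges of a rectangle, together with the pairs joined by
increasing and by decreasing arcs. The value of `pos` is the position on the boundary, in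
counterclockwise order from the upper left corner. -/
structure BoxPattern (B L T R : List ℕ) (I D : ℕ → ℕ → Prop) (pos : ℕ → ℝ) : Prop where
  order : (L.reverse ++ (B.filter (· ∉ L) ++ (R.filter (· ∉ B) ++
    (T.filter fun z => z ∉ L ∧ z ∉ R).reverse))).Pairwise fun x y => pos x < pos y
  nodup_top : T.Nodup
  nodup_right : R.Nodup
  corner_BL : ∀ z, z ∈ B → z ∈ L → (∃ l, B = z :: l) ∧ ∃ l, L = z :: l
  corner_BR : ∀ z, z ∈ B → z ∈ R → (∃ l, B = l ++ [z]) ∧ ∃ l, R = z :: l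
  corner_TL : ∀ z, z ∈ T → z ∈ L → (∃ l, T = z :: l) ∧ ∃ l, L = l ++ [z]
  corner_TR : ∀ z, z ∈ T → z ∈ R → (∃ l, T = l ++ [z]) ∧ ∃ l, R = l ++ [z]
  disjoint_LR : ∀ z, z ∈ L → z ∉ R
  disjoint_BT : ∀ z, z ∈ B → z ∉ T
  inc_symm : ∀ x y, I x y → I y x
  dec_symm : ∀ x y, D x y → D y x
  unique : ∀ x y y', I x y ∨ D x y → I x y' ∨ D x y' → y = y'
  not_both : ∀ x y y', I x y → ¬ D x y'
  inc_ends : ∀ x y, I x y → ((x ∈ L ∨ x ∈ B) ∧ x ∉ T ∧ x ∉ R ∧ (y ∈ T ∨ y ∈ R) ∧ y ∉ L ∧ y ∉ B) ∨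
    ((y ∈ L ∨ y ∈ B) ∧ y ∉ T ∧ y ∉ R ∧ (x ∈ T ∨ x ∈ R) ∧ x ∉ L ∧ x ∉ B)
  dec_ends : ∀ x y, D x y → ((x ∈ L ∨ x ∈ T) ∧ x ∉ B ∧ x ∉ R ∧ (y ∈ B ∨ y ∈ R) ∧ y ∉ L ∧ y ∉ T) ∨
    ((y ∈ L ∨ y ∈ T) ∧ y ∉ B ∧ y ∉ R ∧ (x ∈ B ∨ x ∈ R) ∧ x ∉ L ∧ x ∉ T)
  exists_join : ∀ x, x ∈ L ∨ x ∈ B ∨ x ∈ T ∨ x ∈ R → (x ∈ L → x ∉ B ∧ x ∉ T) →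
    (x ∈ R → x ∉ B ∧ x ∉ T) → (∃ y, I x y) ∨ ∃ y, D x y
  noncrossing : ∀ x y x' y', I x y ∨ D x y → I x' y' ∨ D x' y' → pos x < pos x' → pos x' < pos y →
    pos x < pos y' ∧ pos y' < pos y

/-- The slope information in terms of the pairs of joined points. -/
def JoinCode (I D : ℕ → ℕ → Prop) (z v : ℕ) : Prop :=
  (v = 1 ∧ ∃ w, I z w) ∨ (v = 2 ∧ ∃ w, D z w) ∨ (v = 0 ∧ ¬ (∃ w, I z w) ∧ ¬ ∃ w, D z w)

/-- The quadrants in which the slopes at the points of the upper and right edges give information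
for the neighbouring subcells: `0` and `1` stand for the lower right and lower left quadrant, used
by the subcells above, and `2` and `3` stand for the upper left and lower left quadrant, used by the
subcells to the right. -/
def SubcellRecord.Writes (R : SubcellRecord) (κ z : ℕ) : Prop :=
  (κ = 0 ∧ z ∈ R.top ∧ z ∉ R.right) ∨ (κ = 1 ∧ z ∈ R.top ∧ z ∉ R.left) ∨
    (κ = 2 ∧ z ∈ R.right ∧ z ∉ R.top) ∨ (κ = 3 ∧ z ∈ R.right ∧ z ∉ R.bottom)

/-- The properties of the record of a subcell that are used by the algorithm. The predicates `eh`
and `ev` tell which points are extrema, `val κ z` is the information passed on between subcells at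
the point `z`, and `avail κ z` means that it is known from the previous subcells. -/
structure RecordSpec (R : SubcellRecord) (I D : ℕ → ℕ → Prop) (pos : ℕ → ℝ) (eh ev : ℕ → Prop)
    (val : ℕ → ℕ → Prop) (avail : ℕ → ℕ → Prop) : Prop
    extends BoxPattern R.bottom R.left R.top R.right I D pos where
  write0 : ∀ z, z ∈ R.top → z ∉ R.right → (val 0 z ↔ ((∃ w, D z w) ↔ ev z))
  write1 : ∀ z, z ∈ R.top → z ∉ R.left → (val 1 z ↔ ((∃ w, I z w) ↔ ev z))
  write2 : ∀ z, z ∈ R.right → z ∉ R.top → (val 2 z ↔ ((∃ w, D z w) ↔ eh z))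
  write3 : ∀ z, z ∈ R.right → z ∉ R.bottom → (val 3 z ↔ ((∃ w, I z w) ↔ eh z))
  read0 : R.onBottom = false → ∀ z, z ∈ R.bottom → z ∉ R.right →
    avail 0 z ∧ ((∃ w, I z w) ↔ val 0 z)
  read1 : R.onBottom = false → ∀ z, z ∈ R.bottom → z ∉ R.left →
    avail 1 z ∧ ((∃ w, D z w) ↔ val 1 z)
  read2 : R.onLeft = false → ∀ z, z ∈ R.left → z ∉ R.top → avail 2 z ∧ ((∃ w, I z w) ↔ val 2 z)
  read3 : R.onLeft = false → ∀ z, z ∈ R.left → z ∉ R.bottom → avail 3 z ∧ ((∃ w, D z w) ↔ val 3 z)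
  bottomSlope : if R.onBottom = true then List.Forall₂ (JoinCode I D) R.bottom R.bottomSlope
    else R.bottomSlope = []
  leftSlope : if R.onLeft = true then List.Forall₂ (JoinCode I D) R.left R.leftSlope
    else R.leftSlope = []

section

variable {pts : ℕ → ℝ × ℝ} {size : ℕ} {A : Set (ℝ × ℝ)} {coord : ℝ × ℝ → ℝ} {l : List ℕ}

/-- A corner of the subcell has extreme coordinate along an edge, so it can only be the first or the
last entry of the list of that edge. -/
theorem Lists.head_of_le (h : Lists pts size A coord l) {z : ℕ} (hz : z ∈ l)
    (hle : ∀ u ∈ A, coord (pts z) ≤ coord u) : ∃ l', l = z :: l' := by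
  cases l with
  | nil => simp at hz
  | cons x l' =>
    rcases List.mem_cons.1 hz with rfl | hz
    · exact ⟨l', rfl⟩
    · have h1 := List.rel_of_pairwise_cons h.1 hz
      have h2 := hle _ ((h.2 x).1 List.mem_cons_self).2
      exact absurd h1 h2.not_gt

theorem Lists.last_of_le (h : Lists pts size A coord l) {z : ℕ} (hz : z ∈ l)
    (hle : ∀ u ∈ A, coord u ≤ coord (pts z)) : ∃ l', l = l' ++ [z] := by
  rcases List.eq_nil_or_concat l with rfl | ⟨l', x, rfl⟩
  · simp at hz
  · rw [List.concat_eq_append] at *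
    rcases List.mem_append.1 hz with hz | hz
    · have h1 := (List.pairwise_append.1 h.1).2.2 z hz x (by simp)
      have h2 := hle _ ((h.2 x).1 (by simp)).2
      exact absurd h1 h2.not_gt
    · rw [List.mem_singleton.1 hz]; exact ⟨l', rfl⟩

end

variable {E : Type*} [NormedAddCommGroup E] [NormedSpace ℝ E] {γ₁ γ₂ : PiecewiseC2 E} {δ : ℝ}

/-- The pairs of marked points joined by an increasing arc in the subcell `S`. -/
def incPairs (δ : ℝ) (pts : ℕ → ℝ × ℝ) (size : ℕ) (S : Subcell γ₁ γ₂) (x y : ℕ) : Prop :=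
  x < size ∧ y < size ∧ IncJoin (bdry γ₁ γ₂ δ) S.a S.b S.c S.d (pts x) (pts y)

/-- The pairs of marked points joined by a decreasing arc in the subcell `S`. -/
def decPairs (δ : ℝ) (pts : ℕ → ℝ × ℝ) (size : ℕ) (S : Subcell γ₁ γ₂) (x y : ℕ) : Prop :=
  x < size ∧ y < size ∧ DecJoin (bdry γ₁ γ₂ δ) S.a S.b S.c S.d (pts x) (pts y)

theorem incJoin_ends {L : Set (ℝ × ℝ)} {a b c d : ℝ} {z w : ℝ × ℝ} (h : IncJoin L a b c d z w) :
    (z.1 < w.1 ∧ z.2 < w.2 ∧ (z.1 = a ∨ z.2 = c) ∧ (w.1 = b ∨ w.2 = d)) ∨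
    (w.1 < z.1 ∧ w.2 < z.2 ∧ (w.1 = a ∨ w.2 = c) ∧ (z.1 = b ∨ z.2 = d)) := by
  obtain ⟨K, h | h⟩ := h
  · exact Or.inl ⟨h.lt.1, h.lt.2, h.low, h.high⟩
  · exact Or.inr ⟨h.lt.1, h.lt.2, h.low, h.high⟩

theorem decJoin_ends {L : Set (ℝ × ℝ)} {a b c d : ℝ} {z w : ℝ × ℝ} (h : DecJoin L a b c d z w) :
    (z.1 < w.1 ∧ w.2 < z.2 ∧ (z.1 = a ∨ z.2 = d) ∧ (w.1 = b ∨ w.2 = c)) ∨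
    (w.1 < z.1 ∧ z.2 < w.2 ∧ (w.1 = a ∨ w.2 = d) ∧ (z.1 = b ∨ z.2 = c)) := by
  obtain ⟨K, h | h⟩ := h.exists_decArc
  · exact Or.inl ⟨h.lt.1, h.lt.2, h.low, h.high⟩
  · exact Or.inr ⟨h.lt.1, h.lt.2, h.low, h.high⟩

/-- The marked points of a subcell and the arcs between them have the pattern used by the
algorithm. -/
theorem RecordOf.boxPattern (hG : Generic γ₁ γ₂ δ) {pts : ℕ → ℝ × ℝ} {size : ℕ}
    (hpts : BijOn pts (Iio size) (marked γ₁ γ₂ δ)) {R : SubcellRecord} {S : Subcell γ₁ γ₂}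
    (hS : S.IsSubcell δ) (hR : RecordOf δ pts size R S) :
    BoxPattern R.bottom R.left R.top R.right (incPairs δ pts size S) (decPairs δ pts size S)
      fun z => edgePos S.a S.b S.c S.d (pts z) := by
  have hT := hS.tameBox hG
  have hab := hT.hab
  have hcd := hT.hcd
  obtain ⟨hB, hL, hTp, hRt, -⟩ := hR
  have mB : ∀ z, z ∈ R.bottom ↔ z < size ∧ pts z ∈ bdry γ₁ γ₂ δ ∧
    ((pts z).1 ∈ Icc S.a S.b ∧ (pts z).2 = S.c) := hB.2
  have mL : ∀ z, z ∈ R.left ↔ z < size ∧ pts z ∈ bdry γ₁ γ₂ δ ∧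
    ((pts z).1 = S.a ∧ (pts z).2 ∈ Icc S.c S.d) := hL.2
  have mT : ∀ z, z ∈ R.top ↔ z < size ∧ pts z ∈ bdry γ₁ γ₂ δ ∧
    ((pts z).1 ∈ Icc S.a S.b ∧ (pts z).2 = S.d) := hTp.2
  have mR : ∀ z, z ∈ R.right ↔ z < size ∧ pts z ∈ bdry γ₁ γ₂ δ ∧
    ((pts z).1 = S.b ∧ (pts z).2 ∈ Icc S.c S.d) := hRt.2
  have hidx : ∀ w, w ∈ bdry γ₁ γ₂ δ ∧ w ∈ boxEdge S.a S.b S.c S.d → ∃ y < size, pts y = w := by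
    intro w hw
    obtain ⟨y, hy, rfl⟩ := hpts.surjOn ⟨S, hS, by rwa [Subcell.marked_eq hab.le hcd.le]⟩
    exact ⟨y, hy, rfl⟩
  refine ⟨?_, hTp.nodup, hRt.nodup, ?_, ?_, ?_, ?_, ?_, ?_, ?_, ?_, ?_, ?_, ?_, ?_, ?_, ?_⟩
  · have pL : ∀ z ∈ R.left, edgePos S.a S.b S.c S.d (pts z) = S.d - (pts z).2 ∧
        (pts z).2 ∈ Icc S.c S.d := by
      intro z hz
      have := (mL z).1 hz
      exact ⟨by rw [edgePos, if_pos this.2.2.1], this.2.2.2⟩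
    have pB : ∀ z ∈ R.bottom, z ∉ R.left → edgePos S.a S.b S.c S.d (pts z) =
        (S.d - S.c) + ((pts z).1 - S.a) ∧ (pts z).1 ∈ Ioc S.a S.b := by
      intro z hz hz'
      have h1 := (mB z).1 hz
      rw [mL] at hz'
      have h2 : (pts z).1 ≠ S.a := fun h => hz' ⟨h1.1, h1.2.1, h, by
        rw [h1.2.2.2]; exact left_mem_Icc.2 hcd.le⟩
      exact ⟨by rw [edgePos, if_neg h2, if_pos h1.2.2.2], lt_of_le_of_ne h1.2.2.1.1 h2.symm,
        h1.2.2.1.2⟩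
    have pR : ∀ z ∈ R.right, z ∉ R.bottom → edgePos S.a S.b S.c S.d (pts z) =
        (S.d - S.c) + (S.b - S.a) + ((pts z).2 - S.c) ∧ (pts z).2 ∈ Ioc S.c S.d := by
      intro z hz hz'
      have h1 := (mR z).1 hz
      rw [mB] at hz'
      have h2 : (pts z).2 ≠ S.c := fun h => hz' ⟨h1.1, h1.2.1, by
        rw [h1.2.2.1]; exact right_mem_Icc.2 hab.le, h⟩
      exact ⟨by rw [edgePos, if_neg (by rw [h1.2.2.1]; exact hab.ne'), if_neg h2,
        if_pos h1.2.2.1], lt_of_le_of_ne h1.2.2.2.1 h2.symm, h1.2.2.2.2⟩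
    have pT : ∀ z ∈ R.top, z ∉ R.left → z ∉ R.right → edgePos S.a S.b S.c S.d (pts z) =
        (S.d - S.c) + (S.b - S.a) + (S.d - S.c) + (S.b - (pts z).1) ∧ (pts z).1 < S.b := by
      intro z hz hz' hz''
      have h1 := (mT z).1 hz
      rw [mL] at hz'
      rw [mR] at hz''
      have h2 : (pts z).1 ≠ S.a := fun h => hz' ⟨h1.1, h1.2.1, h, by
        rw [h1.2.2.2]; exact right_mem_Icc.2 hcd.le⟩
      have h3 : (pts z).1 ≠ S.b := fun h => hz'' ⟨h1.1, h1.2.1, h, by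
        rw [h1.2.2.2]; exact right_mem_Icc.2 hcd.le⟩
      exact ⟨by rw [edgePos, if_neg h2, if_neg (by rw [h1.2.2.2]; exact hcd.ne'), if_neg h3],
        lt_of_le_of_ne h1.2.2.1.2 h3⟩
    rw [List.pairwise_append, List.pairwise_append, List.pairwise_append, List.pairwise_reverse,
      List.pairwise_reverse]
    refine ⟨hL.1.imp_of_mem ?_, ⟨(hB.1.filter _).imp_of_mem ?_, ⟨(hRt.1.filter _).imp_of_mem ?_,
      (hTp.1.filter _).imp_of_mem ?_, ?_⟩, ?_⟩, ?_⟩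
    · intro x y hx hy h
      rw [(pL x hx).1, (pL y hy).1]
      linarith
    · intro x y hx hy h
      simp only [List.mem_filter, decide_eq_true_eq] at hx hy
      rw [(pB x hx.1 hx.2).1, (pB y hy.1 hy.2).1]
      linarith
    · intro x y hx hy h
      simp only [List.mem_filter, decide_eq_true_eq] at hx hy
      rw [(pR x hx.1 hx.2).1, (pR y hy.1 hy.2).1]
      linarith
    · intro x y hx hy h
      simp only [List.mem_filter, decide_eq_true_eq] at hx hy
      rw [(pT x hx.1 hx.2.1 hx.2.2).1, (pT y hy.1 hy.2.1 hy.2.2).1]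
      linarith
    · intro x hx y hy
      simp only [List.mem_filter, List.mem_reverse, decide_eq_true_eq] at hx hy
      obtain ⟨e1, h1⟩ := pR x hx.1 hx.2
      obtain ⟨e2, h2⟩ := pT y hy.1 hy.2.1 hy.2.2
      rw [e1, e2]
      linarith [h1.2]
    · intro x hx y hy
      simp only [List.mem_filter, List.mem_append, List.mem_reverse, decide_eq_true_eq] at hx hy
      obtain ⟨e1, h1⟩ := pB x hx.1 hx.2
      rcases hy with hy | hy
      · obtain ⟨e2, h2⟩ := pR y hy.1 hy.2
        rw [e1, e2]
        linarith [h1.2, h2.1]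
      · obtain ⟨e2, h2⟩ := pT y hy.1 hy.2.1 hy.2.2
        rw [e1, e2]
        linarith [h1.2]
    · intro x hx y hy
      simp only [List.mem_filter, List.mem_append, List.mem_reverse, decide_eq_true_eq] at hx hy
      obtain ⟨e1, h1⟩ := pL x hx
      rcases hy with hy | hy | hy
      · obtain ⟨e2, h2⟩ := pB y hy.1 hy.2
        rw [e1, e2]
        linarith [h1.1, h2.1]
      · obtain ⟨e2, h2⟩ := pR y hy.1 hy.2
        rw [e1, e2]
        linarith [h1.1, h2.1]
      · obtain ⟨e2, h2⟩ := pT y hy.1 hy.2.1 hy.2.2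
        rw [e1, e2]
        linarith [h1.1]
  · intro z h1 h2
    have e1 := (mB z).1 h1
    have e2 := (mL z).1 h2
    exact ⟨hB.head_of_le h1 fun u hu => by rw [e2.2.2.1]; exact hu.2.1.1,
      hL.head_of_le h2 fun u hu => by rw [e1.2.2.2]; exact hu.2.2.1⟩
  · intro z h1 h2
    have e1 := (mB z).1 h1
    have e2 := (mR z).1 h2
    exact ⟨hB.last_of_le h1 fun u hu => by rw [e2.2.2.1]; exact hu.2.1.2,
      hRt.head_of_le h2 fun u hu => by rw [e1.2.2.2]; exact hu.2.2.1⟩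
  · intro z h1 h2
    have e1 := (mT z).1 h1
    have e2 := (mL z).1 h2
    exact ⟨hTp.head_of_le h1 fun u hu => by rw [e2.2.2.1]; exact hu.2.1.1,
      hL.last_of_le h2 fun u hu => by rw [e1.2.2.2]; exact hu.2.2.2⟩
  · intro z h1 h2
    have e1 := (mT z).1 h1
    have e2 := (mR z).1 h2
    exact ⟨hTp.last_of_le h1 fun u hu => by rw [e2.2.2.1]; exact hu.2.1.2,
      hRt.last_of_le h2 fun u hu => by rw [e1.2.2.2]; exact hu.2.2.2⟩
  · intro z h1 h2
    have e1 := (mL z).1 h1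
    have e2 := (mR z).1 h2
    exact hab.ne (e1.2.2.1.symm.trans e2.2.2.1)
  · intro z h1 h2
    have e1 := (mB z).1 h1
    have e2 := (mT z).1 h2
    exact hcd.ne (e1.2.2.2.symm.trans e2.2.2.2)
  · exact fun x y h => ⟨h.2.1, h.1, h.2.2.symm⟩
  · exact fun x y h => ⟨h.2.1, h.1, h.2.2.symm⟩
  · intro x y y' h h'
    have hy : y < size := h.elim (fun h => h.2.1) fun h => h.2.1
    have hy' : y' < size := h'.elim (fun h => h.2.1) fun h => h.2.1
    exact hpts.injOn hy hy' (ArcJoin.eq hT (h.imp (fun h => h.2.2) fun h => h.2.2)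
      (h'.imp (fun h => h.2.2) fun h => h.2.2))
  · exact fun x y y' h h' => hT.not_incJoin_decJoin h.2.2 h'.2.2
  · rintro x y ⟨hx, hy, h⟩
    have h1 := h.mem_left
    have h2 := h.mem_right
    have hx' := h1.2.1
    have hy' := h2.2.1
    simp only [mB, mL, mT, mR, hx, hy, h1.1, h2.1, true_and, mem_Icc, mem_prod] at hx' hy' ⊢
    rcases incJoin_ends h with ⟨a1, a2, a3, a4⟩ | ⟨a1, a2, a3, a4⟩
    · left
      refine ⟨?_, ?_, ?_, ?_, ?_, ?_⟩
      · exact a3.imp (fun h => ⟨h, hx'.2⟩) fun h => ⟨hx'.1, h⟩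
      · rintro ⟨-, h⟩; linarith
      · rintro ⟨h, -⟩; linarith
      · exact a4.symm.imp (fun h => ⟨hy'.1, h⟩) fun h => ⟨h, hy'.2⟩
      · rintro ⟨h, -⟩; linarith
      · rintro ⟨-, h⟩; linarith
    · right
      refine ⟨?_, ?_, ?_, ?_, ?_, ?_⟩
      · exact a3.imp (fun h => ⟨h, hy'.2⟩) fun h => ⟨hy'.1, h⟩
      · rintro ⟨-, h⟩; linarith
      · rintro ⟨h, -⟩; linarith
      · exact a4.symm.imp (fun h => ⟨hx'.1, h⟩) fun h => ⟨h, hx'.2⟩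
      · rintro ⟨h, -⟩; linarith
      · rintro ⟨-, h⟩; linarith
  · rintro x y ⟨hx, hy, h⟩
    have h1 := h.mem_left
    have h2 := h.mem_right
    have hx' := h1.2.1
    have hy' := h2.2.1
    simp only [mB, mL, mT, mR, hx, hy, h1.1, h2.1, true_and, mem_Icc, mem_prod] at hx' hy' ⊢
    rcases decJoin_ends h with ⟨a1, a2, a3, a4⟩ | ⟨a1, a2, a3, a4⟩
    · left
      refine ⟨?_, ?_, ?_, ?_, ?_, ?_⟩
      · exact a3.imp (fun h => ⟨h, hx'.2⟩) fun h => ⟨hx'.1, h⟩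
      · rintro ⟨-, h⟩; linarith
      · rintro ⟨h, -⟩; linarith
      · exact a4.symm.imp (fun h => ⟨hy'.1, h⟩) fun h => ⟨h, hy'.2⟩
      · rintro ⟨h, -⟩; linarith
      · rintro ⟨-, h⟩; linarith
    · right
      refine ⟨?_, ?_, ?_, ?_, ?_, ?_⟩
      · exact a3.imp (fun h => ⟨h, hy'.2⟩) fun h => ⟨hy'.1, h⟩
      · rintro ⟨-, h⟩; linarith
      · rintro ⟨h, -⟩; linarith
      · exact a4.symm.imp (fun h => ⟨hx'.1, h⟩) fun h => ⟨h, hx'.2⟩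
      · rintro ⟨h, -⟩; linarith
      · rintro ⟨-, h⟩; linarith
  · intro x hx hl hr
    rw [mB, mT, mL] at hl
    rw [mB, mT, mR] at hr
    rw [mB, mT, mL, mR] at hx
    have hx1 : x < size := by tauto
    have hx2 : pts x ∈ bdry γ₁ γ₂ δ := by tauto
    simp only [hx1, hx2, true_and, mem_Icc] at hx hl hr
    have hB : pts x ∈ boxEdge S.a S.b S.c S.d := by
      refine ⟨⟨?_, ?_⟩, by tauto⟩
      · rcases hx with h | h | h | h
        · rw [h.1]; exact left_mem_Icc.2 hab.le
        · exact h.1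
        · exact h.1
        · rw [h.1]; exact right_mem_Icc.2 hab.le
      · rcases hx with h | h | h | h
        · exact h.2
        · rw [h.2]; exact left_mem_Icc.2 hcd.le
        · rw [h.2]; exact right_mem_Icc.2 hcd.le
        · exact h.2
    have hc : (pts x).1 ∈ Ioo S.a S.b ∨ (pts x).2 ∈ Ioo S.c S.d := by
      simp only [mem_Ioo]
      have b1 := hB.1.1
      have b2 := hB.1.2
      simp only [mem_Icc] at b1 b2
      by_contra hcon
      grind
    rcases hT.exists_join hx2 hB hc with ⟨w, hw⟩ | ⟨w, hw⟩
    · obtain ⟨y, hy, rfl⟩ := hidx w hw.mem_right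
      exact Or.inl ⟨y, hx1, hy, hw⟩
    · obtain ⟨y, hy, rfl⟩ := hidx w hw.mem_right
      exact Or.inr ⟨y, hx1, hy, hw⟩
  · intro x y x' y' h h' h1 h2
    exact hT.noncrossing (h.imp (fun h => h.2.2) fun h => h.2.2)
      (h'.imp (fun h => h.2.2) fun h => h.2.2) h1 h2

/-- The other end of an arc is again a marked point, hence has a number. -/
theorem exists_incPairs_iff (hG : Generic γ₁ γ₂ δ) {pts : ℕ → ℝ × ℝ} {size : ℕ}
    (hpts : BijOn pts (Iio size) (marked γ₁ γ₂ δ)) {S : Subcell γ₁ γ₂} (hS : S.IsSubcell δ) {x : ℕ}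
    (hx : x < size) :
    (∃ y, incPairs δ pts size S x y) ↔
      ∃ w, IncJoin (bdry γ₁ γ₂ δ) S.a S.b S.c S.d (pts x) w := by
  have hT := hS.tameBox hG
  refine ⟨fun ⟨y, h⟩ => ⟨_, h.2.2⟩, fun ⟨w, h⟩ => ?_⟩
  obtain ⟨y, hy, rfl⟩ := hpts.surjOn
    ⟨S, hS, by rw [Subcell.marked_eq hT.hab.le hT.hcd.le]; exact h.mem_right⟩
  exact ⟨y, hx, hy, h⟩

theorem exists_decPairs_iff (hG : Generic γ₁ γ₂ δ) {pts : ℕ → ℝ × ℝ} {size : ℕ}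
    (hpts : BijOn pts (Iio size) (marked γ₁ γ₂ δ)) {S : Subcell γ₁ γ₂} (hS : S.IsSubcell δ) {x : ℕ}
    (hx : x < size) :
    (∃ y, decPairs δ pts size S x y) ↔
      ∃ w, DecJoin (bdry γ₁ γ₂ δ) S.a S.b S.c S.d (pts x) w := by
  have hT := hS.tameBox hG
  refine ⟨fun ⟨y, h⟩ => ⟨_, h.2.2⟩, fun ⟨w, h⟩ => ?_⟩
  obtain ⟨y, hy, rfl⟩ := hpts.surjOn
    ⟨S, hS, by rw [Subcell.marked_eq hT.hab.le hT.hcd.le]; exact h.mem_right⟩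
  exact ⟨y, hx, hy, h⟩

/-- The information that is passed on between neighbouring subcells: whether `B_δ` enters a
quadrant at a point if and only if the point is an extremum. -/
def quadrantFlag (γ₁ γ₂ : PiecewiseC2 E) (δ : ℝ) (pts : ℕ → ℝ × ℝ) (κ z : ℕ) : Prop :=
  match κ with
  | 0 => Enters (bdry γ₁ γ₂ δ) (pts z) 1 (-1) ↔ pts z ∈ Ev γ₁ γ₂ δ
  | 1 => Enters (bdry γ₁ γ₂ δ) (pts z) (-1) (-1) ↔ pts z ∈ Ev γ₁ γ₂ δ
  | 2 => Enters (bdry γ₁ γ₂ δ) (pts z) (-1) 1 ↔ pts z ∈ Eh γ₁ γ₂ δ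
  | _ => Enters (bdry γ₁ γ₂ δ) (pts z) (-1) (-1) ↔ pts z ∈ Eh γ₁ γ₂ δ

theorem forall₂_getElem? {α β : Type*} {P : α → β → Prop} {l : List α} {m : List β}
    (h : List.Forall₂ P l m) {k : ℕ} {b : β} (hb : m[k]? = some b) :
    ∃ a, l[k]? = some a ∧ P a b := by
  induction h generalizing k with
  | nil => simp at hb
  | cons h _ ih =>
    cases k with
    | zero => simp only [List.getElem?_cons_zero, Option.some.injEq] at hb ⊢; exact ⟨_, rfl, hb ▸ h⟩
    | succ k => simp only [List.getElem?_cons_succ] at hb ⊢; exact ih hb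

/-- In a list of subcells in lexicographic order, earlier subcells have smaller indices. -/
theorem exists_lt_of_before {subs : List (Subcell γ₁ γ₂)} (hord : subs.Pairwise Subcell.Before)
    {k : ℕ} {S S' : Subcell γ₁ γ₂} (hk : subs[k]? = some S) (hS' : S' ∈ subs)
    (h : S'.Before S) : ∃ k' < k, subs[k']? = some S' := by
  obtain ⟨k', hk'⟩ := List.mem_iff_getElem?.1 hS'
  refine ⟨k', ?_, hk'⟩
  obtain ⟨l, e⟩ := List.getElem?_eq_some_iff.1 hk
  obtain ⟨l', e'⟩ := List.getElem?_eq_some_iff.1 hk'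
  rcases lt_trichotomy k' k with h1 | rfl | h1
  · exact h1
  · rw [e] at e'; subst e'; exact (h.asymm h).elim
  · have := List.pairwise_iff_getElem.1 hord k k' l l' h1
    rw [e, e'] at this
    exact (h.asymm this).elim

/-- Here the geometry ends: what follows uses only this purely combinatorial interface. A flag
written at an upper or right edge is the state of a quadrant of the writing subcell, combined with
the extremum bit; by the alternative at edges it equals the state of the neighbouring quadrant of
the reading subcell. -/
theorem IsInput.recordSpec (hG : Generic γ₁ γ₂ δ) {pts : ℕ → ℝ × ℝ}
    {subs : List (Subcell γ₁ γ₂)} {D : InputData} (h : IsInput δ pts subs D) {k : ℕ}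
    {R : SubcellRecord} {S : Subcell γ₁ γ₂} (hk : subs[k]? = some S) (hkR : D.subcells[k]? = some R) :
    RecordSpec R (incPairs δ pts D.size S) (decPairs δ pts D.size S)
      (fun z => edgePos S.a S.b S.c S.d (pts z)) (fun z => pts z ∈ Eh γ₁ γ₂ δ)
      (fun z => pts z ∈ Ev γ₁ γ₂ δ) (quadrantFlag γ₁ γ₂ δ pts)
      fun κ z => ∃ k' < k, ∃ R', D.subcells[k']? = some R' ∧ R'.Writes κ z := by
  obtain ⟨hpts, -, hsubs, hord, hrec⟩ := h
  have hS := ((hsubs S).1 (List.mem_of_getElem? hk)).1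
  have hR : RecordOf δ pts D.size R S := by
    obtain ⟨R', hR', h⟩ := forall₂_getElem? hrec hk
    rw [hkR, Option.some.injEq] at hR'
    exact hR' ▸ h
  have hT := hS.tameBox hG
  have hab := hT.hab
  have hcd := hT.hcd
  have hbox := hR.boxPattern hG hpts hS
  obtain ⟨hB, hL, hTp, hRt, honB, honL, hBs, hLs⟩ := hR
  have mB : ∀ z, z ∈ R.bottom ↔ z < D.size ∧ pts z ∈ bdry γ₁ γ₂ δ ∧
    ((pts z).1 ∈ Icc S.a S.b ∧ (pts z).2 = S.c) := hB.2
  have mL : ∀ z, z ∈ R.left ↔ z < D.size ∧ pts z ∈ bdry γ₁ γ₂ δ ∧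
    ((pts z).1 = S.a ∧ (pts z).2 ∈ Icc S.c S.d) := hL.2
  have mT : ∀ z, z ∈ R.top ↔ z < D.size ∧ pts z ∈ bdry γ₁ γ₂ δ ∧
    ((pts z).1 ∈ Icc S.a S.b ∧ (pts z).2 = S.d) := hTp.2
  have mR : ∀ z, z ∈ R.right ↔ z < D.size ∧ pts z ∈ bdry γ₁ γ₂ δ ∧
    ((pts z).1 = S.b ∧ (pts z).2 ∈ Icc S.c S.d) := hRt.2
  have mem : ∀ z ∈ R.bottom ++ R.left ++ R.top ++ R.right, z < D.size ∧ pts z ∈ bdry γ₁ γ₂ δ ∧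
      pts z ∈ boxEdge S.a S.b S.c S.d := by
    intro z hz
    simp only [List.mem_append, mB, mL, mT, mR] at hz
    have h1 : z < D.size ∧ pts z ∈ bdry γ₁ γ₂ δ := by tauto
    refine ⟨h1.1, h1.2, ?_⟩
    simp only [boxEdge, mem_ofPred_eq, mem_prod, mem_Icc] at hz ⊢
    grind
  have hI : ∀ z ∈ R.bottom ++ R.left ++ R.top ++ R.right,
      ((∃ y, incPairs δ pts D.size S z y) ↔
        ((pts z).1 < S.b ∧ (pts z).2 < S.d ∧ Enters (bdry γ₁ γ₂ δ) (pts z) 1 1) ∨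
        (S.a < (pts z).1 ∧ S.c < (pts z).2 ∧ Enters (bdry γ₁ γ₂ δ) (pts z) (-1) (-1))) := by
    intro z hz
    have := mem z hz
    rw [exists_incPairs_iff hG hpts hS this.1, IncJoin.exists_iff hT this.2.1 this.2.2]
  have hD : ∀ z ∈ R.bottom ++ R.left ++ R.top ++ R.right,
      ((∃ y, decPairs δ pts D.size S z y) ↔
        ((pts z).1 < S.b ∧ S.c < (pts z).2 ∧ Enters (bdry γ₁ γ₂ δ) (pts z) 1 (-1)) ∨
        (S.a < (pts z).1 ∧ (pts z).2 < S.d ∧ Enters (bdry γ₁ γ₂ δ) (pts z) (-1) 1)) := by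
    intro z hz
    have := mem z hz
    rw [exists_decPairs_iff hG hpts hS this.1, DecJoin.exists_iff hT this.2.1 this.2.2]
  have hslope : ∀ {l m : List ℕ}, l ⊆ R.bottom ++ R.left ++ R.top ++ R.right →
      List.Forall₂ (fun k v => SlopeCode δ S (pts k) v) l m →
      List.Forall₂ (JoinCode (incPairs δ pts D.size S) (decPairs δ pts D.size S)) l m := by
    intro l m hl hf
    induction hf with
    | nil => exact List.Forall₂.nil
    | cons h _ ih =>
      rw [List.cons_subset] at hl
      refine List.Forall₂.cons ?_ (ih hl.2)
      have h1 := mem _ hl.1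
      rw [hS.slopeCode_iff hG (by rw [Subcell.marked_eq hab.le hcd.le]; exact h1.2)] at h
      unfold JoinCode
      rwa [exists_incPairs_iff hG hpts hS h1.1, exists_decPairs_iff hG hpts hS h1.1]
  -- The cuts go through the whole cell, so the neighbour below has the same horizontal extent and
  -- carries the point on its upper edge. Having a marked point, it is listed, and it comes earlier.
  have below : R.onBottom = false → ∀ z ∈ R.bottom, ∃ k' < k, ∃ R', D.subcells[k']? = some R' ∧
      z ∈ R'.top ∧ ((pts z).1 < S.b → z ∉ R'.right) ∧ (S.a < (pts z).1 → z ∉ R'.left) := by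
    intro hf z hz
    obtain ⟨c', hS'⟩ := hS.exists_below hG fun h => by simp [honB.2 h] at hf
    set S' : Subcell γ₁ γ₂ := ⟨S.i, S.j, S.a, S.b, c', S.c⟩ with hS'def
    have hz' := (mB z).1 hz
    have hmem : S' ∈ subs := (hsubs S').2
      ⟨hS', pts z, hz'.2.1, Or.inl (Or.inl (Or.inr ⟨hz'.2.2.1, hz'.2.2.2⟩))⟩
    have hc' : c' < S.c := hS'.2.2.2.1
    obtain ⟨k', hk', hkS⟩ := exists_lt_of_before hord hk hmem
      (Or.inr ⟨rfl, Or.inr ⟨rfl, Or.inl hc'⟩⟩)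
    obtain ⟨R', hR', hrec'⟩ := forall₂_getElem? hrec hkS
    refine ⟨k', hk', R', hR', ?_, ?_, ?_⟩
    · exact (hrec'.2.2.1.2 z).2 ⟨hz'.1, hz'.2.1, hz'.2.2.1, hz'.2.2.2⟩
    · intro hlt hr
      exact hlt.ne ((hrec'.2.2.2.1.2 z).1 hr).2.2.1
    · intro hlt hr
      exact hlt.ne' ((hrec'.2.1.2 z).1 hr).2.2.1
  have leftOf : R.onLeft = false → ∀ z ∈ R.left, ∃ k' < k, ∃ R', D.subcells[k']? = some R' ∧
      z ∈ R'.right ∧ ((pts z).2 < S.d → z ∉ R'.top) ∧ (S.c < (pts z).2 → z ∉ R'.bottom) := by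
    intro hf z hz
    obtain ⟨a', hS'⟩ := hS.exists_leftOf hG fun h => by simp [honL.2 h] at hf
    set S' : Subcell γ₁ γ₂ := ⟨S.i, S.j, a', S.a, S.c, S.d⟩ with hS'def
    have hz' := (mL z).1 hz
    have hmem : S' ∈ subs := (hsubs S').2
      ⟨hS', pts z, hz'.2.1, Or.inr ⟨hz'.2.2.1, hz'.2.2.2⟩⟩
    have ha' : a' < S.a := hS'.1.2.2.1
    obtain ⟨k', hk', hkS⟩ := exists_lt_of_before hord hk hmem
      (Or.inr ⟨rfl, Or.inr ⟨rfl, Or.inr ⟨rfl, ha'⟩⟩⟩)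
    obtain ⟨R', hR', hrec'⟩ := forall₂_getElem? hrec hkS
    refine ⟨k', hk', R', hR', ?_, ?_, ?_⟩
    · exact (hrec'.2.2.2.1.2 z).2 ⟨hz'.1, hz'.2.1, hz'.2.2.1, hz'.2.2.2⟩
    · intro hlt hr
      exact hlt.ne ((hrec'.2.2.1.2 z).1 hr).2.2.2
    · intro hlt hr
      exact hlt.ne' ((hrec'.1.2 z).1 hr).2.2.2
  have nR : ∀ z, z ∈ R.bottom ∨ z ∈ R.top → z ∉ R.right → (pts z).1 < S.b := by
    intro z hz hz'
    rw [mB, mT] at hz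
    rw [mR] at hz'
    by_contra hge
    rcases hz with hz | hz
    · exact hz' ⟨hz.1, hz.2.1, le_antisymm hz.2.2.1.2 (not_lt.1 hge), hz.2.2.2.ge,
        hz.2.2.2.le.trans hcd.le⟩
    · exact hz' ⟨hz.1, hz.2.1, le_antisymm hz.2.2.1.2 (not_lt.1 hge), hcd.le.trans hz.2.2.2.ge,
        hz.2.2.2.le⟩
  have nL : ∀ z, z ∈ R.bottom ∨ z ∈ R.top → z ∉ R.left → S.a < (pts z).1 := by
    intro z hz hz'
    rw [mB, mT] at hz
    rw [mL] at hz'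
    by_contra hge
    rcases hz with hz | hz
    · exact hz' ⟨hz.1, hz.2.1, le_antisymm (not_lt.1 hge) hz.2.2.1.1, hz.2.2.2.ge,
        hz.2.2.2.le.trans hcd.le⟩
    · exact hz' ⟨hz.1, hz.2.1, le_antisymm (not_lt.1 hge) hz.2.2.1.1, hcd.le.trans hz.2.2.2.ge,
        hz.2.2.2.le⟩
  have nT : ∀ z, z ∈ R.left ∨ z ∈ R.right → z ∉ R.top → (pts z).2 < S.d := by
    intro z hz hz'
    rw [mL, mR] at hz
    rw [mT] at hz'
    by_contra hge
    rcases hz with hz | hz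
    · exact hz' ⟨hz.1, hz.2.1, ⟨hz.2.2.1.ge, hz.2.2.1.le.trans hab.le⟩,
        le_antisymm hz.2.2.2.2 (not_lt.1 hge)⟩
    · exact hz' ⟨hz.1, hz.2.1, ⟨hab.le.trans hz.2.2.1.ge, hz.2.2.1.le⟩,
        le_antisymm hz.2.2.2.2 (not_lt.1 hge)⟩
  have nB : ∀ z, z ∈ R.left ∨ z ∈ R.right → z ∉ R.bottom → S.c < (pts z).2 := by
    intro z hz hz'
    rw [mL, mR] at hz
    rw [mB] at hz'
    by_contra hge
    rcases hz with hz | hz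
    · exact hz' ⟨hz.1, hz.2.1, ⟨hz.2.2.1.ge, hz.2.2.1.le.trans hab.le⟩,
        le_antisymm (not_lt.1 hge) hz.2.2.2.1⟩
    · exact hz' ⟨hz.1, hz.2.1, ⟨hab.le.trans hz.2.2.1.ge, hz.2.2.1.le⟩,
        le_antisymm (not_lt.1 hge) hz.2.2.2.1⟩
  refine ⟨hbox, ?_, ?_, ?_, ?_, ?_, ?_, ?_, ?_, ?_, ?_⟩
  -- On an edge of the rectangle one of the two quadrants in the criterion for an arc is outside.
  -- The remaining one is the quadrant recorded in the flag.
  · intro z hz hz'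
    have h1 := nR z (Or.inr hz) hz'
    have h2 := ((mT z).1 hz).2.2.2
    rw [hD z (by simp [hz]), h2]
    simp only [quadrantFlag, lt_irrefl, false_and, and_false, or_false, h1, hcd, true_and]
  · intro z hz hz'
    have h1 := nL z (Or.inr hz) hz'
    have h2 := ((mT z).1 hz).2.2.2
    rw [hI z (by simp [hz]), h2]
    simp only [quadrantFlag, lt_irrefl, false_and, and_false, false_or, h1, hcd, true_and]
  · intro z hz hz'
    have h1 := nT z (Or.inr hz) hz'
    have h2 := ((mR z).1 hz).2.2.1
    rw [hD z (by simp [hz]), h2]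
    simp only [quadrantFlag, lt_irrefl, false_and, false_or, h1, hab, true_and]
  · intro z hz hz'
    have h1 := nB z (Or.inr hz) hz'
    have h2 := ((mR z).1 hz).2.2.1
    rw [hI z (by simp [hz]), h2]
    simp only [quadrantFlag, lt_irrefl, false_and, false_or, h1, hab, true_and]
  · intro hf z hz hz'
    have h1 := nR z (Or.inl hz) hz'
    obtain ⟨hzs, hzb, hzx, h2⟩ := (mB z).1 hz
    constructor
    · obtain ⟨k', hk', R', hR', a1, a2, -⟩ := below hf z hz
      exact ⟨k', hk', R', hR', Or.inl ⟨rfl, a1, a2 h1⟩⟩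
    · rw [hI z (by simp [hz])]
      have := hS.enters_up_iff hG (fun h => by simp [honB.2 h] at hf) hzb hzx h2 isSign_one
        (fun _ => h1) (fun h => by norm_num at h)
      simp only [quadrantFlag, ← this, h2, lt_irrefl, false_and, and_false, or_false, h1, hcd,
        true_and]
  · intro hf z hz hz'
    have h1 := nL z (Or.inl hz) hz'
    obtain ⟨hzs, hzb, hzx, h2⟩ := (mB z).1 hz
    constructor
    · obtain ⟨k', hk', R', hR', a1, -, a2⟩ := below hf z hz
      exact ⟨k', hk', R', hR', Or.inr (Or.inl ⟨rfl, a1, a2 h1⟩)⟩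
    · rw [hD z (by simp [hz])]
      have := hS.enters_up_iff hG (fun h => by simp [honB.2 h] at hf) hzb hzx h2 isSign_neg_one
        (fun h => by norm_num at h) (fun _ => h1)
      simp only [quadrantFlag, ← this, h2, lt_irrefl, false_and, and_false, false_or, h1, hcd,
        true_and]
  · intro hf z hz hz'
    have h1 := nT z (Or.inl hz) hz'
    obtain ⟨hzs, hzb, h2, hzy⟩ := (mL z).1 hz
    constructor
    · obtain ⟨k', hk', R', hR', a1, a2, -⟩ := leftOf hf z hz
      exact ⟨k', hk', R', hR', Or.inr (Or.inr (Or.inl ⟨rfl, a1, a2 h1⟩))⟩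
    · rw [hI z (by simp [hz])]
      have := hS.enters_right_iff hG (fun h => by simp [honL.2 h] at hf) hzb hzy h2 isSign_one
        (fun _ => h1) (fun h => by norm_num at h)
      simp only [quadrantFlag, ← this, h2, lt_irrefl, false_and, or_false, h1, hab, true_and]
  · intro hf z hz hz'
    have h1 := nB z (Or.inl hz) hz'
    obtain ⟨hzs, hzb, h2, hzy⟩ := (mL z).1 hz
    constructor
    · obtain ⟨k', hk', R', hR', a1, -, a2⟩ := leftOf hf z hz
      exact ⟨k', hk', R', hR', Or.inr (Or.inr (Or.inr ⟨rfl, a1, a2 h1⟩))⟩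
    · rw [hD z (by simp [hz])]
      have := hS.enters_right_iff hG (fun h => by simp [honL.2 h] at hf) hzb hzy h2 isSign_neg_one
        (fun h => by norm_num at h) (fun _ => h1)
      simp only [quadrantFlag, ← this, h2, lt_irrefl, false_and, or_false, h1, hab, true_and]
  · split_ifs at hBs ⊢ with hb
    · exact hslope (fun x hx => by simp [hx]) hBs
    · exact hBs
  · split_ifs at hLs ⊢ with hb
    · exact hslope (fun x hx => by simp [hx]) hLs
    · exact hLs

end FreeSpace

/-! ### Noncrossing matchings and the stack -/

namespace FreeSpace

/-- A noncrossing partial matching of points on a line. -/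
structure Matching (A : ℕ → ℕ → Prop) (pos : ℕ → ℝ) : Prop where
  symm : ∀ x y, A x y → A y x
  unique : ∀ x y y', A x y → A x y' → y = y'
  noncrossing : ∀ x y x' y', A x y → A x' y' → pos x < pos x' → pos x' < pos y →
    pos x < pos y' ∧ pos y' < pos y

open Classical in
/-- The points of `pre` that are matched with points of `post`, in reverse order. -/
noncomputable def pending (A : ℕ → ℕ → Prop) (pre post : List ℕ) : List ℕ :=
  (pre.filter fun x => ∃ y ∈ post, A x y).reverse

theorem mem_pending {A : ℕ → ℕ → Prop} {pre post : List ℕ} {x : ℕ} :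
    x ∈ pending A pre post ↔ x ∈ pre ∧ ∃ y ∈ post, A x y := by
  simp [pending]

/-- The list `es` contains the matched pairs in `pre`. -/
def Closed (A : ℕ → ℕ → Prop) (pos : ℕ → ℝ) (pre : List ℕ) (es : List (ℕ × ℕ)) : Prop :=
  es.Nodup ∧ ∀ x y, (x, y) ∈ es ↔ A x y ∧ x ∈ pre ∧ y ∈ pre ∧ pos x < pos y

section matching

variable {A : ℕ → ℕ → Prop} {pos : ℕ → ℝ} {pre post : List ℕ} {z : ℕ}

theorem lt_of_mem_pre (hW : (pre ++ z :: post).Pairwise fun x y => pos x < pos y) {x : ℕ}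
    (hx : x ∈ pre) : pos x < pos z :=
  (List.pairwise_append.1 hW).2.2 x hx z List.mem_cons_self

theorem lt_of_mem_post (hW : (pre ++ z :: post).Pairwise fun x y => pos x < pos y) {x : ℕ}
    (hx : x ∈ post) : pos z < pos x :=
  List.rel_of_pairwise_cons (List.pairwise_append.1 hW).2.1 hx

theorem pending_of_unmatched (hA : Matching A pos) (h : ∀ y, ¬ A z y) :
    pending A (pre ++ [z]) post = pending A pre (z :: post) := by
  classical
  unfold pending
  have h1 : ¬ ∃ y ∈ post, A z y := fun ⟨y, _, hy⟩ => h y hy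
  rw [List.filter_append, List.filter_cons_of_neg (by simpa using h1), List.filter_nil,
    List.append_nil, List.reverse_inj]
  refine List.filter_congr fun x _ => ?_
  have h2 : ¬ A x z := fun h' => h x (hA.symm _ _ h')
  simp [h2]

theorem pending_push (hA : Matching A pos)
    (hW : (pre ++ z :: post).Pairwise fun x y => pos x < pos y) {y : ℕ} (h : A z y)
    (hy : y ∈ post) : pending A (pre ++ [z]) post = z :: pending A pre (z :: post) := by
  classical
  unfold pending
  have h1 : ∃ y ∈ post, A z y := ⟨y, hy, h⟩
  rw [List.filter_append, List.filter_cons_of_pos (by simpa using h1), List.filter_nil,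
    List.reverse_append, List.reverse_singleton, List.singleton_append, List.cons.injEq,
    List.reverse_inj]
  refine ⟨rfl, ?_⟩
  refine List.filter_congr fun x hx => ?_
  have h2 : ¬ A x z := fun h' => by
    obtain rfl := hA.unique _ _ _ (hA.symm _ _ h') h
    exact lt_asymm (lt_of_mem_pre hW hx) (lt_of_mem_post hW hy)
  simp [h2]

/-- This is the reason why a stack suffices: a point between `y` and its partner `z` has its own
partner between them as well, so nothing stored after `y` is still pending when `z` is reached. -/
theorem pending_pop (hA : Matching A pos)
    (hW : (pre ++ z :: post).Pairwise fun x y => pos x < pos y) {y : ℕ} (h : A z y)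
    (hy : y ∈ pre) : pending A pre (z :: post) = y :: pending A (pre ++ [z]) post := by
  classical
  obtain ⟨p, q, rfl⟩ := List.append_of_mem hy
  have hyp : ∀ x ∈ p, pos x < pos y := by
    intro x hx
    rw [List.append_assoc] at hW
    exact (List.pairwise_append.1 hW).2.2 x hx y (by simp)
  have hyq : ∀ x ∈ q, pos y < pos x := by
    intro x hx
    rw [List.append_assoc] at hW
    exact List.rel_of_pairwise_cons (List.pairwise_append.1 hW).2.1 (by simp [hx])
  have hpz : ∀ x ∈ p, ¬ A x z := fun x hx h' => by
    have := hA.unique _ _ _ (hA.symm _ _ h') h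
    subst this
    exact lt_irrefl _ (hyp _ hx)
  -- A partner of `x` at or after `z` would either be `z`, against uniqueness, or make the pairs
  -- cross.
  have hqz : ∀ x ∈ q, ¬ ∃ u ∈ z :: post, A x u := by
    rintro x hx ⟨u, hu, hxu⟩
    rcases List.mem_cons.1 hu with rfl | hu
    · have := hA.unique _ _ _ (hA.symm _ _ hxu) h
      subst this
      exact lt_irrefl _ (hyq _ hx)
    · have h1 := hA.noncrossing y z x u (hA.symm _ _ h) hxu (hyq _ hx)
        (lt_of_mem_pre hW (by simp [hx]))
      exact lt_asymm h1.2 (lt_of_mem_post hW hu)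
  have hyz : ¬ ∃ u ∈ post, A y u := by
    rintro ⟨u, hu, hyu⟩
    have := hA.unique _ _ _ (hA.symm _ _ h) hyu
    subst this
    exact lt_irrefl _ (lt_of_mem_post hW hu)
  have hzz : ¬ ∃ u ∈ post, A z u := by
    rintro ⟨u, hu, hzu⟩
    have := hA.unique _ _ _ h hzu
    subst this
    exact lt_asymm (lt_of_mem_pre hW hy) (lt_of_mem_post hW hu)
  have hqz' : ∀ x ∈ q, ¬ ∃ u ∈ post, A x u := fun x hx ⟨u, hu, hxu⟩ =>
    hqz x hx ⟨u, List.mem_cons_of_mem _ hu, hxu⟩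
  have e1 : q.filter (fun x => decide (∃ u ∈ z :: post, A x u)) = [] := by
    rw [List.filter_eq_nil_iff]
    intro x hx
    simpa using hqz x hx
  have e2 : q.filter (fun x => decide (∃ u ∈ post, A x u)) = [] := by
    rw [List.filter_eq_nil_iff]
    intro x hx
    simpa using hqz' x hx
  have e3 : ∃ u ∈ z :: post, A y u := ⟨z, List.mem_cons_self, hA.symm _ _ h⟩
  have e4 : p.filter (fun x => decide (∃ u ∈ z :: post, A x u)) =
      p.filter (fun x => decide (∃ u ∈ post, A x u)) :=
    List.filter_congr fun x hx => by simp [hpz x hx]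
  unfold pending
  rw [List.filter_append, List.filter_append, List.filter_append, List.filter_cons_of_pos (by simpa using e3),
    List.filter_cons_of_neg (by simpa using hyz), List.filter_cons_of_neg (by simpa using hzz), e1, e2, e4]
  simp

theorem Closed.skip {es : List (ℕ × ℕ)} (h : Closed A pos pre es) (hA : Matching A pos)
    (hW : (pre ++ z :: post).Pairwise fun x y => pos x < pos y) (hz : ∀ y ∈ pre, ¬ A z y) :
    Closed A pos (pre ++ [z]) es := by
  refine ⟨h.1, fun x y => ?_⟩
  rw [h.2]
  constructor
  · rintro ⟨h1, h2, h3, h4⟩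
    exact ⟨h1, by simp [h2], by simp [h3], h4⟩
  · rintro ⟨h1, h2, h3, h4⟩
    simp only [List.mem_append, List.mem_singleton] at h2 h3
    rcases h2 with h2 | rfl
    · rcases h3 with h3 | rfl
      · exact ⟨h1, h2, h3, h4⟩
      · exact (hz x h2 (hA.symm _ _ h1)).elim
    · rcases h3 with h3 | rfl
      · exact (hz y h3 h1).elim
      · exact (lt_irrefl _ h4).elim

theorem Closed.pop {es : List (ℕ × ℕ)} (h : Closed A pos pre es) (hA : Matching A pos)
    (hW : (pre ++ z :: post).Pairwise fun x y => pos x < pos y) {y : ℕ} (hz : A z y)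
    (hy : y ∈ pre) : Closed A pos (pre ++ [z]) (es ++ [(y, z)]) := by
  have hzp : z ∉ pre := fun h => lt_irrefl _ (lt_of_mem_pre hW h)
  refine ⟨?_, fun x u => ?_⟩
  · rw [List.nodup_append]
    refine ⟨h.1, List.nodup_singleton _, fun a ha b hb => ?_⟩
    rw [List.mem_singleton] at hb
    rintro rfl
    rw [hb] at ha
    exact hzp ((h.2 y z).1 ha).2.2.1
  · simp only [List.mem_append, List.mem_singleton, h.2, Prod.mk.injEq]
    constructor
    · rintro (⟨h1, h2, h3, h4⟩ | ⟨rfl, rfl⟩)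
      · exact ⟨h1, Or.inl h2, Or.inl h3, h4⟩
      · exact ⟨hA.symm _ _ hz, Or.inl hy, Or.inr rfl, lt_of_mem_pre hW hy⟩
    · rintro ⟨h1, h2, h3, h4⟩
      rcases h2 with h2 | rfl
      · rcases h3 with h3 | rfl
        · exact Or.inl ⟨h1, h2, h3, h4⟩
        · exact Or.inr ⟨hA.unique _ _ _ (hA.symm _ _ h1) hz, rfl⟩
      · rcases h3 with h3 | rfl
        · exact (lt_asymm h4 (lt_of_mem_pre hW h3)).elim
        · exact (lt_irrefl _ h4).elim

/-- Matched points of a list without repetitions inject into any list that contains their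
partners. -/
theorem Matching.length_le (hA : Matching A pos) {l m : List ℕ} (hl : l.Nodup)
    (h : ∀ x ∈ l, ∃ y ∈ m, A x y) : l.length ≤ m.length := by
  classical
  choose! f hf hfA using h
  have hinj : (l.map f).Nodup := by
    refine List.Nodup.map_on (fun x hx y hy hxy => ?_) hl
    have h1 := hfA y hy
    rw [← hxy] at h1
    exact hA.unique _ _ _ (hA.symm _ _ (hfA x hx)) (hA.symm _ _ h1)
  have := (List.subperm_of_subset hinj (l₂ := m) fun y hy => by
    obtain ⟨x, hx, rfl⟩ := List.mem_map.1 hy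
    exact hf x hx).length_le
  simpa using this

end matching

/-- Used to account for corners: a list of an edge contains at most one point of a given adjacent
edge. -/
theorem length_filter_add_of_unique {l : List ℕ} (hl : l.Nodup) (P : ℕ → Prop) [DecidablePred P]
    (hP : ∀ x ∈ l, ∀ y ∈ l, P x → P y → x = y) [Decidable (∃ x ∈ l, P x)] :
    (l.filter fun x => ¬ P x).length + (if ∃ x ∈ l, P x then 1 else 0) = l.length := by
  have h1 := List.length_eq_length_filter_add (l := l) fun x => decide (P x)
  have h2 : (l.filter fun x => decide (P x)).length = if ∃ x ∈ l, P x then 1 else 0 := by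
    split_ifs with h
    · obtain ⟨x, hx, hx'⟩ := h
      rw [List.length_eq_one_iff]
      refine ⟨x, ?_⟩
      have hn := hl.filter fun x => decide (P x)
      have hmem : ∀ y, y ∈ l.filter (fun x => decide (P x)) ↔ y ∈ [x] := by
        intro y
        simp only [List.mem_filter, decide_eq_true_eq, List.mem_singleton]
        exact ⟨fun h => hP y h.1 x hx h.2 hx', by rintro rfl; exact ⟨hx, hx'⟩⟩
      exact List.perm_singleton.1 ((List.perm_ext_iff_of_nodup hn (List.nodup_singleton x)).2 hmem)
    · rw [List.length_eq_zero_iff, List.filter_eq_nil_iff]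
      intro x hx
      simpa using fun h' => h ⟨x, hx, h'⟩
  have h3 : (l.filter fun x => ! decide (P x)) = l.filter fun x => decide (¬ P x) := by
    refine List.filter_congr fun x _ => by simp
  rw [h3] at h1
  omega

/-- The points on the boundary of a rectangle in counterclockwise order, beginning at the upper left
corner. -/
def boundaryOrder (B L T R : List ℕ) : List ℕ :=
  L.reverse ++ (B.filter (· ∉ L) ++ (R.filter (· ∉ B) ++
    (T.filter fun z => z ∉ L ∧ z ∉ R).reverse))

theorem mem_boundaryOrder {B L T R : List ℕ} {x : ℕ} :
    x ∈ boundaryOrder B L T R ↔ x ∈ L ∨ x ∈ B ∨ x ∈ T ∨ x ∈ R := by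
  simp only [boundaryOrder, List.mem_append, List.mem_reverse, List.mem_filter, decide_eq_true_eq]
  tauto

open Classical in
/-- The tag under which a point is stored on the stack. -/
noncomputable def stackTag (L : List ℕ) (I : ℕ → ℕ → Prop) (z : ℕ) : ℕ :=
  if ∃ y, I z y then 1 else if z ∈ L then 2 else 3

/-! ### The decision between push and pop on the four edges -/

namespace BoxPattern

variable {B L T R : List ℕ} {I D : ℕ → ℕ → Prop} {pos : ℕ → ℝ} {pre post : List ℕ} {z : ℕ}

theorem matching (h : BoxPattern B L T R I D pos) : Matching (fun x y => I x y ∨ D x y) pos where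
  symm x y := fun hxy => hxy.imp (h.inc_symm x y) (h.dec_symm x y)
  unique := h.unique
  noncrossing := h.noncrossing

theorem mem_of_joined (h : BoxPattern B L T R I D pos) {x y : ℕ} (hxy : I x y ∨ D x y) :
    y ∈ boundaryOrder B L T R := by
  rw [mem_boundaryOrder]
  rcases hxy with hxy | hxy
  · have := h.inc_ends x y hxy; tauto
  · have := h.dec_ends x y hxy; tauto

theorem ne_of_joined (h : BoxPattern B L T R I D pos) {x y : ℕ} (hxy : I x y ∨ D x y) : x ≠ y := by
  rintro rfl
  rcases hxy with hxy | hxy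
  · have := h.inc_ends x x hxy; tauto
  · have := h.dec_ends x x hxy; tauto

theorem pre_or_post (h : BoxPattern B L T R I D pos)
    (hW : boundaryOrder B L T R = pre ++ z :: post) {y : ℕ} (hzy : I z y ∨ D z y) :
    y ∈ pre ∨ y ∈ post := by
  have h1 := h.mem_of_joined hzy
  rw [hW, List.mem_append, List.mem_cons] at h1
  have := h.ne_of_joined hzy
  tauto

theorem pairwise (h : BoxPattern B L T R I D pos) (hW : boundaryOrder B L T R = pre ++ z :: post) :
    (pre ++ z :: post).Pairwise fun x y => pos x < pos y := hW ▸ h.order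

/-- The partners of the points of the left edge come later. -/
theorem left_post (h : BoxPattern B L T R I D pos) (hW : boundaryOrder B L T R = pre ++ z :: post)
    (hz : z ∈ L) (hpre : ∀ x ∈ pre, x ∈ L) {y : ℕ} (hzy : I z y ∨ D z y) : y ∈ post := by
  refine (h.pre_or_post hW hzy).resolve_left fun hy => ?_
  have hy := hpre y hy
  rcases hzy with hzy | hzy
  · have := h.inc_ends z y hzy; tauto
  · have := h.dec_ends z y hzy; tauto

/-- The partners of the points of the lower edge with increasing arcs come later. -/
theorem bottom_inc_post (h : BoxPattern B L T R I D pos)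
    (hW : boundaryOrder B L T R = pre ++ z :: post) (hz : z ∈ B) (hpre : ∀ x ∈ pre, x ∈ L ∨ x ∈ B)
    {y : ℕ} (hzy : I z y) : y ∈ post := by
  refine (h.pre_or_post hW (Or.inl hzy)).resolve_left fun hy => ?_
  have hy := hpre y hy
  have := h.inc_ends z y hzy
  tauto

theorem stackTag_eq_two_iff {x : ℕ} : stackTag L I x = 2 ↔ x ∈ L ∧ ¬ ∃ y, I x y := by
  unfold stackTag
  split_ifs <;> simp_all

theorem stackTag_eq_one_iff {x : ℕ} : stackTag L I x = 1 ↔ ∃ y, I x y := by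
  unfold stackTag
  split_ifs <;> simp_all

/-- A decreasing arc from the lower edge ends at the topmost stored point if and only if that point
is the end of a decreasing arc on the left edge. -/
theorem bottom_dec_pre_iff (h : BoxPattern B L T R I D pos)
    (hW : boundaryOrder B L T R = pre ++ z :: post) (hz : z ∈ B) (hpre : ∀ x ∈ pre, x ∈ L ∨ x ∈ B)
    {y : ℕ} (hzy : D z y) :
    y ∈ pre ↔ ∃ u l, pending (fun x y => I x y ∨ D x y) pre (z :: post) = u :: l ∧
      stackTag L I u = 2 := by
  have hP := h.pairwise hW
  have hends := h.dec_ends z y hzy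
  constructor
  · intro hy
    refine ⟨y, _, pending_pop h.matching hP (Or.inr hzy) hy, ?_⟩
    rw [stackTag_eq_two_iff]
    have h1 := hpre y hy
    refine ⟨by tauto, fun ⟨v, hv⟩ => h.not_both y v z hv (h.dec_symm _ _ hzy)⟩
  · rintro ⟨u, l, hul, htag⟩
    -- Suppose the partner `y` of `z` comes later. The top `u` of the stack has its partner `v` on
    -- the lower or right edge. Since the pairs do not cross, `y` precedes `v`; but `y` is on the
    -- left edge, which is already behind, or on the upper edge, which comes after `v`.
    refine (h.pre_or_post hW (Or.inr hzy)).resolve_right fun hy => ?_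
    rw [stackTag_eq_two_iff] at htag
    have hu : u ∈ pending (fun x y => I x y ∨ D x y) pre (z :: post) := by rw [hul]; simp
    obtain ⟨hup, v, hv, huv⟩ := mem_pending.1 hu
    have huv : D u v := huv.resolve_left fun h' => htag.2 ⟨v, h'⟩
    have hvz : v ≠ z := by
      rintro rfl
      have := h.unique v u y (Or.inr (h.dec_symm _ _ huv)) (Or.inr hzy)
      subst this
      exact lt_asymm (lt_of_mem_pre hP hup) (lt_of_mem_post hP hy)
    have hv : v ∈ post := (List.mem_cons.1 hv).resolve_left hvz
    have hn := h.noncrossing u v z y (Or.inr huv) (Or.inr hzy) (lt_of_mem_pre hP hup)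
      (lt_of_mem_post hP hv)
    have e1 := h.dec_ends u v huv
    have hvB : (v ∈ B ∨ v ∈ R) ∧ v ∉ L := by
      rcases e1 with ⟨-, -, -, e, e', -⟩ | ⟨-, -, -, -, e, -⟩
      · exact ⟨e, e'⟩
      · exact (e htag.1).elim
    have hyT : (y ∈ L ∨ y ∈ T) ∧ y ∉ R := by
      rcases hends with ⟨-, e, -⟩ | ⟨e, -, e', -⟩
      · exact (e hz).elim
      · exact ⟨e, e'⟩
    have hzL : z ∉ L := by
      rcases hends with ⟨-, e, -⟩ | ⟨-, -, -, -, e, -⟩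
      · exact (e hz).elim
      · exact e
    clear e1 hends
    have hord := h.order
    rw [List.pairwise_append, List.pairwise_append, List.pairwise_append] at hord
    obtain ⟨-, ⟨-, ⟨-, -, o1⟩, o2⟩, o3⟩ := hord
    simp only [List.mem_append, List.mem_reverse, List.mem_filter, decide_eq_true_eq] at o1 o2 o3
    by_cases hyL : y ∈ L
    · exact lt_asymm (o3 y hyL z (Or.inl ⟨hz, hzL⟩)) (lt_of_mem_post hP hy)
    · have hyT' : y ∈ T ∧ y ∉ L ∧ y ∉ R := by tauto
      by_cases hvB' : v ∈ B
      · exact lt_asymm hn.2 (o2 v ⟨hvB', hvB.2⟩ y (Or.inr hyT'))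
      · exact lt_asymm hn.2 (o1 v (by tauto) y hyT')

/-- The partners of the points inside the upper edge come before the upper edge. -/
theorem top_pre (h : BoxPattern B L T R I D pos) (hW : boundaryOrder B L T R = pre ++ z :: post)
    (hz : z ∈ T) (hpost : ∀ x ∈ post, x ∈ T) {y : ℕ} (hzy : I z y ∨ D z y) : y ∈ pre := by
  refine (h.pre_or_post hW hzy).resolve_right fun hy => ?_
  have hy := hpost y hy
  rcases hzy with hzy | hzy
  · have := h.inc_ends z y hzy; tauto
  · have := h.dec_ends z y hzy; tauto

/-- Only corners can be unmatched; each alternative in the hypothesis describes a point on one edge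
that is no corner. -/
theorem exists_join_of_notMem (h : BoxPattern B L T R I D pos) {x : ℕ}
    (hx : x ∈ T ∧ x ∉ L ∧ x ∉ R ∨ x ∈ R ∧ x ∉ B ∧ x ∉ T ∨ x ∈ B ∧ x ∉ L ∧ x ∉ R ∨
      x ∈ L ∧ x ∉ B ∧ x ∉ T) : ∃ y, I x y ∨ D x y := by
  have h1 := h.disjoint_LR x
  have h2 := h.disjoint_BT x
  have := h.exists_join x (by tauto) (by grind) (by grind)
  rcases this with ⟨y, hy⟩ | ⟨y, hy⟩
  · exact ⟨y, Or.inl hy⟩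
  · exact ⟨y, Or.inr hy⟩

section right

variable {l₁ l₂ : List ℕ}

open Classical in
/-- The numbers of points that are compared on the right edge. -/
theorem right_count (h : BoxPattern B L T R I D pos) (hR : R = l₁ ++ z :: l₂) :
    (T.filter fun x => x ∉ L ∧ x ∉ R).length + (z :: l₂).length +
      (if ∃ x ∈ T, x ∈ L then 1 else 0) = T.length + ((z :: l₂).filter fun x => x ∉ T).length := by
  have c1 := length_filter_add_of_unique h.nodup_top (· ∈ L) (fun x hx y hy hxL hyL => by
    obtain ⟨⟨l, e⟩, -⟩ := h.corner_TL x hx hxL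
    obtain ⟨⟨l', e'⟩, -⟩ := h.corner_TL y hy hyL
    rw [e] at e'
    exact (List.cons.inj e').1)
  have last : ∀ x ∈ T, ∀ y ∈ T, x ∈ R → y ∈ R → x = y := fun x hx y hy hxR hyR => by
    obtain ⟨⟨l, e⟩, -⟩ := h.corner_TR x hx hxR
    obtain ⟨⟨l', e'⟩, -⟩ := h.corner_TR y hy hyR
    rw [e] at e'
    have := (List.append_inj' e' rfl).2
    simpa using this
  have c2 := length_filter_add_of_unique (h.nodup_top.filter fun x => x ∉ L) (· ∈ R)
    (fun x hx y hy => last x (List.mem_filter.1 hx).1 y (List.mem_filter.1 hy).1)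
  rw [List.filter_filter] at c2
  have hnd : (z :: l₂).Nodup := by
    have := h.nodup_right
    rw [hR] at this
    exact (List.nodup_append.1 this).2.1
  have c3 := length_filter_add_of_unique hnd (· ∈ T) (fun x hx y hy hxT hyT =>
    last x hxT y hyT (by rw [hR]; simp_all) (by rw [hR]; simp_all))
  -- A marked upper right corner is the last point of the right edge, so it is among the remaining
  -- points `z :: l₂` and is counted on both sides of the identity.
  have e1 : (∃ x ∈ z :: l₂, x ∈ T) ↔ ∃ x ∈ T.filter (fun x => x ∉ L), x ∈ R := by
    constructor
    · rintro ⟨x, hx, hxT⟩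
      have hxR : x ∈ R := by rw [hR]; simp_all
      refine ⟨x, List.mem_filter.2 ⟨hxT, ?_⟩, hxR⟩
      simpa using fun hL => h.disjoint_LR x hL hxR
    · rintro ⟨x, hx, hxR⟩
      have hxT := (List.mem_filter.1 hx).1
      refine ⟨x, ?_, hxT⟩
      obtain ⟨-, l, e⟩ := h.corner_TR x hxT hxR
      have : (l₁ ++ z :: l₂).getLast? = (l ++ [x]).getLast? := by rw [← hR, ← e]
      rw [List.getLast?_append_cons, List.getLast?_concat] at this
      exact List.mem_of_getLast? this
  have e2 : (T.filter fun x => decide (x ∉ R) && decide (x ∉ L)) =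
      T.filter fun x => x ∉ L ∧ x ∉ R := List.filter_congr fun x _ => by
    simp [Bool.and_comm]
  rw [e2] at c2
  have e3 : (if ∃ x ∈ z :: l₂, x ∈ T then 1 else 0) =
      if ∃ x ∈ T.filter (fun x => x ∉ L), x ∈ R then 1 else 0 := by simp only [e1]
  omega

theorem nodup_pending (h : BoxPattern B L T R I D pos)
    (hW : boundaryOrder B L T R = pre ++ z :: post) (m : List ℕ) :
    (pending (fun x y => I x y ∨ D x y) pre m).Nodup := by
  have h1 := (List.pairwise_append.1 (h.pairwise hW)).1
  have h2 : pre.Nodup := h1.imp fun h => by rintro rfl; exact lt_irrefl _ h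
  exact List.nodup_reverse.2 (h2.filter _)

open Classical in
/-- If the partner of a point of the right edge is stored, then the stored points and the remaining
points of the right edge are more than the points of the upper edge. -/
theorem right_pop_lt (h : BoxPattern B L T R I D pos)
    (hW : boundaryOrder B L T R = pre ++ z :: post) (hR : R = l₁ ++ z :: l₂)
    (hpost : ∀ x, x ∈ post ↔ x ∈ l₂ ∨ x ∈ T ∧ x ∉ L ∧ x ∉ R) {y : ℕ} (hzy : I z y ∨ D z y)
    (hy : y ∈ pre) :
    T.length < (pending (fun x y => I x y ∨ D x y) pre (z :: post)).length + (z :: l₂).length +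
      (if ∃ x ∈ T, x ∈ L then 1 else 0) := by
  have hP := h.pairwise hW
  have hc := h.right_count hR
  have hpop := pending_pop h.matching hP hzy hy
  -- Every point inside the upper edge has a partner, and it is stored after the pop or remains on
  -- the right edge. As the pop has removed one more stored point, which belongs to `z`, the
  -- inequality becomes strict.
  have hle : (T.filter fun x => x ∉ L ∧ x ∉ R).length ≤
      (pending (fun x y => I x y ∨ D x y) (pre ++ [z]) post ++ l₂.filter fun x => x ∉ T).length := by
    refine h.matching.length_le (h.nodup_top.filter _) fun w hw => ?_
    simp only [List.mem_filter, decide_eq_true_eq] at hw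
    obtain ⟨v, hv⟩ := h.exists_join_of_notMem (x := w) (by tauto)
    refine ⟨v, ?_, hv⟩
    have hwp : w ∈ post := (hpost w).2 (Or.inr hw)
    have hvT : v ∉ T := fun hvT => by
      rcases hv with hv | hv
      · have := h.inc_ends w v hv; tauto
      · have := h.dec_ends w v hv; tauto
    have hvz : v ≠ z := by
      rintro rfl
      have := h.unique v w y (h.matching.symm _ _ hv) hzy
      subst this
      exact lt_asymm (lt_of_mem_pre hP hy) (lt_of_mem_post hP hwp)
    have hvm := h.mem_of_joined hv
    rw [hW, List.mem_append, List.mem_cons, hpost] at hvm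
    rw [List.mem_append, mem_pending, List.mem_filter]
    rcases hvm with hvm | hvm | hvm | hvm
    · exact Or.inl ⟨by simp [hvm], w, hwp, h.matching.symm _ _ hv⟩
    · exact (hvz hvm).elim
    · exact Or.inr ⟨hvm, by simpa using hvT⟩
    · exact (hvT hvm.1).elim
  rw [hpop]
  rw [List.length_append] at hle
  have hf : (l₂.filter fun x => x ∉ T).length ≤ ((z :: l₂).filter fun x => x ∉ T).length :=
    ((List.sublist_cons_self z l₂).filter _).length_le
  simp only [List.length_cons] at *
  omega

open Classical in
/-- If no partner of a point of the right edge is stored, then the stored points and the remaining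
points of the right edge are at most as many as the points of the upper edge. -/
theorem right_not_pop_le (h : BoxPattern B L T R I D pos)
    (hW : boundaryOrder B L T R = pre ++ z :: post) (hR : R = l₁ ++ z :: l₂) (hzB : z ∉ B)
    (hpost : post = l₂ ++ (T.filter fun x => x ∉ L ∧ x ∉ R).reverse)
    (hl₂ : ∀ x ∈ l₂, x ∉ B) (hno : ∀ y ∈ pre, ¬ (I z y ∨ D z y)) :
    (pending (fun x y => I x y ∨ D x y) pre (z :: post)).length + (z :: l₂).length +
      (if ∃ x ∈ T, x ∈ L then 1 else 0) ≤ T.length := by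
  have hP := h.pairwise hW
  have hc := h.right_count hR
  have hzR : z ∈ R := by rw [hR]; simp
  have hl₂R : ∀ x ∈ l₂, x ∈ R := fun x hx => by rw [hR]; simp [hx]
  have mpost : ∀ x, x ∈ post ↔ x ∈ l₂ ∨ x ∈ T ∧ x ∉ L ∧ x ∉ R := by
    intro x; rw [hpost]; simp
  have hPl : ∀ x ∈ l₂, ∀ w, w ∈ T → w ∉ L → w ∉ R → pos x < pos w := by
    intro x hx w h1 h2 h3
    have := (List.pairwise_append.1 hP).2.1
    rw [List.pairwise_cons, hpost, List.pairwise_append] at this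
    exact this.2.2.2 x hx w (by simp [h1, h2, h3])
  have hnd : (pending (fun x y => I x y ∨ D x y) pre (z :: post) ++
      (z :: l₂).filter fun x => x ∉ T).Nodup := by
    refine List.nodup_append.2 ⟨h.nodup_pending hW _, ?_, ?_⟩
    · have := h.nodup_right
      rw [hR] at this
      exact (List.nodup_append.1 this).2.1.filter _
    · intro a ha b hb
      rintro rfl
      have h1 := (mem_pending.1 ha).1
      have h2 := (List.mem_filter.1 hb).1
      rcases List.mem_cons.1 h2 with rfl | h2
      · exact lt_irrefl _ (lt_of_mem_pre hP h1)
      · exact lt_asymm (lt_of_mem_pre hP h1) (lt_of_mem_post hP ((mpost a).2 (Or.inl h2)))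
  -- Conversely every stored point and every remaining point of the right edge, except a corner, is
  -- matched into the inside of the upper edge: the arc of `z` goes there and the other arcs must
  -- not cross it.
  have hle : (pending (fun x y => I x y ∨ D x y) pre (z :: post) ++
      (z :: l₂).filter fun x => x ∉ T).length ≤ (T.filter fun x => x ∉ L ∧ x ∉ R).length := by
    refine h.matching.length_le hnd fun x hx => ?_
    simp only [List.mem_append, mem_pending, List.mem_filter, decide_eq_true_eq] at hx ⊢
    by_cases hzT : z ∈ T
    -- If `z` is the upper right corner it is the last point of its edge and itself not counted;
    -- only the stored points have to be considered.
    · have hl : l₂ = [] := by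
        obtain ⟨-, l, e⟩ := h.corner_TR z hzT hzR
        have hn := h.nodup_right
        have h1 : (l₁ ++ z :: l₂).getLast? = (l ++ [z]).getLast? := by rw [← hR, ← e]
        rw [List.getLast?_append_cons, List.getLast?_concat] at h1
        rw [hR] at hn
        have h2 := (List.nodup_cons.1 (List.nodup_append.1 hn).2.1).1
        cases l₂ with
        | nil => rfl
        | cons a l =>
          rw [List.getLast?_cons_cons] at h1
          exact (h2 (List.mem_of_getLast? h1)).elim
      subst hl
      rcases hx with ⟨hx, u, hu, hxu⟩ | ⟨hx, hxT⟩
      · rw [List.mem_cons, mpost] at hu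
        rcases hu with rfl | hu | hu
        · exact (hno x hx (h.matching.symm _ _ hxu)).elim
        · simp at hu
        · exact ⟨u, hu, hxu⟩
      · simp only [List.mem_singleton] at hx
        subst hx
        exact (hxT hzT).elim
    · obtain ⟨w, hw⟩ := h.exists_join_of_notMem (x := z) (by tauto)
      have hwp : w ∈ post := (h.pre_or_post hW hw).resolve_left fun h' => hno w h' hw
      have hwT : w ∈ T ∧ w ∉ L ∧ w ∉ R := by
        rcases (mpost w).1 hwp with hw' | hw'
        · have hwR := hl₂R w hw'
          rcases hw with hw | hw
          · have := h.inc_ends z w hw; tauto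
          · have := h.dec_ends z w hw; tauto
        · exact hw'
      have hzw := lt_of_mem_post hP hwp
      rcases hx with ⟨hx, u, hu, hxu⟩ | ⟨hx, hxT⟩
      · rw [List.mem_cons, mpost] at hu
        rcases hu with rfl | hu | hu
        · exact (hno x hx (h.matching.symm _ _ hxu)).elim
        · have h1 := h.noncrossing x u z w hxu hw (lt_of_mem_pre hP hx)
            (lt_of_mem_post hP ((mpost u).2 (Or.inl hu)))
          exact (lt_asymm h1.2 (hPl u hu w hwT.1 hwT.2.1 hwT.2.2)).elim
        · exact ⟨u, hu, hxu⟩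
      · rcases List.mem_cons.1 hx with rfl | hx
        · exact ⟨w, hwT, hw⟩
        · have hxR := hl₂R x hx
          obtain ⟨v, hv⟩ := h.exists_join_of_notMem (x := x) (Or.inr (Or.inl ⟨hxR, hl₂ x hx, hxT⟩))
          refine ⟨v, ?_, hv⟩
          have hvm := h.mem_of_joined hv
          rw [hW, List.mem_append, List.mem_cons, mpost] at hvm
          have hvR : v ∉ R := fun hvR => by
            rcases hv with hv | hv
            · have := h.inc_ends x v hv; tauto
            · have := h.dec_ends x v hv; tauto
          rcases hvm with hvm | rfl | hvm | hvm
          · have h1 := h.noncrossing v x z w (h.matching.symm _ _ hv) hw (lt_of_mem_pre hP hvm)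
              (lt_of_mem_post hP ((mpost x).2 (Or.inl hx)))
            exact (lt_asymm h1.2 (hPl x hx w hwT.1 hwT.2.1 hwT.2.2)).elim
          · exact (hvR hzR).elim
          · exact (hvR (hl₂R v hvm)).elim
          · exact hvm
  rw [List.length_append] at hle
  simp only [List.length_cons] at *
  omega

/-- A point inside the right edge whose partner comes later is the end of a decreasing arc. -/
theorem right_push (h : BoxPattern B L T R I D pos)
    (hW : boundaryOrder B L T R = pre ++ z :: post) (hzR : z ∈ R)
    (hpost : ∀ x ∈ post, x ∈ R ∨ x ∈ T ∧ x ∉ L ∧ x ∉ R)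
    (hpre : ∀ x ∈ L, x ∈ pre) (hpre' : ∀ x ∈ B, x ∈ pre) {y : ℕ} (hy : y ∈ post)
    (hzy : I z y ∨ D z y) : D z y ∧ z ∉ T := by
  have hP := h.pairwise hW
  have h1 := hpost y hy
  have hyB : y ∉ L ∧ y ∉ B := ⟨fun h' => lt_asymm (lt_of_mem_pre hP (hpre y h'))
    (lt_of_mem_post hP hy), fun h' => lt_asymm (lt_of_mem_pre hP (hpre' y h'))
    (lt_of_mem_post hP hy)⟩
  rcases hzy with hzy | hzy
  · have := h.inc_ends z y hzy; tauto
  · have := h.dec_ends z y hzy; tauto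

end right

end BoxPattern

end FreeSpace

namespace RAM

/-! ### Reasoning about programs -/

/-- On the given input, the program halts within `T` steps in a configuration satisfying `Q`. -/
def Runs (input : List ℕ) (c : Cmd) (s : State) (T : ℕ) (Q : State → Prop) : Prop :=
  ∃ t s', Exec input c s t s' ∧ t ≤ T ∧ Q s'

/-- A bound for the running time of a program without loops. -/
def Cmd.cost : Cmd → ℕ
  | .skip => 1
  | .assign _ e => e.cost + 1
  | .store a e => a.cost + e.cost + 1
  | .emit e => e.cost + 1
  | .seq c₁ c₂ => c₁.cost + c₂.cost
  | .ite e c₁ c₂ => e.cost + 1 + (c₁.cost + c₂.cost)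
  | .loop _ _ => 0

/-- The weakest precondition of a program without loops. -/
def wp (input : List ℕ) : Cmd → (State → Prop) → State → Prop
  | .skip, Q, s => Q s
  | .assign r e, Q, s => Q { s with reg := Function.update s.reg r (e.eval input s) }
  | .store a e, Q, s =>
      Q { s with mem := Function.update s.mem (a.eval input s) (e.eval input s) }
  | .emit e, Q, s => Q { s with out := s.out ++ [e.eval input s] }
  | .seq c₁ c₂, Q, s => wp input c₁ (wp input c₂ Q) s
  | .ite e c₁ c₂, Q, s =>
      (e.eval input s ≠ 0 → wp input c₁ Q s) ∧ (e.eval input s = 0 → wp input c₂ Q s)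
  | .loop _ _, _, _ => False

variable {input : List ℕ}

/-- For programs without loops `Cmd.cost` adds the costs of both branches of a test, which bounds
the time independently of the state. The bodies of the loops are handled in this way, with constant
bounds. -/
theorem runs_of_wp {c : Cmd} {Q : State → Prop} {s : State} (h : wp input c Q s) :
    Runs input c s c.cost Q := by
  induction c generalizing s Q with
  | skip => exact ⟨_, _, Exec.skip s, le_rfl, h⟩
  | assign r e => exact ⟨_, _, Exec.assign s r e, le_rfl, h⟩
  | store a e => exact ⟨_, _, Exec.store s a e, le_rfl, h⟩
  | emit e => exact ⟨_, _, Exec.emit s e, le_rfl, h⟩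
  | seq c₁ c₂ ih₁ ih₂ =>
    obtain ⟨t, s', he, ht, h'⟩ := ih₁ h
    obtain ⟨t', s'', he', ht', h''⟩ := ih₂ h'
    exact ⟨_, _, Exec.seq he he', add_le_add ht ht', h''⟩
  | ite e c₁ c₂ ih₁ ih₂ =>
    by_cases hb : e.eval input s = 0
    · obtain ⟨t, s', he, ht, h'⟩ := ih₂ (h.2 hb)
      exact ⟨_, _, Exec.ite_false hb he, by simp only [Cmd.cost]; omega, h'⟩
    · obtain ⟨t, s', he, ht, h'⟩ := ih₁ (h.1 hb)
      exact ⟨_, _, Exec.ite_true hb he, by simp only [Cmd.cost]; omega, h'⟩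
  | loop e c => exact h.elim

theorem wp_mono {c : Cmd} {Q Q' : State → Prop} (hQ : ∀ s, Q s → Q' s) {s : State}
    (h : wp input c Q s) : wp input c Q' s := by
  induction c generalizing s Q Q' with
  | skip => exact hQ _ h
  | assign r e => exact hQ _ h
  | store a e => exact hQ _ h
  | emit e => exact hQ _ h
  | seq c₁ c₂ ih₁ ih₂ => exact ih₁ (fun s' h' => ih₂ hQ h') h
  | ite e c₁ c₂ ih₁ ih₂ => exact ⟨fun hb => ih₁ hQ (h.1 hb), fun hb => ih₂ hQ (h.2 hb)⟩
  | loop e c => exact h.elim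

theorem Runs.seq {c₁ c₂ : Cmd} {s : State} {T₁ T₂ : ℕ} {P Q : State → Prop}
    (h₁ : Runs input c₁ s T₁ P) (h₂ : ∀ s', P s' → Runs input c₂ s' T₂ Q) :
    Runs input (.seq c₁ c₂) s (T₁ + T₂) Q := by
  obtain ⟨t, s', he, ht, h'⟩ := h₁
  obtain ⟨t', s'', he', ht', h''⟩ := h₂ s' h'
  exact ⟨_, _, Exec.seq he he', add_le_add ht ht', h''⟩

theorem Runs.mono {c : Cmd} {s : State} {T T' : ℕ} {P Q : State → Prop} (h : Runs input c s T P)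
    (hT : T ≤ T') (hQ : ∀ s', P s' → Q s') : Runs input c s T' Q := by
  obtain ⟨t, s', he, ht, h'⟩ := h
  exact ⟨t, s', he, ht.trans hT, hQ _ h'⟩

/-- A loop that processes the elements of a list one after the other. -/
theorem runs_loop {α : Type*} {e : Expr} {c : Cmd} (l : List α) (T : α → ℕ)
    (P : List α → List α → State → Prop)
    (hstep : ∀ l₁ x l₂, l = l₁ ++ x :: l₂ → ∀ s, P l₁ (x :: l₂) s →
      e.eval input s ≠ 0 ∧ Runs input c s (T x) (P (l₁ ++ [x]) l₂))
    (hend : ∀ s, P l [] s → e.eval input s = 0) {s : State} (hs : P [] l s) :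
    Runs input (.loop e c) s ((l.map fun x => e.cost + 1 + T x).sum + (e.cost + 1)) (P l []) := by
  suffices h : ∀ l₂ l₁, l = l₁ ++ l₂ → ∀ s, P l₁ l₂ s → Runs input (.loop e c) s
      ((l₂.map fun x => e.cost + 1 + T x).sum + (e.cost + 1)) (P l []) from h l [] rfl s hs
  intro l₂
  induction l₂ with
  | nil =>
    intro l₁ h s hs
    rw [List.append_nil] at h
    subst h
    exact ⟨_, _, Exec.loop_done (hend s hs), by simp, hs⟩
  | cons x l₂ ih =>
    intro l₁ h s hs
    obtain ⟨h0, t, s', he, ht, h'⟩ := hstep l₁ x l₂ h s hs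
    obtain ⟨t', s'', he', ht', h''⟩ := ih (l₁ ++ [x]) (by simp [h]) s' h'
    refine ⟨_, _, Exec.loop_step h0 he he', ?_, h''⟩
    simp only [List.map_cons, List.sum_cons]
    omega

/-! ### Auxiliary expressions and a stack -/

/-- Nonzero if and only if the values differ. -/
def neq (a b : Expr) : Expr := .plus (.minus a b) (.minus b a)

/-- Six times the value. -/
def six (e : Expr) : Expr := .plus (.plus (.plus e e) (.plus e e)) (.plus e e)

/-- Nonzero if and only if the value is one. -/
def isOne (e : Expr) : Expr := .minus (.const 1) (neq e (.const 1))

theorem eval_neq {a b : Expr} {s : State} :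
    (neq a b).eval input s = 0 ↔ a.eval input s = b.eval input s := by
  simp only [neq, Expr.eval]; omega

theorem eval_six {e : Expr} {s : State} : (six e).eval input s = 6 * e.eval input s := by
  simp only [six, Expr.eval]; omega

theorem eval_isOne {e : Expr} {s : State} :
    (isOne e).eval input s = 0 ↔ e.eval input s ≠ 1 := by
  simp only [isOne, neq, Expr.eval]; omega

/-- The content of the memory cells that represent a stack of pairs, the top of which is the head of
the list. -/
def StackAt (mem : ℕ → ℕ) : List (ℕ × ℕ) → Prop
  | [] => mem 5 = 0
  | p :: st => mem (6 * (st.length + 1) + 4) = p.1 ∧ mem (6 * (st.length + 1) + 5) = p.2 ∧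
      StackAt mem st

/-- The memory is laid out in blocks of six: the cells `6 * z + κ` with `κ < 4` hold the flags of
the point `z`, and the cells `6 * i + 4` and `6 * i + 5` hold the `i`-th stack entry. The residues
keep the two uses apart. Entries are counted from one, so that cell `5` stays zero and marks the
empty stack. -/
theorem StackAt.congr {mem mem' : ℕ → ℕ} {st : List (ℕ × ℕ)} (h : StackAt mem st)
    (hm : ∀ i ≤ st.length, mem' (6 * i + 4) = mem (6 * i + 4) ∧ mem' (6 * i + 5) = mem (6 * i + 5)) :
    StackAt mem' st := by
  induction st with
  | nil => exact (hm 0 le_rfl).2.trans h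
  | cons p st ih =>
    have := hm (st.length + 1) (by simp)
    exact ⟨this.1.trans h.1, this.2.trans h.2.1, ih h.2.2 fun i hi => hm i (by simp; omega)⟩

/-- The configuration holds a stack, has written the output `out`, and the memory holds the values
of the predicates `val κ` for those arguments that satisfy `known κ`. -/
structure Holds (val known : ℕ → ℕ → Prop) (st : List (ℕ × ℕ)) (out : List ℕ) (s : State) :
    Prop where
  height : s.reg 0 = st.length
  stack : StackAt s.mem st
  slot : ∀ κ z, known κ z → κ < 4 ∧ (s.mem (6 * z + κ) ≠ 0 ↔ val κ z)
  output : s.out = out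

variable {val known : ℕ → ℕ → Prop} {st : List (ℕ × ℕ)} {out : List ℕ} {s s' : State}

theorem Holds.congr (h : Holds val known st out s) (h0 : s'.reg 0 = s.reg 0) (hm : s'.mem = s.mem)
    (ho : s'.out = s.out) : Holds val known st out s' :=
  ⟨h0.trans h.height, by rw [hm]; exact h.stack, by rw [hm]; exact h.slot, ho.trans h.output⟩

theorem Holds.mono {known' : ℕ → ℕ → Prop} (h : Holds val known st out s)
    (hk : ∀ κ z, known' κ z → known κ z) : Holds val known' st out s :=
  ⟨h.height, h.stack, fun κ z hz => h.slot κ z (hk κ z hz), h.output⟩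

/-- Push the point in register `2` with the tag in register `5`. -/
def push : Cmd :=
  .seq (.assign 0 (.plus (.reg 0) (.const 1)))
    (.seq (.store (.plus (six (.reg 0)) (.const 4)) (.reg 2))
      (.store (.plus (six (.reg 0)) (.const 5)) (.reg 5)))

/-- Pop a point and write the number of the subcell, this point and the point in register `2` to the
output. -/
def popEmit : Cmd :=
  .seq (.assign 4 (.mem (.plus (six (.reg 0)) (.const 4))))
    (.seq (.assign 5 (.mem (.plus (six (.reg 0)) (.const 5))))
      (.seq (.assign 0 (.minus (.reg 0) (.const 1)))
        (.seq (.emit (.reg 6)) (.seq (.emit (.reg 4)) (.emit (.reg 2))))))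

/-- Store, for the point in register `2`, whether the two values are both zero or both nonzero. -/
def storeIff (κ : ℕ) (a b : Expr) : Cmd :=
  .ite a
    (.ite b (.store (.plus (six (.reg 2)) (.const κ)) (.const 1))
      (.store (.plus (six (.reg 2)) (.const κ)) (.const 0)))
    (.ite b (.store (.plus (six (.reg 2)) (.const κ)) (.const 0))
      (.store (.plus (six (.reg 2)) (.const κ)) (.const 1)))

theorem wp_push {Q : State → Prop} (h : Holds val known st out s)
    (hQ : ∀ s', (∀ r, r ≠ 0 → s'.reg r = s.reg r) →
      Holds val known ((s.reg 2, s.reg 5) :: st) out s' → Q s') : wp input push Q s := by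
  simp only [push, wp, Expr.eval, eval_six]
  refine hQ _ (fun r hr => by simp [hr]) ⟨?_, ⟨?_, ?_, ?_⟩, ?_, ?_⟩
  · simp [h.height]
  · simp [h.height]
  · simp [h.height]
  · refine h.stack.congr fun i hi => ?_
    have h1 : 6 * i + 4 ≠ 6 * (st.length + 1) + 4 := by omega
    have h2 : 6 * i + 4 ≠ 6 * (st.length + 1) + 5 := by omega
    have h3 : 6 * i + 5 ≠ 6 * (st.length + 1) + 4 := by omega
    have h4 : 6 * i + 5 ≠ 6 * (st.length + 1) + 5 := by omega
    simp only [Function.update_apply, h.height, if_true, h1, h2, h3, h4, if_false, and_self]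
  · intro κ z hk
    obtain ⟨hκ, hv⟩ := h.slot κ z hk
    have h1 : 6 * z + κ ≠ 6 * (st.length + 1) + 4 := by omega
    have h2 : 6 * z + κ ≠ 6 * (st.length + 1) + 5 := by omega
    refine ⟨hκ, ?_⟩
    simp only [Function.update_apply, h.height, if_true, h1, h2, if_false]
    exact hv
  · exact h.output

theorem wp_popEmit {Q : State → Prop} {p : ℕ × ℕ} (h : Holds val known (p :: st) out s)
    (hQ : ∀ s', (∀ r, r ≠ 0 → r ≠ 4 → r ≠ 5 → s'.reg r = s.reg r) → s'.reg 5 = p.2 →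
      Holds val known st (out ++ [s.reg 6, p.1, s.reg 2]) s' → Q s') : wp input popEmit Q s := by
  simp only [popEmit, wp, Expr.eval, eval_six]
  have hh : s.reg 0 = st.length + 1 := h.height
  refine hQ _ (fun r h0 h4 h5 => by simp [h0, h4, h5]) ?_ ⟨?_, h.stack.2.2, h.slot, ?_⟩
  · simp [hh, h.stack.2.1]
  · simp [hh]
  · simp [hh, h.stack.1, h.output]

/-- The written cell has residue `κ < 4` modulo six, so it meets neither the stack nor the flag of
another point or of another kind. -/
theorem wp_storeIff {Q : State → Prop} {κ : ℕ} {a b : Expr} (h : Holds val known st out s)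
    (hκ : κ < 4)
    (hv : val κ (s.reg 2) ↔ (a.eval input s ≠ 0 ↔ b.eval input s ≠ 0))
    (hQ : ∀ s', s'.reg = s.reg →
      Holds val (fun κ' z => known κ' z ∨ κ' = κ ∧ z = s.reg 2) st out s' → Q s') :
    wp input (storeIff κ a b) Q s := by
  have main : ∀ v : ℕ, (v ≠ 0 ↔ val κ (s.reg 2)) →
      Q { s with mem := Function.update s.mem (6 * s.reg 2 + κ) v } := by
    intro v hv
    refine hQ _ rfl ⟨h.height, h.stack.congr fun i hi => ?_, ?_, h.output⟩
    · have h1 : 6 * i + 4 ≠ 6 * s.reg 2 + κ := by omega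
      have h2 : 6 * i + 5 ≠ 6 * s.reg 2 + κ := by omega
      simp only [Function.update_apply, h1, h2, if_false, and_self]
    · intro κ' z hk
      simp only [Function.update_apply]
      rcases hk with hk | ⟨rfl, rfl⟩
      · obtain ⟨hκ', hv'⟩ := h.slot κ' z hk
        refine ⟨hκ', ?_⟩
        split_ifs with he
        · have h1 : κ' = κ := by omega
          have h2 : z = s.reg 2 := by omega
          rw [h1, h2]
          exact hv
        · exact hv'
      · exact ⟨hκ, by simpa using hv⟩
  simp only [storeIff, wp, Expr.eval, eval_six]
  refine ⟨fun h1 => ⟨fun h2 => main 1 ?_, fun h2 => main 0 ?_⟩,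
    fun h1 => ⟨fun h2 => main 0 ?_, fun h2 => main 1 ?_⟩⟩ <;> rw [hv] <;> simp [h1, h2]

/-- No separate test for emptiness is needed: below the first entry the tag that is read is the
sentinel `0`. -/
theorem Holds.top_tag (h : Holds val known st out s) :
    s.mem (6 * s.reg 0 + 5) = 2 ↔ ∃ p l, st = p :: l ∧ p.2 = 2 := by
  rw [h.height]
  cases st with
  | nil => simp [show s.mem 5 = 0 from h.stack]
  | cons p st => simp [h.stack.2.1]

theorem wp_seq {c₁ c₂ : Cmd} {Q : State → Prop} (P : State → Prop) (h₁ : wp input c₁ P s)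
    (h₂ : ∀ s', P s' → wp input c₂ Q s') : wp input (.seq c₁ c₂) Q s :=
  wp_mono h₂ h₁

theorem wp_ite {e : Expr} {c₁ c₂ : Cmd} {Q : State → Prop}
    (h₁ : e.eval input s ≠ 0 → wp input c₁ Q s) (h₂ : e.eval input s = 0 → wp input c₂ Q s) :
    wp input (.ite e c₁ c₂) Q s := ⟨h₁, h₂⟩

/-- The configurations `s` and `s'` differ at most in the register `r`. -/
structure EqExcept (r : ℕ) (s s' : State) : Prop where
  reg : ∀ i, i ≠ r → s'.reg i = s.reg i
  mem : s'.mem = s.mem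
  out : s'.out = s.out

theorem wp_assign {r : ℕ} {e : Expr} {Q : State → Prop}
    (hQ : ∀ s', EqExcept r s s' → s'.reg r = e.eval input s → Q s') :
    wp input (.assign r e) Q s :=
  hQ _ ⟨fun i hi => by simp [hi], rfl, rfl⟩ (by simp)

theorem wp_assign_seq {r : ℕ} {e : Expr} {c : Cmd} {Q : State → Prop}
    (hQ : ∀ s', EqExcept r s s' → s'.reg r = e.eval input s → wp input c Q s') :
    wp input (.seq (.assign r e) c) Q s :=
  wp_assign hQ

theorem Holds.eqExcept {r : ℕ} (h : Holds val known st out s) (he : EqExcept r s s') (hr : r ≠ 0) :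
    Holds val known st out s' :=
  h.congr (he.reg 0 hr.symm) he.mem he.out

end RAM

/-! ### Records in the input and the invariant of the traversal -/

namespace FreeSpace

open RAM

/-- The list `l` stands in the input from the position `p` on. -/
def SegAt (input : List ℕ) (p : ℕ) (l : List ℕ) : Prop :=
  ∀ l₁ x l₂, l = l₁ ++ x :: l₂ → input.getD (p + l₁.length) 0 = x

theorem segAt_of_append {u l v : List ℕ} : SegAt (u ++ l ++ v) u.length l := by
  rintro l₁ x l₂ rfl
  rw [List.append_assoc, List.getD_append_right _ _ _ _ (by omega), List.append_assoc,
    List.getD_append_right _ _ _ _ (by omega)]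
  simp

theorem forall₂_split {α β : Type*} {P : α → β → Prop} {l : List α} {m : List β}
    (h : List.Forall₂ P l m) {l₁ l₂ : List α} {x : α} (hl : l = l₁ ++ x :: l₂) :
    ∃ m₁ v m₂, m = m₁ ++ v :: m₂ ∧ m₁.length = l₁.length ∧ P x v := by
  induction l₁ generalizing l m with
  | nil =>
    subst hl
    obtain ⟨v, m', hv, -, rfl⟩ := List.forall₂_cons_left_iff.1 h
    exact ⟨[], v, m', rfl, rfl, hv⟩
  | cons a l₁ ih =>
    subst hl
    obtain ⟨v, m', hv, hm, rfl⟩ := List.forall₂_cons_left_iff.1 h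
    obtain ⟨m₁, w, m₂, rfl, hlen, hw⟩ := ih hm rfl
    exact ⟨v :: m₁, w, m₂, rfl, by simp [hlen], hw⟩

/-- A slope list runs parallel to the list of points, so the slope is read at the index of the
point. -/
theorem SegAt.code {input : List ℕ} {p : ℕ} {P : ℕ → ℕ → Prop} {l m : List ℕ} (h : SegAt input p m)
    (hf : List.Forall₂ P l m) {l₁ l₂ : List ℕ} {x : ℕ} (hl : l = l₁ ++ x :: l₂) :
    P x (input.getD (p + l₁.length) 0) := by
  obtain ⟨m₁, v, m₂, rfl, hlen, hv⟩ := forall₂_split hf hl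
  rw [← hlen, h m₁ v m₂ rfl]
  exact hv

/-- The record `R` stands in the input from the position `off` on. -/
structure RecordAt (input : List ℕ) (off : ℕ) (R : SubcellRecord) : Prop where
  word0 : input.getD off 0 = R.onBottom.toNat
  word1 : input.getD (off + 1) 0 = R.onLeft.toNat
  word2 : input.getD (off + 2) 0 = R.bottom.length
  word3 : input.getD (off + 3) 0 = R.left.length
  word4 : input.getD (off + 4) 0 = R.top.length
  word5 : input.getD (off + 5) 0 = R.right.length
  bottom : SegAt input (off + 6) R.bottom
  left : SegAt input (off + 6 + R.bottom.length) R.left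
  top : SegAt input (off + 6 + R.bottom.length + R.left.length) R.top
  right : SegAt input (off + 6 + R.bottom.length + R.left.length + R.top.length) R.right
  bottomSlope : SegAt input (off + 6 + R.bottom.length + R.left.length + R.top.length +
    R.right.length) R.bottomSlope
  leftSlope : SegAt input (off + 6 + R.bottom.length + R.left.length + R.top.length +
    R.right.length + R.bottomSlope.length) R.leftSlope

theorem recordAt_of_append {u v : List ℕ} {R : SubcellRecord} :
    RecordAt (u ++ R.words ++ v) u.length R := by
  have seg : ∀ (p q l : List ℕ), R.words = p ++ l ++ q →
      SegAt (u ++ R.words ++ v) (u.length + p.length) l := by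
    intro p q l h
    have := segAt_of_append (u := u ++ p) (l := l) (v := q ++ v)
    rw [h]
    simpa using this
  have word : ∀ (p q : List ℕ) (x : ℕ), R.words = p ++ [x] ++ q →
      (u ++ R.words ++ v).getD (u.length + p.length) 0 = x := by
    intro p q x h
    simpa using seg p q [x] h [] x [] rfl
  refine ⟨word [] _ _ rfl, word [_] _ _ rfl, word [_, _] _ _ rfl, word [_, _, _] _ _ rfl,
    word [_, _, _, _] _ _ rfl, word [_, _, _, _, _] _ _ rfl, ?_, ?_, ?_, ?_, ?_, ?_⟩
  · have := seg [R.onBottom.toNat, R.onLeft.toNat, R.bottom.length, R.left.length, R.top.length,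
      R.right.length] (R.left ++ R.top ++ R.right ++ R.bottomSlope ++ R.leftSlope) R.bottom
      (by simp [SubcellRecord.words])
    simpa using this
  · have := seg ([R.onBottom.toNat, R.onLeft.toNat, R.bottom.length, R.left.length, R.top.length,
      R.right.length] ++ R.bottom) (R.top ++ R.right ++ R.bottomSlope ++ R.leftSlope) R.left
      (by simp [SubcellRecord.words])
    convert this using 1
    simp; omega
  · have := seg ([R.onBottom.toNat, R.onLeft.toNat, R.bottom.length, R.left.length, R.top.length,
      R.right.length] ++ R.bottom ++ R.left) (R.right ++ R.bottomSlope ++ R.leftSlope) R.top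
      (by simp [SubcellRecord.words])
    convert this using 1
    simp; omega
  · have := seg ([R.onBottom.toNat, R.onLeft.toNat, R.bottom.length, R.left.length, R.top.length,
      R.right.length] ++ R.bottom ++ R.left ++ R.top) (R.bottomSlope ++ R.leftSlope) R.right
      (by simp [SubcellRecord.words])
    convert this using 1
    simp; omega
  · have := seg ([R.onBottom.toNat, R.onLeft.toNat, R.bottom.length, R.left.length, R.top.length,
      R.right.length] ++ R.bottom ++ R.left ++ R.top ++ R.right) R.leftSlope R.bottomSlope
      (by simp [SubcellRecord.words])
    convert this using 1
    simp; omega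
  · have := seg ([R.onBottom.toNat, R.onLeft.toNat, R.bottom.length, R.left.length, R.top.length,
      R.right.length] ++ R.bottom ++ R.left ++ R.top ++ R.right ++ R.bottomSlope) [] R.leftSlope
      (by simp [SubcellRecord.words])
    convert this using 1
    simp; omega

/-- The registers that contain the header of a record and the positions of its parts. -/
structure Header (R : SubcellRecord) (k off : ℕ) (s : State) : Prop where
  r6 : s.reg 6 = k
  r8 : s.reg 8 = R.onBottom.toNat
  r9 : s.reg 9 = R.onLeft.toNat
  r10 : s.reg 10 = R.bottom.length
  r11 : s.reg 11 = R.left.length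
  r12 : s.reg 12 = R.top.length
  r13 : s.reg 13 = R.right.length
  r14 : s.reg 14 = off + 6
  r15 : s.reg 15 = off + 6 + R.bottom.length
  r16 : s.reg 16 = off + 6 + R.bottom.length + R.left.length
  r17 : s.reg 17 = off + 6 + R.bottom.length + R.left.length + R.top.length
  r18 : s.reg 18 = off + 6 + R.bottom.length + R.left.length + R.top.length + R.right.length
  r19 : s.reg 19 = off + 6 + R.bottom.length + R.left.length + R.top.length + R.right.length +
    R.bottomSlope.length
  r20 : s.reg 20 = off + R.words.length

theorem Header.congr {R : SubcellRecord} {k off : ℕ} {s s' : State} (h : Header R k off s)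
    (hs : ∀ r, 6 ≤ r → r ≤ 20 → s'.reg r = s.reg r) : Header R k off s' := by
  constructor
  all_goals rw [hs _ (by norm_num) (by norm_num)]
  exacts [h.r6, h.r8, h.r9, h.r10, h.r11, h.r12, h.r13, h.r14, h.r15, h.r16, h.r17, h.r18, h.r19,
    h.r20]

open Classical in
/-- The registers that are fixed while a record is processed: the header, the marked points at the
four corners of the subcell, and whether there is one at the upper left corner. -/
structure Registers (R : SubcellRecord) (k off : ℕ) (s : State) : Prop
    extends Header R k off s where
  r21 : ∀ z, z + 1 = s.reg 21 ↔ z ∈ R.top ∧ z ∈ R.left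
  r22 : ∀ z, z + 1 = s.reg 22 ↔ z ∈ R.bottom ∧ z ∈ R.left
  r23 : ∀ z, z + 1 = s.reg 23 ↔ z ∈ R.bottom ∧ z ∈ R.right
  r24 : ∀ z, z + 1 = s.reg 24 ↔ z ∈ R.top ∧ z ∈ R.right
  r25 : s.reg 25 = if ∃ x ∈ R.top, x ∈ R.left then 1 else 0

theorem Registers.congr {R : SubcellRecord} {k off : ℕ} {s s' : State} (h : Registers R k off s)
    (hs : ∀ r, 6 ≤ r → s'.reg r = s.reg r) : Registers R k off s' := by
  refine ⟨h.toHeader.congr fun r hr _ => hs r hr, ?_, ?_, ?_, ?_, ?_⟩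
  all_goals rw [hs _ (by norm_num)]
  exacts [h.r21, h.r22, h.r23, h.r24, h.r25]

theorem Registers.eqExcept {R : SubcellRecord} {k off : ℕ} {s s' : State} {r : ℕ}
    (h : Registers R k off s) (hs : EqExcept r s s') (hr : r < 6) : Registers R k off s' :=
  h.congr fun i hi => hs.reg i (by omega)

/-- The points of `pre` have been processed: the stack holds the points whose partner is still to
come, and the output has been extended by the pairs found so far. -/
def Progress (L : List ℕ) (I D : ℕ → ℕ → Prop) (pos : ℕ → ℝ) (k : ℕ) (val known : ℕ → ℕ → Prop)
    (out : List ℕ) (pre post : List ℕ) (s : State) : Prop :=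
  ∃ es, Closed (fun x y => I x y ∨ D x y) pos pre es ∧
    Holds val known ((pending (fun x y => I x y ∨ D x y) pre post).map fun z => (z, stackTag L I z))
      (out ++ es.flatMap fun e => [k, e.1, e.2]) s

section progress

variable {B L T R : List ℕ} {I D : ℕ → ℕ → Prop} {pos : ℕ → ℝ} {k : ℕ} {val known : ℕ → ℕ → Prop}
  {out pre post : List ℕ} {s s' : State} {input : List ℕ} {z : ℕ}

theorem Progress.eqExcept {r : ℕ} (h : Progress L I D pos k val known out pre post s)
    (he : EqExcept r s s') (hr : r ≠ 0) : Progress L I D pos k val known out pre post s' := by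
  obtain ⟨es, h1, h2⟩ := h
  exact ⟨es, h1, h2.eqExcept he hr⟩

theorem Progress.mono {known' : ℕ → ℕ → Prop} (h : Progress L I D pos k val known out pre post s)
    (hk : ∀ κ z, known' κ z → known κ z) : Progress L I D pos k val known' out pre post s := by
  obtain ⟨es, h1, h2⟩ := h
  exact ⟨es, h1, h2.mono hk⟩

theorem Progress.skip (hB : BoxPattern B L T R I D pos)
    (hW : boundaryOrder B L T R = pre ++ z :: post)
    (h : Progress L I D pos k val known out pre (z :: post) s) (hz : ∀ y, ¬ (I z y ∨ D z y)) :
    Progress L I D pos k val known out (pre ++ [z]) post s := by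
  obtain ⟨es, h1, h2⟩ := h
  refine ⟨es, h1.skip hB.matching (hB.pairwise hW) fun y _ => hz y, ?_⟩
  rwa [pending_of_unmatched hB.matching hz]

theorem Progress.wp_push (hB : BoxPattern B L T R I D pos)
    (hW : boundaryOrder B L T R = pre ++ z :: post)
    (h : Progress L I D pos k val known out pre (z :: post) s) {y : ℕ} (hzy : I z y ∨ D z y)
    (hy : y ∈ post) (h2 : s.reg 2 = z) (h5 : s.reg 5 = stackTag L I z) {Q : State → Prop}
    (hQ : ∀ s', (∀ r, r ≠ 0 → s'.reg r = s.reg r) →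
      Progress L I D pos k val known out (pre ++ [z]) post s' → Q s') : wp input push Q s := by
  obtain ⟨es, h1, hh⟩ := h
  have hP := hB.pairwise hW
  refine RAM.wp_push hh fun s' hs' hh' => hQ s' hs' ⟨es, ?_, ?_⟩
  · refine h1.skip hB.matching hP fun u hu hzu => ?_
    have := hB.unique z u y hzu hzy
    subst this
    exact lt_asymm (lt_of_mem_pre hP hu) (lt_of_mem_post hP hy)
  · rw [pending_push hB.matching hP hzy hy, List.map_cons]
    rwa [h2, h5] at hh'

/-- Since the matching is noncrossing, the popped point is the partner `y`. The tag of `y` is kept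
in register `5`, because it tells the slope at `z`. -/
theorem Progress.wp_popEmit (hB : BoxPattern B L T R I D pos)
    (hW : boundaryOrder B L T R = pre ++ z :: post)
    (h : Progress L I D pos k val known out pre (z :: post) s) {y : ℕ} (hzy : I z y ∨ D z y)
    (hy : y ∈ pre) (h2 : s.reg 2 = z) (h6 : s.reg 6 = k) {Q : State → Prop}
    (hQ : ∀ s', (∀ r, r ≠ 0 → r ≠ 4 → r ≠ 5 → s'.reg r = s.reg r) →
      s'.reg 5 = stackTag L I y →
      Progress L I D pos k val known out (pre ++ [z]) post s' → Q s') : wp input popEmit Q s := by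
  obtain ⟨es, h1, hh⟩ := h
  have hP := hB.pairwise hW
  rw [pending_pop hB.matching hP hzy hy, List.map_cons] at hh
  refine RAM.wp_popEmit hh fun s' hs' h5 hh' => hQ s' hs' h5
    ⟨es ++ [(y, z)], h1.pop hB.matching hP hzy hy, ?_⟩
  simpa [h2, h6] using hh'

theorem Progress.wp_storeIff (h : Progress L I D pos k val known out pre post s) {κ : ℕ} (hκ : κ < 4)
    (h2 : s.reg 2 = z) {a b : Expr}
    (hv : val κ z ↔ (a.eval input s ≠ 0 ↔ b.eval input s ≠ 0)) {Q : State → Prop}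
    (hQ : ∀ s', s'.reg = s.reg →
      Progress L I D pos k val (fun κ' x => known κ' x ∨ κ' = κ ∧ x = z) out pre post s' → Q s') :
    wp input (storeIff κ a b) Q s := by
  obtain ⟨es, h1, hh⟩ := h
  subst h2
  exact RAM.wp_storeIff hh hκ hv fun s' hs' hh' => hQ s' hs' ⟨es, h1, hh'⟩

theorem Progress.slot (h : Progress L I D pos k val known out pre post s) {κ : ℕ}
    (hk : known κ z) : s.mem (6 * z + κ) ≠ 0 ↔ val κ z := by
  obtain ⟨es, h1, hh⟩ := h
  exact (hh.slot κ z hk).2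

theorem Progress.top_tag (h : Progress L I D pos k val known out pre post s) :
    s.mem (6 * s.reg 0 + 5) = 2 ↔ ∃ u l, pending (fun x y => I x y ∨ D x y) pre post = u :: l ∧
      stackTag L I u = 2 := by
  obtain ⟨es, h1, hh⟩ := h
  rw [hh.top_tag]
  constructor
  · rintro ⟨p, l, h, hp⟩
    obtain ⟨u, l', h3, rfl, rfl⟩ := List.map_eq_cons_iff.1 h
    exact ⟨u, l', h3, hp⟩
  · rintro ⟨u, l, h, hu⟩
    exact ⟨_, _, by rw [h, List.map_cons], hu⟩

theorem Progress.height (h : Progress L I D pos k val known out pre post s) :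
    s.reg 0 = (pending (fun x y => I x y ∨ D x y) pre post).length := by
  obtain ⟨es, h1, hh⟩ := h
  simpa using hh.height

end progress

section code

variable {B L T R : List ℕ} {I D : ℕ → ℕ → Prop} {pos : ℕ → ℝ} {z v : ℕ}

theorem JoinCode.eq_one_iff (h : JoinCode I D z v) (hB : BoxPattern B L T R I D pos) :
    v = 1 ↔ ∃ y, I z y := by
  rcases h with ⟨rfl, h⟩ | ⟨rfl, y, h⟩ | ⟨rfl, h, -⟩
  · simp [h]
  · simp only [OfNat.ofNat_ne_one, false_iff]
    rintro ⟨y', h'⟩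
    exact hB.not_both z y' y h' h
  · simp only [zero_ne_one, false_iff]; exact h

theorem JoinCode.eq_two_iff (h : JoinCode I D z v) (hB : BoxPattern B L T R I D pos) :
    v = 2 ↔ ∃ y, D z y := by
  rcases h with ⟨rfl, y, h⟩ | ⟨rfl, h⟩ | ⟨rfl, -, h⟩
  · simp only [OfNat.one_ne_ofNat, false_iff]
    rintro ⟨y', h'⟩
    exact hB.not_both z y y' h h'
  · simp [h]
  · simp only [OfNat.zero_ne_ofNat, false_iff]; exact h

end code

end FreeSpace

namespace FreeSpace

open RAM

/-! ### The program -/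

/-- The stored information of kind `κ` at the point in register `2`. -/
def slotExpr (κ : ℕ) : Expr := .mem (.plus (six (.reg 2)) (.const κ))

/-- Nonzero if and only if the number of the point in register `2`, increased by one, is not the
content of the register `r`. -/
def notCorner (r : ℕ) : Expr := neq (.plus (.reg 2) (.const 1)) (.reg r)

/-- Nonzero if and only if one of the flags `j` and `j + 1` of the point in register `2` is set. -/
def flagExpr (j : ℕ) : Expr :=
  .plus (.inp (.plus (.plus (.plus (.reg 2) (.reg 2)) (.plus (.reg 2) (.reg 2))) (.const (j + 2))))
    (.inp (.plus (.plus (.plus (.reg 2) (.reg 2)) (.plus (.reg 2) (.reg 2))) (.const (j + 3))))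

/-- Determine the slope at a point of the left edge. -/
def leftCode : Cmd :=
  .ite (.reg 9) (.assign 3 (.inp (.plus (.reg 19) (.reg 1))))
    (.ite (notCorner 21)
      (.ite (notCorner 22)
        (.ite (slotExpr 2) (.assign 3 (.const 1)) (.assign 3 (.const 2)))
        (.ite (slotExpr 2) (.assign 3 (.const 1)) (.assign 3 (.const 0))))
      (.ite (slotExpr 3) (.assign 3 (.const 2)) (.assign 3 (.const 0))))

/-- Handle a point of the left edge. -/
def leftBody : Cmd :=
  .seq (.assign 1 (.minus (.reg 1) (.const 1))) <|
  .seq (.assign 2 (.inp (.plus (.reg 15) (.reg 1)))) <|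
  .seq leftCode <|
  .seq (.ite (.reg 3) (.seq (.assign 5 (.reg 3)) push) .skip) <|
  .ite (notCorner 21) .skip (storeIff 0 (.reg 3) (flagExpr 2))

/-- Determine the slope at a point of the lower edge. -/
def bottomCode : Cmd :=
  .ite (.reg 8) (.assign 3 (.inp (.plus (.reg 18) (.reg 1))))
    (.ite (notCorner 23)
      (.ite (slotExpr 0) (.assign 3 (.const 1)) (.assign 3 (.const 2)))
      (.ite (slotExpr 1) (.assign 3 (.const 2)) (.assign 3 (.const 0))))

/-- Push or pop at a point of the lower edge. -/
def bottomMatch : Cmd :=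
  .ite (.reg 3)
    (.ite (.minus (.reg 3) (.const 1))
      (.ite (neq (.mem (.plus (six (.reg 0)) (.const 5))) (.const 2))
        (.seq (.assign 5 (.const 3)) push) popEmit)
      (.seq (.assign 5 (.const 1)) push))
    .skip

/-- Handle a point of the lower edge. -/
def bottomBody : Cmd :=
  .seq (.assign 2 (.inp (.plus (.reg 14) (.reg 1)))) <|
  .seq (.ite (notCorner 22)
    (.seq bottomCode <| .seq bottomMatch <|
      .ite (notCorner 23) .skip (storeIff 2 (.reg 3) (flagExpr 0))) .skip) <|
  .assign 1 (.plus (.reg 1) (.const 1))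

/-- Determine the slope from the tag of the partner. -/
def codeOfTag : Cmd :=
  .ite (neq (.reg 5) (.const 1)) (.assign 3 (.const 2)) (.assign 3 (.const 1))

/-- Push or pop at a point of the right edge. -/
def rightMatch : Cmd :=
  .ite (.minus (.plus (.reg 0) (.plus (.minus (.reg 13) (.reg 1)) (.reg 25))) (.reg 12))
    (.seq popEmit codeOfTag)
    (.ite (notCorner 24) (.seq (.assign 5 (.const 3)) (.seq push (.assign 3 (.const 2))))
      (.assign 3 (.const 0)))

/-- Handle a point of the right edge. -/
def rightBody : Cmd :=
  .seq (.assign 2 (.inp (.plus (.reg 17) (.reg 1)))) <|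
  .seq (.ite (notCorner 23)
    (.seq rightMatch <| .seq (storeIff 3 (isOne (.reg 3)) (flagExpr 0)) <|
      .ite (notCorner 24) (storeIff 2 (.minus (.reg 3) (.const 1)) (flagExpr 0))
        (storeIff 1 (isOne (.reg 3)) (flagExpr 2))) .skip) <|
  .assign 1 (.plus (.reg 1) (.const 1))

/-- Handle a point of the upper edge. -/
def topBody : Cmd :=
  .seq (.assign 1 (.minus (.reg 1) (.const 1))) <|
  .seq (.assign 2 (.inp (.plus (.reg 16) (.reg 1)))) <|
  .ite (notCorner 21)
    (.ite (notCorner 24)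
      (.seq popEmit <| .seq codeOfTag <|
        .seq (storeIff 0 (.minus (.reg 3) (.const 1)) (flagExpr 2))
          (storeIff 1 (isOne (.reg 3)) (flagExpr 2))) .skip) .skip

theorem eval_slotExpr {input : List ℕ} {κ : ℕ} {s : State} :
    (slotExpr κ).eval input s = s.mem (6 * s.reg 2 + κ) := by
  simp [slotExpr, Expr.eval, eval_six]

theorem eval_notCorner {input : List ℕ} {r : ℕ} {s : State} :
    (notCorner r).eval input s = 0 ↔ s.reg 2 + 1 = s.reg r := by
  rw [notCorner, eval_neq]; rfl

theorem eval_flagExpr {input : List ℕ} {j : ℕ} {s : State} :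
    (flagExpr j).eval input s =
      input.getD (4 * s.reg 2 + (j + 2)) 0 + input.getD (4 * s.reg 2 + (j + 3)) 0 := by
  have h : s.reg 2 + s.reg 2 + (s.reg 2 + s.reg 2) = 4 * s.reg 2 := by ring
  simp only [flagExpr, Expr.eval, h]

/-! ### Correctness of the single steps -/

/-- What is known about the quadrants after the points `pre` of the record `R` were processed. -/
def knownAfter (avail : ℕ → ℕ → Prop) (R : SubcellRecord) (pre : List ℕ) (κ z : ℕ) : Prop :=
  avail κ z ∨ z ∈ pre ∧ R.Writes κ z

/-- The flags of the points of a record in the input. -/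
def FlagsAt (input : List ℕ) (R : SubcellRecord) (eh ev : ℕ → Prop) : Prop :=
  ∀ z, z ∈ R.left ∨ z ∈ R.bottom ∨ z ∈ R.top ∨ z ∈ R.right →
    (input.getD (4 * z + 2) 0 + input.getD (4 * z + 3) 0 ≠ 0 ↔ eh z) ∧
    (input.getD (4 * z + 4) 0 + input.getD (4 * z + 5) 0 ≠ 0 ↔ ev z)

section steps

variable {R : SubcellRecord} {I D : ℕ → ℕ → Prop} {pos : ℕ → ℝ} {eh ev : ℕ → Prop}
  {val avail : ℕ → ℕ → Prop} {input out : List ℕ} {k off z : ℕ} {s : State}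

/-- On the left edge of the cell the slope is read from the input. Elsewhere flag `2` tells whether
an increasing arc starts, and a point without one has a decreasing arc unless it is a corner. At the
lower left corner only an increasing arc is possible, at the upper left corner only a decreasing
one, for which flag `3` is consulted. -/
theorem wp_leftCode (hR : RecordSpec R I D pos eh ev val avail) (hA : RecordAt input off R)
    (hs : Registers R k off s) {l₁ l₂ : List ℕ} (hl : R.left = l₁ ++ z :: l₂)
    (h1 : s.reg 1 = l₁.length) (h2 : s.reg 2 = z)
    (hslot : ∀ κ, avail κ z → (s.mem (6 * z + κ) ≠ 0 ↔ val κ z)) :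
    wp input leftCode (fun s' => EqExcept 3 s s' ∧ JoinCode I D z (s'.reg 3)) s := by
  have hz : z ∈ R.left := by rw [hl]; simp
  refine wp_ite (fun hb => ?_) (fun hb => ?_)
  · refine wp_assign fun s' e h3 => ⟨e, ?_⟩
    have hon : R.onLeft = true := by
      rw [Expr.eval, hs.r9] at hb
      by_contra h
      simp [h] at hb
    rw [h3]
    simp only [Expr.eval, hs.r19, h1]
    have := hR.leftSlope
    rw [if_pos hon] at this
    exact hA.leftSlope.code this hl
  · have hon : R.onLeft = false := by
      rw [Expr.eval, hs.r9] at hb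
      by_contra h
      simp [h] at hb
    have r2 := hR.read2 hon z hz
    have r3 := hR.read3 hon z hz
    refine wp_ite (fun hc => ?_) (fun hc => ?_)
    · rw [Ne, eval_notCorner, h2, hs.r21] at hc
      have hzT : z ∉ R.top := fun h => hc ⟨h, hz⟩
      obtain ⟨a2, r2⟩ := r2 hzT
      have e2 := hslot 2 a2
      rw [← r2] at e2
      refine wp_ite (fun hd => ?_) (fun hd => ?_)
      · rw [Ne, eval_notCorner, h2, hs.r22] at hd
        have hzB : z ∉ R.bottom := fun h => hd ⟨h, hz⟩
        refine wp_ite (fun hi => ?_) (fun hi => ?_) <;> rw [eval_slotExpr, h2] at hi <;>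
          refine wp_assign fun s' e h3 => ⟨e, ?_⟩ <;> rw [h3]
        · exact Or.inl ⟨rfl, e2.1 hi⟩
        · refine Or.inr (Or.inl ⟨rfl, ?_⟩)
          obtain ⟨y, hy⟩ := hR.exists_join_of_notMem (Or.inr (Or.inr (Or.inr ⟨hz, hzB, hzT⟩)))
          exact ⟨y, hy.resolve_left fun h => e2.2 ⟨y, h⟩ hi⟩
      · rw [eval_notCorner, h2, hs.r22] at hd
        have hnd : ¬ ∃ y, D z y := by
          rintro ⟨y, hy⟩
          have := hR.dec_ends z y hy
          tauto
        refine wp_ite (fun hi => ?_) (fun hi => ?_) <;> rw [eval_slotExpr, h2] at hi <;>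
          refine wp_assign fun s' e h3 => ⟨e, ?_⟩ <;> rw [h3]
        · exact Or.inl ⟨rfl, e2.1 hi⟩
        · exact Or.inr (Or.inr ⟨rfl, fun h => e2.2 h hi, hnd⟩)
    · rw [eval_notCorner, h2, hs.r21] at hc
      obtain ⟨a3, r3⟩ := r3 fun h => hR.disjoint_BT z h hc.1
      have e3 := hslot 3 a3
      rw [← r3] at e3
      have hni : ¬ ∃ y, I z y := by
        rintro ⟨y, hy⟩
        have := hR.inc_ends z y hy
        tauto
      refine wp_ite (fun hi => ?_) (fun hi => ?_) <;> rw [eval_slotExpr, h2] at hi <;>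
        refine wp_assign fun s' e h3 => ⟨e, ?_⟩ <;> rw [h3]
      · exact Or.inr (Or.inl ⟨rfl, e3.1 hi⟩)
      · exact Or.inr (Or.inr ⟨rfl, hni, fun h => e3.2 h hi⟩)

/-- As on the left edge, with flag `0` for increasing arcs. At the lower right corner only a
decreasing arc is possible, and flag `1` decides. The lower left corner has been handled with the
left edge. -/
theorem wp_bottomCode (hR : RecordSpec R I D pos eh ev val avail) (hA : RecordAt input off R)
    (hs : Registers R k off s) {l₁ l₂ : List ℕ} (hl : R.bottom = l₁ ++ z :: l₂) (hzL : z ∉ R.left)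
    (h1 : s.reg 1 = l₁.length) (h2 : s.reg 2 = z)
    (hslot : ∀ κ, avail κ z → (s.mem (6 * z + κ) ≠ 0 ↔ val κ z)) :
    wp input bottomCode (fun s' => EqExcept 3 s s' ∧ JoinCode I D z (s'.reg 3)) s := by
  have hz : z ∈ R.bottom := by rw [hl]; simp
  refine wp_ite (fun hb => ?_) (fun hb => ?_)
  · refine wp_assign fun s' e h3 => ⟨e, ?_⟩
    have hon : R.onBottom = true := by
      rw [Expr.eval, hs.r8] at hb
      by_contra h
      simp [h] at hb
    rw [h3]
    simp only [Expr.eval, hs.r18, h1]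
    have := hR.bottomSlope
    rw [if_pos hon] at this
    exact hA.bottomSlope.code this hl
  · have hon : R.onBottom = false := by
      rw [Expr.eval, hs.r8] at hb
      by_contra h
      simp [h] at hb
    have r0 := hR.read0 hon z hz
    obtain ⟨a1, r1⟩ := hR.read1 hon z hz hzL
    have e1 := hslot 1 a1
    rw [← r1] at e1
    refine wp_ite (fun hc => ?_) (fun hc => ?_)
    · rw [Ne, eval_notCorner, h2, hs.r23] at hc
      have hzR : z ∉ R.right := fun h => hc ⟨hz, h⟩
      obtain ⟨a0, r0⟩ := r0 hzR
      have e0 := hslot 0 a0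
      rw [← r0] at e0
      refine wp_ite (fun hi => ?_) (fun hi => ?_) <;> rw [eval_slotExpr, h2] at hi <;>
        refine wp_assign fun s' e h3 => ⟨e, ?_⟩ <;> rw [h3]
      · exact Or.inl ⟨rfl, e0.1 hi⟩
      · refine Or.inr (Or.inl ⟨rfl, ?_⟩)
        obtain ⟨y, hy⟩ := hR.exists_join_of_notMem
          (Or.inr (Or.inr (Or.inl ⟨hz, hzL, hzR⟩)))
        exact ⟨y, hy.resolve_left fun h => e0.2 ⟨y, h⟩ hi⟩
    · rw [eval_notCorner, h2, hs.r23] at hc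
      have hni : ¬ ∃ y, I z y := by
        rintro ⟨y, hy⟩
        have := hR.inc_ends z y hy
        tauto
      refine wp_ite (fun hi => ?_) (fun hi => ?_) <;> rw [eval_slotExpr, h2] at hi <;>
        refine wp_assign fun s' e h3 => ⟨e, ?_⟩ <;> rw [h3]
      · exact Or.inr (Or.inl ⟨rfl, e1.1 hi⟩)
      · exact Or.inr (Or.inr ⟨rfl, hni, fun h => e1.2 h hi⟩)

/-- The state of the machine between two steps of the traversal of the boundary. -/
structure Between (R : SubcellRecord) (I D : ℕ → ℕ → Prop) (pos : ℕ → ℝ)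
    (val avail : ℕ → ℕ → Prop) (out : List ℕ) (k off : ℕ) (pre post : List ℕ) (i : ℕ) (s : State) :
    Prop where
  regs : Registers R k off s
  index : s.reg 1 = i
  progress : Progress R.left I D pos k val (knownAfter avail R pre) out pre post s

theorem left_step (hR : RecordSpec R I D pos eh ev val avail) (hA : RecordAt input off R)
    (hF : FlagsAt input R eh ev) {l₁ l₂ rest : List ℕ} (hl : R.left.reverse = l₁ ++ z :: l₂)
    (hrest : boundaryOrder R.bottom R.left R.top R.right = R.left.reverse ++ rest)
    (h : Between R I D pos val avail out k off l₁ (z :: l₂ ++ rest) (z :: l₂).length s) :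
    wp input leftBody
      (Between R I D pos val avail out k off (l₁ ++ [z]) (l₂ ++ rest) l₂.length) s := by
  have hB := hR.toBoxPattern
  have hL : R.left = l₂.reverse ++ z :: l₁.reverse := by
    rw [← List.reverse_reverse R.left, hl]; simp
  have hz : z ∈ R.left := by rw [hL]; simp
  have hW : boundaryOrder R.bottom R.left R.top R.right = l₁ ++ z :: (l₂ ++ rest) := by
    rw [hrest, hl]; simp
  have hpre : ∀ x ∈ l₁, x ∈ R.left := fun x hx => by rw [hL]; simp [hx]
  obtain ⟨hreg, hi, hp⟩ := h
  refine wp_assign_seq fun s₁ e₁ v₁ => wp_assign_seq fun s₂ e₂ v₂ => ?_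
  have hreg₁ := hreg.eqExcept e₁ (by norm_num)
  have hreg₂ := hreg₁.eqExcept e₂ (by norm_num)
  have hp₂ := (hp.eqExcept e₁ (by norm_num)).eqExcept e₂ (by norm_num)
  have i₁ : s₁.reg 1 = l₂.length := by rw [v₁]; simp [Expr.eval, hi]
  have i₂ : s₂.reg 1 = l₂.length := by rw [e₂.reg 1 (by norm_num), i₁]
  have z₂ : s₂.reg 2 = z := by
    rw [v₂]
    simp only [Expr.eval, hreg₁.r15, i₁]
    have := hA.left _ _ _ hL
    rwa [List.length_reverse] at this
  refine wp_seq _ (wp_leftCode hR hA hreg₂ hL (by simpa using i₂) z₂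
    fun κ hκ => hp₂.slot (Or.inl hκ)) ?_
  rintro s₃ ⟨e₃, hcode⟩
  have hreg₃ := hreg₂.eqExcept e₃ (by norm_num)
  have hp₃ := hp₂.eqExcept e₃ (by norm_num)
  have i₃ : s₃.reg 1 = l₂.length := by rw [e₃.reg 1 (by norm_num), i₂]
  have z₃ : s₃.reg 2 = z := by rw [e₃.reg 2 (by norm_num), z₂]
  refine wp_seq (fun s' => Registers R k off s' ∧ s'.reg 1 = l₂.length ∧ s'.reg 2 = z ∧
    s'.reg 3 = s₃.reg 3 ∧ Progress R.left I D pos k val (knownAfter avail R l₁) out (l₁ ++ [z])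
      (l₂ ++ rest) s') ?_ ?_
  · refine wp_ite (fun hv => ?_) (fun hv => ?_)
    · have hv : s₃.reg 3 ≠ 0 := hv
      obtain ⟨y, hy⟩ : ∃ y, I z y ∨ D z y := by
        rcases hcode with ⟨-, y, h⟩ | ⟨-, y, h⟩ | ⟨h, -⟩
        · exact ⟨y, Or.inl h⟩
        · exact ⟨y, Or.inr h⟩
        · exact (hv h).elim
      refine wp_assign_seq fun s₄ e₄ v₄ => ?_
      have htag : s₄.reg 5 = stackTag R.left I z := by
        rw [v₄]
        simp only [Expr.eval]
        have c1 := hcode.eq_one_iff hB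
        rcases hcode with ⟨h, h'⟩ | ⟨h, -⟩ | ⟨h, -⟩
        · rw [h, BoxPattern.stackTag_eq_one_iff.2 h']
        · rw [h, BoxPattern.stackTag_eq_two_iff.2 ⟨hz, fun h' => by rw [← c1, h] at h'; simp at h'⟩]
        · exact (hv h).elim
      refine (hp₃.eqExcept e₄ (by norm_num)).wp_push hB hW hy (hB.left_post hW hz hpre hy)
        (by rw [e₄.reg 2 (by norm_num), z₃]) htag fun s' hs' hp' => ⟨?_, ?_, ?_, ?_, hp'⟩
      · exact (hreg₃.eqExcept e₄ (by norm_num)).congr fun r hr => hs' r (by omega)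
      · rw [hs' 1 (by norm_num), e₄.reg 1 (by norm_num), i₃]
      · rw [hs' 2 (by norm_num), e₄.reg 2 (by norm_num), z₃]
      · rw [hs' 3 (by norm_num), e₄.reg 3 (by norm_num)]
    · have hv : s₃.reg 3 = 0 := hv
      refine ⟨hreg₃, i₃, z₃, rfl, hp₃.skip hB hW fun y hy => ?_⟩
      have c1 := hcode.eq_one_iff hB
      have c2 := hcode.eq_two_iff hB
      rw [hv] at c1 c2
      rcases hy with hy | hy
      · simpa using c1.2 ⟨y, hy⟩
      · simpa using c2.2 ⟨y, hy⟩
  · rintro s₄ ⟨hreg₄, i₄, z₄, v₄, hp₄⟩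
    -- Of the points of the left edge only the upper left corner passes on information, for its
    -- lower right quadrant. It is done here because the corner is skipped on the upper edge. Any
    -- arc there is decreasing, so a nonzero code means decreasing.
    refine wp_ite (fun hc => ?_) (fun hc => ?_)
    · rw [Ne, eval_notCorner, z₄, hreg₄.r21] at hc
      refine ⟨hreg₄, i₄, hp₄.mono ?_⟩
      rintro κ x (h | ⟨hx, hw⟩)
      · exact Or.inl h
      · rcases List.mem_append.1 hx with hx | hx
        · exact Or.inr ⟨hx, hw⟩
        · rw [List.mem_singleton] at hx
          subst hx
          have := hR.disjoint_LR x hz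
          unfold SubcellRecord.Writes at hw
          tauto
    · rw [eval_notCorner, z₄, hreg₄.r21] at hc
      have c1 := hcode.eq_one_iff hB
      have c2 := hcode.eq_two_iff hB
      have hni : ¬ ∃ y, I z y := by
        rintro ⟨y, hy⟩
        have := hR.inc_ends z y hy
        tauto
      have hv : (∃ y, D z y) ↔ s₃.reg 3 ≠ 0 := by
        rw [← c2]
        rcases hcode with ⟨h, h'⟩ | ⟨h, -⟩ | ⟨h, -⟩
        · exact (hni h').elim
        · simp [h]
        · simp [h]
      refine hp₄.wp_storeIff (by norm_num) z₄ ?_ fun s' hs' hp' => ⟨?_, ?_, hp'.mono ?_⟩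
      · rw [hR.write0 z hc.1 (hR.disjoint_LR z hz), hv, eval_flagExpr, z₄, (hF z (Or.inl hz)).2,
          ← v₄]
        rfl
      · exact hreg₄.congr fun r _ => by rw [hs']
      · rw [hs', i₄]
      · rintro κ x (h | ⟨hx, hw⟩)
        · exact Or.inl (Or.inl h)
        · rcases List.mem_append.1 hx with hx | hx
          · exact Or.inl (Or.inr ⟨hx, hw⟩)
          · rw [List.mem_singleton] at hx
            subst hx
            have := hR.disjoint_LR x hz
            unfold SubcellRecord.Writes at hw
            right
            tauto

end steps

end FreeSpace

/-! ### The steps along the lower, right and upper edges -/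

namespace FreeSpace

open RAM

section steps

variable {R : SubcellRecord} {I D : ℕ → ℕ → Prop} {pos : ℕ → ℝ} {eh ev : ℕ → Prop}
  {val avail known : ℕ → ℕ → Prop} {input out pre post : List ℕ} {k off z : ℕ} {s : State}

theorem JoinCode.ne_zero_iff {v : ℕ} (h : JoinCode I D z v) : v ≠ 0 ↔ ∃ y, I z y ∨ D z y := by
  rcases h with ⟨rfl, y, h⟩ | ⟨rfl, y, h⟩ | ⟨rfl, h1, h2⟩
  · exact ⟨fun _ => ⟨y, Or.inl h⟩, fun _ => by norm_num⟩
  · exact ⟨fun _ => ⟨y, Or.inr h⟩, fun _ => by norm_num⟩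
  · refine ⟨fun h => (h rfl).elim, ?_⟩
    rintro ⟨y, h | h⟩
    · exact (h1 ⟨y, h⟩).elim
    · exact (h2 ⟨y, h⟩).elim

theorem JoinCode.le_two {v : ℕ} (h : JoinCode I D z v) : v ≤ 2 := by
  rcases h with ⟨rfl, -⟩ | ⟨rfl, -⟩ | ⟨rfl, -⟩ <;> norm_num

/-- An increasing arc leads to the upper or right edge and is pushed with tag `1`. A decreasing arc
comes from the left edge if the top tag is `2`; otherwise it leads to the right edge and is pushed
with tag `3`, which keeps it from being mistaken for a point of the left edge. -/
theorem wp_bottomMatch (hB : BoxPattern R.bottom R.left R.top R.right I D pos)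
    (hW : boundaryOrder R.bottom R.left R.top R.right = pre ++ z :: post) (hz : z ∈ R.bottom)
    (hzL : z ∉ R.left) (hpre : ∀ x ∈ pre, x ∈ R.left ∨ x ∈ R.bottom) (hs : Registers R k off s)
    (h2 : s.reg 2 = z) (hcode : JoinCode I D z (s.reg 3))
    (hp : Progress R.left I D pos k val known out pre (z :: post) s) :
    wp input bottomMatch (fun s' => Registers R k off s' ∧ s'.reg 1 = s.reg 1 ∧ s'.reg 2 = z ∧
      s'.reg 3 = s.reg 3 ∧ Progress R.left I D pos k val known out (pre ++ [z]) post s') s := by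
  have c1 := hcode.eq_one_iff hB
  have c2 := hcode.eq_two_iff hB
  have c3 := hcode.le_two
  have pushed : ∀ {y t}, I z y ∨ D z y → y ∈ post → stackTag R.left I z = t →
      wp input (.seq (.assign 5 (.const t)) push) (fun s' => Registers R k off s' ∧
        s'.reg 1 = s.reg 1 ∧ s'.reg 2 = z ∧ s'.reg 3 = s.reg 3 ∧
        Progress R.left I D pos k val known out (pre ++ [z]) post s') s := by
    intro y t hy hyp ht
    refine wp_assign_seq fun s₁ e₁ v₁ => ?_
    refine (hp.eqExcept e₁ (by norm_num)).wp_push hB hW hy hyp (by rw [e₁.reg 2 (by norm_num), h2])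
      (by rw [v₁, ht]; rfl) fun s' hs' hp' => ⟨?_, ?_, ?_, ?_, hp'⟩
    · exact (hs.eqExcept e₁ (by norm_num)).congr fun r hr => hs' r (by omega)
    · rw [hs' 1 (by norm_num), e₁.reg 1 (by norm_num)]
    · rw [hs' 2 (by norm_num), e₁.reg 2 (by norm_num), h2]
    · rw [hs' 3 (by norm_num), e₁.reg 3 (by norm_num)]
  refine wp_ite (fun hv => ?_) (fun hv => ?_)
  · have hv : s.reg 3 ≠ 0 := hv
    refine wp_ite (fun hd => ?_) (fun hd => ?_)
    · have hd : s.reg 3 - 1 ≠ 0 := hd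
      obtain ⟨y, hy⟩ := c2.1 (by omega)
      have hiff := hB.bottom_dec_pre_iff hW hz hpre hy
      rw [← hp.top_tag] at hiff
      refine wp_ite (fun ht => ?_) (fun ht => ?_)
      · have ht' : ¬ s.mem (6 * s.reg 0 + 5) = 2 := by
          rw [Ne, eval_neq] at ht
          simpa [Expr.eval, eval_six] using ht
        refine pushed (Or.inr hy)
          ((hB.pre_or_post hW (Or.inr hy)).resolve_left fun h => ht' (hiff.1 h)) ?_
        unfold stackTag
        rw [if_neg, if_neg hzL]
        rintro ⟨y', hy'⟩
        exact hB.not_both _ _ _ hy' hy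
      · have ht' : s.mem (6 * s.reg 0 + 5) = 2 := by
          rw [eval_neq] at ht
          simpa [Expr.eval, eval_six] using ht
        refine hp.wp_popEmit hB hW (Or.inr hy) (hiff.2 ht') h2 hs.r6
          fun s' hs' _ hp' => ⟨?_, ?_, ?_, ?_, hp'⟩
        · exact hs.congr fun r hr => hs' r (by omega) (by omega) (by omega)
        · exact hs' 1 (by norm_num) (by norm_num) (by norm_num)
        · rw [hs' 2 (by norm_num) (by norm_num) (by norm_num), h2]
        · exact hs' 3 (by norm_num) (by norm_num) (by norm_num)
    · have hd : s.reg 3 - 1 = 0 := hd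
      obtain ⟨y, hy⟩ := c1.1 (by omega)
      exact pushed (Or.inl hy) (hB.bottom_inc_post hW hz hpre hy)
        (BoxPattern.stackTag_eq_one_iff.2 ⟨y, hy⟩)
  · have hv : s.reg 3 = 0 := hv
    refine ⟨hs, rfl, h2, rfl, hp.skip hB hW fun y hy => ?_⟩
    exact hcode.ne_zero_iff.2 ⟨y, hy⟩ hv

theorem knownAfter_append {pre' : List ℕ} {κ x : ℕ} (h : knownAfter avail R (pre ++ pre') κ x) :
    knownAfter avail R pre κ x ∨ x ∈ pre' ∧ R.Writes κ x := by
  rcases h with h | ⟨h, hw⟩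
  · exact Or.inl (Or.inl h)
  · rcases List.mem_append.1 h with h | h
    · exact Or.inl (Or.inr ⟨h, hw⟩)
    · exact Or.inr ⟨h, hw⟩

theorem bottom_step (hR : RecordSpec R I D pos eh ev val avail) (hA : RecordAt input off R)
    (hF : FlagsAt input R eh ev) {l₁ l₂ rest : List ℕ} (hl : R.bottom = l₁ ++ z :: l₂)
    (hrest : boundaryOrder R.bottom R.left R.top R.right =
      R.left.reverse ++ (R.bottom.filter (· ∉ R.left) ++ rest))
    (h : Between R I D pos val avail out k off (R.left.reverse ++ l₁.filter (· ∉ R.left))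
      ((z :: l₂).filter (· ∉ R.left) ++ rest) l₁.length s) :
    wp input bottomBody
      (Between R I D pos val avail out k off (R.left.reverse ++ (l₁ ++ [z]).filter (· ∉ R.left))
        (l₂.filter (· ∉ R.left) ++ rest) (l₁ ++ [z]).length) s := by
  have hB := hR.toBoxPattern
  have hz : z ∈ R.bottom := by rw [hl]; simp
  obtain ⟨hreg, hi, hp⟩ := h
  refine wp_assign_seq fun s₁ e₁ v₁ => ?_
  have hreg₁ := hreg.eqExcept e₁ (by norm_num)
  have hp₁ := hp.eqExcept e₁ (by norm_num)
  have i₁ : s₁.reg 1 = l₁.length := by rw [e₁.reg 1 (by norm_num), hi]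
  have z₁ : s₁.reg 2 = z := by
    rw [v₁]
    simp only [Expr.eval, hreg.r14, hi]
    exact hA.bottom _ _ _ hl
  refine wp_seq (fun s' => Registers R k off s' ∧ s'.reg 1 = l₁.length ∧
    Progress R.left I D pos k val
      (knownAfter avail R (R.left.reverse ++ (l₁ ++ [z]).filter (· ∉ R.left))) out
      (R.left.reverse ++ (l₁ ++ [z]).filter (· ∉ R.left)) (l₂.filter (· ∉ R.left) ++ rest) s') ?_ ?_
  · refine wp_ite (fun hc => ?_) (fun hc => ?_)
    · rw [Ne, eval_notCorner, z₁, hreg₁.r22] at hc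
      have hzL : z ∉ R.left := fun h => hc ⟨hz, h⟩
      have e₁ : (l₁ ++ [z]).filter (· ∉ R.left) = l₁.filter (· ∉ R.left) ++ [z] := by simp [hzL]
      have e₂ : (z :: l₂).filter (· ∉ R.left) = z :: l₂.filter (· ∉ R.left) := by simp [hzL]
      rw [e₂, List.cons_append] at hp₁
      rw [e₁, ← List.append_assoc]
      have hW : boundaryOrder R.bottom R.left R.top R.right =
          (R.left.reverse ++ l₁.filter (· ∉ R.left)) ++ z :: (l₂.filter (· ∉ R.left) ++ rest) := by
        rw [hrest, hl, List.filter_append, e₂]; simp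
      have hpre : ∀ x ∈ R.left.reverse ++ l₁.filter (· ∉ R.left), x ∈ R.left ∨ x ∈ R.bottom := by
        intro x hx
        rw [hl]
        simp only [List.mem_append, List.mem_reverse, List.mem_filter] at hx ⊢
        tauto
      generalize R.left.reverse ++ l₁.filter (· ∉ R.left) = pre at *
      generalize l₂.filter (· ∉ R.left) ++ rest = post at *
      refine wp_seq _ (wp_bottomCode hR hA hreg₁ hl hzL i₁ z₁ fun κ hκ => hp₁.slot (Or.inl hκ)) ?_
      rintro s₂ ⟨e₂, hcode⟩
      refine wp_seq _ (wp_bottomMatch hB hW hz hzL hpre (hreg₁.eqExcept e₂ (by norm_num))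
        (by rw [e₂.reg 2 (by norm_num), z₁]) hcode (hp₁.eqExcept e₂ (by norm_num))) ?_
      rintro s₃ ⟨hreg₃, i₃, z₃, v₃, hp₃⟩
      rw [e₂.reg 1 (by norm_num), i₁] at i₃
      -- Among these points only the lower right corner passes on information, to the subcell on the
      -- right; it is skipped on the right edge.
      refine wp_ite (fun hc => ?_) (fun hc => ?_)
      · rw [Ne, eval_notCorner, z₃, hreg₃.r23] at hc
        refine ⟨hreg₃, i₃, hp₃.mono fun κ x hx => ?_⟩
        refine (knownAfter_append hx).resolve_right ?_
        rintro ⟨h, hw⟩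
        rw [List.mem_singleton] at h
        subst h
        have := hR.disjoint_BT x hz
        unfold SubcellRecord.Writes at hw
        tauto
      · rw [eval_notCorner, z₃, hreg₃.r23] at hc
        have hni : ¬ ∃ y, I z y := by
          rintro ⟨y, hy⟩
          have := hR.inc_ends z y hy
          tauto
        have hv : (∃ y, D z y) ↔ s₂.reg 3 ≠ 0 := by
          rw [hcode.ne_zero_iff]
          refine ⟨fun ⟨y, h⟩ => ⟨y, Or.inr h⟩, fun ⟨y, h⟩ => ⟨y, h.resolve_left fun h => hni ⟨y, h⟩⟩⟩
        refine hp₃.wp_storeIff (by norm_num) z₃ ?_ fun s' hs' hp' => ⟨?_, ?_, hp'.mono ?_⟩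
        · rw [hR.write2 z hc.2 (hR.disjoint_BT z hz), hv, eval_flagExpr, z₃,
            (hF z (Or.inr (Or.inl hz))).1, ← v₃]
          rfl
        · exact hreg₃.congr fun r _ => by rw [hs']
        · rw [hs', i₃]
        · intro κ x hx
          rcases knownAfter_append hx with h | ⟨h, hw⟩
          · exact Or.inl h
          · rw [List.mem_singleton] at h
            subst h
            have := hR.disjoint_BT x hz
            unfold SubcellRecord.Writes at hw
            right
            tauto
    · rw [eval_notCorner, z₁, hreg₁.r22] at hc
      have e₁ : (l₁ ++ [z]).filter (· ∉ R.left) = l₁.filter (· ∉ R.left) := by simp [hc.2]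
      have e₂ : (z :: l₂).filter (· ∉ R.left) = l₂.filter (· ∉ R.left) := by simp [hc.2]
      rw [e₂] at hp₁
      rw [e₁]
      exact ⟨hreg₁, i₁, hp₁⟩
  · rintro s₂ ⟨hreg₂, i₂, hp₂⟩
    refine wp_assign fun s₃ e₃ v₃ => ⟨hreg₂.eqExcept e₃ (by norm_num), ?_,
      hp₂.eqExcept e₃ (by norm_num)⟩
    rw [v₃]
    simp [Expr.eval, i₂]

/-- An arc is increasing or decreasing as a whole, so the tag of one end gives the slope at the
other. -/
theorem wp_codeOfTag (hB : BoxPattern R.bottom R.left R.top R.right I D pos) {y : ℕ}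
    (hzy : I z y ∨ D z y) (h5 : s.reg 5 = stackTag R.left I y) :
    wp input codeOfTag (fun s' => EqExcept 3 s s' ∧ JoinCode I D z (s'.reg 3)) s := by
  refine wp_ite (fun hv => ?_) (fun hv => ?_) <;> refine wp_assign fun s' e h3 => ⟨e, ?_⟩ <;>
    rw [h3]
  · rw [Ne, eval_neq] at hv
    simp only [Expr.eval, h5, BoxPattern.stackTag_eq_one_iff] at hv
    exact Or.inr (Or.inl ⟨rfl, y, hzy.resolve_left fun h => hv ⟨z, hB.inc_symm _ _ h⟩⟩)
  · rw [eval_neq] at hv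
    simp only [Expr.eval, h5, BoxPattern.stackTag_eq_one_iff] at hv
    obtain ⟨u, hu⟩ := hv
    rcases hzy with h | h
    · exact Or.inl ⟨rfl, y, h⟩
    · exact (hB.not_both _ _ _ hu (hB.dec_symm _ _ h)).elim

/-- A point that does not pop is either pushed, and then its arc is decreasing, or it is the upper
right corner, which has no later partner and hence no arc at all. -/
theorem wp_rightMatch (hB : BoxPattern R.bottom R.left R.top R.right I D pos)
    (hW : boundaryOrder R.bottom R.left R.top R.right = pre ++ z :: post) {l₁ l₂ : List ℕ}
    (hl : R.right = l₁ ++ z :: l₂) (hzB : z ∉ R.bottom)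
    (hpost : post = l₂ ++ (R.top.filter fun x => x ∉ R.left ∧ x ∉ R.right).reverse)
    (hl₂ : ∀ x ∈ l₂, x ∉ R.bottom) (hpreL : ∀ x ∈ R.left, x ∈ pre) (hpreB : ∀ x ∈ R.bottom, x ∈ pre)
    (hs : Registers R k off s) (h1 : s.reg 1 = l₁.length) (h2 : s.reg 2 = z)
    (hp : Progress R.left I D pos k val known out pre (z :: post) s) :
    wp input rightMatch (fun s' => Registers R k off s' ∧ s'.reg 1 = s.reg 1 ∧ s'.reg 2 = z ∧
      JoinCode I D z (s'.reg 3) ∧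
      Progress R.left I D pos k val known out (pre ++ [z]) post s') s := by
  classical
  have hzR : z ∈ R.right := by rw [hl]; simp
  have hzL : z ∉ R.left := fun h => hB.disjoint_LR z h hzR
  have mpost : ∀ x, x ∈ post ↔ x ∈ l₂ ∨ x ∈ R.top ∧ x ∉ R.left ∧ x ∉ R.right := by
    intro x; rw [hpost]; simp
  -- The counting rule in terms of the registers: the truncated difference is nonzero exactly if
  -- stored points, remaining points of the right edge and a marked upper left corner together
  -- outnumber the points of the upper edge. The corner is added because it is listed on the upper
  -- edge but belongs to the left edge in the traversal.
  have hrule : (∃ y ∈ pre, I z y ∨ D z y) ↔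
      s.reg 0 + (s.reg 13 - s.reg 1 + s.reg 25) - s.reg 12 ≠ 0 := by
    have e : s.reg 13 - s.reg 1 = (z :: l₂).length := by
      rw [hs.r13, h1, hl]; simp
    rw [hp.height, e, hs.r25, hs.r12]
    constructor
    · rintro ⟨y, hy, hzy⟩
      have := hB.right_pop_lt hW hl mpost hzy hy
      omega
    · intro h
      by_contra hno
      push Not at hno
      have := hB.right_not_pop_le hW hl hzB hpost hl₂ fun y hy h =>
        h.elim (hno y hy).1 (hno y hy).2
      omega
  refine wp_ite (fun hv => ?_) (fun hv => ?_)
  · obtain ⟨y, hy, hzy⟩ := hrule.2 hv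
    refine hp.wp_popEmit hB hW hzy hy h2 hs.r6 fun s₁ hs₁ h5 hp₁ => ?_
    refine wp_mono ?_ (wp_codeOfTag hB hzy h5)
    rintro s₂ ⟨e₂, hcode⟩
    refine ⟨?_, ?_, ?_, hcode, hp₁.eqExcept e₂ (by norm_num)⟩
    · exact (hs.congr fun r hr => hs₁ r (by omega) (by omega) (by omega)).eqExcept e₂ (by norm_num)
    · rw [e₂.reg 1 (by norm_num), hs₁ 1 (by norm_num) (by norm_num) (by norm_num)]
    · rw [e₂.reg 2 (by norm_num), hs₁ 2 (by norm_num) (by norm_num) (by norm_num), h2]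
  · have hno : ∀ y ∈ pre, ¬ (I z y ∨ D z y) := fun y hy h =>
      (hrule.1 ⟨y, hy, h⟩) hv
    have hdown : ∀ y, I z y ∨ D z y → y ∈ post ∧ D z y ∧ z ∉ R.top := by
      intro y hzy
      have hy := (hB.pre_or_post hW hzy).resolve_left fun h => hno y h hzy
      refine ⟨hy, hB.right_push hW hzR (fun x hx => ?_) hpreL hpreB hy hzy⟩
      exact ((mpost x).1 hx).imp (fun h => by rw [hl]; simp [h]) id
    refine wp_ite (fun hc => ?_) (fun hc => ?_)
    · rw [Ne, eval_notCorner, h2, hs.r24] at hc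
      have hzT : z ∉ R.top := fun h => hc ⟨h, hzR⟩
      obtain ⟨y, hy⟩ := hB.exists_join_of_notMem (Or.inr (Or.inl ⟨hzR, hzB, hzT⟩))
      obtain ⟨hyp, hyd, -⟩ := hdown y hy
      refine wp_assign_seq fun s₁ e₁ v₁ => ?_
      refine (hp.eqExcept e₁ (by norm_num)).wp_push hB hW hy hyp
        (by rw [e₁.reg 2 (by norm_num), h2]) ?_ fun s₂ hs₂ hp₂ => wp_assign fun s₃ e₃ v₃ =>
          ⟨?_, ?_, ?_, ?_, hp₂.eqExcept e₃ (by norm_num)⟩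
      · rw [v₁, Expr.eval, stackTag, if_neg, if_neg hzL]
        rintro ⟨y', hy'⟩
        exact hB.not_both _ _ _ hy' hyd
      · exact ((hs.eqExcept e₁ (by norm_num)).congr fun r hr => hs₂ r (by omega)).eqExcept e₃
          (by norm_num)
      · rw [e₃.reg 1 (by norm_num), hs₂ 1 (by norm_num), e₁.reg 1 (by norm_num)]
      · rw [e₃.reg 2 (by norm_num), hs₂ 2 (by norm_num), e₁.reg 2 (by norm_num), h2]
      · rw [v₃]
        exact Or.inr (Or.inl ⟨rfl, y, hyd⟩)
    · rw [eval_notCorner, h2, hs.r24] at hc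
      refine wp_assign fun s₁ e₁ v₁ => ⟨hs.eqExcept e₁ (by norm_num), e₁.reg 1 (by norm_num),
        by rw [e₁.reg 2 (by norm_num), h2], ?_, ?_⟩
      · rw [v₁]
        exact Or.inr (Or.inr ⟨rfl, fun ⟨y, h⟩ => (hdown y (Or.inl h)).2.2 hc.1,
          fun ⟨y, h⟩ => (hdown y (Or.inr h)).2.2 hc.1⟩)
      · exact (hp.eqExcept e₁ (by norm_num)).skip hB hW fun y hy => (hdown y hy).2.2 hc.1

theorem eval_isOne_reg {input : List ℕ} {s : State} :
    (isOne (.reg 3)).eval input s ≠ 0 ↔ s.reg 3 = 1 := by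
  rw [Ne, eval_isOne, not_not]; rfl

theorem right_step (hR : RecordSpec R I D pos eh ev val avail) (hA : RecordAt input off R)
    (hF : FlagsAt input R eh ev) {l₁ l₂ : List ℕ} (hl : R.right = l₁ ++ z :: l₂)
    (h : Between R I D pos val avail out k off
      (R.left.reverse ++ (R.bottom.filter (· ∉ R.left) ++ l₁.filter (· ∉ R.bottom)))
      ((z :: l₂).filter (· ∉ R.bottom) ++
        (R.top.filter fun x => x ∉ R.left ∧ x ∉ R.right).reverse) l₁.length s) :
    wp input rightBody
      (Between R I D pos val avail out k off
        (R.left.reverse ++ (R.bottom.filter (· ∉ R.left) ++ (l₁ ++ [z]).filter (· ∉ R.bottom)))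
        (l₂.filter (· ∉ R.bottom) ++ (R.top.filter fun x => x ∉ R.left ∧ x ∉ R.right).reverse)
        (l₁ ++ [z]).length) s := by
  have hB := hR.toBoxPattern
  have hz : z ∈ R.right := by rw [hl]; simp
  have hzL : z ∉ R.left := fun h => hR.disjoint_LR z h hz
  -- A point shared with the lower edge is the first of the right edge, so the later points need no
  -- filtering.
  have hl₂ : ∀ x ∈ l₂, x ∉ R.bottom := by
    intro x hx hxB
    obtain ⟨-, l, e⟩ := hR.corner_BR x hxB (by rw [hl]; simp [hx])
    have hn := hR.nodup_right
    rw [e] at hn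
    rw [e] at hl
    cases l₁ with
    | nil =>
      simp only [List.nil_append, List.cons.injEq] at hl
      rw [hl.2] at hn
      exact (List.nodup_cons.1 hn).1 hx
    | cons a l₁ =>
      simp only [List.cons_append, List.cons.injEq] at hl
      rw [hl.2] at hn
      exact (List.nodup_cons.1 hn).1 (by simp [hx])
  obtain ⟨hreg, hi, hp⟩ := h
  refine wp_assign_seq fun s₁ e₁ v₁ => ?_
  have hreg₁ := hreg.eqExcept e₁ (by norm_num)
  have hp₁ := hp.eqExcept e₁ (by norm_num)
  have i₁ : s₁.reg 1 = l₁.length := by rw [e₁.reg 1 (by norm_num), hi]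
  have z₁ : s₁.reg 2 = z := by
    rw [v₁]
    simp only [Expr.eval, hreg.r17, hi]
    exact hA.right _ _ _ hl
  refine wp_seq (fun s' => Registers R k off s' ∧ s'.reg 1 = l₁.length ∧
    Progress R.left I D pos k val (knownAfter avail R
        (R.left.reverse ++ (R.bottom.filter (· ∉ R.left) ++ (l₁ ++ [z]).filter (· ∉ R.bottom)))) out
      (R.left.reverse ++ (R.bottom.filter (· ∉ R.left) ++ (l₁ ++ [z]).filter (· ∉ R.bottom)))
      (l₂.filter (· ∉ R.bottom) ++ (R.top.filter fun x => x ∉ R.left ∧ x ∉ R.right).reverse) s')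
    ?_ ?_
  · refine wp_ite (fun hc => ?_) (fun hc => ?_)
    · rw [Ne, eval_notCorner, z₁, hreg₁.r23] at hc
      have hzB : z ∉ R.bottom := fun h => hc ⟨h, hz⟩
      have f₁ : (l₁ ++ [z]).filter (· ∉ R.bottom) = l₁.filter (· ∉ R.bottom) ++ [z] := by simp [hzB]
      have f₂ : (z :: l₂).filter (· ∉ R.bottom) = z :: l₂.filter (· ∉ R.bottom) := by simp [hzB]
      have f₃ : l₂.filter (· ∉ R.bottom) = l₂ := by
        rw [List.filter_eq_self]; simpa using hl₂
      have hW : boundaryOrder R.bottom R.left R.top R.right =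
          (R.left.reverse ++ (R.bottom.filter (· ∉ R.left) ++ l₁.filter (· ∉ R.bottom))) ++
          z :: (l₂ ++ (R.top.filter fun x => x ∉ R.left ∧ x ∉ R.right).reverse) := by
        have f₅ : R.right.filter (· ∉ R.bottom) = l₁.filter (· ∉ R.bottom) ++ z :: l₂ := by
          conv_lhs => rw [hl]
          rw [List.filter_append, f₂, f₃]
        rw [boundaryOrder, f₅]
        simp
      rw [f₂, f₃, List.cons_append] at hp₁
      have f₄ : R.left.reverse ++ (R.bottom.filter (· ∉ R.left) ++ (l₁ ++ [z]).filter (· ∉ R.bottom))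
          = (R.left.reverse ++ (R.bottom.filter (· ∉ R.left) ++ l₁.filter (· ∉ R.bottom))) ++ [z] := by
        rw [f₁]; simp
      rw [f₄, f₃]
      have hpreL : ∀ x ∈ R.left, x ∈ R.left.reverse ++ (R.bottom.filter (· ∉ R.left) ++
          l₁.filter (· ∉ R.bottom)) := fun x hx => by simp [hx]
      have hpreB : ∀ x ∈ R.bottom, x ∈ R.left.reverse ++ (R.bottom.filter (· ∉ R.left) ++
          l₁.filter (· ∉ R.bottom)) := fun x hx => by
        by_cases h : x ∈ R.left <;> simp [hx, h]
      generalize R.left.reverse ++ (R.bottom.filter (· ∉ R.left) ++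
        l₁.filter (· ∉ R.bottom)) = pre at *
      refine wp_seq _ (wp_rightMatch hB hW hl hzB rfl hl₂ hpreL hpreB hreg₁ i₁ z₁ hp₁) ?_
      generalize l₂ ++ (R.top.filter fun x => x ∉ R.left ∧ x ∉ R.right).reverse = post at *
      rintro s₂ ⟨hreg₂, i₂, z₂, hcode, hp₂⟩
      have c1 := hcode.eq_one_iff hB
      have c2 := hcode.eq_two_iff hB
      have c3 := hcode.le_two
      have hflag := hF z (Or.inr (Or.inr (Or.inr hz)))
      refine wp_seq (fun s' => s'.reg = s₂.reg ∧ Progress R.left I D pos k val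
        (fun κ x => knownAfter avail R pre κ x ∨ κ = 3 ∧ x = z) out (pre ++ [z]) post s') ?_ ?_
      · refine hp₂.wp_storeIff (by norm_num) z₂ ?_ fun s' hs' hp' => ⟨hs', hp'⟩
        rw [hR.write3 z hz hzB, eval_isOne_reg, c1, eval_flagExpr, z₂, hflag.1]
      · rintro s₃ ⟨hs₃, hp₃⟩
        have hreg₃ : Registers R k off s₃ := hreg₂.congr fun r _ => by rw [hs₃]
        have z₃ : s₃.reg 2 = z := by rw [hs₃, z₂]
        have c1' : s₃.reg 3 = 1 ↔ ∃ y, I z y := by rw [hs₃]; exact c1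
        have c2' : s₃.reg 3 = 2 ↔ ∃ y, D z y := by rw [hs₃]; exact c2
        have c3' : s₃.reg 3 ≤ 2 := by rw [hs₃]; exact c3
        -- The upper right corner has no upper left quadrant in the subcell. Instead it passes its
        -- lower left quadrant also to the subcell above, since it is skipped on the upper edge.
        refine wp_ite (fun hc => ?_) (fun hc => ?_)
        · rw [Ne, eval_notCorner, z₃, hreg₃.r24] at hc
          have hzT : z ∉ R.top := fun h => hc ⟨h, hz⟩
          refine hp₃.wp_storeIff (by norm_num) z₃ ?_ fun s' hs' hp' => ⟨?_, ?_, hp'.mono ?_⟩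
          · have hv : (Expr.minus (.reg 3) (.const 1)).eval input s₃ ≠ 0 ↔ s₃.reg 3 = 2 := by
              simp only [Expr.eval]; omega
            rw [hR.write2 z hz hzT, hv, c2', eval_flagExpr, z₃, hflag.1]
          · exact hreg₃.congr fun r _ => by rw [hs']
          · rw [hs', hs₃, i₂, i₁]
          · intro κ x hx
            rcases knownAfter_append hx with h | ⟨h, hw⟩
            · exact Or.inl (Or.inl h)
            · rw [List.mem_singleton] at h
              subst h
              unfold SubcellRecord.Writes at hw
              simp only [and_true]
              clear c1 c2 c1' c2' hpreL hpreB
              tauto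
        · rw [eval_notCorner, z₃, hreg₃.r24] at hc
          refine hp₃.wp_storeIff (by norm_num) z₃ ?_ fun s' hs' hp' => ⟨?_, ?_, hp'.mono ?_⟩
          · rw [hR.write1 z hc.1 hzL, eval_isOne_reg, c1', eval_flagExpr, z₃, hflag.2]
          · exact hreg₃.congr fun r _ => by rw [hs']
          · rw [hs', hs₃, i₂, i₁]
          · intro κ x hx
            rcases knownAfter_append hx with h | ⟨h, hw⟩
            · exact Or.inl (Or.inl h)
            · rw [List.mem_singleton] at h
              subst h
              unfold SubcellRecord.Writes at hw
              simp only [and_true]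
              clear c1 c2 c1' c2' hpreL hpreB
              tauto
    · rw [eval_notCorner, z₁, hreg₁.r23] at hc
      have f₁ : (l₁ ++ [z]).filter (· ∉ R.bottom) = l₁.filter (· ∉ R.bottom) := by simp [hc.1]
      have f₂ : (z :: l₂).filter (· ∉ R.bottom) = l₂.filter (· ∉ R.bottom) := by simp [hc.1]
      rw [f₂] at hp₁
      rw [f₁]
      exact ⟨hreg₁, i₁, hp₁⟩
  · rintro s₂ ⟨hreg₂, i₂, hp₂⟩
    refine wp_assign fun s₃ e₃ v₃ => ⟨hreg₂.eqExcept e₃ (by norm_num), ?_,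
      hp₂.eqExcept e₃ (by norm_num)⟩
    rw [v₃]
    simp [Expr.eval, i₂]

/-- The two corners were handled with the left and the right edge and are skipped. All other points
of the upper edge have their partner on the stack. -/
theorem top_step (hR : RecordSpec R I D pos eh ev val avail) (hA : RecordAt input off R)
    (hF : FlagsAt input R eh ev) {l₁ l₂ pre : List ℕ} (hl : R.top.reverse = l₁ ++ z :: l₂)
    (hpre : boundaryOrder R.bottom R.left R.top R.right =
      pre ++ R.top.reverse.filter fun x => x ∉ R.left ∧ x ∉ R.right)
    (h : Between R I D pos val avail out k off (pre ++ l₁.filter fun x => x ∉ R.left ∧ x ∉ R.right)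
      ((z :: l₂).filter fun x => x ∉ R.left ∧ x ∉ R.right) (z :: l₂).length s) :
    wp input topBody
      (Between R I D pos val avail out k off
        (pre ++ (l₁ ++ [z]).filter fun x => x ∉ R.left ∧ x ∉ R.right)
        (l₂.filter fun x => x ∉ R.left ∧ x ∉ R.right) l₂.length) s := by
  have hB := hR.toBoxPattern
  have hL : R.top = l₂.reverse ++ z :: l₁.reverse := by
    rw [← List.reverse_reverse R.top, hl]; simp
  have hz : z ∈ R.top := by rw [hL]; simp
  obtain ⟨hreg, hi, hp⟩ := h
  refine wp_assign_seq fun s₁ e₁ v₁ => wp_assign_seq fun s₂ e₂ v₂ => ?_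
  have hreg₁ := hreg.eqExcept e₁ (by norm_num)
  have hreg₂ := hreg₁.eqExcept e₂ (by norm_num)
  have hp₂ := (hp.eqExcept e₁ (by norm_num)).eqExcept e₂ (by norm_num)
  have i₁ : s₁.reg 1 = l₂.length := by rw [v₁]; simp [Expr.eval, hi]
  have i₂ : s₂.reg 1 = l₂.length := by rw [e₂.reg 1 (by norm_num), i₁]
  have z₂ : s₂.reg 2 = z := by
    rw [v₂]
    simp only [Expr.eval, hreg₁.r16, i₁]
    have := hA.top _ _ _ hL
    rwa [List.length_reverse] at this
  have skip : z ∈ R.left ∨ z ∈ R.right → Between R I D pos val avail out k off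
        (pre ++ (l₁ ++ [z]).filter fun x => x ∉ R.left ∧ x ∉ R.right)
        (l₂.filter fun x => x ∉ R.left ∧ x ∉ R.right) l₂.length s₂ := by
    intro h
    have hn : ¬ (z ∉ R.left ∧ z ∉ R.right) := by tauto
    have f₁ : ((l₁ ++ [z]).filter fun x => x ∉ R.left ∧ x ∉ R.right) =
        l₁.filter fun x => x ∉ R.left ∧ x ∉ R.right := by
      rw [List.filter_append, List.filter_cons_of_neg (by simpa using hn)]; simp
    have f₂ : ((z :: l₂).filter fun x => x ∉ R.left ∧ x ∉ R.right) =
        l₂.filter fun x => x ∉ R.left ∧ x ∉ R.right := by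
      rw [List.filter_cons_of_neg (by simpa using hn)]
    rw [f₂] at hp₂
    rw [f₁]
    exact ⟨hreg₂, i₂, hp₂⟩
  refine wp_ite (fun hc => ?_) (fun hc => ?_)
  · rw [Ne, eval_notCorner, z₂, hreg₂.r21] at hc
    have hzL : z ∉ R.left := fun h => hc ⟨hz, h⟩
    refine wp_ite (fun hc' => ?_) (fun hc' => ?_)
    · rw [Ne, eval_notCorner, z₂, hreg₂.r24] at hc'
      have hzR : z ∉ R.right := fun h => hc' ⟨hz, h⟩
      have f₁ : ((l₁ ++ [z]).filter fun x => x ∉ R.left ∧ x ∉ R.right) =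
          (l₁.filter fun x => x ∉ R.left ∧ x ∉ R.right) ++ [z] := by
        rw [List.filter_append, List.filter_cons_of_pos (by simpa using ⟨hzL, hzR⟩)]; simp
      have f₂ : ((z :: l₂).filter fun x => x ∉ R.left ∧ x ∉ R.right) =
          z :: l₂.filter fun x => x ∉ R.left ∧ x ∉ R.right := by
        rw [List.filter_cons_of_pos (by simpa using ⟨hzL, hzR⟩)]
      have hW : boundaryOrder R.bottom R.left R.top R.right =
          (pre ++ l₁.filter fun x => x ∉ R.left ∧ x ∉ R.right) ++
            z :: l₂.filter fun x => x ∉ R.left ∧ x ∉ R.right := by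
        rw [hpre, hl, List.filter_append, f₂]; simp
      have hpost : ∀ x ∈ l₂.filter fun x => x ∉ R.left ∧ x ∉ R.right, x ∈ R.top := by
        intro x hx
        rw [hL]
        simp [(List.mem_filter.1 hx).1]
      rw [f₂] at hp₂
      rw [f₁, ← List.append_assoc]
      generalize (pre ++ l₁.filter fun x => x ∉ R.left ∧ x ∉ R.right) = pre at *
      generalize (l₂.filter fun x => x ∉ R.left ∧ x ∉ R.right) = post at *
      obtain ⟨y, hy⟩ := hB.exists_join_of_notMem (Or.inl ⟨hz, hzL, hzR⟩)
      refine hp₂.wp_popEmit hB hW hy (hB.top_pre hW hz hpost hy) z₂ hreg₂.r6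
        fun s₃ hs₃ h5 hp₃ => ?_
      refine wp_seq _ (wp_codeOfTag hB hy h5) ?_
      rintro s₄ ⟨e₄, hcode⟩
      have hp₄ := hp₃.eqExcept e₄ (by norm_num)
      have hreg₄ : Registers R k off s₄ := (hreg₂.congr fun r hr =>
        hs₃ r (by omega) (by omega) (by omega)).eqExcept e₄ (by norm_num)
      have i₄ : s₄.reg 1 = l₂.length := by
        rw [e₄.reg 1 (by norm_num), hs₃ 1 (by norm_num) (by norm_num) (by norm_num), i₂]
      have z₄ : s₄.reg 2 = z := by
        rw [e₄.reg 2 (by norm_num), hs₃ 2 (by norm_num) (by norm_num) (by norm_num), z₂]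
      have c1 := hcode.eq_one_iff hB
      have c2 := hcode.eq_two_iff hB
      have c3 := hcode.le_two
      have hflag := hF z (Or.inr (Or.inr (Or.inl hz)))
      refine wp_seq (fun s' => s'.reg = s₄.reg ∧ Progress R.left I D pos k val
        (fun κ x => knownAfter avail R pre κ x ∨ κ = 0 ∧ x = z) out (pre ++ [z]) post s') ?_ ?_
      · refine hp₄.wp_storeIff (by norm_num) z₄ ?_ fun s' hs' hp' => ⟨hs', hp'⟩
        have hv : (Expr.minus (.reg 3) (.const 1)).eval input s₄ ≠ 0 ↔ s₄.reg 3 = 2 := by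
          simp only [Expr.eval]; omega
        rw [hR.write0 z hz hzR, hv, c2, eval_flagExpr, z₄, hflag.2]
      · rintro s₅ ⟨hs₅, hp₅⟩
        refine hp₅.wp_storeIff (by norm_num) (by rw [hs₅, z₄]) ?_
          fun s' hs' hp' => ⟨?_, ?_, hp'.mono ?_⟩
        · rw [hR.write1 z hz hzL, eval_isOne_reg, hs₅, c1, eval_flagExpr, hs₅, z₄, hflag.2]
        · exact hreg₄.congr fun r _ => by rw [hs', hs₅]
        · rw [hs', hs₅, i₄]
        · intro κ x hx
          rcases knownAfter_append hx with h | ⟨h, hw⟩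
          · exact Or.inl (Or.inl h)
          · rw [List.mem_singleton] at h
            subst h
            unfold SubcellRecord.Writes at hw
            simp only [and_true]
            clear c1 c2 hpre hpost
            tauto
    · rw [eval_notCorner, z₂, hreg₂.r24] at hc'
      exact skip (Or.inr hc'.2)
  · rw [eval_notCorner, z₂, hreg₂.r21] at hc
    exact skip (Or.inl hc.2)

end steps

end FreeSpace

namespace FreeSpace

open RAM

/-! ### Handling a record -/

/-- Read the header of the record that starts at the position in register `7`. -/
def readHeader : Cmd :=
  .seq (.assign 8 (.inp (.reg 7))) <|
  .seq (.assign 9 (.inp (.plus (.reg 7) (.const 1)))) <|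
  .seq (.assign 10 (.inp (.plus (.reg 7) (.const 2)))) <|
  .seq (.assign 11 (.inp (.plus (.reg 7) (.const 3)))) <|
  .seq (.assign 12 (.inp (.plus (.reg 7) (.const 4)))) <|
  .seq (.assign 13 (.inp (.plus (.reg 7) (.const 5)))) <|
  .seq (.assign 14 (.plus (.reg 7) (.const 6))) <|
  .seq (.assign 15 (.plus (.reg 14) (.reg 10))) <|
  .seq (.assign 16 (.plus (.reg 15) (.reg 11))) <|
  .seq (.assign 17 (.plus (.reg 16) (.reg 12))) <|
  .seq (.assign 18 (.plus (.reg 17) (.reg 13))) <|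
  .seq (.ite (.reg 8) (.assign 19 (.plus (.reg 18) (.reg 10))) (.assign 19 (.reg 18))) <|
  .ite (.reg 9) (.assign 20 (.plus (.reg 19) (.reg 11))) (.assign 20 (.reg 19))

/-- The first element of the list at the position in register `b`. -/
def firstExpr (b : ℕ) : Expr := .inp (.reg b)

/-- The last element of the list at the position in register `b` with length in register `n`. -/
def lastExpr (b n : ℕ) : Expr := .inp (.minus (.plus (.reg b) (.reg n)) (.const 1))

/-- Write to register `c` the successor of the common value of `e₁` and `e₂`, or zero if the values
differ or one of the lists with lengths in the registers `n₁` and `n₂` is empty. -/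
def findCorner (c n₁ n₂ : ℕ) (e₁ e₂ : Expr) : Cmd :=
  .seq (.assign c (.const 0)) <|
    .ite (.reg n₁) (.ite (.reg n₂)
      (.ite (neq e₁ e₂) .skip (.assign c (.plus e₁ (.const 1)))) .skip) .skip

/-- Initialize the registers for a record. -/
def setup : Cmd :=
  .seq readHeader <|
  .seq (findCorner 21 12 11 (firstExpr 16) (lastExpr 15 11)) <|
  .seq (findCorner 22 10 11 (firstExpr 14) (firstExpr 15)) <|
  .seq (findCorner 23 10 13 (lastExpr 14 10) (firstExpr 17)) <|
  .seq (findCorner 24 12 13 (lastExpr 16 12) (lastExpr 17 13)) <|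
  .ite (.reg 21) (.assign 25 (.const 1)) (.assign 25 (.const 0))

/-- Handle the record that starts at the position in register `7`. -/
def recordCmd : Cmd :=
  .seq (.seq setup (.assign 1 (.reg 11))) <|
  .seq (.loop (.reg 1) leftBody) <|
  .seq (.assign 1 (.const 0)) <|
  .seq (.loop (.minus (.reg 10) (.reg 1)) bottomBody) <|
  .seq (.assign 1 (.const 0)) <|
  .seq (.loop (.minus (.reg 13) (.reg 1)) rightBody) <|
  .seq (.assign 1 (.reg 12)) <|
  .seq (.loop (.reg 1) topBody) <|
  .seq (.assign 7 (.reg 20)) (.assign 6 (.plus (.reg 6) (.const 1)))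

/-- Handle all records. -/
def mainCmd : Cmd :=
  .seq (.seq (.assign 7 (.inp (.const 0)))
    (.assign 7 (.plus (.plus (.plus (.reg 7) (.reg 7)) (.plus (.reg 7) (.reg 7))) (.const 2)))) <|
  .loop (.minus (.inp (.const 1)) (.reg 6)) recordCmd

theorem SegAt.head {input : List ℕ} {p : ℕ} {l : List ℕ} (h : SegAt input p l) {z : ℕ}
    {l' : List ℕ} (hl : l = z :: l') : input.getD p 0 = z := by
  simpa using h [] z l' hl

theorem SegAt.last {input : List ℕ} {p : ℕ} {l : List ℕ} (h : SegAt input p l) {z : ℕ}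
    {l' : List ℕ} (hl : l = l' ++ [z]) : input.getD (p + l.length - 1) 0 = z := by
  have := h l' z [] hl
  rw [hl]
  simpa [← Nat.add_assoc] using this

theorem SegAt.head_mem {input : List ℕ} {p : ℕ} {l : List ℕ} (h : SegAt input p l) (hl : l ≠ []) :
    input.getD p 0 ∈ l := by
  obtain ⟨z, l', rfl⟩ := List.exists_cons_of_ne_nil hl
  rw [h.head rfl]
  exact List.mem_cons_self

theorem SegAt.last_mem {input : List ℕ} {p : ℕ} {l : List ℕ} (h : SegAt input p l) (hl : l ≠ []) :
    input.getD (p + l.length - 1) 0 ∈ l := by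
  have e := (List.dropLast_append_getLast hl).symm
  rw [h.last e]
  exact List.getLast_mem hl

/-- A marked corner is the first or last entry in the lists of both its edges, so comparing one
entry of each list finds it. The stored value is the number plus one, so that `0` means that no
marked point is there. -/
theorem wp_findCorner {input : List ℕ} {s : State} {c n₁ n₂ x₁ x₂ : ℕ} {e₁ e₂ : Expr}
    {l₁ l₂ : List ℕ} {Q : State → Prop} (hc₁ : n₁ ≠ c) (hc₂ : n₂ ≠ c) (hn₁ : s.reg n₁ = l₁.length)
    (hn₂ : s.reg n₂ = l₂.length)
    (he₁ : ∀ s', EqExcept c s s' → e₁.eval input s' = x₁)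
    (he₂ : ∀ s', EqExcept c s s' → e₂.eval input s' = x₂)
    (hx₁ : l₁ ≠ [] → x₁ ∈ l₁) (hx₂ : l₂ ≠ [] → x₂ ∈ l₂)
    (hx : ∀ z, z ∈ l₁ → z ∈ l₂ → x₁ = z ∧ x₂ = z)
    (hQ : ∀ s', EqExcept c s s' → (∀ z, z + 1 = s'.reg c ↔ z ∈ l₁ ∧ z ∈ l₂) → Q s') :
    wp input (findCorner c n₁ n₂ e₁ e₂) Q s := by
  refine wp_assign_seq fun s₁ h₁ v₁ => ?_
  have v₁ : s₁.reg c = 0 := v₁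
  refine wp_ite (fun hb₁ => wp_ite (fun hb₂ => wp_ite (fun hne => ?_) (fun he => ?_)) (fun hb₂ => ?_))
    (fun hb₁ => ?_)
  · refine hQ s₁ h₁ fun z => ?_
    rw [Ne, eval_neq, he₁ _ h₁, he₂ _ h₁] at hne
    rw [v₁]
    refine ⟨fun h => by omega, fun h => ?_⟩
    obtain ⟨h1, h2⟩ := hx z h.1 h.2
    exact (hne (h1.trans h2.symm)).elim
  · rw [eval_neq, he₁ _ h₁, he₂ _ h₁] at he
    have m₁ : x₁ ∈ l₁ := hx₁ fun h => hb₁ (by simp [Expr.eval, h₁.reg n₁ hc₁, hn₁, h])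
    have m₂ : x₂ ∈ l₂ := hx₂ fun h => hb₂ (by simp [Expr.eval, h₁.reg n₂ hc₂, hn₂, h])
    refine wp_assign fun s₂ h₂ v₂ => hQ s₂ ⟨fun i hi => ?_, ?_, ?_⟩ fun z => ?_
    · rw [h₂.reg i hi, h₁.reg i hi]
    · rw [h₂.mem, h₁.mem]
    · rw [h₂.out, h₁.out]
    · rw [v₂]
      simp only [Expr.eval, he₁ _ h₁, Nat.add_right_cancel_iff]
      exact ⟨fun h => ⟨h ▸ m₁, h ▸ he ▸ m₂⟩, fun h => (hx z h.1 h.2).1.symm⟩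
  · refine hQ s₁ h₁ fun z => ?_
    have : l₂ = [] := by
      simpa [Expr.eval, h₁.reg n₂ hc₂, hn₂] using hb₂
    simp [v₁, this]
  · refine hQ s₁ h₁ fun z => ?_
    have : l₁ = [] := by
      simpa [Expr.eval, h₁.reg n₁ hc₁, hn₁] using hb₁
    simp [v₁, this]

section record

variable {R : SubcellRecord} {I D : ℕ → ℕ → Prop} {pos : ℕ → ℝ} {eh ev : ℕ → Prop}
  {val avail : ℕ → ℕ → Prop} {input out : List ℕ} {k off : ℕ} {s : State}

/-- The header does not contain the lengths of the slope lists; they follow from the two bits and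
the lengths of the point lists. The program needs them to find the left slopes and the next record.
-/
theorem RecordSpec.length_bottomSlope (hR : RecordSpec R I D pos eh ev val avail) :
    R.bottomSlope.length = if R.onBottom = true then R.bottom.length else 0 := by
  have h := hR.bottomSlope
  split_ifs at h ⊢
  · exact h.length_eq.symm
  · simp [h]

theorem RecordSpec.length_leftSlope (hR : RecordSpec R I D pos eh ev val avail) :
    R.leftSlope.length = if R.onLeft = true then R.left.length else 0 := by
  have h := hR.leftSlope
  split_ifs at h ⊢
  · exact h.length_eq.symm
  · simp [h]

theorem wp_readHeader (hR : RecordSpec R I D pos eh ev val avail) (hA : RecordAt input off R)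
    (h6 : s.reg 6 = k) (h7 : s.reg 7 = off) {Q : State → Prop}
    (hQ : ∀ s', Header R k off s' → s'.reg 0 = s.reg 0 → s'.mem = s.mem → s'.out = s.out → Q s') :
    wp input readHeader Q s := by
  have hl : R.words.length = 6 + R.bottom.length + R.left.length + R.top.length + R.right.length +
      R.bottomSlope.length + R.leftSlope.length := by
    simp [SubcellRecord.words]; omega
  have hbs := hR.length_bottomSlope
  have hls := hR.length_leftSlope
  refine wp_assign_seq fun s₁ e₁ v₁ => wp_assign_seq fun s₂ e₂ v₂ => wp_assign_seq fun s₃ e₃ v₃ =>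
    wp_assign_seq fun s₄ e₄ v₄ => wp_assign_seq fun s₅ e₅ v₅ => wp_assign_seq fun s₆ e₆ v₆ =>
    wp_assign_seq fun s₇ e₇ v₇ => wp_assign_seq fun s₈ e₈ v₈ => wp_assign_seq fun s₉ e₉ v₉ =>
    wp_assign_seq fun t e v => wp_assign_seq fun t' e' v' => ?_
  simp only [Expr.eval] at v₁ v₂ v₃ v₄ v₅ v₆ v₇ v₈ v₉ v v'
  have fin : ∀ t₁ x, EqExcept 19 t' t₁ → t₁.reg 19 = x → ∀ t₂ y, EqExcept 20 t₁ t₂ → t₂.reg 20 = y →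
      x = t'.reg 18 + R.bottomSlope.length → y = x + R.leftSlope.length → Q t₂ := by
    intro t₁ x f₁ w₁ t₂ y f₂ w₂ hx hy
    subst hx hy
    refine hQ t₂ ⟨?_, ?_, ?_, ?_, ?_, ?_, ?_, ?_, ?_, ?_, ?_, ?_, ?_, ?_⟩ ?_ ?_ ?_
    rotate_left 15
    · rw [f₂.mem, f₁.mem, e'.mem, e.mem, e₉.mem, e₈.mem, e₇.mem, e₆.mem, e₅.mem, e₄.mem, e₃.mem,
        e₂.mem, e₁.mem]
    · rw [f₂.out, f₁.out, e'.out, e.out, e₉.out, e₈.out, e₇.out, e₆.out, e₅.out, e₄.out, e₃.out,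
        e₂.out, e₁.out]
    all_goals
      simp [w₂, f₂.reg, w₁, f₁.reg, v', e'.reg, v, e.reg, v₉, e₉.reg, v₈, e₈.reg, v₇, e₇.reg, v₆,
        e₆.reg, v₅, e₅.reg, v₄, e₄.reg, v₃, e₃.reg, v₂, e₂.reg, v₁, e₁.reg, h6, h7, hA.word0,
        hA.word1, hA.word2, hA.word3, hA.word4, hA.word5, hl, -List.getD_eq_getElem?_getD]
    omega
  have r8 : t'.reg 8 = R.onBottom.toNat := by
    simp [e'.reg, e.reg, e₉.reg, e₈.reg, e₇.reg, e₆.reg, e₅.reg, e₄.reg, e₃.reg, e₂.reg, v₁, h7,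
      hA.word0, -List.getD_eq_getElem?_getD]
  have r9 : t'.reg 9 = R.onLeft.toNat := by
    simp [e'.reg, e.reg, e₉.reg, e₈.reg, e₇.reg, e₆.reg, e₅.reg, e₄.reg, e₃.reg, v₂, e₁.reg, h7,
      hA.word1, -List.getD_eq_getElem?_getD]
  have r10 : t'.reg 10 = R.bottom.length := by
    simp [e'.reg, e.reg, e₉.reg, e₈.reg, e₇.reg, e₆.reg, e₅.reg, e₄.reg, v₃, e₂.reg, e₁.reg, h7,
      hA.word2, -List.getD_eq_getElem?_getD]
  have r11 : t'.reg 11 = R.left.length := by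
    simp [e'.reg, e.reg, e₉.reg, e₈.reg, e₇.reg, e₆.reg, e₅.reg, v₄, e₃.reg, e₂.reg, e₁.reg, h7,
      hA.word3, -List.getD_eq_getElem?_getD]
  refine wp_seq (fun t₁ => EqExcept 19 t' t₁ ∧ t₁.reg 19 = t'.reg 18 + R.bottomSlope.length) ?_ ?_
  · refine wp_ite (fun hb => wp_assign fun t₁ f₁ w₁ => ⟨f₁, ?_⟩)
      (fun hb => wp_assign fun t₁ f₁ w₁ => ⟨f₁, ?_⟩)
    · have : R.onBottom = true := by simpa [Expr.eval, r8] using hb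
      rw [w₁, hbs, if_pos this]
      simp [Expr.eval, r10]
    · have : ¬ R.onBottom = true := by simpa [Expr.eval, r8] using hb
      rw [w₁, hbs, if_neg this]
      simp [Expr.eval]
  · rintro t₁ ⟨f₁, w₁⟩
    refine wp_ite (fun hb => wp_assign fun t₂ f₂ w₂ => fin t₁ _ f₁ w₁ t₂ _ f₂ w₂ rfl ?_)
      (fun hb => wp_assign fun t₂ f₂ w₂ => fin t₁ _ f₁ w₁ t₂ _ f₂ w₂ rfl ?_)
    · have : R.onLeft = true := by simpa [Expr.eval, f₁.reg, r9] using hb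
      rw [hls, if_pos this]
      simp [Expr.eval, w₁, f₁.reg, r11]
    · have : ¬ R.onLeft = true := by simpa [Expr.eval, f₁.reg, r9] using hb
      rw [hls, if_neg this]
      simp [Expr.eval, w₁]

theorem wp_setup (hR : RecordSpec R I D pos eh ev val avail) (hA : RecordAt input off R)
    (h6 : s.reg 6 = k) (h7 : s.reg 7 = off) {Q : State → Prop}
    (hQ : ∀ s', Registers R k off s' → s'.reg 0 = s.reg 0 → s'.mem = s.mem → s'.out = s.out →
      Q s') : wp input setup Q s := by
  classical
  refine wp_seq (fun s' => Header R k off s' ∧ s'.reg 0 = s.reg 0 ∧ s'.mem = s.mem ∧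
    s'.out = s.out) (wp_readHeader hR hA h6 h7 fun s' h1 h2 h3 h4 => ⟨h1, h2, h3, h4⟩) ?_
  rintro s₀ ⟨h₀, z₀, m₀, o₀⟩
  refine wp_seq (fun s' => EqExcept 21 s₀ s' ∧ ∀ z, z + 1 = s'.reg 21 ↔ z ∈ R.top ∧ z ∈ R.left)
    (wp_findCorner (x₁ := input.getD (off + 6 + R.bottom.length + R.left.length) 0)
    (x₂ := input.getD (off + 6 + R.bottom.length + R.left.length - 1) 0) (by norm_num) (by norm_num)
    h₀.r12 h₀.r11 (fun s' hs => ?_) (fun s' hs => ?_) hA.top.head_mem hA.left.last_mem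
    (fun z h1 h2 => ?_) fun s' hs h => ⟨hs, h⟩) ?_
  · simp only [firstExpr, Expr.eval, hs.reg 16 (by norm_num), h₀.r16]
  · simp only [lastExpr, Expr.eval, hs.reg 15 (by norm_num), hs.reg 11 (by norm_num), h₀.r15, h₀.r11]
  · obtain ⟨⟨l, e⟩, l', e'⟩ := hR.corner_TL z h1 h2
    exact ⟨hA.top.head e, hA.left.last e'⟩
  rintro s₁ ⟨e₁, c₁⟩
  have h₁ : Header R k off s₁ := h₀.congr fun r _ _ => e₁.reg r (by omega)
  refine wp_seq (fun s' => EqExcept 22 s₁ s' ∧ ∀ z, z + 1 = s'.reg 22 ↔ z ∈ R.bottom ∧ z ∈ R.left)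
    (wp_findCorner (x₁ := input.getD (off + 6) 0)
    (x₂ := input.getD (off + 6 + R.bottom.length) 0) (by norm_num) (by norm_num)
    h₁.r10 h₁.r11 (fun s' hs => ?_) (fun s' hs => ?_) hA.bottom.head_mem hA.left.head_mem
    (fun z h1 h2 => ?_) fun s' hs h => ⟨hs, h⟩) ?_
  · simp only [firstExpr, Expr.eval, hs.reg 14 (by norm_num), h₁.r14]
  · simp only [firstExpr, Expr.eval, hs.reg 15 (by norm_num), h₁.r15]
  · obtain ⟨⟨l, e⟩, l', e'⟩ := hR.corner_BL z h1 h2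
    exact ⟨hA.bottom.head e, hA.left.head e'⟩
  rintro s₂ ⟨e₂, c₂⟩
  have h₂ : Header R k off s₂ := h₁.congr fun r _ _ => e₂.reg r (by omega)
  refine wp_seq (fun s' => EqExcept 23 s₂ s' ∧ ∀ z, z + 1 = s'.reg 23 ↔ z ∈ R.bottom ∧ z ∈ R.right)
    (wp_findCorner (x₁ := input.getD (off + 6 + R.bottom.length - 1) 0)
    (x₂ := input.getD (off + 6 + R.bottom.length + R.left.length + R.top.length) 0)
    (by norm_num) (by norm_num)
    h₂.r10 h₂.r13 (fun s' hs => ?_) (fun s' hs => ?_) hA.bottom.last_mem hA.right.head_mem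
    (fun z h1 h2 => ?_) fun s' hs h => ⟨hs, h⟩) ?_
  · simp only [lastExpr, Expr.eval, hs.reg 14 (by norm_num), hs.reg 10 (by norm_num), h₂.r14, h₂.r10]
  · simp only [firstExpr, Expr.eval, hs.reg 17 (by norm_num), h₂.r17]
  · obtain ⟨⟨l, e⟩, l', e'⟩ := hR.corner_BR z h1 h2
    exact ⟨hA.bottom.last e, hA.right.head e'⟩
  rintro s₃ ⟨e₃, c₃⟩
  have h₃ : Header R k off s₃ := h₂.congr fun r _ _ => e₃.reg r (by omega)
  refine wp_seq (fun s' => EqExcept 24 s₃ s' ∧ ∀ z, z + 1 = s'.reg 24 ↔ z ∈ R.top ∧ z ∈ R.right)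
    (wp_findCorner
    (x₁ := input.getD (off + 6 + R.bottom.length + R.left.length + R.top.length - 1) 0)
    (x₂ := input.getD (off + 6 + R.bottom.length + R.left.length + R.top.length +
      R.right.length - 1) 0) (by norm_num) (by norm_num)
    h₃.r12 h₃.r13 (fun s' hs => ?_) (fun s' hs => ?_) hA.top.last_mem hA.right.last_mem
    (fun z h1 h2 => ?_) fun s' hs h => ⟨hs, h⟩) ?_
  · simp only [lastExpr, Expr.eval, hs.reg 16 (by norm_num), hs.reg 12 (by norm_num), h₃.r16, h₃.r12]
  · simp only [lastExpr, Expr.eval, hs.reg 17 (by norm_num), hs.reg 13 (by norm_num), h₃.r17, h₃.r13]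
  · obtain ⟨⟨l, e⟩, l', e'⟩ := hR.corner_TR z h1 h2
    exact ⟨hA.top.last e, hA.right.last e'⟩
  rintro s₄ ⟨e₄, c₄⟩
  have h₄ : Header R k off s₄ := h₃.congr fun r _ _ => e₄.reg r (by omega)
  have t₄ : s₄.reg 21 = s₁.reg 21 := by
    rw [e₄.reg 21 (by norm_num), e₃.reg 21 (by norm_num), e₂.reg 21 (by norm_num)]
  have fin : ∀ s₅ v, EqExcept 25 s₄ s₅ → s₅.reg 25 = v →
      (v = if ∃ x ∈ R.top, x ∈ R.left then 1 else 0) → Q s₅ := by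
    intro s₅ v e₅ v₅ hv
    refine hQ s₅ ⟨h₄.congr fun r _ _ => e₅.reg r (by omega), ?_, ?_, ?_, ?_, by rw [v₅, hv]⟩ ?_ ?_ ?_
    · rw [e₅.reg 21 (by norm_num), t₄]; exact c₁
    · rw [e₅.reg 22 (by norm_num), e₄.reg 22 (by norm_num), e₃.reg 22 (by norm_num)]; exact c₂
    · rw [e₅.reg 23 (by norm_num), e₄.reg 23 (by norm_num)]; exact c₃
    · rw [e₅.reg 24 (by norm_num)]; exact c₄
    · rw [e₅.reg 0 (by norm_num), e₄.reg 0 (by norm_num), e₃.reg 0 (by norm_num),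
        e₂.reg 0 (by norm_num), e₁.reg 0 (by norm_num), z₀]
    · rw [e₅.mem, e₄.mem, e₃.mem, e₂.mem, e₁.mem, m₀]
    · rw [e₅.out, e₄.out, e₃.out, e₂.out, e₁.out, o₀]
  refine wp_ite (fun hb => ?_) (fun hb => ?_)
  · refine wp_assign fun s₅ e₅ v₅ => fin s₅ _ e₅ v₅ ?_
    obtain ⟨z, hz⟩ := Nat.exists_eq_succ_of_ne_zero (show s₁.reg 21 ≠ 0 from t₄ ▸ hb)
    rw [if_pos ⟨z, (c₁ z).1 hz.symm⟩]
    rfl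
  · refine wp_assign fun s₅ e₅ v₅ => fin s₅ _ e₅ v₅ ?_
    have hb : s₁.reg 21 = 0 := t₄ ▸ hb
    rw [if_neg]
    · rfl
    · rintro ⟨z, hz⟩
      have := (c₁ z).2 hz
      omega

end record

end FreeSpace

/-! ### Effect and running time of a record -/

namespace FreeSpace

open RAM

section record

variable {R : SubcellRecord} {I D : ℕ → ℕ → Prop} {pos : ℕ → ℝ} {eh ev : ℕ → Prop}
  {val avail : ℕ → ℕ → Prop} {input out : List ℕ} {k off : ℕ} {s : State}

theorem Between.eqExcept {pre post : List ℕ} {i : ℕ} {s' : State}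
    (h : Between R I D pos val avail out k off pre post i s) (he : EqExcept 1 s s') :
    Between R I D pos val avail out k off pre post (s'.reg 1) s' :=
  ⟨h.regs.eqExcept he (by norm_num), rfl, h.progress.eqExcept he (by norm_num)⟩

theorem runs_assign_index {pre post : List ℕ} {i n : ℕ} {e : Expr}
    (h : Between R I D pos val avail out k off pre post i s) (he : e.eval input s = n) :
    Runs input (.assign 1 e) s (e.cost + 1)
      (Between R I D pos val avail out k off pre post n) := by
  refine runs_of_wp (wp_assign fun s' hs hv => ?_)
  have := h.eqExcept hs
  rwa [hv, he] at this

/-- Bounds a loop with constant cost per pass by an affine function of the number of passes. With `c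
= 500` both hypotheses are settled by evaluating the cost of the body. -/
theorem sum_map_const_add_le {α : Type*} (l : List α) {a b c : ℕ} (ha : a ≤ c) (hb : b ≤ c) :
    (l.map fun _ => a).sum + b ≤ c * l.length + c := by
  rw [List.map_const', List.sum_replicate, smul_eq_mul, mul_comm]
  exact add_le_add (Nat.mul_le_mul_right _ ha) hb

theorem runs_leftLoop (hR : RecordSpec R I D pos eh ev val avail) (hA : RecordAt input off R)
    (hF : FlagsAt input R eh ev) {rest : List ℕ}
    (hrest : boundaryOrder R.bottom R.left R.top R.right = R.left.reverse ++ rest)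
    (h : Between R I D pos val avail out k off [] (R.left.reverse ++ rest) R.left.length s) :
    Runs input (.loop (.reg 1) leftBody) s (500 * R.left.length + 500)
      (Between R I D pos val avail out k off R.left.reverse rest 0) := by
  refine Runs.mono (runs_loop R.left.reverse (fun _ => leftBody.cost)
    (fun l₁ l₂ => Between R I D pos val avail out k off l₁ (l₂ ++ rest) l₂.length)
    (fun l₁ z l₂ hl s hs => ⟨?_, runs_of_wp (left_step hR hA hF hl hrest hs)⟩)
    (fun s hs => ?_) (by simpa using h)) ?_ fun s' hs => hs
  · simp [Expr.eval, hs.index]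
  · simp [Expr.eval, hs.index]
  · rw [← List.length_reverse (as := R.left)]
    exact sum_map_const_add_le _ (by decide) (by decide)

theorem runs_bottomLoop (hR : RecordSpec R I D pos eh ev val avail) (hA : RecordAt input off R)
    (hF : FlagsAt input R eh ev) {rest : List ℕ}
    (hrest : boundaryOrder R.bottom R.left R.top R.right =
      R.left.reverse ++ (R.bottom.filter (· ∉ R.left) ++ rest))
    (h : Between R I D pos val avail out k off R.left.reverse
      (R.bottom.filter (· ∉ R.left) ++ rest) 0 s) :
    Runs input (.loop (.minus (.reg 10) (.reg 1)) bottomBody) s (500 * R.bottom.length + 500)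
      (Between R I D pos val avail out k off
        (R.left.reverse ++ R.bottom.filter (· ∉ R.left)) rest R.bottom.length) := by
  refine Runs.mono (runs_loop R.bottom (fun _ => bottomBody.cost)
    (fun l₁ l₂ => Between R I D pos val avail out k off
      (R.left.reverse ++ l₁.filter (· ∉ R.left)) (l₂.filter (· ∉ R.left) ++ rest) l₁.length)
    (fun l₁ z l₂ hl s hs => ⟨?_, runs_of_wp (bottom_step hR hA hF hl hrest hs)⟩)
    (fun s hs => ?_) (by simpa using h)) ?_ fun s' hs => by simpa using hs
  · simp only [Expr.eval, hs.index, hs.regs.r10]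
    rw [hl]
    simp
  · simp [Expr.eval, hs.index, hs.regs.r10]
  · exact sum_map_const_add_le _ (by decide) (by decide)

theorem runs_rightLoop (hR : RecordSpec R I D pos eh ev val avail) (hA : RecordAt input off R)
    (hF : FlagsAt input R eh ev)
    (h : Between R I D pos val avail out k off
      (R.left.reverse ++ R.bottom.filter (· ∉ R.left)) (R.right.filter (· ∉ R.bottom) ++
        (R.top.filter fun x => x ∉ R.left ∧ x ∉ R.right).reverse) 0 s) :
    Runs input (.loop (.minus (.reg 13) (.reg 1)) rightBody) s (500 * R.right.length + 500)
      (Between R I D pos val avail out k off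
        (R.left.reverse ++ (R.bottom.filter (· ∉ R.left) ++ R.right.filter (· ∉ R.bottom)))
        (R.top.filter fun x => x ∉ R.left ∧ x ∉ R.right).reverse R.right.length) := by
  refine Runs.mono (runs_loop R.right (fun _ => rightBody.cost)
    (fun l₁ l₂ => Between R I D pos val avail out k off
      (R.left.reverse ++ (R.bottom.filter (· ∉ R.left) ++ l₁.filter (· ∉ R.bottom)))
      (l₂.filter (· ∉ R.bottom) ++
        (R.top.filter fun x => x ∉ R.left ∧ x ∉ R.right).reverse) l₁.length)
    (fun l₁ z l₂ hl s hs => ⟨?_, runs_of_wp (right_step hR hA hF hl hs)⟩)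
    (fun s hs => ?_) (by simpa using h)) ?_ fun s' hs => by simpa using hs
  · simp only [Expr.eval, hs.index, hs.regs.r13]
    rw [hl]
    simp
  · simp [Expr.eval, hs.index, hs.regs.r13]
  · exact sum_map_const_add_le _ (by decide) (by decide)

theorem runs_topLoop (hR : RecordSpec R I D pos eh ev val avail) (hA : RecordAt input off R)
    (hF : FlagsAt input R eh ev) {pre : List ℕ}
    (hpre : boundaryOrder R.bottom R.left R.top R.right =
      pre ++ R.top.reverse.filter fun x => x ∉ R.left ∧ x ∉ R.right)
    (h : Between R I D pos val avail out k off pre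
      (R.top.reverse.filter fun x => x ∉ R.left ∧ x ∉ R.right) R.top.length s) :
    Runs input (.loop (.reg 1) topBody) s (500 * R.top.length + 500)
      (Between R I D pos val avail out k off (boundaryOrder R.bottom R.left R.top R.right) [] 0) := by
  rw [hpre]
  refine Runs.mono (runs_loop R.top.reverse (fun _ => topBody.cost)
    (fun l₁ l₂ => Between R I D pos val avail out k off
      (pre ++ l₁.filter fun x => x ∉ R.left ∧ x ∉ R.right)
      (l₂.filter fun x => x ∉ R.left ∧ x ∉ R.right) l₂.length)
    (fun l₁ z l₂ hl s hs => ⟨?_, runs_of_wp (top_step hR hA hF hl hpre hs)⟩)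
    (fun s hs => ?_) (by simpa using h)) ?_ fun s' hs => hs
  · simp [Expr.eval, hs.index]
  · simp [Expr.eval, hs.index]
  · rw [← List.length_reverse (as := R.top)]
    exact sum_map_const_add_le _ (by decide) (by decide)

theorem Progress.init (h : Holds val avail [] out s) {post : List ℕ} :
    Progress R.left I D pos k val (knownAfter avail R []) out [] post s := by
  refine ⟨[], ⟨List.nodup_nil, by simp⟩, ?_⟩
  simpa [pending] using h.mono fun κ z hz => hz.resolve_right (by simp)

/-- The pairs of `es` are the joined pairs in the order in which they lie on the boundary of the
subcell. -/
def Enumerates (es : List (ℕ × ℕ)) (A : ℕ → ℕ → Prop) (pos : ℕ → ℝ) : Prop :=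
  es.Nodup ∧ ∀ x y, (x, y) ∈ es ↔ A x y ∧ pos x < pos y

/-- At the end no partner is still to come, so the stack is empty again for the next subcell, and
the list of closed pairs contains all arcs. Each arc appears once, with the earlier end first. -/
theorem Progress.finish (hR : RecordSpec R I D pos eh ev val avail)
    (h : Progress R.left I D pos k val (knownAfter avail R
      (boundaryOrder R.bottom R.left R.top R.right)) out
      (boundaryOrder R.bottom R.left R.top R.right) [] s) :
    ∃ es, Enumerates es (fun x y => I x y ∨ D x y) pos ∧
      Holds val (fun κ z => avail κ z ∨ R.Writes κ z) [] (out ++ es.flatMap fun e => [k, e.1, e.2])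
        s := by
  obtain ⟨es, ⟨h1, h2⟩, h3⟩ := h
  refine ⟨es, ⟨h1, fun x y => ?_⟩, ?_⟩
  · rw [h2]
    refine ⟨fun h => ⟨h.1, h.2.2.2⟩, fun h => ⟨h.1, ?_, hR.mem_of_joined h.1, h.2⟩⟩
    exact hR.mem_of_joined (hR.matching.symm _ _ h.1)
  · have := h3.mono (known' := fun κ z => avail κ z ∨ R.Writes κ z) fun κ z hz => by
      refine hz.imp id fun hw => ⟨mem_boundaryOrder.2 ?_, hw⟩
      rcases hw with hw | hw | hw | hw <;> simp [hw.2.1]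
    simpa [pending] using this

theorem runs_record (hR : RecordSpec R I D pos eh ev val avail) (hA : RecordAt input off R)
    (hF : FlagsAt input R eh ev) (h6 : s.reg 6 = k) (h7 : s.reg 7 = off)
    (hH : Holds val avail [] out s) :
    Runs input recordCmd s
      (3000 * (1 + R.bottom.length + R.left.length + R.top.length + R.right.length))
      fun s' => s'.reg 6 = k + 1 ∧ s'.reg 7 = off + R.words.length ∧
        ∃ es, Enumerates es (fun x y => I x y ∨ D x y) pos ∧
          Holds val (fun κ z => avail κ z ∨ R.Writes κ z) []
            (out ++ es.flatMap fun e => [k, e.1, e.2]) s' := by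
  have hW : boundaryOrder R.bottom R.left R.top R.right =
      (R.left.reverse ++ (R.bottom.filter (· ∉ R.left) ++ R.right.filter (· ∉ R.bottom))) ++
        R.top.reverse.filter fun x => x ∉ R.left ∧ x ∉ R.right := by
    simp [boundaryOrder, List.filter_reverse]
  have h₁ : Runs input (.seq setup (.assign 1 (.reg 11))) s (300 + 2)
      (Between R I D pos val avail out k off []
        (boundaryOrder R.bottom R.left R.top R.right) R.left.length) := by
    refine Runs.seq (P := fun s' => ∃ i, Between R I D pos val avail out k off []
      (boundaryOrder R.bottom R.left R.top R.right) i s') (Runs.mono (runs_of_wp (wp_setup hR hA h6 h7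
      fun s' r z m o => ⟨_, r, rfl, Progress.init (hH.congr z m o)⟩)) (by decide) fun s' hs => hs) ?_
    rintro s' ⟨i, hs⟩
    exact runs_assign_index hs hs.regs.r11
  refine Runs.mono (h₁.seq fun s₁ b₁ => (runs_leftLoop hR hA hF rfl b₁).seq fun s₂ b₂ =>
    (runs_assign_index (n := 0) b₂ rfl).seq fun s₃ b₃ => (runs_bottomLoop hR hA hF rfl b₃).seq
    fun s₄ b₄ => (runs_assign_index (n := 0) b₄ rfl).seq fun s₅ b₅ =>
    (runs_rightLoop hR hA hF b₅).seq fun s₆ b₆ => (runs_assign_index (e := .reg 12) b₆ b₆.regs.r12).seq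
    fun s₇ b₇ => (runs_topLoop hR hA hF hW (by rwa [List.filter_reverse])).seq fun s₈ b₈ =>
    runs_of_wp (wp_assign_seq fun s₉ e₉ v₉ => wp_assign fun s' e v => ?_)) ?_ fun s' hs => hs
  · refine ⟨?_, ?_, ?_⟩
    · rw [v]; simp [Expr.eval, e₉.reg, b₈.regs.r6]
    · rw [e.reg 7 (by norm_num), v₉]; exact b₈.regs.r20
    · exact (((b₈.progress.eqExcept e₉ (by norm_num)).eqExcept e (by norm_num))).finish hR
  -- The setup costs at most `302`, each of the four loops at most `500` per point plus `500`, and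
  -- the remaining assignments little, which `3000` per unit of record size covers.
  · simp only [Cmd.cost, Expr.cost]
    omega

end record

end FreeSpace

namespace FreeSpace

open RAM

/-! ### Handling the whole input -/

/-- The four flags of a marked point. -/
def InputData.flags (D : InputData) (z : ℕ) : List ℕ :=
  [(D.ehPlus z).toNat, (D.ehMinus z).toNat, (D.evPlus z).toNat, (D.evMinus z).toNat]

theorem InputData.length_flags (D : InputData) (n : ℕ) :
    ((List.range n).flatMap D.flags).length = 4 * n := by
  simp [List.length_flatMap, InputData.flags, mul_comm]

theorem InputData.words_eq (D : InputData) :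
    D.words = [D.size, D.subcells.length] ++ (List.range D.size).flatMap D.flags ++
      D.subcells.flatMap SubcellRecord.words := rfl

theorem InputData.flags_at (D : InputData) {z : ℕ} (hz : z < D.size) :
    SegAt D.words (4 * z + 2) (D.flags z) := by
  obtain ⟨m, hm⟩ := Nat.exists_eq_add_of_lt hz
  have hr : List.range D.size = List.range z ++ z :: (List.range m).map (z + 1 + ·) := by
    rw [hm, add_right_comm, List.range_add, List.range_succ]
    simp
  have h := segAt_of_append (u := [D.size, D.subcells.length] ++ (List.range z).flatMap D.flags)
    (l := D.flags z) (v := ((List.range m).map (z + 1 + ·)).flatMap D.flags ++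
      D.subcells.flatMap SubcellRecord.words)
  rw [D.words_eq, hr]
  rw [List.length_append, D.length_flags, List.length_cons, List.length_singleton, add_comm (1 + 1)]
    at h
  simpa using h

theorem InputData.flags_iff (D : InputData) {z : ℕ} (hz : z < D.size) :
    (D.words.getD (4 * z + 2) 0 + D.words.getD (4 * z + 3) 0 ≠ 0 ↔
      D.ehPlus z = true ∨ D.ehMinus z = true) ∧
    (D.words.getD (4 * z + 4) 0 + D.words.getD (4 * z + 5) 0 ≠ 0 ↔
      D.evPlus z = true ∨ D.evMinus z = true) := by
  have h := D.flags_at hz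
  have h0 : D.words.getD (4 * z + 2) 0 = _ := h [] _ _ rfl
  have h1 : D.words.getD (4 * z + 3) 0 = _ := h [_] _ _ rfl
  have h2 : D.words.getD (4 * z + 4) 0 = _ := h [_, _] _ _ rfl
  have h3 : D.words.getD (4 * z + 5) 0 = _ := h [_, _, _] _ _ rfl
  rw [h0, h1, h2, h3]
  cases D.ehPlus z <;> cases D.ehMinus z <;> cases D.evPlus z <;> cases D.evMinus z <;> simp

theorem InputData.recordAt (D : InputData) {l₁ l₂ : List SubcellRecord} {R : SubcellRecord}
    (h : D.subcells = l₁ ++ R :: l₂) :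
    RecordAt D.words (4 * D.size + 2 + (l₁.flatMap SubcellRecord.words).length) R := by
  have := recordAt_of_append (R := R) (v := l₂.flatMap SubcellRecord.words)
    (u := [D.size, D.subcells.length] ++ (List.range D.size).flatMap D.flags ++
      l₁.flatMap SubcellRecord.words)
  rw [List.length_append, List.length_append, D.length_flags, List.length_cons,
    List.length_singleton, add_comm (1 + 1)] at this
  rw [D.words_eq]
  conv => enter [1, 2]; rw [h]
  simpa using this

/-- The quadrants for which the records before the `k`-th one store information. -/
def InputData.WrittenBefore (D : InputData) (k κ z : ℕ) : Prop :=
  ∃ k' < k, ∃ R, D.subcells[k']? = some R ∧ R.Writes κ z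

/-- The first `n` subcells have been processed. -/
def AfterRecords (D : InputData) (A : ℕ → ℕ → ℕ → Prop) (pos : ℕ → ℕ → ℝ) (val : ℕ → ℕ → Prop) (n : ℕ)
    (s : State) : Prop :=
  ∃ edges : List (ℕ × ℕ × ℕ), edges.Nodup ∧
    (∀ k i j, (k, i, j) ∈ edges ↔ k < n ∧ A k i j ∧ pos k i < pos k j) ∧
    Holds val (D.WrittenBefore n) [] (edges.flatMap fun e => [e.1, e.2.1, e.2.2]) s

theorem AfterRecords.eqExcept {D : InputData} {A : ℕ → ℕ → ℕ → Prop} {pos : ℕ → ℕ → ℝ}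
    {val : ℕ → ℕ → Prop} {n r : ℕ} {s s' : State} (h : AfterRecords D A pos val n s)
    (he : EqExcept r s s') (hr : r ≠ 0) : AfterRecords D A pos val n s' := by
  obtain ⟨edges, h1, h2, h3⟩ := h
  exact ⟨edges, h1, h2, h3.eqExcept he hr⟩

/-- Between records the stack is empty, the flags written by all earlier records are available, and
the output lists the arcs of all earlier subcells. The subcell number distinguishes triples from
different records. -/
theorem runs_main {D : InputData} {I J : ℕ → ℕ → ℕ → Prop} {pos : ℕ → ℕ → ℝ} {eh ev : ℕ → Prop}
    {val : ℕ → ℕ → Prop}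
    (hspec : ∀ k R, D.subcells[k]? = some R →
      RecordSpec R (I k) (J k) (pos k) eh ev val (D.WrittenBefore k))
    (hF : ∀ R ∈ D.subcells, FlagsAt D.words R eh ev) :
    Runs D.words mainCmd State.init
      (4000 * (D.subcells.map fun R =>
        1 + R.bottom.length + R.left.length + R.top.length + R.right.length).sum + 100)
      (AfterRecords D (fun k x y => I k x y ∨ J k x y) pos val D.subcells.length) := by
  set A : ℕ → ℕ → ℕ → Prop := fun k x y => I k x y ∨ J k x y
  have h0 : D.words.getD 0 0 = D.size := rfl
  have h1 : D.words.getD 1 0 = D.subcells.length := rfl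
  have start : wp D.words (.seq (.assign 7 (.inp (.const 0)))
      (.assign 7 (.plus (.plus (.plus (.reg 7) (.reg 7)) (.plus (.reg 7) (.reg 7))) (.const 2))))
      (fun s => s.reg 6 = 0 ∧ s.reg 7 = 4 * D.size + 2 ∧ AfterRecords D A pos val 0 s) State.init := by
    refine wp_assign_seq fun s₁ e₁ v₁ => wp_assign fun s₂ e₂ v₂ => ⟨?_, ?_, ?_⟩
    · rw [e₂.reg 6 (by norm_num), e₁.reg 6 (by norm_num)]; rfl
    · rw [v₂]
      simp only [Expr.eval, v₁, h0]
      ring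
    · refine AfterRecords.eqExcept (AfterRecords.eqExcept ?_ e₁ (by norm_num)) e₂ (by norm_num)
      refine ⟨[], List.nodup_nil, by simp, rfl, rfl, ?_, rfl⟩
      rintro κ z ⟨k, hk, -⟩
      omega
  refine Runs.mono ((runs_of_wp start).seq fun s hs => runs_loop D.subcells
    (fun R => 3000 * (1 + R.bottom.length + R.left.length + R.top.length + R.right.length))
    (fun l₁ l₂ s => s.reg 6 = l₁.length ∧
      s.reg 7 = 4 * D.size + 2 + (l₁.flatMap SubcellRecord.words).length ∧
      AfterRecords D A pos val l₁.length s) ?_ ?_ (by simpa using hs)) ?_ fun s hs => hs.2.2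
  · rintro l₁ R l₂ hl s ⟨h6, h7, edges, hn, hmem, hH⟩
    have hk : D.subcells[l₁.length]? = some R := by rw [hl]; simp
    refine ⟨?_, ?_⟩
    · simp only [Expr.eval, h1, h6]
      rw [hl]
      simp
    refine (runs_record (hspec _ R hk) (D.recordAt hl) (hF R (List.mem_of_getElem? hk)) h6 h7
      hH).mono le_rfl ?_
    rintro s' ⟨h6', h7', es, ⟨hes, hes'⟩, hH'⟩
    refine ⟨by simp [h6'], by simp [h7', add_assoc], edges ++ es.map (Prod.mk l₁.length), ?_, ?_, ?_⟩
    · refine hn.append (hes.map (Prod.mk_right_injective _)) ?_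
      rintro ⟨k, i, j⟩ h h'
      obtain ⟨e, -, he⟩ := List.mem_map.1 h'
      have := ((hmem k i j).1 h).1
      simp only [Prod.mk.injEq] at he
      omega
    · intro k i j
      have : (k, i, j) ∈ es.map (Prod.mk l₁.length) ↔ k = l₁.length ∧ (i, j) ∈ es := by
        simp only [List.mem_map, Prod.mk.injEq]
        constructor
        · rintro ⟨e, he, rfl, rfl⟩; exact ⟨rfl, he⟩
        · rintro ⟨rfl, he⟩; exact ⟨_, he, rfl, rfl⟩
      rw [List.mem_append, this, hmem, List.length_append, List.length_singleton, hes']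
      constructor
      · rintro (⟨h, h'⟩ | ⟨rfl, h⟩)
        · exact ⟨by omega, h'⟩
        · exact ⟨by omega, h⟩
      · rintro ⟨h, h'⟩
        rcases Nat.lt_succ_iff_lt_or_eq.1 h with h | rfl
        · exact Or.inl ⟨h, h'⟩
        · exact Or.inr ⟨rfl, h'⟩
    · have e : (edges ++ es.map (Prod.mk l₁.length)).flatMap (fun e => [e.1, e.2.1, e.2.2]) =
          edges.flatMap (fun e => [e.1, e.2.1, e.2.2]) ++
            es.flatMap fun e => [l₁.length, e.1, e.2] := by
        rw [List.flatMap_append, List.flatMap_map]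
      rw [e]
      refine hH'.mono ?_
      rintro κ z ⟨k', hk', R', hR', hw⟩
      rw [List.length_append, List.length_singleton] at hk'
      rcases Nat.lt_succ_iff_lt_or_eq.1 hk' with h | rfl
      · exact Or.inl ⟨k', h, R', hR', hw⟩
      · rw [hk, Option.some.injEq] at hR'
        exact Or.inr (hR' ▸ hw)
  · rintro s ⟨h6, -⟩
    simp [Expr.eval, h6, h1, -List.getD_eq_getElem?_getD]
  -- Passing from `3000` to `4000` absorbs the loop test, as every record has size at least one.
  · have : ∀ l : List SubcellRecord, (l.map fun R => (Expr.minus (.inp (.const 1)) (.reg 6)).cost + 1 +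
        3000 * (1 + R.bottom.length + R.left.length + R.top.length + R.right.length)).sum ≤
        4000 * (l.map fun R =>
          1 + R.bottom.length + R.left.length + R.top.length + R.right.length).sum := by
      intro l
      induction l with
      | nil => simp
      | cons R l ih =>
        simp only [List.map_cons, List.sum_cons, Expr.cost] at ih ⊢
        omega
    have := this D.subcells
    simp only [Cmd.cost, Expr.cost] at this ⊢
    omega

/-- Joined points have different positions, so exactly one of the two orders of a pair is listed. -/
theorem BoxPattern.pos_ne {B L T R : List ℕ} {I D : ℕ → ℕ → Prop} {pos : ℕ → ℝ}
    (h : BoxPattern B L T R I D pos) {x y : ℕ} (hxy : I x y ∨ D x y) : pos x ≠ pos y := by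
  have hp : (boundaryOrder B L T R).Pairwise fun x y => pos x ≠ pos y := h.order.imp ne_of_lt
  have : Std.Symm fun x y => pos x ≠ pos y := ⟨fun _ _ => Ne.symm⟩
  exact hp.forall (h.mem_of_joined (h.matching.symm _ _ hxy))
    (h.mem_of_joined hxy) (h.ne_of_joined hxy)

/-- Connects the machine with the geometry: the matched numbers of a record are the pairs of points
joined in its subcell, and the flag bits in the input are those of `E_h` and `E_v`, since every
extremum has the forbidden region on one side. -/
theorem IsInput.isOutput {E : Type*} [NormedAddCommGroup E] [NormedSpace ℝ E]
    {γ₁ γ₂ : PiecewiseC2 E} {δ : ℝ} (hG : Generic γ₁ γ₂ δ) {pts : ℕ → ℝ × ℝ}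
    {subs : List (Subcell γ₁ γ₂)} {D : InputData} (h : IsInput δ pts subs D) :
    Runs D.words mainCmd State.init (80000 * D.size + 100)
      fun s => IsOutput δ pts D.size subs s.out := by
  have hlen : D.subcells.length = subs.length := h.2.2.2.2.length_eq
  have hget : ∀ k : ℕ, k < D.subcells.length → ∃ S R, subs[k]? = some S ∧ D.subcells[k]? = some R := by
    intro k hk
    exact ⟨_, _, List.getElem?_eq_getElem (hlen ▸ hk), List.getElem?_eq_getElem hk⟩
  have hsome : ∀ (k : ℕ) (S : Subcell γ₁ γ₂), subs[k]? = some S → ∃ R, D.subcells[k]? = some R := by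
    intro k S hS
    obtain ⟨hk, -⟩ := List.getElem?_eq_some_iff.1 hS
    exact ⟨_, List.getElem?_eq_getElem (hlen ▸ hk)⟩
  set I : ℕ → ℕ → ℕ → Prop := fun k x y => ∃ S, subs[k]? = some S ∧ incPairs δ pts D.size S x y
    with hI
  set J : ℕ → ℕ → ℕ → Prop := fun k x y => ∃ S, subs[k]? = some S ∧ decPairs δ pts D.size S x y
    with hJ
  set pos : ℕ → ℕ → ℝ := fun k z => (subs[k]?).elim 0 fun S => edgePos S.a S.b S.c S.d (pts z)
    with hpos
  have hspec : ∀ (k : ℕ) R (S : Subcell γ₁ γ₂), subs[k]? = some S → D.subcells[k]? = some R →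
      RecordSpec R (I k) (J k) (pos k) (fun z => pts z ∈ Eh γ₁ γ₂ δ) (fun z => pts z ∈ Ev γ₁ γ₂ δ)
        (quadrantFlag γ₁ γ₂ δ pts) (D.WrittenBefore k) := by
    intro k R S hS hR
    have e1 : I k = incPairs δ pts D.size S := by
      funext x y; simp [hI, hS]
    have e2 : J k = decPairs δ pts D.size S := by
      funext x y; simp [hJ, hS]
    have e3 : pos k = fun z => edgePos S.a S.b S.c S.d (pts z) := by
      funext z; simp [hpos, hS]
    rw [e1, e2, e3]
    exact h.recordSpec hG hS hR
  have hF : ∀ R ∈ D.subcells, FlagsAt D.words R (fun z => pts z ∈ Eh γ₁ γ₂ δ)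
      (fun z => pts z ∈ Ev γ₁ γ₂ δ) := by
    intro R hR z hz
    obtain ⟨k, hk⟩ := List.getElem?_of_mem hR
    obtain ⟨S, R', hS, hR'⟩ := hget k (List.getElem?_eq_some_iff.1 hk).1
    obtain ⟨R', hR', hrec⟩ := forall₂_getElem? h.2.2.2.2 hS
    rw [hk, Option.some.injEq] at hR'
    subst hR'
    obtain ⟨hb, hl, ht, hr, -⟩ := hrec
    have hz : z < D.size := by
      rcases hz with hz | hz | hz | hz
      exacts [((hl.2 z).1 hz).1, ((hb.2 z).1 hz).1, ((ht.2 z).1 hz).1, ((hr.2 z).1 hz).1]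
    obtain ⟨f1, f2, f3, f4⟩ := h.2.1 z hz
    beta_reduce
    rw [hG.mem_Eh_iff, hG.mem_Ev_iff, ← f1, ← f2, ← f3, ← f4]
    exact D.flags_iff hz
  refine (runs_main (I := I) (J := J) (pos := pos) (val := quadrantFlag γ₁ γ₂ δ pts)
    (fun k R hR => ?_) hF).mono ?_ ?_
  · obtain ⟨S, R', hS, -⟩ := hget k (List.getElem?_eq_some_iff.1 hR).1
    exact hspec k R S hS hR
  -- `80000` is `4000` per unit of record size times the bound `20` on the size per marked point.
  · have := h.sum_length_le
    omega
  · rintro s ⟨edges, hn, hmem, hH⟩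
    refine ⟨edges, hH.output, hn, fun k i j h1 h2 => ?_, fun k i j => ?_⟩
    · exact lt_asymm ((hmem k i j).1 h1).2.2 ((hmem k j i).1 h2).2.2
    · constructor
      · intro hk
        have hA : k < D.subcells.length ∧ (I k i j ∨ J k i j) := by
          rcases hk with hk | hk
          · obtain ⟨h1, h2, -⟩ := (hmem _ _ _).1 hk
            exact ⟨h1, h2⟩
          · obtain ⟨h1, h2, -⟩ := (hmem _ _ _).1 hk
            obtain ⟨S, R, hS, hR⟩ := hget k h1
            exact ⟨h1, (hspec k R S hS hR).matching.symm _ _ h2⟩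
        obtain ⟨S, hS, hij⟩ : ∃ S, subs[k]? = some S ∧
            (incPairs δ pts D.size S i j ∨ decPairs δ pts D.size S i j) := by
          rcases hA.2 with ⟨S, hS, hij⟩ | ⟨S, hS, hij⟩
          exacts [⟨S, hS, Or.inl hij⟩, ⟨S, hS, Or.inr hij⟩]
        have hSub := ((h.2.2.1 S).1 (List.mem_of_getElem? hS)).1
        rcases hij with ⟨hi, hj, hij⟩ | ⟨hi, hj, hij⟩
        exacts [⟨S, hS, hi, hj, (hSub.joined_iff hG).2 (Or.inl hij)⟩,
          ⟨S, hS, hi, hj, (hSub.joined_iff hG).2 (Or.inr hij)⟩]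
      · rintro ⟨S, hS, hi, hj, hij⟩
        have hSub := ((h.2.2.1 S).1 (List.mem_of_getElem? hS)).1
        obtain ⟨R, hR⟩ := hsome k S hS
        have hk := (List.getElem?_eq_some_iff.1 hR).1
        have hA : I k i j ∨ J k i j := ((hSub.joined_iff hG).1 hij).imp
          (fun h => ⟨S, hS, hi, hj, h⟩) fun h => ⟨S, hS, hi, hj, h⟩
        have hB := (hspec k R S hS hR).toBoxPattern
        have hA' := hB.matching.symm _ _ hA
        rw [hmem, hmem]
        rcases (hB.pos_ne hA).lt_or_gt with hlt | hlt
        exacts [Or.inl ⟨hk, hA, hlt⟩, Or.inr ⟨hk, hA', hlt⟩]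

end FreeSpace

theorem lemma2p2 :
    ∃ (P : RAM.Cmd) (K : ℕ),
      ∀ (d : ℕ) (p : ℝ≥0∞) [Fact (1 ≤ p)] (_ : 1 < p) (_ : p ≠ ∞)
        (γ₁ γ₂ : PiecewiseC2 (PiLp p (fun _ : Fin d => ℝ))) (δ : ℝ) (_ : 0 < δ)
        (_ : FreeSpace.singularSet γ₁ γ₂ δ = ∅)
        (_ : (FreeSpace.Eh γ₁ γ₂ δ).Finite) (_ : (FreeSpace.Ev γ₁ γ₂ δ).Finite)
        (pts : ℕ → ℝ × ℝ) (subs : List (FreeSpace.Subcell γ₁ γ₂)) (D : FreeSpace.InputData)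
        (_ : FreeSpace.IsInput δ pts subs D),
        ∃ (t : ℕ) (s : RAM.State),
          RAM.Exec D.words P RAM.State.init t s ∧
          t ≤ K * ((FreeSpace.marked γ₁ γ₂ δ).ncard + 1) ∧
          FreeSpace.IsOutput δ pts D.size subs s.out := by
  refine ⟨FreeSpace.mainCmd, 80000, ?_⟩
  intro d p _ hp hp' γ₁ γ₂ δ hδ hsing hEh hEv pts subs D h
  have hG : FreeSpace.Generic γ₁ γ₂ δ :=
    ⟨fun v hv => PiLp.contDiffAt_norm hp hp' hv, hδ, hsing, hEh, hEv⟩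
  obtain ⟨t, s, he, ht, hs⟩ := h.isOutput hG
  refine ⟨t, s, he, ht.trans ?_, hs⟩
  -- The numbering is a bijection, so the input size is the number of marked points, and `K * (size
  -- + 1)` absorbs the constant `100`.
  have : (FreeSpace.marked γ₁ γ₂ δ).ncard = D.size := by
    rw [← h.1.image_eq, h.1.injOn.ncard_image, Set.ncard_Iio_nat]
  rw [this]
  omega
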